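/- Let $n,m\ge 1$ be integers with $(n,m)\ne(2,2)$. Let $\mathfrak h$ be the Cartan subalgebra of $\mathfrak g=\mathfrak{sl}(n,m)$, i.e. the diagonal matrices $\mathrm{diag}(a_1,\dots,a_n;b_1,\dots,b_m)$ over $\mathbb C$ with $\sum a_i=\sum b_p$, and let $\varepsilon_i,\delta_p\in\mathfrak h^*$ be the coordinate functions, so that $\varepsilon_1+\dots+\varepsilon_n=\delta_1+\dots+\delta_m$. Let $P_0\subset\mathfrak h^*$ be the group of weights of $\mathfrak g_0$, that is, of all $\lambda$ with $\lambda(E_{ii}-E_{jj})\in\mathbb Z$ whenever $i,j$ are both among the first $n$ or both among the last $m$ indices. Let $W_0=S_n\times S_m$ act by permutations of the $\varepsilon_i$ and of the $\delta_p$, and put $x_i=e^{\varepsilon_i}$, $y_p=e^{\delta_p}$ in the group ring $\mathbb Z[P_0]$. Let $$J(\mathfrak g)=\{f\in\mathbb Z[P_0]^{W_0}\mid D_{i,p}f\in(e^{\varepsilon_i-\delta_p}-1)\ \text{for all } 1\le i\le n,\ 1\le p\le m\},$$ where $D_{i,p}e^\lambda=\lambda(H_{i,p})e^\lambda$, $H_{i,p}\in\mathfrak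 h$ is the diagonal matrix with entries $1$ at the $i$-th even and the $p$-th odd place and $0$ elsewhere, and the ideal is taken in $\mathbb C[P_0]$. For $a\in\mathbb C/\mathbb Z$ let $J(\mathfrak g)_a$ be the set of those $f\in J(\mathfrak g)$ all of whose weights lie in $a(\varepsilon_1+\dots+\varepsilon_n)+\sum_i\mathbb Z\varepsilon_i+\sum_p\mathbb Z\delta_p$. Let $\mathbb Z[x^{\pm1},y^{\pm1}]_0^{S_n\times S_m}$ be the quotient of the ring $\mathbb Z[x_1^{\pm1},\dots,x_n^{\pm1},y_1^{\pm1},\dots,y_m^{\pm1}]^{S_n\times S_m}$ of invariant Laurent polynomials in independent variables by the ideal generated by $x_1\cdots x_n-y_1\cdots y_m$. Then: 1. $J(\mathfrak g)=\bigoplus_{a\in\mathbb C/\mathbb Z}J(\mathfrak g)_a$. 2. The natural map $\mathbb Z[x^{\pm1},y^{\pm1}]_0^{S_n\times S_m}\to\mathbb Z[P_0]$ is injective. 3. If $a\in\mathbb C\setminus\mathbb Z$, then $$J(\mathfrak g)_a=(x_1\cdots x_n)^a\prod_{i=1}^n\prod_{p=1}^m\Bigl(1-\frac{x_i}{y_p}\Bigr)\,\mathbb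 Z[x^{\pm1},y^{\pm1}]_0^{S_n\times S_m}.$$ 4. $$J(\mathfrak g)_0=\Bigl\{f\in\mathbb Z[x^{\pm1},y^{\pm1}]_0^{S_n\times S_m}\ \Big|\ y_p\frac{\partial f}{\partial y_p}+x_i\frac{\partial f}{\partial x_i}\in(y_p-x_i)\ \text{for all } i,p\Bigr\},$$ where the ideal is taken in the quotient of the ring of all Laurent polynomials by $(x_1\cdots x_n-y_1\cdots y_m)$. 5. $J(\mathfrak g)_0$ is a subring, generated over $\mathbb Z$ by the elements $h_k,h_k^*$, $k\in\mathbb N$, where $\sum_{k\ge0}h_kt^k=\prod_{p}(1-y_pt)/\prod_{i}(1-x_it)$ and $h_k^*$ is obtained from $h_k$ by replacing all $x_i,y_p$ by their inverses. 6. If $(n,m)\ne(1,1)$, then $J(\mathfrak g)_0$ is the Grothendieck ring of finite-dimensional representations of the algebraic supergroup $SL(n,m)$ (over $\mathbb C$): the supercharacter map $[V]\mapsto\sum_\lambda(\dim (V_\lambda)_0-\dim (V_\lambda)_1)e^\lambda$ is a ring isomorphism from this Grothendieck ring onto $J(\mathfrak g)_0$. Here the Grothendieck ring is the abelian group generated by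 the classes $[V]$ of finite-dimensional $\mathbb Z_2$-graded representations, with relations $[V]=[V_1]+[V_2]$ for all exact sequences $0\to V_1\to V\to V_2\to0$ and $[\Pi V]=-[V]$ for the parity change $\Pi$, with the product $[U][V]=[U\otimes V]$. -/

import Mathlib

open scoped BigOperators

noncomputable section

namespace SuperSL

/-! ### Weights of `sl(n,m)` -/

/-- Indices of the rows of an `(n|m) × (n|m)` supermatrix; `inl` is even, `inr` is odd. -/
abbrev Idx (n m : ℕ) : Type := Fin n ⊕ Fin m

/-- The Cartan subalgebra of `sl(n,m)`: diagonal matrices with zero supertrace. -/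
def cartan (n m : ℕ) : Submodule ℂ (Idx n m → ℂ) where
  carrier := {h | ∑ i, h (Sum.inl i) = ∑ p, h (Sum.inr p)}
  add_mem' := by
    intro a b ha hb
    simp only [Set.mem_ofPred_eq, Pi.add_apply, Finset.sum_add_distrib] at *
    rw [ha, hb]
  zero_mem' := by simp
  smul_mem' := by
    intro c a ha
    simp only [Set.mem_ofPred_eq, Pi.smul_apply, smul_eq_mul, ← Finset.mul_sum] at *
    rw [ha]

/-- The weights `ε_i` (`k = inl i`) and `δ_p` (`k = inr p`) of the standard representation. -/
def eps {n m : ℕ} (k : Idx n m) : Module.Dual ℂ (cartan n m) :=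
  (LinearMap.proj k).comp (cartan n m).subtype

/-- The coroot `E_ii - E_jj` of the even root `ε_i - ε_j`. -/
def corootL {n m : ℕ} (i j : Fin n) : cartan n m :=
  ⟨Pi.single (Sum.inl i) 1 - Pi.single (Sum.inl j) 1, by
    simp [cartan, Pi.single_apply, Finset.sum_sub_distrib]⟩

/-- The coroot `E_pp - E_qq` of the even root `δ_p - δ_q`. -/
def corootR {n m : ℕ} (p q : Fin m) : cartan n m :=
  ⟨Pi.single (Sum.inr p) 1 - Pi.single (Sum.inr q) 1, by
    simp [cartan, Pi.single_apply, Finset.sum_sub_distrib]⟩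

/-- `H = E_ii + E_pp`. For the isotropic root `α = ε_i - δ_p` one has `(α, λ) = λ(H)`. -/
def isoH {n m : ℕ} (i : Fin n) (p : Fin m) : cartan n m :=
  ⟨Pi.single (Sum.inl i) 1 + Pi.single (Sum.inr p) 1, by
    simp [cartan, Pi.single_apply]⟩

/-- The group `P₀` of weights of the even part: the linear forms on the Cartan subalgebra
that take integral values on all coroots of even roots. -/
def P0 (n m : ℕ) : AddSubgroup (Module.Dual ℂ (cartan n m)) where
  carrier := {l | (∀ i j, ∃ z : ℤ, l (corootL i j) = z) ∧ (∀ p q, ∃ z : ℤ, l (corootR p q) = z)}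
  add_mem' := by
    rintro a b ⟨ha, ha'⟩ ⟨hb, hb'⟩
    refine ⟨fun i j => ?_, fun p q => ?_⟩
    · obtain ⟨z, hz⟩ := ha i j
      obtain ⟨w, hw⟩ := hb i j
      exact ⟨z + w, by simp [hz, hw]⟩
    · obtain ⟨z, hz⟩ := ha' p q
      obtain ⟨w, hw⟩ := hb' p q
      exact ⟨z + w, by simp [hz, hw]⟩
  zero_mem' := ⟨fun _ _ => ⟨0, by simp⟩, fun _ _ => ⟨0, by simp⟩⟩
  neg_mem' := by
    rintro a ⟨ha, ha'⟩
    refine ⟨fun i j => ?_, fun p q => ?_⟩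
    · obtain ⟨z, hz⟩ := ha i j
      exact ⟨-z, by simp [hz]⟩
    · obtain ⟨z, hz⟩ := ha' p q
      exact ⟨-z, by simp [hz]⟩

theorem eps_mem {n m : ℕ} (k : Idx n m) : eps k ∈ P0 n m := by
  refine ⟨fun i j => ?_, fun p q => ?_⟩
  · refine ⟨(if k = Sum.inl i then 1 else 0) - (if k = Sum.inl j then 1 else 0), ?_⟩
    simp [eps, corootL, Pi.single_apply]
  · refine ⟨(if k = Sum.inr p then 1 else 0) - (if k = Sum.inr q then 1 else 0), ?_⟩
    simp [eps, corootR, Pi.single_apply]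

/-- `ε_i`, `δ_p` as elements of `P₀`. -/
def wt {n m : ℕ} (k : Idx n m) : P0 n m := ⟨eps k, eps_mem k⟩

theorem omega_mem {n m : ℕ} (s : ℂ) : s • ∑ i : Fin n, eps (m := m) (Sum.inl i) ∈ P0 n m := by
  refine ⟨fun i j => ⟨0, ?_⟩, fun p q => ⟨0, ?_⟩⟩
  · simp [eps, corootL, Pi.single_apply, Finset.sum_sub_distrib]
  · simp [eps, corootR]

/-- The weight `s (ε_1 + ⋯ + ε_n)`, `s ∈ ℂ`; its exponential is `(x_1 ⋯ x_n)^s`. -/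
def omega (n m : ℕ) (s : ℂ) : P0 n m := ⟨s • ∑ i : Fin n, eps (Sum.inl i), omega_mem s⟩

/-- The exponent `k` of the monomial `x^k` regarded as the weight
`∑ k_i ε_i + ∑ k_p δ_p`. -/
def latticeHom (n m : ℕ) : (Idx n m → ℤ) →+ P0 n m where
  toFun k := ∑ j, k j • wt j
  map_zero' := by simp
  map_add' a b := by simp [add_smul, Finset.sum_add_distrib]

/-! ### Weyl group -/

/-- `W₀ = S_n × S_m`. -/
abbrev Weyl (n m : ℕ) : Type := Equiv.Perm (Fin n) × Equiv.Perm (Fin m)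

/-- The permutation of the indices given by an element of `W₀`. -/
def Weyl.perm {n m : ℕ} (w : Weyl n m) : Equiv.Perm (Idx n m) := Equiv.sumCongr w.1 w.2

/-- `W₀` acts on the Cartan subalgebra by permuting coordinates. -/
def weylCartan {n m : ℕ} (w : Weyl n m) : cartan n m →ₗ[ℂ] cartan n m where
  toFun h := ⟨fun k => h.1 (w.perm k), by
    have h1 := Equiv.sum_comp w.1 (fun i => h.1 (Sum.inl i))
    have h2 := Equiv.sum_comp w.2 (fun i => h.1 (Sum.inr i))
    have h3 : ∑ i, h.1 (Sum.inl i) = ∑ p, h.1 (Sum.inr p) := h.2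
    change ∑ i, h.1 (Sum.inl (w.1 i)) = ∑ p, h.1 (Sum.inr (w.2 p))
    rw [h1, h2, h3]⟩
  map_add' _ _ := rfl
  map_smul' _ _ := rfl

theorem weylCartan_corootL {n m : ℕ} (w : Weyl n m) (i j : Fin n) :
    weylCartan w (corootL i j) = corootL (w.1.symm i) (w.1.symm j) := by
  apply Subtype.ext
  funext k
  rcases k with k | k <;>
    simp [weylCartan, corootL, Weyl.perm, Pi.single_apply, Equiv.eq_symm_apply]

theorem weylCartan_corootR {n m : ℕ} (w : Weyl n m) (i j : Fin m) :
    weylCartan w (corootR i j) = corootR (w.2.symm i) (w.2.symm j) := by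
  apply Subtype.ext
  funext k
  rcases k with k | k <;>
    simp [weylCartan, corootR, Weyl.perm, Pi.single_apply, Equiv.eq_symm_apply]

/-- The action of `W₀` on `P₀`; it sends `ε_i` to `ε_{w i}` and `δ_p` to `δ_{w p}`. -/
def weylWeight {n m : ℕ} (w : Weyl n m) : P0 n m →+ P0 n m where
  toFun l := ⟨l.1.comp (weylCartan w), by
    refine ⟨fun i j => ?_, fun p q => ?_⟩
    · rw [LinearMap.comp_apply, weylCartan_corootL]
      exact l.2.1 _ _
    · rw [LinearMap.comp_apply, weylCartan_corootR]
      exact l.2.2 _ _⟩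
  map_zero' := rfl
  map_add' _ _ := rfl

/-- The action of `W₀` on exponents of Laurent monomials. -/
def weylLattice {n m : ℕ} (w : Weyl n m) : (Idx n m → ℤ) →+ (Idx n m → ℤ) where
  toFun k := fun j => k (w.perm.symm j)
  map_zero' := rfl
  map_add' _ _ := rfl

/-! ### Group rings and the ring `J(sl(n,m))` -/

/-- `ℤ[P₀]`. -/
abbrev ZP (n m : ℕ) : Type := AddMonoidAlgebra ℤ (P0 n m)

/-- `ℂ[P₀]`. -/
abbrev CP (n m : ℕ) : Type := AddMonoidAlgebra ℂ (P0 n m)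

/-- `ℤ[x_1^{±1}, …, x_n^{±1}, y_1^{±1}, …, y_m^{±1}]`. -/
abbrev Laurent (n m : ℕ) : Type := AddMonoidAlgebra ℤ (Idx n m → ℤ)

/-- The exponential `e^l`. -/
abbrev ex {R M : Type} [Semiring R] (l : M) : AddMonoidAlgebra R M := AddMonoidAlgebra.single l 1

/-- The additive map `e^l ↦ φ(l) e^l` on a group ring. -/
def expDeriv {R M : Type} [CommRing R] [AddCommGroup M] (φ : M →+ R) :
    AddMonoidAlgebra R M →+ AddMonoidAlgebra R M :=
  (Finsupp.liftAddHom fun l =>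
    (AddMonoidAlgebra.singleAddHom l).comp (AddMonoidHom.mulLeft (φ l))).comp
      AddMonoidAlgebra.coeffAddEquiv.toAddMonoidHom

theorem expDeriv_single {R M : Type} [CommRing R] [AddCommGroup M] (φ : M →+ R) (l : M) (c : R) :
    expDeriv φ (AddMonoidAlgebra.single l c) = AddMonoidAlgebra.single l (φ l * c) := by
  simp [expDeriv, AddMonoidAlgebra.singleAddHom]

theorem expDeriv_mul {R M : Type} [CommRing R] [AddCommGroup M] (φ : M →+ R)
    (f g : AddMonoidAlgebra R M) :
    expDeriv φ (f * g) = expDeriv φ f * g + f * expDeriv φ g := by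
  induction f using AddMonoidAlgebra.induction_linear with
  | zero => simp
  | add a b ha hb => simp only [add_mul, map_add, ha, hb]; abel
  | single l c =>
    induction g using AddMonoidAlgebra.induction_linear with
    | zero => simp
    | add a b ha hb => simp only [mul_add, map_add, ha, hb]; abel
    | single l' c' =>
      simp only [AddMonoidAlgebra.single_mul_single, expDeriv_single, map_add,
        ← AddMonoidAlgebra.single_add]
      congr 1
      ring

/-- `D_α e^l = (α, l) e^l` for `α = ε_i - δ_p`, on `ℂ[P₀]`. -/
def Diso {n m : ℕ} (i : Fin n) (p : Fin m) : CP n m →+ CP n m :=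
  expDeriv
    { toFun := fun l => l.1 (isoH i p)
      map_zero' := rfl
      map_add' := fun _ _ => rfl }

/-- The operator `x_i ∂/∂x_i + y_p ∂/∂y_p` on Laurent polynomials. -/
def Dlaurent {n m : ℕ} (i : Fin n) (p : Fin m) : Laurent n m →+ Laurent n m :=
  expDeriv
    { toFun := fun k => k (Sum.inl i) + k (Sum.inr p)
      map_zero' := by simp
      map_add' := fun a b => by simp only [Pi.add_apply]; ring }

/-- `ℤ[P₀]^{W₀}`. -/
def ZPinv (n m : ℕ) : Subring (ZP n m) :=
  ⨅ w : Weyl n m,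
    RingHom.eqLocus (AddMonoidAlgebra.mapDomainRingHom ℤ (weylWeight w)) (RingHom.id (ZP n m))

/-- `ℤ[x^{±1}, y^{±1}]^{S_n × S_m}`. -/
def LaurentInv (n m : ℕ) : Subring (Laurent n m) :=
  ⨅ w : Weyl n m,
    RingHom.eqLocus (AddMonoidAlgebra.mapDomainRingHom ℤ (weylLattice w)) (RingHom.id (Laurent n m))

/-- The inclusion `ℤ[P₀] ⊂ ℂ[P₀]`. -/
def toCP (n m : ℕ) : ZP n m →+* CP n m := AddMonoidAlgebra.mapRingHom (P0 n m) (Int.castRingHom ℂ)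

/-- The ring `J(sl(n,m))` of exponential super-invariants: `f ∈ ℤ[P₀]^{W₀}` with
`D_α f ∈ (e^α - 1)` for all `α = ε_i - δ_p` (for `-α` the condition is the same one).
As `(α, l)` can be any complex number, the ideal is taken in `ℂ[P₀]`. -/
def J (n m : ℕ) : Subring (ZP n m) where
  carrier := {f | f ∈ ZPinv n m ∧ ∀ (i : Fin n) (p : Fin m),
    Diso i p (toCP n m f) ∈ Ideal.span {(ex (wt (Sum.inl i) - wt (Sum.inr p)) - 1 : CP n m)}}
  mul_mem' := by
    rintro a b ⟨ha, ha'⟩ ⟨hb, hb'⟩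
    refine ⟨mul_mem ha hb, fun i p => ?_⟩
    rw [map_mul, Diso, expDeriv_mul]
    exact add_mem (Ideal.mul_mem_right _ _ (ha' i p)) (Ideal.mul_mem_left _ _ (hb' i p))
  one_mem' := by
    refine ⟨one_mem _, fun i p => ?_⟩
    rw [map_one, AddMonoidAlgebra.one_def, Diso, expDeriv_single]
    simp
  add_mem' := by
    rintro a b ⟨ha, ha'⟩ ⟨hb, hb'⟩
    refine ⟨add_mem ha hb, fun i p => ?_⟩
    rw [map_add, map_add]
    exact add_mem (ha' i p) (hb' i p)
  zero_mem' := ⟨zero_mem _, fun i p => by simp⟩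
  neg_mem' := by
    rintro a ⟨ha, ha'⟩
    refine ⟨neg_mem ha, fun i p => ?_⟩
    rw [map_neg, map_neg]
    exact neg_mem (ha' i p)

/-- `ℂ/ℤ`. -/
abbrev CmodZ : Type := ℂ ⧸ AddSubgroup.zmultiples (1 : ℂ)

/-- The weights in `P₀` of class `a ∈ ℂ/ℤ`, i.e. `s (ε_1 + ⋯ + ε_n) + ∑ k_i ε_i + ∑ k_p δ_p`
with `s` in the class `a` and integral `k_i`, `k_p`. -/
def weightClass (n m : ℕ) (a : CmodZ) : Set (P0 n m) :=
  {l | ∃ s : ℂ, (QuotientAddGroup.mk s : CmodZ) = a ∧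
    ∃ k : Idx n m → ℤ, l = omega n m s + latticeHom n m k}

/-- The component `J(sl(n,m))_a`, `a ∈ ℂ/ℤ`: the elements of `J(sl(n,m))` all of whose weights
are of class `a`. -/
def Jcomp (n m : ℕ) (a : CmodZ) : AddSubgroup (ZP n m) where
  carrier := {f | f ∈ J n m ∧ ∀ l, f.coeff l ≠ 0 → l ∈ weightClass n m a}
  add_mem' := by
    rintro f g ⟨hf, hf'⟩ ⟨hg, hg'⟩
    refine ⟨add_mem hf hg, fun l hl => ?_⟩
    by_cases h : f.coeff l = 0
    · refine hg' l fun h' => hl ?_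
      simp [h, h']
    · exact hf' l h
  zero_mem' := ⟨zero_mem _, fun l hl => absurd rfl hl⟩
  neg_mem' := by
    rintro f ⟨hf, hf'⟩
    refine ⟨neg_mem hf, fun l hl => hf' l fun h => hl ?_⟩
    simp [h]

theorem weightClass_zero_add {n m : ℕ} {l l' : P0 n m} (h : l ∈ weightClass n m 0)
    (h' : l' ∈ weightClass n m 0) : l + l' ∈ weightClass n m 0 := by
  obtain ⟨s, hs, k, rfl⟩ := h
  obtain ⟨s', hs', k', rfl⟩ := h'
  refine ⟨s + s', ?_, k + k', ?_⟩
  · rw [QuotientAddGroup.mk_add, hs, hs', add_zero]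
  · have : omega n m (s + s') = omega n m s + omega n m s' :=
      Subtype.ext (add_smul _ _ _)
    rw [this, map_add]
    abel

/-- The component `J(sl(n,m))_0` is a subring. -/
def Jzero (n m : ℕ) : Subring (ZP n m) where
  __ := Jcomp n m 0
  mul_mem' := by
    classical
    rintro f g ⟨hf, hf'⟩ ⟨hg, hg'⟩
    refine ⟨mul_mem hf hg, fun l hl => ?_⟩
    have h1 : l ∈ (f * g).coeff.support := Finsupp.mem_support_iff.2 hl
    have h2 := AddMonoidAlgebra.support_coeff_mul_subset f g h1
    obtain ⟨a, ha, b, hb, rfl⟩ := Finset.mem_add.1 h2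
    exact weightClass_zero_add (hf' a (Finsupp.mem_support_iff.1 ha))
      (hg' b (Finsupp.mem_support_iff.1 hb))
  one_mem' := by
    classical
    refine ⟨one_mem _, fun l hl => ?_⟩
    have : l = 0 := by
      by_contra h
      apply hl
      rw [AddMonoidAlgebra.one_def, AddMonoidAlgebra.coeff_single, Finsupp.single_apply,
        if_neg (fun h' => h h'.symm)]
    subst this
    refine ⟨0, rfl, 0, ?_⟩
    have : omega n m 0 = 0 := Subtype.ext (zero_smul _ _)
    simp [this]

/-! ### Explicit elements -/

/-- The ring homomorphism `ℤ[x^{±1}, y^{±1}] → ℤ[P₀]`, `x_i ↦ e^{ε_i}`, `y_p ↦ e^{δ_p}`. -/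
def toZP (n m : ℕ) : Laurent n m →+* ZP n m :=
  AddMonoidAlgebra.mapDomainRingHom ℤ (latticeHom n m)

/-- The variable `x_i` (`k = inl i`) or `y_p` (`k = inr p`). -/
def var {n m : ℕ} (k : Idx n m) : Laurent n m := ex (Pi.single k 1)

/-- `x_1 ⋯ x_n - y_1 ⋯ y_m`. -/
def detRel (n m : ℕ) : Laurent n m :=
  ∏ i : Fin n, var (Sum.inl i) - ∏ p : Fin m, var (Sum.inr p)

theorem var_weyl {n m : ℕ} (w : Weyl n m) (k : Idx n m) :
    AddMonoidAlgebra.mapDomainRingHom ℤ (weylLattice w) (var k) = var (w.perm k) := by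
  have h : weylLattice w (Pi.single k 1) = Pi.single (w.perm k) 1 := by
    funext j
    simp [weylLattice, Pi.single_apply, Equiv.symm_apply_eq]
  simp [var, ex, h]

theorem detRel_mem (n m : ℕ) : detRel n m ∈ LaurentInv n m := by
  refine (Subring.mem_iInf).2 fun w => ?_
  change AddMonoidAlgebra.mapDomainRingHom ℤ (weylLattice w) (detRel n m) = detRel n m
  have h1 : ∏ i : Fin n, var (n := n) (m := m) (w.perm (Sum.inl i)) = ∏ i, var (Sum.inl i) :=
    Equiv.prod_comp w.1 (fun i => var (n := n) (m := m) (Sum.inl i))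
  have h2 : ∏ i : Fin m, var (n := n) (m := m) (w.perm (Sum.inr i)) = ∏ i, var (Sum.inr i) :=
    Equiv.prod_comp w.2 (fun i => var (n := n) (m := m) (Sum.inr i))
  rw [detRel, map_sub, map_prod, map_prod]
  simp only [var_weyl, h1, h2]

/-- `∏_{i,p} (1 - x_i / y_p)` in `ℤ[P₀]`. -/
def kacFactor (n m : ℕ) : ZP n m :=
  ∏ i : Fin n, ∏ p : Fin m, (1 - ex (wt (Sum.inl i) - wt (Sum.inr p)))

/-- The coefficient of `t^k` in the expansion at `t = 0` of
`∏_p (1 - v_p t) / ∏_i (1 - u_i t)`. -/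
def hCoeff {B : Type} [CommRing B] {n m : ℕ} (u : Fin n → B) (v : Fin m → B) (k : ℕ) : B :=
  PowerSeries.coeff k
    ((∏ p, (1 - PowerSeries.C (v p) * PowerSeries.X)) *
      PowerSeries.invOfUnit (∏ i, (1 - PowerSeries.C (u i) * PowerSeries.X)) 1)

/-- `h_k(x, y)`. -/
def hk (n m : ℕ) (k : ℕ) : ZP n m :=
  hCoeff (fun i : Fin n => ex (wt (Sum.inl i))) (fun p : Fin m => ex (wt (Sum.inr p))) k

/-- `h_k^* = h_k(x^{-1}, y^{-1})`. -/
def hkStar (n m : ℕ) (k : ℕ) : ZP n m :=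
  hCoeff (fun i : Fin n => ex (-wt (Sum.inl i))) (fun p : Fin m => ex (-wt (Sum.inr p))) k

/-! ### Commutative superalgebras and points of `SL(n,m)` -/

/-- `(-1)^i` for a parity `i`. -/
def sgn (i : ZMod 2) : ℂ := if i = 0 then 1 else -1

theorem sgn_zero : sgn 0 = 1 := by simp [sgn]

theorem sgn_add (i j : ZMod 2) : sgn (i + j) = sgn i * sgn j := by
  revert i j
  have h : ∀ i : ZMod 2, i = 0 ∨ i = 1 := by decide
  intro i j
  have h2 : (1 : ZMod 2) + 1 = 0 := by decide
  rcases h i with rfl | rfl <;> rcases h j with rfl | rfl <;> simp [sgn, h2]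

/-- A (super)commutative `ℤ/2`-graded algebra over `ℂ`. -/
structure SAlg : Type 1 where
  carrier : Type
  [ring : Ring carrier]
  [algebra : Algebra ℂ carrier]
  /-- the homogeneous components -/
  grade : ZMod 2 → Submodule ℂ carrier
  [graded : GradedAlgebra grade]
  comm : ∀ (i j : ZMod 2) (a b : carrier), a ∈ grade i → b ∈ grade j →
    a * b = sgn (i * j) • (b * a)

instance : CoeSort SAlg Type := ⟨SAlg.carrier⟩

instance (A : SAlg) : Ring A := A.ring

instance (A : SAlg) : Algebra ℂ A := A.algebra

instance (A : SAlg) : GradedAlgebra A.grade := A.graded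

/-- The even part is a commutative ring. -/
instance (A : SAlg) : CommRing (A.grade 0) where
  __ := SetLike.GradeZero.instRing A.grade
  mul_comm a b := by
    apply Subtype.ext
    have h := A.comm 0 0 a b a.2 b.2
    rw [mul_zero, sgn_zero, one_smul] at h
    exact h

theorem SAlg.mul_mul_swap (A : SAlg) {i j : ZMod 2} {a b c d : A} (hb : b ∈ A.grade i)
    (hc : c ∈ A.grade j) : a * b * (c * d) = sgn (i * j) • (a * c * (b * d)) := by
  rw [mul_assoc, ← mul_assoc b, A.comm i j b c hb hc]
  simp only [smul_mul_assoc, mul_smul_comm, mul_assoc]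

/-- Homomorphisms of superalgebras: parity preserving algebra homomorphisms. -/
structure SAlg.Hom (A B : SAlg) where
  toAlgHom : A →ₐ[ℂ] B
  map_grade : ∀ (i : ZMod 2) (a : A), a ∈ A.grade i → toAlgHom a ∈ B.grade i

/-- The even component of an element of a superalgebra. -/
def SAlg.even (A : SAlg) (a : A) : A.grade 0 := DirectSum.decompose A.grade a 0

/-- The parity of a row of an `(n|m) × (n|m)` supermatrix. -/
def stdParity {n m : ℕ} : Idx n m → ZMod 2 := Sum.elim (fun _ => 0) (fun _ => 1)

/-- Even supermatrices: the entry at `(i, j)` has parity `p(i) + p(j)`. -/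
def IsEvenMat {ι κ : Type} (A : SAlg) (p : ι → ZMod 2) (q : κ → ZMod 2) (g : Matrix ι κ A) : Prop :=
  ∀ i j, g i j ∈ A.grade (p i + q j)

/-- The block `d` of the even supermatrix `(a b; c d)`. -/
def blockD {n m : ℕ} (A : SAlg) (g : Matrix (Idx n m) (Idx n m) A) :
    Matrix (Fin m) (Fin m) (A.grade 0) :=
  Matrix.of fun p q => A.even (g (Sum.inr p) (Sum.inr q))

/-- `a - b d⁻¹ c` for the even supermatrix `(a b; c d)` (with invertible `d`). -/
def schurComplement {n m : ℕ} (A : SAlg) (g : Matrix (Idx n m) (Idx n m) A) :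
    Matrix (Fin n) (Fin n) (A.grade 0) :=
  Matrix.of fun i j => A.even (g (Sum.inl i) (Sum.inl j) -
    ∑ p, ∑ q, g (Sum.inl i) (Sum.inr p) * (((blockD A g)⁻¹ p q : A.grade 0) : A) *
      g (Sum.inr q) (Sum.inl j))

/-- The Berezinian `det(a - b d⁻¹ c) det(d)⁻¹` of an invertible even supermatrix `(a b; c d)`
(then `d` is invertible). -/
def berezinian {n m : ℕ} (A : SAlg) (g : Matrix (Idx n m) (Idx n m) A) : A.grade 0 :=
  (schurComplement A g).det * Ring.inverse (blockD A g).det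

/-- The `A`-points of the algebraic supergroup `SL(n,m)`: invertible even supermatrices over `A`
with Berezinian `1`. They form a group under matrix multiplication, since the Berezinian
is multiplicative. -/
def SLPoints (n m : ℕ) (A : SAlg) : Set (Matrix (Idx n m) (Idx n m) A) :=
  {g | IsEvenMat A stdParity stdParity g ∧ IsUnit g ∧ berezinian A g = 1}

/-! ### Representations of the supergroup `SL(n,m)` -/

/-- A finite dimensional representation of the algebraic supergroup `SL(n,m)`, on a superspace
with a homogeneous basis indexed by `ι`: a family, natural in the commutative superalgebra `A`, of
group homomorphisms from `SL(n,m)(A)` to the group `GL(V)(A)` of invertible even matrices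
over `A`. (Invertibility of `act A g` follows from `act_one` and `act_mul`.) -/
structure SLRep (n m : ℕ) : Type 1 where
  ι : Type
  [fin : Fintype ι]
  [dec : DecidableEq ι]
  /-- the parities of the basis vectors -/
  par : ι → ZMod 2
  /-- the action of the points -/
  act : ∀ A : SAlg, SLPoints n m A → Matrix ι ι A
  act_even : ∀ (A : SAlg) (g : SLPoints n m A), IsEvenMat A par par (act A g)
  act_one : ∀ (A : SAlg) (g : SLPoints n m A), g.1 = 1 → act A g = 1
  act_mul : ∀ (A : SAlg) (g h k : SLPoints n m A), k.1 = g.1 * h.1 → act A k = act A g * act A h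
  act_natural : ∀ (A B : SAlg) (f : SAlg.Hom A B) (g : SLPoints n m A) (g' : SLPoints n m B),
    g'.1 = g.1.map f.toAlgHom → act B g' = (act A g).map f.toAlgHom

instance {n m : ℕ} (V : SLRep n m) : Fintype V.ι := V.fin

instance {n m : ℕ} (V : SLRep n m) : DecidableEq V.ι := V.dec

/-- Parity preserving morphisms of representations, as matrices over `ℂ`. -/
structure SLRep.Hom {n m : ℕ} (V W : SLRep n m) where
  mat : Matrix W.ι V.ι ℂ
  even : ∀ i j, mat i j ≠ 0 → W.par i = V.par j
  comm : ∀ (A : SAlg) (g : SLPoints n m A),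
    W.act A g * mat.map (algebraMap ℂ A) = mat.map (algebraMap ℂ A) * V.act A g

/-- Exactness of `0 → U → V → W → 0`. -/
def SLRep.IsShortExact {n m : ℕ} {U V W : SLRep n m} (S : SLRep.Hom U V) (T : SLRep.Hom V W) :
    Prop :=
  Function.Injective S.mat.mulVec ∧ Function.Exact S.mat.mulVec T.mat.mulVec ∧
    Function.Surjective T.mat.mulVec

/-- The parity change functor. (In terms of matrix entries relative to a basis of the right
`A`-module `V ⊗ A` the action does not change.) -/
def SLRep.parityShift {n m : ℕ} (V : SLRep n m) : SLRep n m where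
  ι := V.ι
  par i := V.par i + 1
  act := V.act
  act_even A g i j := by
    have h : V.par i + 1 + (V.par j + 1) = V.par i + V.par j := by
      have h2 : (1 : ZMod 2) + 1 = 0 := by decide
      rw [add_add_add_comm, h2, add_zero]
    rw [h]
    exact V.act_even A g i j
  act_one := V.act_one
  act_mul := V.act_mul
  act_natural := V.act_natural

/-- The tensor product: `g (e_j ⊗ f_l) = g e_j ⊗ g f_l` in the right `A`-module `V ⊗ W ⊗ A`,
where an entry of `g` is moved past a basis vector of `W` by the sign rule. -/
def SLRep.tensor {n m : ℕ} (V W : SLRep n m) : SLRep n m where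
  ι := V.ι × W.ι
  par i := V.par i.1 + W.par i.2
  act A g := Matrix.of fun i j =>
    sgn ((V.par i.1 + V.par j.1) * W.par i.2) • (V.act A g i.1 j.1 * W.act A g i.2 j.2)
  act_even A g i j := by
    have h := SetLike.mul_mem_graded (V.act_even A g i.1 j.1) (W.act_even A g i.2 j.2)
    rw [add_add_add_comm] at h
    exact Submodule.smul_mem _ _ h
  act_one A g hg := by
    ext ⟨i, k⟩ ⟨j, l⟩
    rw [Matrix.of_apply, V.act_one A g hg, W.act_one A g hg]
    have h2 : ∀ i : ZMod 2, i + i = 0 := by decide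
    by_cases h : i = j
    · subst h
      simp [h2, sgn_zero, Matrix.one_apply]
    · simp [h, Matrix.one_apply]
  act_mul A g h k hk := by
    ext ⟨i, k⟩ ⟨r, s⟩
    rw [Matrix.of_apply, V.act_mul A g h _ hk, W.act_mul A g h _ hk, Matrix.mul_apply,
      Matrix.mul_apply, Matrix.mul_apply, Finset.sum_mul_sum, Fintype.sum_prod_type,
      Finset.smul_sum]
    refine Finset.sum_congr rfl fun j _ => ?_
    rw [Finset.smul_sum]
    refine Finset.sum_congr rfl fun l _ => ?_
    simp only [Matrix.of_apply]
    rw [smul_mul_smul_comm, SAlg.mul_mul_swap A (W.act_even A g k l) (V.act_even A h j r),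
      smul_smul, ← sgn_add, ← sgn_add]
    have hs : ∀ a b c d e : ZMod 2,
        (a + b) * d = (a + c) * d + (c + b) * e + (d + e) * (c + b) := by decide
    rw [hs (V.par i) (V.par r) (V.par j) (W.par k) (W.par l)]
  act_natural A B f g g' hg := by
    ext ⟨i, k⟩ ⟨j, l⟩
    rw [Matrix.of_apply, V.act_natural A B f g g' hg, W.act_natural A B f g g' hg]
    simp

instance {n m : ℕ} : Mul (SLRep n m) := ⟨SLRep.tensor⟩

/-! ### The Grothendieck ring -/

/-- The subgroup of relations: `[U] - [V] + [W]` for exact sequences `0 → U → V → W → 0`,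
and `[V] + [Π V]`. -/
def grothRel (n m : ℕ) : AddSubgroup (FreeAbelianGroup (SLRep n m)) :=
  AddSubgroup.closure
    ({x | ∃ (U V W : SLRep n m) (S : SLRep.Hom U V) (T : SLRep.Hom V W),
        SLRep.IsShortExact S T ∧
          x = FreeAbelianGroup.of U - FreeAbelianGroup.of V + FreeAbelianGroup.of W} ∪
      {x | ∃ V : SLRep n m, x = FreeAbelianGroup.of V + FreeAbelianGroup.of V.parityShift})

theorem sgn_smul_comm_even {n m : ℕ} {V W : SLRep n m} (S : SLRep.Hom V W) (A : SAlg)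
    (c : ZMod 2) (k : W.ι) (l : V.ι) (x : A) :
    sgn (c * W.par k) • (algebraMap ℂ A (S.mat k l) * x) =
      algebraMap ℂ A (S.mat k l) * (sgn (c * V.par l) • x) := by
  by_cases h : S.mat k l = 0
  · simp [h]
  · rw [S.even k l h, mul_smul_comm]

/-- `id_U ⊗ S`. -/
def SLRep.Hom.tensorLeft {n m : ℕ} (U : SLRep n m) {V W : SLRep n m} (S : SLRep.Hom V W) :
    SLRep.Hom (U * V) (U * W) where
  mat := Matrix.of fun (i : U.ι × W.ι) (j : U.ι × V.ι) => if i.1 = j.1 then S.mat i.2 j.2 else 0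
  even := by
    rintro ⟨i, k⟩ ⟨j, l⟩ h
    by_cases hij : i = j
    · subst hij
      have h' : S.mat k l ≠ 0 := fun h0 => h ((if_pos rfl).trans h0)
      change U.par i + W.par k = U.par i + V.par l
      rw [S.even k l h']
    · exact absurd (if_neg hij) h
  comm A g := by
    apply Matrix.ext
    rintro ⟨i, k⟩ ⟨r, s⟩
    have hS := congrFun (congrFun (S.comm A g) k) s
    simp only [Matrix.mul_apply, Matrix.map_apply] at hS
    change ∑ x : U.ι × W.ι, sgn ((U.par i + U.par x.1) * W.par k) •
        (U.act A g i x.1 * W.act A g k x.2) *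
          algebraMap ℂ A (if x.1 = r then S.mat x.2 s else 0) =
      ∑ x : U.ι × V.ι, algebraMap ℂ A (if i = x.1 then S.mat k x.2 else 0) *
        sgn ((U.par x.1 + U.par r) * V.par x.2) • (U.act A g x.1 r * V.act A g x.2 s)
    rw [Fintype.sum_prod_type, Fintype.sum_prod_type]
    rw [Finset.sum_eq_single r, Finset.sum_eq_single i]
    · simp only [if_true, smul_mul_assoc, mul_assoc]
      rw [← Finset.smul_sum, ← Finset.mul_sum, hS, Finset.mul_sum, Finset.smul_sum]
      refine Finset.sum_congr rfl fun l _ => ?_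
      rw [← sgn_smul_comm_even, ← mul_assoc, ← mul_assoc, Algebra.commutes]
    · intro j _ hj
      refine Finset.sum_eq_zero fun l _ => ?_
      rw [if_neg (Ne.symm hj)]
      simp
    · simp
    · intro j _ hj
      refine Finset.sum_eq_zero fun l _ => ?_
      rw [if_neg hj]
      simp
    · simp

/-- `S ⊗ id_U`. -/
def SLRep.Hom.tensorRight {n m : ℕ} (U : SLRep n m) {V W : SLRep n m} (S : SLRep.Hom V W) :
    SLRep.Hom (V * U) (W * U) where
  mat := Matrix.of fun (i : W.ι × U.ι) (j : V.ι × U.ι) => if i.2 = j.2 then S.mat i.1 j.1 else 0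
  even := by
    rintro ⟨i, k⟩ ⟨j, l⟩ h
    by_cases hkl : k = l
    · subst hkl
      have h' : S.mat i j ≠ 0 := fun h0 => h ((if_pos rfl).trans h0)
      change W.par i + U.par k = V.par j + U.par k
      rw [S.even i j h']
    · exact absurd (if_neg hkl) h
  comm A g := by
    apply Matrix.ext
    rintro ⟨i, k⟩ ⟨r, s⟩
    have hS := congrFun (congrFun (S.comm A g) i) r
    simp only [Matrix.mul_apply, Matrix.map_apply] at hS
    change ∑ x : W.ι × U.ι, sgn ((W.par i + W.par x.1) * U.par k) •
        (W.act A g i x.1 * U.act A g k x.2) *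
          algebraMap ℂ A (if x.2 = s then S.mat x.1 r else 0) =
      ∑ x : V.ι × U.ι, algebraMap ℂ A (if k = x.2 then S.mat i x.1 else 0) *
        sgn ((V.par x.1 + V.par r) * U.par x.2) • (V.act A g x.1 r * U.act A g x.2 s)
    rw [Fintype.sum_prod_type, Fintype.sum_prod_type]
    have e1 : ∀ j : W.ι, (∑ l : U.ι, sgn ((W.par i + W.par j) * U.par k) •
        (W.act A g i j * U.act A g k l) * algebraMap ℂ A (if l = s then S.mat j r else 0)) =
        sgn ((W.par i + V.par r) * U.par k) •
          (W.act A g i j * algebraMap ℂ A (S.mat j r) * U.act A g k s) := by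
      intro j
      rw [Finset.sum_eq_single s]
      · by_cases h : S.mat j r = 0
        · simp [h]
        · rw [if_pos rfl, S.even j r h, smul_mul_assoc, mul_assoc, mul_assoc, Algebra.commutes]
      · intro l _ hl
        rw [if_neg hl]
        simp
      · simp
    have e2 : ∀ j : V.ι, (∑ l : U.ι, algebraMap ℂ A (if k = l then S.mat i j else 0) *
        sgn ((V.par j + V.par r) * U.par l) • (V.act A g j r * U.act A g l s)) =
        sgn ((W.par i + V.par r) * U.par k) •
          (algebraMap ℂ A (S.mat i j) * V.act A g j r * U.act A g k s) := by
      intro j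
      rw [Finset.sum_eq_single k]
      · by_cases h : S.mat i j = 0
        · simp [h]
        · rw [if_pos rfl, S.even i j h, mul_smul_comm, mul_assoc]
      · intro l _ hl
        rw [if_neg (Ne.symm hl)]
        simp
      · simp
    simp only [e1, e2, ← Finset.smul_sum, ← Finset.sum_mul]
    rw [hS]

theorem SLRep.Hom.tensorLeft_mulVec {n m : ℕ} (U : SLRep n m) {V W : SLRep n m}
    (S : SLRep.Hom V W) (v : U.ι × V.ι → ℂ) (i : U.ι) (k : W.ι) :
    (S.tensorLeft U).mat.mulVec v (i, k) = S.mat.mulVec (fun l => v (i, l)) k := by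
  refine (Fintype.sum_prod_type (α₁ := U.ι) (α₂ := V.ι) _).trans ?_
  rw [Finset.sum_eq_single i]
  · refine Finset.sum_congr rfl fun l _ => ?_
    change (if i = i then S.mat k l else 0) * _ = _
    rw [if_pos rfl]
  · intro j _ hj
    refine Finset.sum_eq_zero fun l _ => ?_
    change (if i = j then S.mat k l else 0) * _ = _
    rw [if_neg (Ne.symm hj), zero_mul]
  · simp

theorem SLRep.Hom.tensorRight_mulVec {n m : ℕ} (U : SLRep n m) {V W : SLRep n m}
    (S : SLRep.Hom V W) (v : V.ι × U.ι → ℂ) (i : W.ι) (k : U.ι) :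
    (S.tensorRight U).mat.mulVec v (i, k) = S.mat.mulVec (fun l => v (l, k)) i := by
  refine (Fintype.sum_prod_type (α₁ := V.ι) (α₂ := U.ι) _).trans ?_
  refine Finset.sum_congr rfl fun j _ => ?_
  rw [Finset.sum_eq_single k]
  · change (if k = k then S.mat i j else 0) * _ = _
    rw [if_pos rfl]
  · intro l _ hl
    change (if k = l then S.mat i j else 0) * _ = _
    rw [if_neg (Ne.symm hl), zero_mul]
  · simp

theorem SLRep.IsShortExact.tensorLeft {n m : ℕ} (X : SLRep n m) {U V W : SLRep n m}
    {S : SLRep.Hom U V} {T : SLRep.Hom V W} (h : SLRep.IsShortExact S T) :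
    SLRep.IsShortExact (S.tensorLeft X) (T.tensorLeft X) := by
  obtain ⟨h1, h2, h3⟩ := h
  refine ⟨fun v w hvw => ?_, fun v => ⟨fun hv => ?_, ?_⟩, fun w => ?_⟩
  · funext ⟨i, k⟩
    have : (fun l => v (i, l)) = fun l => w (i, l) := h1 <| funext fun k => by
      rw [← SLRep.Hom.tensorLeft_mulVec X S v i k, ← SLRep.Hom.tensorLeft_mulVec X S w i k, hvw]
    exact congrFun this k
  · have : ∀ i : X.ι, ∃ u, S.mat.mulVec u = fun l => v (i, l) := fun i =>
      (h2 _).1 <| funext fun k => by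
        rw [← SLRep.Hom.tensorLeft_mulVec X T v i k, hv]
        rfl
    choose u hu using this
    refine ⟨fun ik => u ik.1 ik.2, funext fun ⟨i, k⟩ => ?_⟩
    exact (SLRep.Hom.tensorLeft_mulVec X _ _ i k).trans (congrFun (hu i) k)
  · rintro ⟨u, rfl⟩
    funext ⟨i, k⟩
    refine (SLRep.Hom.tensorLeft_mulVec X _ _ i k).trans ?_
    have : (fun l => (S.tensorLeft X).mat.mulVec u (i, l)) = S.mat.mulVec fun l => u (i, l) :=
      funext fun l => SLRep.Hom.tensorLeft_mulVec X S u i l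
    rw [this, h2.apply_apply_eq_zero]
    rfl
  · have : ∀ i : X.ι, ∃ u, T.mat.mulVec u = fun l => w (i, l) := fun i => h3 _
    choose u hu using this
    refine ⟨fun ik => u ik.1 ik.2, funext fun ⟨i, k⟩ => ?_⟩
    exact (SLRep.Hom.tensorLeft_mulVec X _ _ i k).trans (congrFun (hu i) k)

theorem SLRep.IsShortExact.tensorRight {n m : ℕ} (X : SLRep n m) {U V W : SLRep n m}
    {S : SLRep.Hom U V} {T : SLRep.Hom V W} (h : SLRep.IsShortExact S T) :
    SLRep.IsShortExact (S.tensorRight X) (T.tensorRight X) := by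
  obtain ⟨h1, h2, h3⟩ := h
  refine ⟨fun v w hvw => ?_, fun v => ⟨fun hv => ?_, ?_⟩, fun w => ?_⟩
  · funext ⟨i, k⟩
    have : (fun l => v (l, k)) = fun l => w (l, k) := h1 <| funext fun i => by
      rw [← SLRep.Hom.tensorRight_mulVec X S v i k, ← SLRep.Hom.tensorRight_mulVec X S w i k, hvw]
    exact congrFun this i
  · have : ∀ k : X.ι, ∃ u, S.mat.mulVec u = fun l => v (l, k) := fun k =>
      (h2 _).1 <| funext fun i => by
        rw [← SLRep.Hom.tensorRight_mulVec X T v i k, hv]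
        rfl
    choose u hu using this
    refine ⟨fun ik => u ik.2 ik.1, funext fun ⟨i, k⟩ => ?_⟩
    exact (SLRep.Hom.tensorRight_mulVec X _ _ i k).trans (congrFun (hu k) i)
  · rintro ⟨u, rfl⟩
    funext ⟨i, k⟩
    refine (SLRep.Hom.tensorRight_mulVec X _ _ i k).trans ?_
    have : (fun l => (S.tensorRight X).mat.mulVec u (l, k)) = S.mat.mulVec fun l => u (l, k) :=
      funext fun l => SLRep.Hom.tensorRight_mulVec X S u l k
    rw [this, h2.apply_apply_eq_zero]
    rfl
  · have : ∀ k : X.ι, ∃ u, T.mat.mulVec u = fun l => w (l, k) := fun k => h3 _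
    choose u hu using this
    refine ⟨fun ik => u ik.2 ik.1, funext fun ⟨i, k⟩ => ?_⟩
    exact (SLRep.Hom.tensorRight_mulVec X _ _ i k).trans (congrFun (hu k) i)

/-- The zero representation. -/
def SLRep.zero (n m : ℕ) : SLRep n m where
  ι := Empty
  par := Empty.elim
  act _ _ := 0
  act_even _ _ i := i.elim
  act_one _ _ _ := Subsingleton.elim _ _
  act_mul _ _ _ _ _ := Subsingleton.elim _ _
  act_natural _ _ _ _ _ _ := Subsingleton.elim _ _

/-- The zero morphism to the zero representation. -/
def SLRep.Hom.toZero {n m : ℕ} (V : SLRep n m) : SLRep.Hom V (SLRep.zero n m) where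
  mat := fun i => Empty.elim i
  even i := Empty.elim i
  comm _ _ := funext fun i => Empty.elim i

theorem zero_mem_grothRel (n m : ℕ) : FreeAbelianGroup.of (SLRep.zero n m) ∈ grothRel n m := by
  have hs : Subsingleton ((SLRep.zero n m).ι → ℂ) := ⟨fun a b => funext fun i => Empty.elim i⟩
  have h : FreeAbelianGroup.of (SLRep.zero n m) - FreeAbelianGroup.of (SLRep.zero n m) +
      FreeAbelianGroup.of (SLRep.zero n m) ∈ grothRel n m :=
    AddSubgroup.subset_closure (Or.inl ⟨_, _, _, SLRep.Hom.toZero _, SLRep.Hom.toZero _,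
      ⟨fun a b _ => Subsingleton.elim a b,
        fun a => ⟨fun _ => ⟨0, Subsingleton.elim _ _⟩, fun _ => Subsingleton.elim _ _⟩,
        fun a => ⟨0, Subsingleton.elim _ _⟩⟩, rfl⟩)
  simpa using h

theorem iso_mem_grothRel {n m : ℕ} {V W : SLRep n m} (S : SLRep.Hom V W)
    (hS : Function.Bijective S.mat.mulVec) :
    FreeAbelianGroup.of V - FreeAbelianGroup.of W ∈ grothRel n m := by
  have hs : Subsingleton ((SLRep.zero n m).ι → ℂ) := ⟨fun a b => funext fun i => Empty.elim i⟩
  have h : FreeAbelianGroup.of V - FreeAbelianGroup.of W +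
      FreeAbelianGroup.of (SLRep.zero n m) ∈ grothRel n m :=
    AddSubgroup.subset_closure (Or.inl ⟨_, _, _, S, SLRep.Hom.toZero _,
      ⟨hS.1, fun a => ⟨fun _ => hS.2 a, fun _ => Subsingleton.elim _ _⟩,
        fun a => ⟨0, Subsingleton.elim _ _⟩⟩, rfl⟩)
  simpa using sub_mem h (zero_mem_grothRel n m)

theorem diag_mem_grothRel {n m : ℕ} {V W : SLRep n m} (e : W.ι ≃ V.ι) (c : W.ι → ℂ)
    (hc : ∀ i, c i ≠ 0) (hpar : ∀ i, W.par i = V.par (e i))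
    (hcomm : ∀ (A : SAlg) (g : SLPoints n m A) (i j : W.ι),
      c j • W.act A g i j = c i • V.act A g (e i) (e j)) :
    FreeAbelianGroup.of V - FreeAbelianGroup.of W ∈ grothRel n m := by
  let S : SLRep.Hom V W :=
    { mat := fun i j => if e i = j then c i else 0
      even := by
        intro i j h
        by_cases hij : e i = j
        · rw [hpar, hij]
        · exact absurd (if_neg hij) h
      comm := by
        intro A g
        apply Matrix.ext
        intro i j
        obtain ⟨j, rfl⟩ := e.surjective j
        change ∑ k, W.act A g i k * algebraMap ℂ A (if e k = e j then c k else 0) =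
          ∑ k, algebraMap ℂ A (if e i = k then c i else 0) * V.act A g k (e j)
        rw [Finset.sum_eq_single j, Finset.sum_eq_single (e i), if_pos rfl, if_pos rfl,
          ← Algebra.commutes, ← Algebra.smul_def, ← Algebra.smul_def, hcomm]
        · intro k _ hk
          rw [if_neg (Ne.symm hk)]
          simp
        · simp
        · intro k _ hk
          rw [if_neg (fun h => hk (e.injective h))]
          simp
        · simp }
  have hS : ∀ v i, S.mat.mulVec v i = c i * v (e i) := by
    intro v i
    change ∑ j, (if e i = j then c i else 0) * v j = _
    simp
  refine iso_mem_grothRel S ⟨fun v w hvw => ?_, fun w => ?_⟩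
  · funext j
    obtain ⟨i, rfl⟩ := e.surjective j
    have h := congrFun hvw i
    rw [hS, hS] at h
    exact mul_left_cancel₀ (hc i) h
  · refine ⟨fun j => (c (e.symm j))⁻¹ * w (e.symm j), funext fun i => ?_⟩
    rw [hS, Equiv.symm_apply_apply, mul_inv_cancel_left₀ (hc i)]

theorem sgn_ne_zero (i : ZMod 2) : sgn i ≠ 0 := by
  unfold sgn
  split_ifs <;> simp

theorem tensor_parityShift {n m : ℕ} (U V : SLRep n m) :
    FreeAbelianGroup.of (U * V.parityShift) - FreeAbelianGroup.of (U * V).parityShift ∈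
      grothRel n m := by
  refine diag_mem_grothRel (W := (U * V).parityShift) (V := U * V.parityShift)
    (Equiv.refl (U.ι × V.ι)) (fun i : U.ι × V.ι => sgn (U.par i.1)) (fun i => sgn_ne_zero _)
    (fun i => add_assoc _ _ _) ?_
  rintro A g ⟨i, k⟩ ⟨j, l⟩
  change sgn (U.par j) • sgn ((U.par i + U.par j) * V.par k) • (U.act A g i j * V.act A g k l) =
    sgn (U.par i) • sgn ((U.par i + U.par j) * (V.par k + 1)) • (U.act A g i j * V.act A g k l)
  rw [smul_smul, smul_smul, ← sgn_add, ← sgn_add]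
  have hs : ∀ a b c : ZMod 2, b + (a + b) * c = a + (a + b) * (c + 1) := by decide
  rw [hs (U.par i) (U.par j) (V.par k)]

theorem parityShift_tensor {n m : ℕ} (U V : SLRep n m) :
    FreeAbelianGroup.of (V.parityShift * U) - FreeAbelianGroup.of (V * U).parityShift ∈
      grothRel n m := by
  refine diag_mem_grothRel (W := (V * U).parityShift) (V := V.parityShift * U)
    (Equiv.refl (V.ι × U.ι)) (fun i : V.ι × U.ι => 1) (fun i => one_ne_zero)
    (fun i => add_right_comm _ _ _) ?_
  rintro A g ⟨i, k⟩ ⟨j, l⟩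
  change (1 : ℂ) • sgn ((V.par i + V.par j) * U.par k) • (V.act A g i j * U.act A g k l) =
    (1 : ℂ) • sgn ((V.par i + 1 + (V.par j + 1)) * U.par k) • (V.act A g i j * U.act A g k l)
  have hs : ∀ a b : ZMod 2, a + 1 + (b + 1) = a + b := by decide
  rw [hs]

theorem grothRel_mul_left {n m : ℕ} (x y : FreeAbelianGroup (SLRep n m)) (hy : y ∈ grothRel n m) :
    x * y ∈ grothRel n m := by
  induction x using FreeAbelianGroup.induction_on with
  | zero => simp
  | neg U ih => rw [neg_mul]; exact neg_mem ih
  | add a b ha hb => rw [add_mul]; exact add_mem ha hb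
  | of X =>
    induction hy using AddSubgroup.closure_induction with
    | zero => simp
    | add a b _ _ ha hb => rw [mul_add]; exact add_mem ha hb
    | neg a _ ha => rw [mul_neg]; exact neg_mem ha
    | mem a ha =>
      rcases ha with ⟨U, V, W, S, T, h, rfl⟩ | ⟨V, rfl⟩
      · rw [mul_add, mul_sub]
        simp only [FreeAbelianGroup.of_mul_of]
        exact AddSubgroup.subset_closure (Or.inl ⟨_, _, _, _, _, h.tensorLeft X, rfl⟩)
      · rw [mul_add]
        simp only [FreeAbelianGroup.of_mul_of]
        have h1 : FreeAbelianGroup.of (X * V) + FreeAbelianGroup.of (X * V).parityShift ∈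
            grothRel n m := AddSubgroup.subset_closure (Or.inr ⟨_, rfl⟩)
        have h2 := add_mem h1 (tensor_parityShift X V)
        convert h2 using 1
        abel

theorem grothRel_mul_right {n m : ℕ} (x y : FreeAbelianGroup (SLRep n m))
    (hx : x ∈ grothRel n m) : x * y ∈ grothRel n m := by
  induction y using FreeAbelianGroup.induction_on with
  | zero => simp
  | neg U ih => rw [mul_neg]; exact neg_mem ih
  | add a b ha hb => rw [mul_add]; exact add_mem ha hb
  | of X =>
    induction hx using AddSubgroup.closure_induction with
    | zero => simp
    | add a b _ _ ha hb => rw [add_mul]; exact add_mem ha hb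
    | neg a _ ha => rw [neg_mul]; exact neg_mem ha
    | mem a ha =>
      rcases ha with ⟨U, V, W, S, T, h, rfl⟩ | ⟨V, rfl⟩
      · rw [add_mul, sub_mul]
        simp only [FreeAbelianGroup.of_mul_of]
        exact AddSubgroup.subset_closure (Or.inl ⟨_, _, _, _, _, h.tensorRight X, rfl⟩)
      · rw [add_mul]
        simp only [FreeAbelianGroup.of_mul_of]
        have h1 : FreeAbelianGroup.of (V * X) + FreeAbelianGroup.of (V * X).parityShift ∈
            grothRel n m := AddSubgroup.subset_closure (Or.inr ⟨_, rfl⟩)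
        have h2 := add_mem h1 (parityShift_tensor X V)
        convert h2 using 1
        abel

/-- Congruence modulo the subgroup of relations; it is compatible with the product
`[U] [V] = [U ⊗ V]`. -/
def grothCon (n m : ℕ) : RingCon (FreeAbelianGroup (SLRep n m)) where
  r x y := x - y ∈ grothRel n m
  iseqv :=
    { refl := fun x => by rw [sub_self]; exact zero_mem _
      symm := fun {x y} h => by rw [← neg_sub]; exact neg_mem h
      trans := fun {x y z} h h' => by rw [← sub_add_sub_cancel x y z]; exact add_mem h h' }
  add' := fun {a b c d} h h' => by
    rw [add_sub_add_comm]
    exact add_mem h h'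
  mul' := fun {a b c d} h h' => by
    have e : a * c - b * d = (a - b) * c + b * (c - d) := by
      rw [sub_mul, mul_sub]
      abel
    rw [e]
    exact add_mem (grothRel_mul_right _ _ h) (grothRel_mul_left _ _ h')

/-- The Grothendieck ring of finite dimensional representations of the supergroup `SL(n,m)`. -/
abbrev GrothSL (n m : ℕ) : Type 1 := (grothCon n m).Quotient

/-- The class `[V]`. -/
def grothClass {n m : ℕ} (V : SLRep n m) : GrothSL n m :=
  ((FreeAbelianGroup.of V : FreeAbelianGroup (SLRep n m)) : (grothCon n m).Quotient)

/-! ### Supercharacters -/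

/-- The grading of `ℂ` as a purely even superalgebra. -/
def complexGrade (i : ZMod 2) : Submodule ℂ ℂ := if i = 0 then ⊤ else ⊥

theorem mem_complexGrade_zero (a : ℂ) : a ∈ complexGrade 0 := by simp [complexGrade]

theorem eq_zero_of_mem_complexGrade {i : ZMod 2} (hi : i ≠ 0) {a : ℂ} (ha : a ∈ complexGrade i) :
    a = 0 := by
  simpa [complexGrade, hi] using ha

instance complexGradedAlgebra : GradedAlgebra complexGrade where
  one_mem := mem_complexGrade_zero 1
  mul_mem := by
    intro i j a b ha hb
    by_cases hi : i = 0
    · by_cases hj : j = 0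
      · rw [hi, hj]
        exact mem_complexGrade_zero _
      · rw [eq_zero_of_mem_complexGrade hj hb, mul_zero]
        exact zero_mem _
    · rw [eq_zero_of_mem_complexGrade hi ha, zero_mul]
      exact zero_mem _
  decompose' := fun a => DirectSum.of (fun i => complexGrade i) 0 ⟨a, mem_complexGrade_zero a⟩
  left_inv := fun a => DirectSum.coeAddMonoidHom_of complexGrade 0 _
  right_inv := by
    have key : ∀ a b : ℂ,
        DirectSum.of (fun i => complexGrade i) 0 ⟨a + b, mem_complexGrade_zero _⟩ =
          DirectSum.of (fun i => complexGrade i) 0 ⟨a, mem_complexGrade_zero _⟩ +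
            DirectSum.of (fun i => complexGrade i) 0 ⟨b, mem_complexGrade_zero _⟩ := by
      intro a b
      rw [← map_add]
      rfl
    have key0 : DirectSum.of (fun i => complexGrade i) 0 ⟨0, mem_complexGrade_zero 0⟩ = 0 :=
      map_zero (DirectSum.of (fun i => complexGrade i) 0)
    intro x
    induction x using DirectSum.induction_on with
    | zero => exact key0
    | add a b ha hb =>
      conv_rhs => rw [← ha, ← hb]
      rw [map_add]
      exact key _ _
    | of i x =>
      by_cases hi : i = 0
      · subst hi
        rw [DirectSum.coeAddMonoidHom_of]
      · have hx : x = 0 := Subtype.ext (eq_zero_of_mem_complexGrade hi x.2)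
        subst hx
        rw [map_zero, map_zero]
        exact key0

/-- `ℂ` as a purely even superalgebra. -/
abbrev complexSAlg : SAlg where
  carrier := ℂ
  grade := complexGrade
  comm := by
    intro i j a b ha hb
    by_cases hi : i = 0
    · rw [hi, zero_mul, sgn_zero, one_smul, mul_comm]
    · rw [eq_zero_of_mem_complexGrade hi ha]
      simp

/-- The action of the complex points of `SL(n,m)`. -/
def SLRep.actC {n m : ℕ} (V : SLRep n m) (g : SLPoints n m complexSAlg) : Matrix V.ι V.ι ℂ :=
  V.act complexSAlg g

/-- The weight space of a representation `V` for the weight `∑ k_i ε_i + ∑ k_p δ_p`: the vectors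
on which each diagonal matrix `t` in `SL(n,m)(ℂ)` acts by `∏ t_j ^ k_j`. -/
def SLRep.weightSpace {n m : ℕ} (V : SLRep n m) (k : Idx n m → ℤ) : Submodule ℂ (V.ι → ℂ) where
  carrier := {v | ∀ (t : Idx n m → ℂˣ) (g : SLPoints n m complexSAlg),
    (g.1 : Matrix (Idx n m) (Idx n m) ℂ) = Matrix.diagonal (fun j => (t j : ℂ)) →
      (V.actC g).mulVec v = (∏ j, (t j : ℂ) ^ k j) • v}
  add_mem' := by
    intro a b ha hb t g hg
    rw [Matrix.mulVec_add, ha t g hg, hb t g hg, smul_add]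
  zero_mem' := by
    intro t g hg
    rw [Matrix.mulVec_zero, smul_zero]
  smul_mem' := by
    intro c a ha t g hg
    rw [Matrix.mulVec_smul, ha t g hg, smul_comm]

/-- The homogeneous component of parity `i` of the underlying superspace. -/
def SLRep.component {n m : ℕ} (V : SLRep n m) (i : ZMod 2) : Submodule ℂ (V.ι → ℂ) where
  carrier := {v | ∀ j, V.par j ≠ i → v j = 0}
  add_mem' := by
    intro a b ha hb j hj
    rw [Pi.add_apply, ha j hj, hb j hj, add_zero]
  zero_mem' := fun _ _ => rfl
  smul_mem' := by
    intro c a ha j hj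
    rw [Pi.smul_apply, ha j hj, smul_zero]

/-- The superdimension of the weight space of weight `∑ k_i ε_i + ∑ k_p δ_p`. -/
def SLRep.weightSdim {n m : ℕ} (V : SLRep n m) (k : Idx n m → ℤ) : ℤ :=
  (Module.finrank ℂ (V.weightSpace k ⊓ V.component 0 : Submodule ℂ (V.ι → ℂ)) : ℤ) -
    (Module.finrank ℂ (V.weightSpace k ⊓ V.component 1 : Submodule ℂ (V.ι → ℂ)) : ℤ)

/-- `f` is the supercharacter `∑ (sdim V_l) e^l` of `V` (all weights of `V` are integral
combinations of the `ε_i`, `δ_p`). -/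
def SLRep.IsSupercharacter {n m : ℕ} (V : SLRep n m) (f : ZP n m) : Prop :=
  (∀ k, f.coeff (latticeHom n m k) = V.weightSdim k) ∧
    ∀ l, l ∉ Set.range (latticeHom n m) → f.coeff l = 0

end SuperSL

end

noncomputable section

open AddMonoidAlgebra hiding map coeff coeff_map
open Finset hiding map
open Matrix (diagonal mulVec_mulVec mul_apply one_apply of_apply map_apply fromBlocks det_mul
  zero_mulVec mulVec_zero TransvectionStruct det_diagonal fromCols one_mulVec mulVecLin_apply
  fromBlocks_multiply vandermonde mul_nonsing_inv transvection single_mul_single_same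
  fromBlocks_one det_nonsing_inv smul_mulVec single_mul_single_of_ne fromBlocks_map
  ext_of_mulVec_single vecMulVec_apply vecMulVec sum_mulVec one_apply_ne mul_diagonal mulVec_smul
  diagonal_one diagonal_mul_diagonal diagonal_apply_ne diagonal_apply_eq det_one)
open Sum (inl inr)
open Multiplicative (ofAdd)
open LinearMap (ker mem_ker)
open Function (Injective)
open Finsupp (mem_support_iff)

set_option linter.unusedSectionVars false

namespace SuperSL

/-- Square matrices. -/
abbrev SqMat (k : ℕ) (R : Type) : Type := Matrix (Fin k) (Fin k) R

/-- Supermatrices. -/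
abbrev SMat (n m : ℕ) (R : Type) : Type := Matrix (Idx n m) (Idx n m) R

/-! ### Kernels of maps of group rings -/

section GroupRing

variable {R M N : Type} [CommRing R] [AddCommGroup M] [AddCommGroup N]

theorem ex_zero : (ex (0 : M) : AddMonoidAlgebra R M) = 1 := rfl

theorem ex_add (a b : M) : (ex (a + b) : AddMonoidAlgebra R M) = ex a * ex b := by
  simp [ex, single_mul_single]

theorem ex_neg_mul_ex (a : M) : (ex (-a) * ex a : AddMonoidAlgebra R M) = 1 := by
  rw [← ex_add, neg_add_cancel, ex_zero]

theorem ex_mul_ex_neg (a : M) : (ex a * ex (-a) : AddMonoidAlgebra R M) = 1 := by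
  rw [← ex_add, add_neg_cancel, ex_zero]

theorem mapDomainRingHom_ex (φ : M →+ N) (a : M) :
    mapDomainRingHom R φ (ex a) = ex (φ a) := by
  simp [ex]

/-- The `a` with `e^a - 1` in a given ideal form a subgroup. -/
def expSubgroup (I : Ideal (AddMonoidAlgebra R M)) : AddSubgroup M where
  carrier := {a | ex a - 1 ∈ I}
  zero_mem' := by simp [ex_zero]
  add_mem' := by
    intro a b ha hb
    have : (ex (a + b) - 1 : AddMonoidAlgebra R M) = ex a * (ex b - 1) + (ex a - 1) := by
      rw [ex_add]; ring
    change ex (a + b) - 1 ∈ I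
    rw [this]
    exact add_mem (I.mul_mem_left _ hb) ha
  neg_mem' := by
    intro a ha
    have : (ex (-a) - 1 : AddMonoidAlgebra R M) = -(ex (-a) * (ex a - 1)) := by
      rw [mul_sub, ex_neg_mul_ex]; ring
    change ex (-a) - 1 ∈ I
    rw [this]
    exact neg_mem (I.mul_mem_left _ ha)

theorem mem_of_mapDomain_eq_zero (φ : M →+ N) (I : Ideal (AddMonoidAlgebra R M))
    (hI : ∀ l, φ l = 0 → ex l - 1 ∈ I) (f : AddMonoidAlgebra R M)
    (hf : mapDomainRingHom R φ f = 0) : f ∈ I := by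
  classical
  have key : ∀ f : AddMonoidAlgebra R M,
      f - mapDomain (Function.invFun φ)
        (mapDomain φ f) ∈ I := by
    intro f
    induction f using AddMonoidAlgebra.induction_linear with
    | zero => simp
    | add a b ha hb =>
      rw [mapDomain_add, mapDomain_add, add_sub_add_comm]
      exact add_mem ha hb
    | single l r =>
      rw [mapDomain_single, mapDomain_single]
      set l' := Function.invFun φ (φ l) with hl'
      have h1 : φ (l - l') = 0 := by
        have h0 : φ l' = φ l := Function.invFun_eq (f := φ) ⟨l, rfl⟩
        rw [map_sub, h0, sub_self]
      have h2 : single l r - single l' r =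
          single l' r * (ex (l - l') - 1) := by
        rw [mul_sub, mul_one, ex, single_mul_single]
        simp
      rw [h2]
      exact I.mul_mem_left _ (hI _ h1)
  have h := key f
  have h0 : mapDomain φ f = 0 := hf
  rwa [h0, mapDomain_zero, sub_zero] at h

theorem mapDomain_eq_zero_iff_dvd (φ : M →+ N) (a : M)
    (hker : ∀ l, φ l = 0 ↔ ∃ z : ℤ, l = z • a) (f : AddMonoidAlgebra R M) :
    mapDomainRingHom R φ f = 0 ↔ (ex a - 1 : AddMonoidAlgebra R M) ∣ f := by
  constructor
  · intro h
    rw [← Ideal.mem_span_singleton]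
    refine mem_of_mapDomain_eq_zero φ _ (fun l hl => ?_) f h
    obtain ⟨z, rfl⟩ := (hker l).1 hl
    have ha : a ∈ expSubgroup (Ideal.span {(ex a - 1 : AddMonoidAlgebra R M)}) :=
      Ideal.subset_span rfl
    exact zsmul_mem ha z
  · rintro ⟨g, rfl⟩
    have : φ a = 0 := (hker a).2 ⟨1, by simp⟩
    rw [map_mul, map_sub, mapDomainRingHom_ex, this, ex_zero, map_one, sub_self, zero_mul]

theorem coeff_mapDomain_expDeriv (φ : M →+ N) (ψ : M →+ R) (h : ∀ l, φ l = 0 → ψ l = 0)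
    (f : AddMonoidAlgebra R M) (l : M) :
    (mapDomainRingHom R φ (expDeriv ψ f)).coeff (φ l) =
      ψ l * (mapDomainRingHom R φ f).coeff (φ l) := by
  classical
  induction f using AddMonoidAlgebra.induction_linear with
  | zero => simp
  | add a b ha hb =>
    simp only [map_add, coeff_add, Finsupp.add_apply, ha, hb, mul_add]
  | single k r =>
    simp only [expDeriv_single, mapDomainRingHom_apply, mapDomain_single, coeff_single,
      Finsupp.single_apply]
    by_cases hk : φ k = φ l
    · have : ψ k = ψ l := by
        have := h (k - l) (by rw [map_sub, hk, sub_self])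
        rwa [map_sub, sub_eq_zero] at this
      simp [hk, this]
    · simp [hk]

theorem exists_coeff_ne_zero_of_mapDomain {φ : M →+ N} {f : AddMonoidAlgebra R M} {ν : N}
    (h : (mapDomainRingHom R φ f).coeff ν ≠ 0) :
    ∃ l, f.coeff l ≠ 0 ∧ φ l = ν := by
  classical
  have h1 : ν ∈ (Finsupp.mapDomain φ f.coeff).support := mem_support_iff.2 h
  obtain ⟨l, hl, rfl⟩ := mem_image.1 (Finsupp.mapDomain_support h1)
  exact ⟨l, mem_support_iff.1 hl, rfl⟩

theorem mapDomain_congr_support {g₁ g₂ : M → N} {f : AddMonoidAlgebra R M}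
    (h : ∀ l, f.coeff l ≠ 0 → g₁ l = g₂ l) :
    mapDomain g₁ f = mapDomain g₂ f := by
  apply coeff_injective
  exact Finsupp.mapDomain_congr fun l hl => h l (mem_support_iff.1 hl)

theorem mapDomain_mapDomain {O : Type} (g : N → O) (g' : M → N) (f : AddMonoidAlgebra R M) :
    mapDomain g (mapDomain g' f) =
      mapDomain (g ∘ g') f := by
  apply coeff_injective
  exact Finsupp.mapDomain_comp.symm

/-- The part of `f` supported on the weights `l` with `c l = q`. -/
def gradedPart {Q : Type} (c : M → Q) (q : Q) (f : AddMonoidAlgebra R M) : AddMonoidAlgebra R M :=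
  open Classical in .ofCoeff (f.coeff.filter fun l => c l = q)

theorem coeff_gradedPart {Q : Type} (c : M → Q) (q : Q) (f : AddMonoidAlgebra R M) (l : M) :
    (gradedPart c q f).coeff l = open Classical in if c l = q then f.coeff l else 0 := by
  classical
  change (f.coeff.filter fun l => c l = q) l = _
  rw [Finsupp.filter_apply]

theorem gradedPart_add {Q : Type} (c : M → Q) (q : Q) (f g : AddMonoidAlgebra R M) :
    gradedPart c q (f + g) = gradedPart c q f + gradedPart c q g := by
  classical
  apply coeff_injective
  exact Finsupp.filter_add

theorem gradedPart_single {Q : Type} (c : M → Q) (q : Q) (l : M) (r : R) :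
    gradedPart c q (single l r) =
      open Classical in if c l = q then single l r else 0 := by
  classical
  split_ifs with h
  · exact coeff_injective (Finsupp.filter_single_of_pos _ h)
  · exact coeff_injective (Finsupp.filter_single_of_neg _ h)

theorem gradedPart_eq_self {Q : Type} {c : M → Q} {q : Q} {f : AddMonoidAlgebra R M}
    (h : ∀ l, f.coeff l ≠ 0 → c l = q) : gradedPart c q f = f := by
  classical
  apply coeff_injective
  exact Finsupp.filter_eq_self_iff _ _ |>.2 h

theorem gradedPart_zero_mul {Q : Type} [AddCommGroup Q] (c : M →+ Q) (q : Q)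
    {f : AddMonoidAlgebra R M} (hf : ∀ l, f.coeff l ≠ 0 → c l = 0) (g : AddMonoidAlgebra R M) :
    gradedPart c q (f * g) = f * gradedPart c q g := by
  classical
  have hz : gradedPart c q (0 : AddMonoidAlgebra R M) = 0 :=
    coeff_injective (Finsupp.filter_zero _)
  have h1 : ∀ l r, c l = 0 → gradedPart c q (single l r * g) =
      single l r * gradedPart c q g := by
    intro l r hl
    induction g using AddMonoidAlgebra.induction_linear with
    | zero => simp [hz]
    | add a b ha hb => rw [mul_add, gradedPart_add, ha, hb, gradedPart_add, mul_add]
    | single k s =>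
      rw [single_mul_single, gradedPart_single, gradedPart_single, map_add, hl, zero_add]
      split_ifs
      · rw [single_mul_single]
      · simp
  have h2 : ∀ s : Finset M, (∀ l ∈ s, c l = 0) →
      gradedPart c q ((∑ l ∈ s, single l (f.coeff l)) * g) =
        (∑ l ∈ s, single l (f.coeff l)) * gradedPart c q g := by
    intro s
    induction s using Finset.induction_on with
    | empty => simp [hz]
    | insert l s hl ih =>
      intro hs
      rw [sum_insert hl, add_mul, gradedPart_add, add_mul,
        h1 _ _ (hs l (mem_insert_self _ _)),
        ih fun k hk => hs k (mem_insert_of_mem hk)]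
  have h3 : f = ∑ l ∈ f.coeff.support, single l (f.coeff l) :=
    (sum_coeff_single f).symm
  have h4 := h2 f.coeff.support fun l hl => hf l (mem_support_iff.1 hl)
  rwa [← h3] at h4

theorem sum_gradedPart {Q : Type} (c : M → Q) (f : AddMonoidAlgebra R M) :
    open Classical in f = ∑ q ∈ f.coeff.support.image c, gradedPart c q f := by
  classical
  apply coeff_injective
  ext l
  rw [coeff_sum, Finsupp.finsetSum_apply]
  simp only [coeff_gradedPart]
  by_cases h : f.coeff l = 0
  · simp [h]
  · have hc : c l ∈ f.coeff.support.image c :=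
      mem_image_of_mem _ (mem_support_iff.2 h)
    rw [sum_ite_eq, if_pos hc]

end GroupRing

/-! ### The weight lattice -/

section Lattice

variable {n m : ℕ}

instance : TwoUniqueSums (P0 n m) :=
  letI : Module ℚ (Module.Dual ℂ (cartan n m)) := Module.compHom _ (algebraMap ℚ ℂ)
  TwoUniqueSums.of_injective_addHom (P0 n m).subtype.toAddHom Subtype.val_injective inferInstance

/-- The exponent of `x_1 ⋯ x_n / (y_1 ⋯ y_m)`. -/
def berExp (n m : ℕ) : Idx n m → ℤ := Sum.elim (fun _ => 1) (fun _ => -1)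

theorem mem_cartan (h : cartan n m) : ∑ i, h.1 (inl i) = ∑ p, h.1 (inr p) := h.2

theorem latticeHom_apply (k : Idx n m → ℤ) (h : cartan n m) :
    (latticeHom n m k).1 h = ∑ j, (k j : ℂ) * h.1 j := by
  have h1 : ((latticeHom n m k : P0 n m) : Module.Dual ℂ (cartan n m)) = ∑ j, k j • eps j := by
    change (P0 n m).subtype (∑ j, k j • wt j) = _
    rw [map_sum]
    rfl
  rw [h1, LinearMap.sum_apply]
  refine sum_congr rfl fun j _ => ?_
  rw [LinearMap.smul_apply, zsmul_eq_mul]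
  rfl

theorem omega_apply (s : ℂ) (h : cartan n m) :
    (omega n m s).1 h = s * ∑ i, h.1 (inl i) := by
  change (s • ∑ i : Fin n, eps (inl i)) h = _
  rw [LinearMap.smul_apply, LinearMap.sum_apply]
  rfl

theorem wt_apply (k : Idx n m) (h : cartan n m) : (wt k).1 h = h.1 k := rfl

theorem latticeHom_single (k : Idx n m) : latticeHom n m (Pi.single k 1) = wt k := by
  apply Subtype.ext
  ext h
  rw [latticeHom_apply, wt_apply]
  simp [Pi.single_apply]

theorem latticeHom_isoH (k : Idx n m → ℤ) (i : Fin n) (p : Fin m) :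
    (latticeHom n m k).1 (isoH i p) = k (inl i) + k (inr p) := by
  rw [latticeHom_apply]
  simp [isoH, Pi.single_apply]

theorem omega_isoH (s : ℂ) (i : Fin n) (p : Fin m) : (omega n m s).1 (isoH i p) = s := by
  rw [omega_apply]
  simp [isoH, Pi.single_apply]

theorem latticeHom_corootL (k : Idx n m → ℤ) (i j : Fin n) :
    (latticeHom n m k).1 (corootL i j) = k (inl i) - k (inl j) := by
  rw [latticeHom_apply]
  simp [corootL, Pi.single_apply, mul_sub]

theorem latticeHom_corootR (k : Idx n m → ℤ) (i j : Fin m) :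
    (latticeHom n m k).1 (corootR i j) = k (inr i) - k (inr j) := by
  rw [latticeHom_apply]
  simp [corootR, Pi.single_apply, mul_sub]

theorem latticeHom_eq_zero_iff (k : Idx n m → ℤ) :
    latticeHom n m k = 0 ↔ ∃ z : ℤ, k = z • berExp n m := by
  constructor
  · intro h
    have hl : ∀ i j, k (inl i) = k (inl j) := fun i j => by
      have := latticeHom_corootL k i j
      rw [h] at this
      have h' : (k (inl i) : ℂ) - k (inl j) = 0 := this.symm
      exact_mod_cast sub_eq_zero.1 h'
    have hr : ∀ i j, k (inr i) = k (inr j) := fun i j => by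
      have := latticeHom_corootR k i j
      rw [h] at this
      have h' : (k (inr i) : ℂ) - k (inr j) = 0 := this.symm
      exact_mod_cast sub_eq_zero.1 h'
    have hlr : ∀ i p, k (inl i) + k (inr p) = 0 := fun i p => by
      have := latticeHom_isoH k i p
      rw [h] at this
      have h' : (k (inl i) : ℂ) + k (inr p) = 0 := this.symm
      exact_mod_cast h'
    by_cases hn : Nonempty (Fin n)
    · obtain ⟨i⟩ := hn
      refine ⟨k (inl i), funext fun j => ?_⟩
      rcases j with j | p
      · simp [berExp, hl j i]
      · have := hlr i p
        simp [berExp]; linarith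
    · by_cases hm : Nonempty (Fin m)
      · obtain ⟨p⟩ := hm
        refine ⟨-k (inr p), funext fun j => ?_⟩
        rcases j with j | q
        · exact absurd ⟨j⟩ hn
        · simp [berExp, hr q p]
      · refine ⟨0, funext fun j => ?_⟩
        rcases j with j | q
        · exact absurd ⟨j⟩ hn
        · exact absurd ⟨q⟩ hm
  · rintro ⟨z, rfl⟩
    apply Subtype.ext
    ext h
    rw [latticeHom_apply]
    have h1 := mem_cartan h
    simp only [Fintype.sum_sum_type, berExp, Pi.smul_apply, Sum.elim_inl, Sum.elim_inr]
    simp [← mul_sum, h1]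

/-- The isotropic root `ε_i - δ_p`. -/
def root (i : Fin n) (p : Fin m) : P0 n m := wt (inl i) - wt (inr p)

theorem root_apply (i : Fin n) (p : Fin m) (h : cartan n m) :
    (root i p).1 h = h.1 (inl i) - h.1 (inr p) := rfl

/-- Restriction of weights to the kernel of an isotropic root. -/
def wallHom (i : Fin n) (p : Fin m) :
    P0 n m →+ Module.Dual ℂ (ker (root i p).1) where
  toFun l := l.1.comp (ker (root i p).1).subtype
  map_zero' := rfl
  map_add' _ _ := rfl

theorem isoH_mem_ker (i j : Fin n) (p q : Fin m) (h : (i = j ↔ p = q)) :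
    isoH i p ∈ ker (root j q).1 := by
  rw [mem_ker, root_apply]
  by_cases hij : i = j
  · obtain rfl := hij
    obtain rfl := h.1 rfl
    simp [isoH]
  · have hpq : p ≠ q := fun e => hij (h.2 e)
    simp [isoH, Ne.symm hij, Ne.symm hpq]

theorem exists_smul_of_wallHom_eq_zero {i : Fin n} {p : Fin m} {l : P0 n m}
    (h : wallHom i p l = 0) : ∃ c : ℂ, l.1 = c • (root i p).1 := by
  have : ker (root i p).1 ≤ ker l.1 := by
    intro x hx
    exact LinearMap.congr_fun h ⟨x, hx⟩
  have h2 := mem_span_of_iInf_ker_le_ker (L := fun _ : Unit => (root i p).1) (K := l.1)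
    (by simpa using this)
  rw [Set.range_const] at h2
  obtain ⟨c, hc⟩ := Submodule.mem_span_singleton.1 h2
  exact ⟨c, hc.symm⟩

theorem root_corootL (i j k : Fin n) (p : Fin m) :
    (root i p).1 (corootL j k) = (if i = j then 1 else 0) - (if i = k then 1 else 0) := by
  rw [root_apply]
  simp [corootL, Pi.single_apply]

theorem root_corootR (i : Fin n) (p q r : Fin m) :
    (root i p).1 (corootR q r) = (if p = r then 1 else 0) - (if p = q then 1 else 0) := by
  rw [root_apply]
  simp [corootR, Pi.single_apply]

theorem exists_ne_fin {k : ℕ} (hk : k ≠ 1) (i : Fin k) : ∃ j, j ≠ i := by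
  have : Nontrivial (Fin k) := Fin.nontrivial_iff_two_le.2 (by have := i.2; omega)
  exact exists_ne i

theorem root_eq_zero (h1 : n = 1) (h2 : m = 1) (i : Fin n) (p : Fin m) : root i p = 0 := by
  subst h1 h2
  apply Subtype.ext
  ext h
  have := mem_cartan h
  simp only [univ_unique, sum_singleton] at this
  rw [root_apply, Subsingleton.elim i default, Subsingleton.elim p default, this, sub_self]
  rfl

theorem wallHom_eq_zero_iff (i : Fin n) (p : Fin m) (l : P0 n m) :
    wallHom i p l = 0 ↔ ∃ z : ℤ, l = z • root i p := by
  constructor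
  · intro h
    obtain ⟨c, hc⟩ := exists_smul_of_wallHom_eq_zero h
    by_cases hn : n = 1
    · by_cases hm : m = 1
      · refine ⟨0, Subtype.ext ?_⟩
        rw [hc, root_eq_zero hn hm]
        simp
      · obtain ⟨q, hq⟩ := exists_ne_fin hm p
        obtain ⟨z, hz⟩ := l.2.2 q p
        refine ⟨z, Subtype.ext ?_⟩
        rw [hc, LinearMap.smul_apply, root_corootR, if_pos rfl, if_neg hq.symm] at hz
        have : c = z := by simpa using hz
        rw [hc, this, Int.cast_smul_eq_zsmul]
        rfl
    · obtain ⟨j, hj⟩ := exists_ne_fin hn i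
      obtain ⟨z, hz⟩ := l.2.1 i j
      refine ⟨z, Subtype.ext ?_⟩
      rw [hc, LinearMap.smul_apply, root_corootL, if_pos rfl, if_neg hj.symm] at hz
      have : c = z := by simpa using hz
      rw [hc, this, Int.cast_smul_eq_zsmul]
      rfl
  · rintro ⟨z, rfl⟩
    rw [map_zsmul]
    have : wallHom i p (root i p) = 0 := by
      ext x
      exact x.2
    rw [this, smul_zero]

theorem wallHom_apply_isoH {i : Fin n} {p : Fin m} {l l' : P0 n m}
    (h : wallHom i p l = wallHom i p l') : l.1 (isoH i p) = l'.1 (isoH i p) :=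
  LinearMap.congr_fun h ⟨isoH i p, isoH_mem_ker i i p p (by simp)⟩

/-- The restriction of `f` to the wall of an isotropic root. -/
def wallRes (i : Fin n) (p : Fin m) :
    ZP n m →+* AddMonoidAlgebra ℤ (Module.Dual ℂ (ker (root (n := n) (m := m) i p).1)) :=
  mapDomainRingHom ℤ (wallHom i p)

theorem wallRes_eq_zero_iff (i : Fin n) (p : Fin m) (f : ZP n m) :
    wallRes i p f = 0 ↔ (ex (root i p) - 1 : ZP n m) ∣ f :=
  mapDomain_eq_zero_iff_dvd (wallHom i p) (root i p) (wallHom_eq_zero_iff i p) f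

theorem Diso_mem_iff (i : Fin n) (p : Fin m) (f : ZP n m) :
    Diso i p (toCP n m f) ∈ Ideal.span {(ex (wt (inl i) - wt (inr p)) - 1 : CP n m)} ↔
      ∀ l : P0 n m, (wallRes i p f).coeff (wallHom i p l) ≠ 0 → l.1 (isoH i p) = 0 := by
  rw [Ideal.mem_span_singleton]
  change (ex (root i p) - 1 : CP n m) ∣ _ ↔ _
  rw [← mapDomain_eq_zero_iff_dvd (wallHom i p) (root i p) (wallHom_eq_zero_iff i p)]
  have h1 : ∀ l, (mapDomainRingHom ℂ (wallHom i p)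
      (Diso i p (toCP n m f))).coeff (wallHom i p l) =
        l.1 (isoH i p) * ((wallRes i p f).coeff (wallHom i p l) : ℤ) := by
    intro l
    rw [Diso, coeff_mapDomain_expDeriv]
    · congr 1
      have : mapDomainRingHom ℂ (wallHom i p) (toCP n m f) =
          mapRingHom _ (Int.castRingHom ℂ) (wallRes i p f) :=
        (RingHom.congr_fun (mapRingHom_comp_mapDomainRingHom
          (Int.castRingHom ℂ) (wallHom i p)) f).symm
      rw [this, coeff_mapRingHom]
      rfl
    · intro l hl
      exact wallHom_apply_isoH (l' := 0) hl
  constructor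
  · intro h l hl
    have := h1 l
    rw [h] at this
    have h0 : (0 : ℂ) = l.1 (isoH i p) * ((wallRes i p f).coeff (wallHom i p l) : ℤ) := this
    rcases mul_eq_zero.1 h0.symm with h2 | h2
    · exact h2
    · exact absurd (by exact_mod_cast h2) hl
  · intro h
    apply coeff_injective
    ext ν
    by_contra hν
    obtain ⟨l, -, rfl⟩ := exists_coeff_ne_zero_of_mapDomain hν
    apply hν
    rw [h1]
    by_cases h2 : (wallRes i p f).coeff (wallHom i p l) = 0
    · simp [h2]
    · simp [h l h2]

theorem mem_J_iff {f : ZP n m} : f ∈ J n m ↔ f ∈ ZPinv n m ∧ ∀ (i : Fin n) (p : Fin m) (l : P0 n m),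
    (wallRes i p f).coeff (wallHom i p l) ≠ 0 → l.1 (isoH i p) = 0 := by
  refine and_congr Iff.rfl ?_
  exact forall₂_congr fun i p => Diso_mem_iff i p f

theorem mem_ZPinv {f : ZP n m} : f ∈ ZPinv n m ↔
    ∀ w : Weyl n m, mapDomainRingHom ℤ (weylWeight w) f = f :=
  Subring.mem_iInf

theorem mem_LaurentInv {f : Laurent n m} : f ∈ LaurentInv n m ↔
    ∀ w : Weyl n m, mapDomainRingHom ℤ (weylLattice w) f = f :=
  Subring.mem_iInf

theorem weylWeight_wt (w : Weyl n m) (k : Idx n m) : weylWeight w (wt k) = wt (w.perm k) := rfl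

theorem weylWeight_latticeHom (w : Weyl n m) (k : Idx n m → ℤ) :
    weylWeight w (latticeHom n m k) = latticeHom n m (weylLattice w k) := by
  change weylWeight w (∑ j, k j • wt j) = ∑ j, k (w.perm.symm j) • wt j
  rw [map_sum, ← Equiv.sum_comp w.perm (fun j => k (w.perm.symm j) • wt j)]
  simp [weylWeight_wt, map_zsmul]

theorem weylWeight_mul (v w : Weyl n m) (l : P0 n m) :
    weylWeight v (weylWeight w l) = weylWeight (v * w) l := by
  have h : ∀ h : cartan n m, weylCartan w (weylCartan v h) = weylCartan (v * w) h := fun h => by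
    apply Subtype.ext
    funext k
    rcases k with k | k <;> rfl
  apply Subtype.ext
  ext x
  exact congrArg l.1 (h x)

theorem weylWeight_one (l : P0 n m) : weylWeight (1 : Weyl n m) l = l := by
  have h : ∀ h : cartan n m, weylCartan 1 h = h := fun h => by
    apply Subtype.ext
    funext k
    rcases k with k | k <;> rfl
  apply Subtype.ext
  ext x
  exact congrArg l.1 (h x)

theorem weylWeight_omega (w : Weyl n m) (s : ℂ) : weylWeight w (omega n m s) = omega n m s := by
  apply Subtype.ext
  ext h
  change (omega n m s).1 (weylCartan w h) = _
  rw [omega_apply, omega_apply]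
  congr 1
  exact Equiv.sum_comp w.1 (fun i => h.1 (inl i))

theorem weylWeight_injective (w : Weyl n m) : Injective (weylWeight w) := by
  intro a b h
  have := congrArg (weylWeight w⁻¹) h
  rwa [weylWeight_mul, weylWeight_mul, inv_mul_cancel, weylWeight_one, weylWeight_one] at this

theorem toZP_weyl (w : Weyl n m) (g : Laurent n m) :
    toZP n m (mapDomainRingHom ℤ (weylLattice w) g) =
      mapDomainRingHom ℤ (weylWeight w) (toZP n m g) := by
  change mapDomain _ (mapDomain _ g) =
    mapDomain _ (mapDomain _ g)
  rw [mapDomain_mapDomain, mapDomain_mapDomain]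
  congr 1
  funext k
  exact (weylWeight_latticeHom w k).symm

theorem toZP_mem_ZPinv {g : Laurent n m} (hg : g ∈ LaurentInv n m) : toZP n m g ∈ ZPinv n m := by
  refine mem_ZPinv.2 fun w => ?_
  rw [← toZP_weyl, mem_LaurentInv.1 hg w]

theorem coeff_toZP_ne_zero {g : Laurent n m} {l : P0 n m} (h : (toZP n m g).coeff l ≠ 0) :
    l ∈ Set.range (latticeHom n m) := by
  obtain ⟨k, -, hk⟩ := exists_coeff_ne_zero_of_mapDomain h
  exact ⟨k, hk⟩

end Lattice

/-! ### Decomposition of `J` by classes of weights -/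

section Classes

variable {n m : ℕ}

theorem weight_eq (i₀ : Fin n) (p₀ : Fin m) (l : P0 n m) :
    ∃ k : Idx n m → ℤ, l = omega n m (l.1 (isoH i₀ p₀)) + latticeHom n m k := by
  choose a ha using fun i => l.2.1 i i₀
  choose b hb using fun p => l.2.2 p p₀
  refine ⟨Sum.elim a b, Subtype.ext ?_⟩
  ext h
  have hh : h = (∑ i, h.1 (inl i) • corootL i i₀) + (∑ p, h.1 (inr p) • corootR p p₀) +
      (∑ i, h.1 (inl i)) • isoH i₀ p₀ := by
    apply Subtype.ext
    have h1 := mem_cartan h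
    funext j
    rcases j with j | q
    · simp [corootL, corootR, isoH, Pi.single_apply, Finset.sum_apply, mul_sub, sum_sub_distrib]
    · simp only [corootL, corootR, isoH, Submodule.coe_add, AddSubmonoidClass.coe_finsetSum,
        Submodule.coe_smul, Pi.add_apply, Finset.sum_apply, Pi.smul_apply, Pi.sub_apply, h1]
      simp [Pi.single_apply, mul_sub, sum_sub_distrib]
  change l.1 h = (omega n m _).1 h + (latticeHom n m _).1 h
  rw [omega_apply, latticeHom_apply, Fintype.sum_sum_type]
  conv_lhs => rw [hh]
  simp only [map_add, map_sum, map_smul, smul_eq_mul, ha, hb, Sum.elim_inl, Sum.elim_inr]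
  simp only [mul_comm (h.1 _)]
  ring

/-- The class in `ℂ/ℤ` of a weight. -/
def classHom (i : Fin n) (p : Fin m) : P0 n m →+ CmodZ where
  toFun l := QuotientAddGroup.mk (l.1 (isoH i p))
  map_zero' := rfl
  map_add' _ _ := rfl

theorem mk_int_add (a : ℂ) (z : ℤ) :
    (QuotientAddGroup.mk (a + z) : CmodZ) = QuotientAddGroup.mk a := by
  rw [QuotientAddGroup.mk_add]
  have : (QuotientAddGroup.mk (z : ℂ) : CmodZ) = 0 :=
    (QuotientAddGroup.eq_zero_iff _).2 ⟨z, by simp⟩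
  rw [this, add_zero]

theorem mem_weightClass_iff (i : Fin n) (p : Fin m) {a : CmodZ} {l : P0 n m} :
    l ∈ weightClass n m a ↔ classHom i p l = a := by
  constructor
  · rintro ⟨s, rfl, k, rfl⟩
    change (QuotientAddGroup.mk ((omega n m s).1 (isoH i p) + (latticeHom n m k).1 (isoH i p)) :
      CmodZ) = _
    rw [omega_isoH, latticeHom_isoH]
    have := mk_int_add s (k (inl i) + k (inr p))
    push_cast at this
    exact this
  · intro h
    obtain ⟨k, hk⟩ := weight_eq i p l
    exact ⟨_, h, k, hk⟩

theorem omega_intCast (z : ℤ) :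
    omega n m z = latticeHom n m (Sum.elim (fun _ => z) (fun _ => 0)) := by
  apply Subtype.ext
  ext h
  rw [omega_apply, latticeHom_apply, Fintype.sum_sum_type]
  simp [mul_sum]

theorem omega_add (s t : ℂ) : omega n m (s + t) = omega n m s + omega n m t :=
  Subtype.ext (add_smul _ _ _)

theorem omega_zero : omega n m 0 = 0 := Subtype.ext (zero_smul _ _)

theorem omega_neg (s : ℂ) : omega n m (-s) = -omega n m s := Subtype.ext (neg_smul _ _)

theorem mem_weightClass_zero_iff {l : P0 n m} :
    l ∈ weightClass n m 0 ↔ l ∈ Set.range (latticeHom n m) := by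
  constructor
  · rintro ⟨s, hs, k, rfl⟩
    obtain ⟨z, hz⟩ := (QuotientAddGroup.eq_zero_iff s).1 hs
    have : s = z := by simpa using hz.symm
    rw [this, omega_intCast, ← map_add]
    exact ⟨_, rfl⟩
  · rintro ⟨k, rfl⟩
    exact ⟨0, rfl, k, by rw [omega_zero, zero_add]⟩

theorem weightClass_weylWeight (w : Weyl n m) {a : CmodZ} {l : P0 n m}
    (h : l ∈ weightClass n m a) : weylWeight w l ∈ weightClass n m a := by
  obtain ⟨s, hs, k, rfl⟩ := h
  exact ⟨s, hs, weylLattice w k, by rw [map_add, weylWeight_omega, weylWeight_latticeHom]⟩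

theorem classHom_weylWeight (i : Fin n) (p : Fin m) (w : Weyl n m) (l : P0 n m) :
    classHom i p (weylWeight w l) = classHom i p l :=
  (mem_weightClass_iff i p).1 (weightClass_weylWeight w ((mem_weightClass_iff i p).2 rfl))

theorem classHom_wallHom (i j : Fin n) (p q : Fin m) {l l' : P0 n m}
    (h : wallHom j q l = wallHom j q l') : classHom i p l = classHom i p l' := by
  have h1 : classHom j q l = classHom j q l' := by
    change (QuotientAddGroup.mk _ : CmodZ) = QuotientAddGroup.mk _
    rw [wallHom_apply_isoH h]
  exact (mem_weightClass_iff i p).1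
    ((mem_weightClass_iff j q).2 (h1.trans ((mem_weightClass_iff j q).1
      ((mem_weightClass_iff i p).2 rfl))))

theorem mapDomain_gradedPart {R M N Q : Type} [CommRing R] [AddCommGroup M] [AddCommGroup N]
    (φ : M →+ N) (c : M → Q) (hc : ∀ l l', φ l = φ l' → c l = c l') (q : Q)
    (f : AddMonoidAlgebra R M) (l : M) :
    (mapDomainRingHom R φ (gradedPart c q f)).coeff (φ l) =
      open Classical in if c l = q then (mapDomainRingHom R φ f).coeff (φ l)
        else 0 := by
  classical
  induction f using AddMonoidAlgebra.induction_linear with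
  | zero =>
    have : gradedPart c q (0 : AddMonoidAlgebra R M) = 0 :=
      coeff_injective (Finsupp.filter_zero _)
    simp [this]
  | add a b ha hb =>
    rw [gradedPart_add, map_add, map_add, coeff_add, coeff_add, Finsupp.add_apply,
      Finsupp.add_apply, ha, hb]
    split_ifs <;> simp
  | single k r =>
    rw [gradedPart_single]
    by_cases hk : φ k = φ l
    · rw [hc _ _ hk]
      split_ifs <;> simp
    · have : (mapDomainRingHom R φ (single k r)).coeff (φ l) = 0 := by
        simp [hk]
      rw [this]
      split_ifs <;> first | exact this | simp

theorem gradedPart_mem_J (i : Fin n) (p : Fin m) (a : CmodZ) {f : ZP n m} (hf : f ∈ J n m) :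
    gradedPart (classHom i p) a f ∈ J n m := by
  classical
  rw [mem_J_iff] at hf ⊢
  refine ⟨mem_ZPinv.2 fun w => ?_, fun j q l hl => hf.2 j q l fun h0 => hl ?_⟩
  · apply coeff_injective
    ext ν
    obtain ⟨l, rfl⟩ : ∃ l, weylWeight w l = ν :=
      ⟨weylWeight w⁻¹ ν, by rw [weylWeight_mul, mul_inv_cancel, weylWeight_one]⟩
    rw [mapDomain_gradedPart _ _ (fun l l' h => by rw [weylWeight_injective w h]),
      mem_ZPinv.1 hf.1 w, coeff_gradedPart, classHom_weylWeight]
  · rw [wallRes, mapDomain_gradedPart _ _ (fun l l' h => classHom_wallHom i j p q h)]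
    rw [wallRes] at h0
    rw [h0]
    split_ifs <;> rfl

theorem iSupIndep_Jcomp (i : Fin n) (p : Fin m) : iSupIndep (Jcomp n m) := by
  intro a
  rw [AddSubgroup.disjoint_def]
  intro f hf hf'
  let T : AddSubgroup (ZP n m) :=
    { carrier := {f | ∀ l, classHom i p l = a → f.coeff l = 0}
      add_mem' := fun {f g} hf hg l hl => by
        rw [coeff_add, Finsupp.add_apply, hf l hl, hg l hl, add_zero]
      zero_mem' := fun l _ => rfl
      neg_mem' := fun {f} hf l hl => by
        rw [coeff_neg, Finsupp.neg_apply, hf l hl, neg_zero] }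
  have hT : (⨆ (b) (_ : b ≠ a), Jcomp n m b) ≤ T := by
    refine iSup₂_le fun b hb g hg l hl => ?_
    by_contra h
    exact hb (((mem_weightClass_iff i p).1 (hg.2 l h)).symm.trans hl)
  apply coeff_injective
  ext l
  by_contra h
  exact h (hT hf' l ((mem_weightClass_iff i p).1 (hf.2 l h)))

theorem iSup_Jcomp (i : Fin n) (p : Fin m) :
    (⨆ a, Jcomp n m a) = (J n m).toAddSubgroup := by
  classical
  apply le_antisymm
  · exact iSup_le fun a f hf => hf.1
  · intro f hf
    rw [sum_gradedPart (classHom i p) f]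
    refine sum_mem fun a _ => AddSubgroup.mem_iSup_of_mem a ⟨gradedPart_mem_J i p a hf, ?_⟩
    intro l hl
    rw [coeff_gradedPart] at hl
    by_cases h : classHom i p l = a
    · exact (mem_weightClass_iff i p).2 h
    · exact absurd (if_neg h) hl

end Classes

/-! ### Invariants of the weight lattice -/

section Invariants

variable {n m : ℕ}

/-- The normalizing functional for lifting weights to exponents. -/
def exponentSum (n m : ℕ) : (Idx n m → ℤ) →+ ℤ where
  toFun k := ∑ i, k (inl i) - ∑ p, k (inr p)
  map_zero' := by simp
  map_add' a b := by simp [sum_add_distrib]; ring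

theorem exponentSum_berExp : exponentSum n m (berExp n m) = n + m := by
  simp [exponentSum, berExp]

theorem exponentSum_weylLattice (w : Weyl n m) (k : Idx n m → ℤ) :
    exponentSum n m (weylLattice w k) = exponentSum n m k := by
  have h1 := Equiv.sum_comp w.1.symm (fun i => k (inl i))
  have h2 := Equiv.sum_comp w.2.symm (fun i => k (inr i))
  change ∑ i, k (inl (w.1.symm i)) - ∑ p, k (inr (w.2.symm p)) = _
  rw [h1, h2]
  rfl

theorem exists_normalized (h : 0 < n + m) (k : Idx n m → ℤ) :
    ∃ k', latticeHom n m k' = latticeHom n m k ∧ 0 ≤ exponentSum n m k' ∧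
      exponentSum n m k' < n + m := by
  have h0 : (0 : ℤ) < n + m := by exact_mod_cast h
  refine ⟨k - (exponentSum n m k / (n + m)) • berExp n m, ?_, ?_, ?_⟩
  · rw [map_sub, (latticeHom_eq_zero_iff _).2 ⟨_, rfl⟩, sub_zero]
  · rw [map_sub, map_zsmul, exponentSum_berExp, smul_eq_mul, mul_comm, ← Int.emod_def]
    exact Int.emod_nonneg _ h0.ne'
  · rw [map_sub, map_zsmul, exponentSum_berExp, smul_eq_mul, mul_comm, ← Int.emod_def]
    exact Int.emod_lt_of_pos _ h0

theorem normalized_unique (h : 0 < n + m) {k k' : Idx n m → ℤ}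
    (hk : latticeHom n m k = latticeHom n m k') (h1 : 0 ≤ exponentSum n m k)
    (h2 : exponentSum n m k < n + m) (h3 : 0 ≤ exponentSum n m k')
    (h4 : exponentSum n m k' < n + m) : k = k' := by
  have h5 : latticeHom n m (k - k') = 0 := by rw [map_sub, hk, sub_self]
  obtain ⟨z, hz⟩ := (latticeHom_eq_zero_iff _).1 h5
  have h6 := congrArg (exponentSum n m) hz
  rw [map_sub, map_zsmul, exponentSum_berExp, smul_eq_mul] at h6
  have h0 : (0 : ℤ) < n + m := by exact_mod_cast h
  have h7 : z = 0 := by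
    by_contra hz0
    rcases lt_or_gt_of_ne hz0 with h8 | h8 <;> nlinarith
  rw [h7, zero_smul, sub_eq_zero] at hz
  exact hz

theorem exists_toZP_eq (h : 0 < n + m) {f : ZP n m} (hf : f ∈ ZPinv n m)
    (hs : ∀ l, f.coeff l ≠ 0 → l ∈ Set.range (latticeHom n m)) :
    ∃ g ∈ LaurentInv n m, toZP n m g = f := by
  have hex : ∀ l : P0 n m, ∃ k : Idx n m → ℤ, l ∈ Set.range (latticeHom n m) →
      latticeHom n m k = l ∧ 0 ≤ exponentSum n m k ∧ exponentSum n m k < n + m := by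
    intro l
    by_cases hl : l ∈ Set.range (latticeHom n m)
    · obtain ⟨k, rfl⟩ := hl
      obtain ⟨k', hk'⟩ := exists_normalized h k
      exact ⟨k', fun _ => hk'⟩
    · exact ⟨0, fun h => absurd h hl⟩
  choose s hsec using hex
  refine ⟨mapDomain s f, mem_LaurentInv.2 fun w => ?_, ?_⟩
  · change mapDomain _ (mapDomain s f) = _
    rw [mapDomain_mapDomain]
    conv_rhs => rw [← mem_ZPinv.1 hf w]
    change _ = mapDomain s (mapDomain _ f)
    rw [mapDomain_mapDomain]
    refine mapDomain_congr_support fun l hl => ?_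
    obtain ⟨h1, h2, h3⟩ := hsec l (hs l hl)
    have hr : weylWeight w l ∈ Set.range (latticeHom n m) :=
      ⟨weylLattice w (s l), by rw [← weylWeight_latticeHom, h1]⟩
    obtain ⟨h4, h5, h6⟩ := hsec _ hr
    refine normalized_unique h ?_ ?_ ?_ h5 h6
    · simp only [Function.comp_apply]
      rw [h4, ← weylWeight_latticeHom, h1]
    · simpa [exponentSum_weylLattice] using h2
    · simpa [exponentSum_weylLattice] using h3
  · change mapDomain _ (mapDomain s f) = _
    rw [mapDomain_mapDomain]
    have : mapDomain (latticeHom n m ∘ s) f =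
        mapDomain id f :=
      mapDomain_congr_support fun l hl => (hsec l (hs l hl)).1
    rw [this]
    exact coeff_injective Finsupp.mapDomain_id

theorem prod_var_inl : ∏ i : Fin n, var (n := n) (m := m) (inl i) =
    ex (Sum.elim (fun _ => 1) (fun _ => 0)) := by
  have h : ∏ i : Fin n, var (n := n) (m := m) (inl i) =
      ex (∑ i : Fin n, Pi.single (inl i) 1) := by
    simp only [var, ex, prod_single, prod_const_one]
  rw [h]
  congr 1
  funext j
  rcases j with j | j <;> simp [Finset.sum_apply, Pi.single_apply]

theorem prod_var_inr : ∏ p : Fin m, var (n := n) (m := m) (inr p) =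
    ex (Sum.elim (fun _ => 0) (fun _ => 1)) := by
  have h : ∏ i : Fin m, var (n := n) (m := m) (inr i) =
      ex (∑ i : Fin m, Pi.single (inr i) 1) := by
    simp only [var, ex, prod_single, prod_const_one]
  rw [h]
  congr 1
  funext j
  rcases j with j | j <;> simp [Finset.sum_apply, Pi.single_apply]

theorem detRel_eq : detRel n m =
    ex (Sum.elim (fun _ => 0) (fun _ => 1)) * (ex (berExp n m) - 1) := by
  rw [detRel, prod_var_inl, prod_var_inr, mul_sub, mul_one, ← ex_add]
  congr 2
  funext j
  rcases j with j | j <;> simp [berExp]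

theorem toZP_eq_zero_iff (g : Laurent n m) : toZP n m g = 0 ↔ detRel n m ∣ g := by
  rw [toZP, mapDomain_eq_zero_iff_dvd _ (berExp n m) latticeHom_eq_zero_iff, detRel_eq]
  refine (IsUnit.mul_left_dvd ?_).symm
  exact IsUnit.of_mul_eq_one _ (ex_mul_ex_neg _)

theorem detRel_ne_zero (h : 0 < n + m) : detRel n m ≠ 0 := by
  intro h0
  rw [detRel, prod_var_inl, prod_var_inr, sub_eq_zero] at h0
  have h1 := single_left_injective (one_ne_zero (α := ℤ)) h0
  rcases Nat.eq_zero_or_pos n with hn | hn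
  · have hm : 0 < m := by omega
    simpa using congrFun h1 (inr ⟨0, hm⟩)
  · simpa using congrFun h1 (inl ⟨0, hn⟩)

theorem ker_toZP (h : 0 < n + m) :
    RingHom.ker ((toZP n m).comp (LaurentInv n m).subtype) =
      Ideal.span {(⟨detRel n m, detRel_mem n m⟩ : LaurentInv n m)} := by
  ext g
  rw [RingHom.mem_ker, Ideal.mem_span_singleton]
  change toZP n m g.1 = 0 ↔ _
  rw [toZP_eq_zero_iff]
  constructor
  · rintro ⟨q, hq⟩
    have hq' : q ∈ LaurentInv n m := by
      refine mem_LaurentInv.2 fun w => mul_left_cancel₀ (detRel_ne_zero h) ?_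
      rw [← hq]
      conv_rhs => rw [← mem_LaurentInv.1 g.2 w, hq, map_mul, mem_LaurentInv.1 (detRel_mem n m) w]
    exact ⟨⟨q, hq'⟩, Subtype.ext hq⟩
  · rintro ⟨q, rfl⟩
    exact ⟨q.1, rfl⟩

end Invariants

/-! ### Divisibility by `∏ (1 - x_i / y_p)` and the components of `J` -/

section Components

variable {n m : ℕ}

theorem prod_dvd_of_ringHom {B ι : Type} [CommRing B] {C : ι → Type}
    [∀ k, CommRing (C k)] [∀ k, IsDomain (C k)] (ρ : ∀ k, B →+* C k) (π : ι → B)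
    (hρ : ∀ k f, ρ k f = 0 → π k ∣ f) (hρ' : ∀ k, ρ k (π k) = 0) (s : Finset ι)
    (hπ : ∀ k ∈ s, ∀ j ∈ s, j ≠ k → ρ k (π j) ≠ 0) (f : B) (hf : ∀ k ∈ s, π k ∣ f) :
    ∏ k ∈ s, π k ∣ f := by
  classical
  induction s using Finset.induction_on with
  | empty => simp
  | insert k s hk ih =>
    obtain ⟨g, rfl⟩ := ih
      (fun a ha b hb => hπ a (mem_insert_of_mem ha) b (mem_insert_of_mem hb))
      (fun a ha => hf a (mem_insert_of_mem ha))
    obtain ⟨q, hq⟩ := hf k (mem_insert_self _ _)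
    have h1 : ρ k (∏ j ∈ s, π j) * ρ k g = 0 := by
      rw [← map_mul, hq, map_mul, hρ', zero_mul]
    have h2 : ρ k (∏ j ∈ s, π j) ≠ 0 := by
      rw [map_prod, prod_ne_zero_iff]
      intro j hj
      exact hπ k (mem_insert_self _ _) j (mem_insert_of_mem hj)
        (fun e => hk (e ▸ hj))
    obtain ⟨r, rfl⟩ := hρ k g ((mul_eq_zero.1 h1).resolve_left h2)
    rw [prod_insert hk]
    exact ⟨r, by ring⟩

theorem root_ne_zsmul_root (hnm : (n, m) ≠ (2, 2)) {i j : Fin n} {p q : Fin m}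
    (h : (j, q) ≠ (i, p)) (z : ℤ) : root j q ≠ z • root i p := by
  intro e
  have E : ∀ x : cartan n m, (root j q).1 x = z * (root i p).1 x := fun x => by
    rw [e]
    change (z • (root i p).1) x = _
    rw [LinearMap.smul_apply, zsmul_eq_mul]
  by_cases hij : j = i
  · have hpq : q ≠ p := fun h' => h (by rw [hij, h'])
    have := E (isoH i p)
    simp [root_apply, isoH, hij, hpq] at this
  · by_cases hpq : q = p
    · have := E (isoH i p)
      simp [root_apply, isoH, hij, hpq] at this
    · have hn : 2 ≤ n := by have := i.2; have := j.2; by_contra h'; apply hij; ext; omega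
      have hm : 2 ≤ m := by have := p.2; have := q.2; by_contra h'; apply hpq; ext; omega
      by_cases hn2 : n = 2
      · have hm2 : m ≠ 2 := fun h' => hnm (by rw [hn2, h'])
        obtain ⟨r, hr⟩ : ∃ r : Fin m, r ∉ ({p, q} : Finset (Fin m)) := by
          by_contra! h'
          have h1 := card_le_two (a := p) (b := q)
          rw [(eq_univ_iff_forall.2 h'), card_univ, Fintype.card_fin] at h1
          omega
        simp only [mem_insert, mem_singleton, not_or] at hr
        have := E (corootR q r)
        rw [root_corootR, root_corootR, if_neg (Ne.symm hr.2), if_pos rfl, if_neg (Ne.symm hr.1),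
          if_neg (Ne.symm hpq)] at this
        simp at this
      · obtain ⟨r, hr⟩ : ∃ r : Fin n, r ∉ ({i, j} : Finset (Fin n)) := by
          by_contra! h'
          have h1 := card_le_two (a := i) (b := j)
          rw [(eq_univ_iff_forall.2 h'), card_univ, Fintype.card_fin] at h1
          omega
        simp only [mem_insert, mem_singleton, not_or] at hr
        have := E (corootL j r)
        rw [root_corootL, root_corootL, if_neg (Ne.symm hr.2), if_pos rfl, if_neg (Ne.symm hr.1),
          if_neg (Ne.symm hij)] at this
        simp at this

instance {V : Type} [AddCommGroup V] [Module ℂ V] : TwoUniqueSums V :=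
  letI : Module ℚ V := Module.compHom _ (algebraMap ℚ ℂ)
  inferInstance

theorem ex_sub_one_ne_zero {M : Type} [AddCommGroup M] {l : M} (hl : l ≠ 0) :
    (ex l - 1 : AddMonoidAlgebra ℤ M) ≠ 0 := by
  rw [sub_ne_zero, ← ex_zero]
  exact fun h => hl (single_left_injective one_ne_zero h)

theorem kacFactor_eq : kacFactor n m = ∏ k : Fin n × Fin m, (1 - ex (root k.1 k.2)) := by
  rw [kacFactor, Fintype.prod_prod_type]
  rfl

theorem kacFactor_dvd (hnm : (n, m) ≠ (2, 2)) {f : ZP n m}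
    (hf : ∀ i p, (ex (root i p) - 1 : ZP n m) ∣ f) : kacFactor n m ∣ f := by
  have h := prod_dvd_of_ringHom (fun k : Fin n × Fin m => wallRes k.1 k.2)
    (fun k => (ex (root k.1 k.2) - 1 : ZP n m)) (fun k f h => (wallRes_eq_zero_iff _ _ f).1 h)
    (fun k => (wallRes_eq_zero_iff _ _ _).2 dvd_rfl) univ ?_ f (fun k _ => hf k.1 k.2)
  · rw [kacFactor_eq]
    refine dvd_trans (prod_dvd_prod_of_dvd _ _ fun k _ => ?_) h
    rw [← neg_sub]
    exact (neg_dvd).2 dvd_rfl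
  · intro k _ j _ hjk
    rw [wallRes, map_sub, mapDomainRingHom_ex, map_one]
    refine ex_sub_one_ne_zero fun h0 => ?_
    obtain ⟨z, hz⟩ := (wallHom_eq_zero_iff _ _ _).1 h0
    exact root_ne_zsmul_root hnm (i := k.1) (p := k.2) (j := j.1) (q := j.2) hjk z hz

theorem root_ne_zero (h : (n, m) ≠ (1, 1)) (i : Fin n) (p : Fin m) : root i p ≠ 0 := by
  intro h0
  have E : ∀ x : cartan n m, (root i p).1 x = 0 := fun x => by rw [h0]; rfl
  by_cases hn : n = 1
  · have hm : m ≠ 1 := fun h' => h (by rw [hn, h'])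
    obtain ⟨q, hq⟩ := exists_ne_fin hm p
    have := E (corootR p q)
    rw [root_corootR, if_neg hq.symm, if_pos rfl] at this
    simp at this
  · obtain ⟨j, hj⟩ := exists_ne_fin hn i
    have := E (corootL i j)
    rw [root_corootL, if_neg hj.symm, if_pos rfl] at this
    simp at this

theorem kacFactor_ne_zero (h : (n, m) ≠ (1, 1)) : kacFactor n m ≠ 0 := by
  rw [kacFactor_eq, prod_ne_zero_iff]
  intro k _
  rw [← neg_sub, neg_ne_zero]
  exact ex_sub_one_ne_zero (root_ne_zero h _ _)

theorem weylWeight_root (w : Weyl n m) (i : Fin n) (p : Fin m) :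
    weylWeight w (root i p) = root (w.1 i) (w.2 p) := rfl

theorem kacFactor_mem_ZPinv : kacFactor n m ∈ ZPinv n m := by
  refine mem_ZPinv.2 fun w => ?_
  rw [kacFactor_eq, map_prod]
  simp only [map_sub, map_one, mapDomainRingHom_ex, weylWeight_root]
  exact Equiv.prod_comp (Equiv.prodCongr w.1 w.2)
    (fun k : Fin n × Fin m => (1 - ex (root k.1 k.2) : ZP n m))

theorem root_mem_range (i : Fin n) (p : Fin m) : root i p ∈ Set.range (latticeHom n m) :=
  ⟨Pi.single (inl i) 1 - Pi.single (inr p) 1, by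
    rw [map_sub, latticeHom_single, latticeHom_single]; rfl⟩

/-- The subring of elements whose weights are integral combinations of the `ε_i`, `δ_p`. -/
def latticeRing (n m : ℕ) : Subring (ZP n m) := (toZP n m).range

theorem mem_latticeRing {f : ZP n m} :
    f ∈ latticeRing n m ↔ ∀ l, f.coeff l ≠ 0 → l ∈ Set.range (latticeHom n m) := by
  constructor
  · rintro ⟨g, rfl⟩ l hl
    exact coeff_toZP_ne_zero hl
  · intro h
    rw [← sum_coeff_single f, Finsupp.sum]
    refine sum_mem fun l hl => ?_
    obtain ⟨k, rfl⟩ := h l (mem_support_iff.1 hl)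
    exact ⟨single k (f.coeff (latticeHom n m k)), by simp [toZP]⟩

theorem ex_mem_latticeRing (k : Idx n m → ℤ) : ex (latticeHom n m k) ∈ latticeRing n m :=
  ⟨ex k, by rw [toZP, mapDomainRingHom_ex]⟩

theorem kacFactor_mem_latticeRing : kacFactor n m ∈ latticeRing n m := by
  rw [kacFactor_eq]
  refine prod_mem fun k _ => sub_mem (one_mem _) ?_
  obtain ⟨x, hx⟩ := root_mem_range k.1 k.2
  rw [← hx]
  exact ex_mem_latticeRing x

theorem mem_latticeRing_of_mul {f g : ZP n m} (hf : f ∈ latticeRing n m) (hf0 : f ≠ 0)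
    (h : f * g ∈ latticeRing n m) : g ∈ latticeRing n m := by
  have hr : ∀ l : P0 n m, QuotientAddGroup.mk' (latticeHom n m).range l = 0 ↔
      l ∈ Set.range (latticeHom n m) := fun l => QuotientAddGroup.eq_zero_iff l
  have h1 := gradedPart_zero_mul (QuotientAddGroup.mk' (latticeHom n m).range) 0
    (fun l hl => (hr l).2 (mem_latticeRing.1 hf l hl)) g
  rw [gradedPart_eq_self fun l hl => (hr l).2 (mem_latticeRing.1 h l hl)] at h1
  rw [mul_left_cancel₀ hf0 h1]
  refine mem_latticeRing.2 fun l hl => (hr l).1 ?_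
  rw [coeff_gradedPart] at hl
  by_contra h'
  exact hl (if_neg h')

theorem exists_of_kacFactor_dvd (h1 : (n, m) ≠ (1, 1)) (h0 : 0 < n + m)
    {f : ZP n m} (hf : f ∈ ZPinv n m) (hs : f ∈ latticeRing n m) (hd : kacFactor n m ∣ f) :
    ∃ g ∈ LaurentInv n m, f = kacFactor n m * toZP n m g := by
  obtain ⟨q, rfl⟩ := hd
  have hq : q ∈ ZPinv n m := by
    refine mem_ZPinv.2 fun w => mul_left_cancel₀ (kacFactor_ne_zero h1) ?_
    conv_rhs => rw [← mem_ZPinv.1 hf w, map_mul, mem_ZPinv.1 kacFactor_mem_ZPinv w]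
  have hq' := mem_latticeRing_of_mul kacFactor_mem_latticeRing (kacFactor_ne_zero h1) hs
  obtain ⟨g, hg, rfl⟩ := exists_toZP_eq h0 hq (mem_latticeRing.1 hq')
  exact ⟨g, hg, rfl⟩

theorem exists_kacFactor_mul (hnm : (n, m) ≠ (2, 2)) (h1 : (n, m) ≠ (1, 1)) (h0 : 0 < n + m)
    {f : ZP n m} (hf : f ∈ ZPinv n m) (hs : f ∈ latticeRing n m)
    (hd : ∀ i p, wallRes i p f = 0) :
    ∃ g ∈ LaurentInv n m, f = kacFactor n m * toZP n m g :=
  exists_of_kacFactor_dvd h1 h0 hf hs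
    (kacFactor_dvd hnm fun i p => (wallRes_eq_zero_iff i p f).1 (hd i p))

theorem ex_omega_mem_ZPinv (s : ℂ) : (ex (omega n m s) : ZP n m) ∈ ZPinv n m :=
  mem_ZPinv.2 fun w => by rw [mapDomainRingHom_ex, weylWeight_omega]

theorem wallRes_eq_zero_of_forall {i : Fin n} {p : Fin m} {f : ZP n m}
    (hf : ∀ l : P0 n m, (wallRes i p f).coeff (wallHom i p l) ≠ 0 → l.1 (isoH i p) = 0)
    (h : ∀ l, f.coeff l ≠ 0 → l.1 (isoH i p) ≠ 0) : wallRes i p f = 0 := by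
  apply coeff_injective
  ext ν
  by_contra hν
  obtain ⟨l, hl, rfl⟩ := exists_coeff_ne_zero_of_mapDomain hν
  exact h l hl (hf l hν)

theorem Jcomp_nonintegral (hn : 1 ≤ n) (hm : 1 ≤ m) (hnm : (n, m) ≠ (2, 2)) (a : ℂ)
    (ha : ∀ z : ℤ, a ≠ z) :
    (Jcomp n m (QuotientAddGroup.mk a) : Set (ZP n m)) =
      {f | ∃ g ∈ LaurentInv n m, f = ex (omega n m a) * kacFactor n m * toZP n m g} := by
  ext f
  constructor
  · rintro ⟨hf, hw⟩
    have hw' : ∀ l, f.coeff l ≠ 0 → ∃ k, l = omega n m a + latticeHom n m k := by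
      intro l hl
      obtain ⟨s, hs, k, rfl⟩ := hw l hl
      obtain ⟨z, hz⟩ := QuotientAddGroup.eq.1 hs
      have : s = a - (z : ℂ) := by
        have h1 : (z : ℂ) = -s + a := by simpa using hz
        rw [h1]; ring
      refine ⟨Sum.elim (fun _ => -z) (fun _ => 0) + k, ?_⟩
      rw [map_add, ← omega_intCast, ← add_assoc, ← omega_add, this]
      push_cast
      rw [sub_eq_add_neg]
    rw [mem_J_iff] at hf
    have hd : ∀ i p, wallRes i p f = 0 := fun i p => by
      refine wallRes_eq_zero_of_forall (hf.2 i p) fun l hl h0 => ?_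
      obtain ⟨k, rfl⟩ := hw' l hl
      change (omega n m a).1 (isoH i p) + (latticeHom n m k).1 (isoH i p) = 0 at h0
      rw [omega_isoH, latticeHom_isoH] at h0
      apply ha (-(k (inl i) + k (inr p)))
      push_cast
      linear_combination h0
    by_cases h1 : (n, m) = (1, 1)
    · obtain ⟨rfl, rfl⟩ := Prod.mk.inj h1
      refine ⟨0, zero_mem _, ?_⟩
      have := (wallRes_eq_zero_iff _ _ f).1 (hd 0 0)
      rw [root_eq_zero rfl rfl, ex_zero, sub_self, zero_dvd_iff] at this
      simp [this]
    · obtain ⟨g, hg, hfg⟩ := exists_kacFactor_mul hnm h1 (by omega)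
        (f := ex (omega n m (-a)) * f) (mul_mem (ex_omega_mem_ZPinv _) hf.1)
        (mem_latticeRing.2 fun l hl => by
          have h2 : (ex (omega n m (-a)) * f).coeff l = f.coeff (omega n m a + l) := by
            rw [ex, coeff_single_mul_apply, one_mul, omega_neg, neg_neg]
          obtain ⟨k, hk⟩ := hw' _ (h2 ▸ hl)
          exact ⟨k, (add_left_cancel hk).symm⟩)
        (fun i p => by rw [map_mul, hd, mul_zero])
      refine ⟨g, hg, ?_⟩
      rw [mul_assoc, ← hfg, ← mul_assoc, ← ex_add, ← omega_add, add_neg_cancel, omega_zero, ex_zero,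
        one_mul]
  · rintro ⟨g, hg, rfl⟩
    refine ⟨mem_J_iff.2 ⟨mul_mem (mul_mem (ex_omega_mem_ZPinv a) kacFactor_mem_ZPinv)
      (toZP_mem_ZPinv hg), fun i p l hl => absurd ?_ hl⟩, fun l hl => ?_⟩
    · have h0 : wallRes i p (kacFactor n m) = 0 := by
        rw [kacFactor_eq, map_prod]
        refine prod_eq_zero (mem_univ (i, p)) ?_
        rw [← neg_sub, map_neg, neg_eq_zero]
        exact (wallRes_eq_zero_iff _ _ _).2 dvd_rfl
      rw [map_mul, map_mul, h0]
      simp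
    · have h1 : kacFactor n m * toZP n m g ∈ latticeRing n m :=
        mul_mem kacFactor_mem_latticeRing ⟨g, rfl⟩
      rw [mul_assoc, ex, coeff_single_mul_apply, one_mul] at hl
      obtain ⟨k, hk⟩ := mem_latticeRing.1 h1 _ hl
      exact ⟨a, rfl, k, by rw [hk]; abel⟩

theorem wallHom_latticeHom_mem (i : Fin n) (p : Fin m) {k : Idx n m → ℤ}
    (hk : wallHom i p (latticeHom n m k) = 0) :
    (ex k - 1 : Laurent n m) ∈ Ideal.span {var (inr p) - var (inl i), detRel n m} := by
  set I : Ideal (Laurent n m) := Ideal.span {var (inr p) - var (inl i), detRel n m}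
  have h1 : Pi.single (inl i) 1 - Pi.single (inr p) 1 ∈ expSubgroup I := by
    change ex _ - 1 ∈ I
    have : (ex (Pi.single (inl i) 1 - Pi.single (inr p) 1) - 1 : Laurent n m) =
        -ex (-Pi.single (inr p) 1) * (var (inr p) - var (inl i)) := by
      rw [sub_eq_add_neg (Pi.single (inl i) 1), ex_add, var, var, mul_sub, neg_mul, ex_neg_mul_ex]
      ring
    rw [this]
    exact I.mul_mem_left _ (Ideal.subset_span (by simp))
  have h2 : berExp n m ∈ expSubgroup I := by
    change ex _ - 1 ∈ I
    have : (ex (berExp n m) - 1 : Laurent n m) =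
        ex (-Sum.elim (fun _ => 0) (fun _ => 1)) * detRel n m := by
      rw [detRel_eq, ← mul_assoc, ex_neg_mul_ex, one_mul]
    rw [this]
    exact I.mul_mem_left _ (Ideal.subset_span (by simp))
  obtain ⟨z, hz⟩ := (wallHom_eq_zero_iff _ _ _).1 hk
  have h3 : latticeHom n m (k - z • (Pi.single (inl i) 1 - Pi.single (inr p) 1)) = 0 := by
    rw [map_sub, map_zsmul, map_sub, latticeHom_single, latticeHom_single, hz]
    exact sub_self _
  obtain ⟨y, hy⟩ := (latticeHom_eq_zero_iff _).1 h3
  have h4 : k = z • (Pi.single (inl i) 1 - Pi.single (inr p) 1) + y • berExp n m := by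
    rw [← hy]; abel
  have h5 : k ∈ expSubgroup I := by
    rw [h4]
    exact add_mem (zsmul_mem h1 z) (zsmul_mem h2 y)
  exact h5

theorem Dlaurent_mem_iff (i : Fin n) (p : Fin m) (g : Laurent n m) :
    Dlaurent i p g ∈ Ideal.span {var (inr p) - var (inl i), detRel n m} ↔
      ∀ l : P0 n m, (wallRes i p (toZP n m g)).coeff (wallHom i p l) ≠ 0 → l.1 (isoH i p) = 0 := by
  let Q := (wallHom (n := n) (m := m) i p).comp (latticeHom n m)
  have hQ : mapDomainRingHom ℤ Q = (wallRes i p).comp (toZP n m) :=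
    mapDomainRingHom_comp _ _
  have hco : ∀ k, (mapDomainRingHom ℤ Q (Dlaurent i p g)).coeff (Q k) =
      (k (inl i) + k (inr p)) * (wallRes i p (toZP n m g)).coeff (Q k) := by
    intro k
    rw [Dlaurent, coeff_mapDomain_expDeriv, hQ]
    · rfl
    · intro k hk
      have h1 := wallHom_apply_isoH (i := i) (p := p) (l := latticeHom n m k) (l' := 0) hk
      rw [latticeHom_isoH] at h1
      have h2 : (k (inl i) : ℂ) + k (inr p) = 0 := h1
      exact_mod_cast h2
  constructor
  · intro h l hl
    obtain ⟨l', hl', hll⟩ := exists_coeff_ne_zero_of_mapDomain hl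
    obtain ⟨k, rfl⟩ := coeff_toZP_ne_zero hl'
    rw [← wallHom_apply_isoH hll, latticeHom_isoH]
    have h0 : mapDomainRingHom ℤ Q (Dlaurent i p g) = 0 := by
      have hle : Ideal.span {var (inr p) - var (inl i), detRel n m} ≤
          RingHom.ker (mapDomainRingHom ℤ Q) := by
        rw [Ideal.span_le]
        rintro x (rfl | rfl)
        · change mapDomainRingHom ℤ Q _ = 0
          rw [map_sub, var, var, mapDomainRingHom_ex, mapDomainRingHom_ex, sub_eq_zero]
          congr 1
          change wallHom i p (latticeHom n m _) = wallHom i p (latticeHom n m _)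
          rw [latticeHom_single, latticeHom_single, eq_comm, ← sub_eq_zero, ← map_sub]
          exact (wallHom_eq_zero_iff i p _).2 ⟨1, (one_smul _ _).symm⟩
        · change mapDomainRingHom ℤ Q _ = 0
          rw [hQ, RingHom.comp_apply, (toZP_eq_zero_iff _).2 dvd_rfl, map_zero]
      exact hle h
    have h1 := hco k
    rw [h0] at h1
    have h2 : 0 = (k (inl i) + k (inr p)) * (wallRes i p (toZP n m g)).coeff (Q k) := h1
    have h3 : (wallRes i p (toZP n m g)).coeff (Q k) ≠ 0 := by
      change (wallRes i p (toZP n m g)).coeff (wallHom i p (latticeHom n m k)) ≠ 0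
      rw [hll]; exact hl
    exact_mod_cast (mul_eq_zero.1 h2.symm).resolve_right h3
  · intro h
    refine mem_of_mapDomain_eq_zero Q _ (fun k hk => wallHom_latticeHom_mem i p hk) _ ?_
    apply coeff_injective
    ext ν
    by_contra hν
    obtain ⟨k, -, rfl⟩ := exists_coeff_ne_zero_of_mapDomain hν
    apply hν
    rw [hco]
    by_cases h2 : (wallRes i p (toZP n m g)).coeff (Q k) = 0
    · rw [h2, mul_zero]; rfl
    · have h3 := h (latticeHom n m k) h2
      rw [latticeHom_isoH] at h3
      have h4 : k (inl i) + k (inr p) = 0 := by exact_mod_cast h3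
      rw [h4, zero_mul]; rfl

theorem mem_Jzero_iff {f : ZP n m} : f ∈ Jzero n m ↔ f ∈ J n m ∧ f ∈ latticeRing n m := by
  rw [mem_latticeRing]
  refine and_congr Iff.rfl (forall₂_congr fun l _ => mem_weightClass_zero_iff)

theorem coe_Jzero (h : 0 < n + m) : (Jzero n m : Set (ZP n m)) =
    {f | ∃ g ∈ LaurentInv n m,
      (∀ (i : Fin n) (p : Fin m), Dlaurent i p g ∈
        Ideal.span {var (inr p) - var (inl i), detRel n m}) ∧ f = toZP n m g} := by
  ext f
  rw [SetLike.mem_coe, mem_Jzero_iff, mem_J_iff]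
  constructor
  · rintro ⟨⟨h1, h2⟩, h3⟩
    obtain ⟨g, hg, rfl⟩ := exists_toZP_eq h h1 (mem_latticeRing.1 h3)
    exact ⟨g, hg, fun i p => (Dlaurent_mem_iff i p g).2 (h2 i p), rfl⟩
  · rintro ⟨g, hg, h2, rfl⟩
    exact ⟨⟨toZP_mem_ZPinv hg, fun i p => (Dlaurent_mem_iff i p g).1 (h2 i p)⟩, ⟨g, rfl⟩⟩

end Components

/-! ### The coefficients `h_k` -/

section HCoeff

variable {B C : Type} [CommRing B] [CommRing C] {n m : ℕ}

/-- The power series `∏_p (1 - v_p t) / ∏_i (1 - u_i t)`. -/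
def hSeries (u : Fin n → B) (v : Fin m → B) : PowerSeries B :=
  (∏ p, (1 - PowerSeries.C (v p) * PowerSeries.X)) *
    PowerSeries.invOfUnit (∏ i, (1 - PowerSeries.C (u i) * PowerSeries.X)) 1

theorem coeff_hSeries (u : Fin n → B) (v : Fin m → B) (k : ℕ) :
    PowerSeries.coeff k (hSeries u v) = hCoeff u v k := rfl

theorem constantCoeff_prod {ι : Type} (s : Finset ι) (u : ι → B) :
    PowerSeries.constantCoeff (∏ i ∈ s, (1 - PowerSeries.C (u i) * PowerSeries.X)) = 1 := by
  rw [map_prod]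
  simp

theorem prod_mul_invOfUnit (u : Fin n → B) :
    (∏ i, (1 - PowerSeries.C (u i) * PowerSeries.X)) *
      PowerSeries.invOfUnit (∏ i, (1 - PowerSeries.C (u i) * PowerSeries.X)) 1 = 1 :=
  PowerSeries.mul_invOfUnit _ _ (by rw [constantCoeff_prod]; rfl)

theorem hSeries_mul (u : Fin n → B) (v : Fin m → B) :
    hSeries u v * ∏ i, (1 - PowerSeries.C (u i) * PowerSeries.X) =
      ∏ p, (1 - PowerSeries.C (v p) * PowerSeries.X) := by
  rw [hSeries, mul_assoc, mul_comm (PowerSeries.invOfUnit _ _), prod_mul_invOfUnit, mul_one]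

theorem eq_hSeries {u : Fin n → B} {v : Fin m → B} {f : PowerSeries B}
    (h : f * ∏ i, (1 - PowerSeries.C (u i) * PowerSeries.X) =
      ∏ p, (1 - PowerSeries.C (v p) * PowerSeries.X)) : f = hSeries u v := by
  rw [hSeries, ← h, mul_assoc, prod_mul_invOfUnit, mul_one]

theorem map_hSeries (φ : B →+* C) (u : Fin n → B) (v : Fin m → B) :
    PowerSeries.map φ (hSeries u v) = hSeries (fun i => φ (u i)) (fun p => φ (v p)) := by
  apply eq_hSeries
  have h := congrArg (PowerSeries.map φ) (hSeries_mul u v)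
  simpa [map_prod] using h

theorem map_hCoeff (φ : B →+* C) (u : Fin n → B) (v : Fin m → B) (k : ℕ) :
    φ (hCoeff u v k) = hCoeff (fun i => φ (u i)) (fun p => φ (v p)) k := by
  rw [← coeff_hSeries, ← coeff_hSeries, ← map_hSeries, PowerSeries.coeff_map]

theorem hCoeff_mem {S : Subring B} {u : Fin n → B} {v : Fin m → B} (hu : ∀ i, u i ∈ S)
    (hv : ∀ p, v p ∈ S) (k : ℕ) : hCoeff u v k ∈ S := by
  have := map_hCoeff S.subtype (fun i => (⟨u i, hu i⟩ : S)) (fun p => (⟨v p, hv p⟩ : S)) k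
  exact this ▸ Subtype.property (hCoeff (fun i => (⟨u i, hu i⟩ : S)) _ k)

theorem hCoeff_comp_equiv (σ : Equiv.Perm (Fin n)) (τ : Equiv.Perm (Fin m)) (u : Fin n → B)
    (v : Fin m → B) (k : ℕ) : hCoeff (fun i => u (σ i)) (fun p => v (τ p)) k = hCoeff u v k := by
  rw [hCoeff, hCoeff, Equiv.prod_comp σ (fun i => 1 - PowerSeries.C (u i) * PowerSeries.X),
    Equiv.prod_comp τ (fun i => 1 - PowerSeries.C (v i) * PowerSeries.X)]

theorem prod_update (u : Fin n → B) (i : Fin n) :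
    ∏ j, (1 - PowerSeries.C (u j) * PowerSeries.X) =
      (1 - PowerSeries.C (u i) * PowerSeries.X) *
        ∏ j, (1 - PowerSeries.C (Function.update u i 0 j) * PowerSeries.X) := by
  rw [← mul_prod_erase univ _ (mem_univ i),
    ← mul_prod_erase univ
      (fun j => 1 - PowerSeries.C (Function.update u i 0 j) * PowerSeries.X) (mem_univ i)]
  simp only [Function.update_self, map_zero, zero_mul, sub_zero, one_mul]
  congr 1
  refine prod_congr rfl fun j hj => ?_
  rw [Function.update_of_ne (ne_of_mem_erase hj)]

theorem hCoeff_update {u : Fin n → B} {v : Fin m → B} {i : Fin n} {p : Fin m} (h : u i = v p)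
    (k : ℕ) : hCoeff u v k = hCoeff (Function.update u i 0) (Function.update v p 0) k := by
  rw [← coeff_hSeries, ← coeff_hSeries]
  congr 1
  refine (eq_hSeries ?_).symm
  rw [prod_update u i, mul_left_comm, hSeries_mul, prod_update v p, h]

theorem hCoeff_castSucc {u : Fin (n + 1) → B} {v : Fin (m + 1) → B}
    (h : u (Fin.last n) = v (Fin.last m)) (k : ℕ) :
    hCoeff u v k = hCoeff (fun i => u i.castSucc) (fun p => v p.castSucc) k := by
  rw [← coeff_hSeries, ← coeff_hSeries]
  congr 1
  refine (eq_hSeries ?_).symm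
  rw [Fin.prod_univ_castSucc, Fin.prod_univ_castSucc, ← mul_assoc, hSeries_mul, h]

end HCoeff

/-! ### The elements `h_k` and `h_k^*` lie in `J` -/

section Generators

variable {n m : ℕ}

/-- The subring generated by the `h_k` and `h_k^*`. -/
def hRing (n m : ℕ) : Subring (ZP n m) :=
  Subring.closure (Set.range (hk n m) ∪ Set.range (hkStar n m))

theorem hk_mem_hRing (k : ℕ) : hk n m k ∈ hRing n m :=
  Subring.subset_closure (Or.inl ⟨k, rfl⟩)

theorem hkStar_mem_hRing (k : ℕ) : hkStar n m k ∈ hRing n m :=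
  Subring.subset_closure (Or.inr ⟨k, rfl⟩)

/-- Elements of a group ring supported on a subgroup. -/
def supportedSubring {M : Type} [AddCommGroup M] (H : AddSubgroup M) :
    Subring (AddMonoidAlgebra ℤ M) :=
  (mapDomainRingHom ℤ H.subtype).range

theorem mem_of_mem_supportedSubring {M : Type} [AddCommGroup M] {H : AddSubgroup M}
    {f : AddMonoidAlgebra ℤ M} (hf : f ∈ supportedSubring H) {l : M} (hl : f.coeff l ≠ 0) :
    l ∈ H := by
  obtain ⟨g, rfl⟩ := hf
  obtain ⟨k, -, rfl⟩ := exists_coeff_ne_zero_of_mapDomain hl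
  exact k.2

theorem ex_mem_supportedSubring {M : Type} [AddCommGroup M] {H : AddSubgroup M} {l : M}
    (hl : l ∈ H) : ex l ∈ supportedSubring H :=
  ⟨ex ⟨l, hl⟩, by rw [mapDomainRingHom_ex]; rfl⟩

theorem hCoeff_ex_mem_Jzero (s : ℤ) (k : ℕ) :
    hCoeff (fun i : Fin n => (ex (s • wt (inl i)) : ZP n m))
      (fun p : Fin m => ex (s • wt (inr p))) k ∈ Jzero n m := by
  rw [mem_Jzero_iff, mem_J_iff]
  refine ⟨⟨mem_ZPinv.2 fun w => ?_, fun i p l hl => ?_⟩, ?_⟩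
  · rw [map_hCoeff]
    simp only [mapDomainRingHom_ex, map_zsmul, weylWeight_wt]
    exact hCoeff_comp_equiv w.1 w.2 (fun i : Fin n => (ex (s • wt (inl i)) : ZP n m))
      (fun p : Fin m => ex (s • wt (inr p))) k
  · rw [wallRes, map_hCoeff] at hl
    simp only [mapDomainRingHom_ex, map_zsmul] at hl
    have hip : wallHom i p (wt (inl i)) = wallHom i p (wt (inr p)) := by
      rw [← sub_eq_zero, ← map_sub]
      exact (wallHom_eq_zero_iff i p _).2 ⟨1, (one_smul _ _).symm⟩
    rw [hCoeff_update (i := i) (p := p) (by rw [hip])] at hl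
    let x : ker (root (n := n) (m := m) i p).1 :=
      ⟨isoH i p, isoH_mem_ker i i p p (by simp)⟩
    let H : AddSubgroup (Module.Dual ℂ (ker (root (n := n) (m := m) i p).1)) :=
      { carrier := {ν | ν x = 0}
        zero_mem' := rfl
        add_mem' := fun {a b} ha hb => by
          change a x + b x = 0
          rw [show a x = 0 from ha, show b x = 0 from hb, add_zero]
        neg_mem' := fun {a} ha => by
          change -(a x) = 0
          rw [show a x = 0 from ha, neg_zero] }
    have h1 : ∀ j : Idx n m, j ≠ inl i → j ≠ inr p → s • wallHom i p (wt j) ∈ H := by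
      intro j hj hj'
      refine zsmul_mem ?_ s
      change (wt j).1 (isoH i p) = 0
      rw [wt_apply]
      simp [isoH, hj, hj']
    exact mem_of_mem_supportedSubring (hCoeff_mem (S := supportedSubring H) (fun j => by
      by_cases hj : j = i
      · subst hj; rw [Function.update_self]; exact zero_mem _
      · rw [Function.update_of_ne hj]
        exact ex_mem_supportedSubring (h1 _ (by simpa using hj) (by simp))) (fun q => by
      by_cases hq : q = p
      · subst hq; rw [Function.update_self]; exact zero_mem _
      · rw [Function.update_of_ne hq]
        exact ex_mem_supportedSubring (h1 _ (by simp) (by simpa using hq))) k) hl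
  · have h : ∀ j : Idx n m, ex (s • wt j) ∈ latticeRing n m := fun j => by
      rw [← latticeHom_single, ← map_zsmul]
      exact ex_mem_latticeRing _
    exact hCoeff_mem (fun i => h _) (fun p => h _) k

theorem hRing_le_Jzero : hRing n m ≤ Jzero n m := by
  rw [hRing, Subring.closure_le]
  rintro _ (⟨k, rfl⟩ | ⟨k, rfl⟩)
  · have := hCoeff_ex_mem_Jzero (n := n) (m := m) 1 k
    simp only [one_smul] at this
    exact this
  · have := hCoeff_ex_mem_Jzero (n := n) (m := m) (-1) k
    simp only [neg_smul, one_smul] at this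
    exact this

end Generators

/-! ### Two-sided sequences -/

section Sequences

variable {K : Type} [Field K] {n m : ℕ}

/-- The shift operator on two-sided sequences. -/
def shift (K : Type) [Field K] : (ℤ → K) →ₗ[K] (ℤ → K) where
  toFun s k := s (k - 1)
  map_add' _ _ := rfl
  map_smul' _ _ := rfl

/-- The two-sided sequence of coefficients of a power series in `t`. -/
def seqZero (f : PowerSeries K) (k : ℤ) : K :=
  if 0 ≤ k then PowerSeries.coeff k.toNat f else 0

/-- The two-sided sequence of coefficients of `t^d f(t⁻¹)`. -/
def seqInfty (d : ℤ) (f : PowerSeries K) (k : ℤ) : K :=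
  if k ≤ d then PowerSeries.coeff (d - k).toNat f else 0

/-- Multiplication of a two-sided sequence by `1 - z t`. -/
def factorOp (z : K) : (ℤ → K) →ₗ[K] (ℤ → K) := 1 - z • shift K

theorem factorOp_apply (z : K) (s : ℤ → K) (k : ℤ) : factorOp z s k = s k - z * s (k - 1) := rfl

theorem factorOp_comm (z w : K) (s : ℤ → K) :
    factorOp z (factorOp w s) = factorOp w (factorOp z s) := by
  funext k
  simp only [factorOp_apply]
  ring

theorem factorOp_seqZero (z : K) (f : PowerSeries K) :
    factorOp z (seqZero f) = seqZero ((1 - PowerSeries.C z * PowerSeries.X) * f) := by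
  funext k
  rw [factorOp_apply]
  simp only [seqZero]
  rcases lt_trichotomy k 0 with h | h | h
  · rw [if_neg (by omega), if_neg (by omega), if_neg (by omega)]; simp
  · subst h
    simp [sub_mul, mul_assoc]
  · rw [if_pos (by omega), if_pos (by omega), if_pos (by omega)]
    obtain ⟨j, rfl⟩ : ∃ j : ℕ, k = j + 1 := ⟨(k - 1).toNat, by omega⟩
    have e1 : ((j : ℤ) + 1).toNat = j + 1 := by omega
    have e2 : ((j : ℤ) + 1 - 1).toNat = j := by omega
    rw [e1, e2, sub_mul, one_mul, map_sub, mul_assoc, PowerSeries.coeff_C_mul,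
      PowerSeries.coeff_succ_X_mul]

theorem factorOp_seqInfty {z : K} (hz : z ≠ 0) (d : ℤ) (f : PowerSeries K) :
    factorOp z (seqInfty d f) =
      (-z) • seqInfty (d + 1) ((1 - PowerSeries.C z⁻¹ * PowerSeries.X) * f) := by
  funext k
  rw [factorOp_apply, Pi.smul_apply, smul_eq_mul]
  simp only [seqInfty]
  rcases lt_trichotomy k (d + 1) with h | h | h
  · rw [if_pos (by omega), if_pos (by omega), if_pos (by omega)]
    obtain ⟨j, hj⟩ : ∃ j : ℕ, d - k = j := ⟨(d - k).toNat, by omega⟩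
    have e1 : (d - k).toNat = j := by omega
    have e2 : (d - (k - 1)).toNat = j + 1 := by omega
    have e3 : (d + 1 - k).toNat = j + 1 := by omega
    rw [e1, e2, e3, sub_mul, one_mul, map_sub, mul_assoc, PowerSeries.coeff_C_mul,
      PowerSeries.coeff_succ_X_mul]
    field_simp
    ring
  · subst h
    rw [if_neg (by omega), if_pos (by omega), if_pos (by omega)]
    simp [sub_mul, mul_assoc]
  · rw [if_neg (by omega), if_neg (by omega), if_neg (by omega)]; simp

/-- Successive multiplication by `1 - z t` for `z` in a list. -/
def listOp (l : List K) : Module.End K (ℤ → K) := (l.map fun z => factorOp z).prod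

theorem listOp_nil (s : ℤ → K) : listOp [] s = s := rfl

theorem listOp_cons (z : K) (l : List K) (s : ℤ → K) :
    listOp (z :: l) s = factorOp z (listOp l s) := by
  rw [listOp, List.map_cons, List.prod_cons]
  rfl

theorem listOp_factorOp (z : K) (l : List K) (s : ℤ → K) :
    listOp l (factorOp z s) = factorOp z (listOp l s) := by
  induction l with
  | nil => rfl
  | cons w l ih => rw [listOp_cons, listOp_cons, ih, factorOp_comm]

theorem listOp_seqZero (l : List K) (f : PowerSeries K) :
    listOp l (seqZero f) =
      seqZero ((l.map fun z => 1 - PowerSeries.C z * PowerSeries.X).prod * f) := by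
  induction l with
  | nil => simp [listOp_nil]
  | cons w l ih => rw [listOp_cons, ih, factorOp_seqZero, List.map_cons, List.prod_cons, mul_assoc]

theorem listOp_seqInfty (l : List K) (hl : ∀ z ∈ l, z ≠ 0) (d : ℤ) (f : PowerSeries K) :
    listOp l (seqInfty d f) = (l.map fun z => -z).prod • seqInfty (d + l.length)
      ((l.map fun z => 1 - PowerSeries.C z⁻¹ * PowerSeries.X).prod * f) := by
  induction l with
  | nil => simp [listOp_nil]
  | cons w l ih =>
    rw [listOp_cons, ih fun z hz => hl z (List.mem_cons_of_mem _ hz), map_smul,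
      factorOp_seqInfty (hl w List.mem_cons_self), List.map_cons, List.prod_cons, List.map_cons,
      List.prod_cons, mul_assoc, smul_smul, List.length_cons, mul_comm (-w)]
    push_cast
    rw [add_assoc]

theorem listOp_zpow {z : K} (hz : z ≠ 0) (l : List K) :
    listOp l (fun k => z ^ k) = fun k => (l.map fun w => 1 - w / z).prod * z ^ k := by
  induction l with
  | nil => simp [listOp_nil]
  | cons w l ih =>
    rw [listOp_cons, ih]
    funext k
    rw [factorOp_apply, List.map_cons, List.prod_cons, zpow_sub_one₀ hz]
    field_simp

theorem eq_of_factorOp_eq_zero {z : K} (hz : z ≠ 0) {s : ℤ → K} (h : factorOp z s = 0) (k : ℤ) :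
    s k = s 0 * z ^ k := by
  have h1 : ∀ k, s k = z * s (k - 1) := fun k => sub_eq_zero.1 (congrFun h k)
  induction k using Int.induction_on with
  | zero => simp
  | succ i ih => rw [h1, add_sub_cancel_right, ih, zpow_add_one₀ hz]; ring
  | pred i ih =>
    have h2 := h1 (-i)
    rw [ih] at h2
    rw [zpow_sub_one₀ hz, ← mul_assoc, h2]
    field_simp

theorem sum_map_sub_sum_map (l : List K) (f g : K → K) :
    (l.map f).sum - (l.map g).sum = (l.map fun z => f z - g z).sum := by
  induction l with
  | nil => simp
  | cons w l ih => simp only [List.map_cons, List.sum_cons, ← ih]; ring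

theorem exists_sum_zpow (l : List K) (hl : l.Nodup) (h0 : ∀ z ∈ l, z ≠ 0) (s : ℤ → K)
    (hs : listOp l s = 0) : ∃ A : K → K, ∀ k, s k = (l.map fun z => A z * z ^ k).sum := by
  induction l generalizing s with
  | nil => exact ⟨0, fun k => by rw [listOp_nil] at hs; simp [hs]⟩
  | cons w l ih =>
    rw [listOp_cons, ← listOp_factorOp] at hs
    obtain ⟨A, hA⟩ := ih (List.nodup_cons.1 hl).2
      (fun z hz => h0 z (List.mem_cons_of_mem _ hz)) _ hs
    have hw := h0 w List.mem_cons_self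
    let p : ℤ → K := fun k => (l.map fun z => A z / (1 - w / z) * z ^ k).sum
    have hp : factorOp w p = factorOp w s := by
      funext k
      rw [hA, factorOp_apply]
      simp only [p]
      rw [← List.sum_map_mul_left, sum_map_sub_sum_map]
      congr 1
      refine List.map_congr_left fun z hz => ?_
      have hz0 := h0 z (List.mem_cons_of_mem _ hz)
      have hzw : z - w ≠ 0 := sub_ne_zero.2 fun e => (List.nodup_cons.1 hl).1 (e ▸ hz)
      have h1 : 1 - w / z ≠ 0 := by
        rw [one_sub_div hz0]; exact div_ne_zero hzw hz0
      rw [zpow_sub_one₀ hz0]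
      field_simp
    have hr : factorOp w (s - p) = 0 := by rw [map_sub, hp, sub_self]
    classical
    refine ⟨fun z => if z = w then (s - p) 0 else A z / (1 - w / z), fun k => ?_⟩
    have h1 := eq_of_factorOp_eq_zero hw hr k
    simp only [List.map_cons, List.sum_cons, if_true, ← h1]
    have h2 : (l.map fun z => (if z = w then (s - p) 0 else A z / (1 - w / z)) * z ^ k) =
        l.map fun z => A z / (1 - w / z) * z ^ k := by
      refine List.map_congr_left fun z hz => ?_
      rw [if_neg fun e : z = w => (List.nodup_cons.1 hl).1 (e ▸ hz)]
    rw [h2]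
    simp [p]

theorem eventually_listOp (l : List K) {s t : ℤ → K} (h : ∀ᶠ k in Filter.atTop, s k = t k) :
    ∀ᶠ k in Filter.atTop, listOp l s k = listOp l t k := by
  induction l with
  | nil => exact h
  | cons w l ih =>
    have h2 : Filter.Tendsto (fun k : ℤ => k - 1) Filter.atTop Filter.atTop :=
      Filter.tendsto_atTop_add_const_right _ _ Filter.tendsto_id
    filter_upwards [ih, h2.eventually ih] with k h1 h2
    rw [listOp_cons, listOp_cons, factorOp_apply, factorOp_apply, h1, h2]

theorem seqInfty_zero_one : seqInfty 0 (1 : PowerSeries K) = seqZero 1 := by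
  funext k
  simp only [seqInfty, seqZero, PowerSeries.coeff_one]
  rcases lt_trichotomy k 0 with h | h | h
  · rw [if_pos h.le, if_neg (by omega), if_neg (by omega)]
  · subst h; simp
  · rw [if_neg (by omega), if_pos h.le, if_neg (by omega)]

/-- The difference of the expansions at `0` and `∞` of `∏ (1 - y_p t) / ∏ (1 - x_i t)`
when `∏ x_i = ∏ y_p`. -/
def expansionDiff (x : Fin n → K) (y : Fin m → K) : ℤ → K :=
  seqZero (hSeries x y) -
    (-1 : K) ^ (n + m) • seqInfty (m - n) (hSeries (fun i => (x i)⁻¹) (fun p => (y p)⁻¹))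

theorem prod_map_ofFn {B : Type} [CommMonoid B] (f : K → B) (x : Fin n → K) :
    ((List.ofFn x).map f).prod = ∏ i, f (x i) := by
  rw [List.map_ofFn, List.prod_ofFn]
  rfl

theorem listOp_expansionDiff {x : Fin n → K} {y : Fin m → K} (hx : ∀ i, x i ≠ 0)
    (hy : ∀ p, y p ≠ 0) (hxy : ∏ i, x i = ∏ p, y p) :
    listOp (List.ofFn x) (expansionDiff x y) = 0 := by
  have h1 := listOp_seqZero (List.ofFn x) (hSeries x y)
  rw [prod_map_ofFn, mul_comm, hSeries_mul] at h1
  have h2 := listOp_seqInfty (List.ofFn x) (by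
    intro z hz
    obtain ⟨i, rfl⟩ := (List.mem_ofFn' x z).1 hz
    exact hx i) (m - n) (hSeries (fun i => (x i)⁻¹) (fun p => (y p)⁻¹))
  rw [prod_map_ofFn, prod_map_ofFn (fun z => 1 - PowerSeries.C z⁻¹ * PowerSeries.X), mul_comm,
    hSeries_mul, List.length_ofFn, sub_add_cancel] at h2
  have h3 := listOp_seqInfty (List.ofFn y) (by
    intro z hz
    obtain ⟨i, rfl⟩ := (List.mem_ofFn' y z).1 hz
    exact hy i) 0 1
  rw [prod_map_ofFn, prod_map_ofFn (fun z => 1 - PowerSeries.C z⁻¹ * PowerSeries.X), mul_one,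
    List.length_ofFn, zero_add, seqInfty_zero_one, listOp_seqZero, prod_map_ofFn, mul_one] at h3
  rw [expansionDiff, map_sub, map_smul, h1, h2, h3, smul_smul, ← sub_smul]
  have h4 : ∀ (k : ℕ) (u : Fin k → K), ∏ i, -u i = (-1) ^ k * ∏ i, u i := fun k u => by
    rw [prod_neg, card_univ, Fintype.card_fin]
  rw [h4, h4, hxy, ← mul_assoc, ← pow_add]
  have h5 : (-1 : K) ^ (n + m + n) = (-1) ^ m := by
    rw [show n + m + n = m + 2 * n by ring, pow_add, pow_mul]
    simp
  rw [h5, sub_self, zero_smul]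

theorem mk_pow_mul {B : Type} [CommRing B] (z : B) :
    PowerSeries.mk (fun k => z ^ k) * (1 - PowerSeries.C z * PowerSeries.X) = 1 := by
  ext k
  rcases k with _ | k
  · simp
  · rw [mul_sub, mul_one, map_sub, mul_left_comm, PowerSeries.coeff_C_mul,
      PowerSeries.coeff_succ_mul_X, PowerSeries.coeff_mk, PowerSeries.coeff_mk, PowerSeries.coeff_one,
      if_neg (by omega), pow_succ]
    ring

theorem expansionDiff_eq {x : Fin n → K} {y : Fin m → K} (hinj : Injective x)
    (hx : ∀ i, x i ≠ 0) (hy : ∀ p, y p ≠ 0) (hxy : ∏ i, x i = ∏ p, y p) (k : ℤ) :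
    expansionDiff x y k = ∑ i, ((∏ p, (1 - y p / x i)) /
      ∏ j ∈ univ.erase i, (1 - x j / x i)) * x i ^ k := by
  classical
  obtain ⟨A, hA⟩ := exists_sum_zpow (List.ofFn x) (List.nodup_ofFn.2 hinj) (by
    intro z hz
    obtain ⟨i, rfl⟩ := (List.mem_ofFn' x z).1 hz
    exact hx i) _ (listOp_expansionDiff hx hy hxy)
  have hA' : expansionDiff x y = ∑ i, A (x i) • fun k => x i ^ k := by
    funext k
    rw [hA, List.map_ofFn, List.sum_ofFn, Finset.sum_apply]
    rfl
  rw [hA', Finset.sum_apply]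
  refine sum_congr rfl fun i _ => ?_
  rw [Pi.smul_apply, smul_eq_mul]
  congr 1
  set l := (univ.erase i).toList.map x with hl
  have hprod : ∀ (B : Type) [CommMonoid B] (f : K → B),
      (l.map f).prod = ∏ j ∈ univ.erase i, f (x j) := fun B _ f => by
    rw [hl, List.map_map, prod_map_toList]
    rfl
  have hne : ∏ j ∈ univ.erase i, (1 - x j / x i) ≠ 0 := by
    rw [prod_ne_zero_iff]
    intro j hj
    rw [one_sub_div (hx i)]
    exact div_ne_zero (sub_ne_zero.2 fun e => ne_of_mem_erase hj (hinj e).symm) (hx i)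
  have h1 : listOp l (expansionDiff x y) =
      fun k => A (x i) * ((∏ j ∈ univ.erase i, (1 - x j / x i)) * x i ^ k) := by
    rw [hA', map_sum, sum_eq_single i]
    · rw [map_smul, listOp_zpow (hx i), hprod]
      rfl
    · intro j _ hj
      rw [map_smul, listOp_zpow (hx j), hprod]
      have : ∏ q ∈ univ.erase i, (1 - x q / x j) = 0 :=
        prod_eq_zero (mem_erase.2 ⟨hj, mem_univ _⟩)
          (by rw [div_self (hx j), sub_self])
      rw [this]
      funext k
      simp
    · simp
  have h2 : ∀ᶠ k in Filter.atTop, expansionDiff x y k = seqZero (hSeries x y) k := by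
    filter_upwards [Filter.eventually_gt_atTop ((m : ℤ) - n)] with k hk
    rw [expansionDiff, Pi.sub_apply, Pi.smul_apply, seqInfty, if_neg (by omega)]
    simp
  have h3 : listOp l (seqZero (hSeries x y)) =
      listOp (List.ofFn y) (seqZero (PowerSeries.mk fun k => x i ^ k)) := by
    rw [listOp_seqZero, listOp_seqZero, prod_map_ofFn, hprod, ← hSeries_mul x y]
    rw [← mul_prod_erase univ _ (mem_univ i)]
    congr 1
    linear_combination (-(hSeries x y) * ∏ j ∈ univ.erase i,
      (1 - PowerSeries.C (x j) * PowerSeries.X)) * mk_pow_mul (x i)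
  have h4 : ∀ᶠ k in Filter.atTop,
      seqZero (PowerSeries.mk fun k => x i ^ k) k = (fun k : ℤ => x i ^ k) k := by
    filter_upwards [Filter.eventually_ge_atTop (0 : ℤ)] with k hk
    rw [seqZero, if_pos hk, PowerSeries.coeff_mk]
    lift k to ℕ using hk
    simp
  have h5 := eventually_listOp l h2
  have h6 := eventually_listOp (List.ofFn y) h4
  obtain ⟨k, h7, h8⟩ := (h5.and h6).exists
  rw [h1, h3, h8, listOp_zpow (hx i), prod_map_ofFn] at h7
  have hk : x i ^ k ≠ 0 := zpow_ne_zero _ (hx i)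
  rw [eq_div_iff hne]
  apply mul_right_cancel₀ hk
  have h7' : A (x i) * ((∏ j ∈ univ.erase i, (1 - x j / x i)) * x i ^ k) =
      (∏ p, (1 - y p / x i)) * x i ^ k := h7
  rw [← h7']
  ring

end Sequences

section Determinants

variable {K : Type} [Field K] {n m : ℕ}

theorem prod_prod_erase_sub (x : Fin n → K) :
    ∃ N : ℕ, ∏ i, ∏ j ∈ univ.erase i, (x i - x j) =
      (-1) ^ N * (vandermonde x).det ^ 2 := by
  refine ⟨∑ i : Fin n, (Ioi i).card, ?_⟩
  have h := prod_prod_Ioi_mul_eq_prod_prod_off_diag (fun j i : Fin n => x i - x j)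
  have h2 : ∀ i : Fin n, univ.erase i = ({i}ᶜ : Finset (Fin n)) := fun i => by
    ext j; simp
  simp only [h2, ← h, Matrix.det_vandermonde]
  rw [← prod_pow_eq_pow_sum, ← prod_pow, ← prod_mul_distrib]
  refine prod_congr rfl fun i _ => ?_
  rw [← prod_pow, ← prod_const, ← prod_mul_distrib]
  exact prod_congr rfl fun j _ => by ring

theorem prod_prod_one_sub_div {x : Fin n → K} {y : Fin m → K} (hx : ∀ i, x i ≠ 0)
    (hy : ∀ p, y p ≠ 0) (hxy : ∏ i, x i = ∏ p, y p) :
    ∏ i, ∏ p, (1 - y p / x i) =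
      (-1) ^ (n * m) * (∏ i, x i) ^ ((n : ℤ) - m) * ∏ i, ∏ p, (1 - x i / y p) := by
  have h1 : ∀ i p, 1 - y p / x i = (-1) * (y p * (x i)⁻¹) * (1 - x i / y p) := by
    intro i p
    field_simp [hx i, hy p]
    ring
  simp only [h1, prod_mul_distrib, prod_const, card_univ, Fintype.card_fin, ← hxy, prod_pow,
    prod_inv_distrib]
  have h0 : ∏ i, x i ≠ 0 := prod_ne_zero_iff.2 fun i _ => hx i
  rw [zpow_sub₀ h0, zpow_natCast, zpow_natCast, ← pow_mul, div_eq_mul_inv, inv_pow, mul_comm m n]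

/-- The alternant `det (x_i ^ k_a)`. -/
def alternant (x : Fin n → K) (k : Fin n → ℤ) : K := (Matrix.of fun a i => x i ^ k a).det

theorem det_expansionDiff {x : Fin n → K} {y : Fin m → K} (hinj : Injective x)
    (hx : ∀ i, x i ≠ 0) (hy : ∀ p, y p ≠ 0) (hxy : ∏ i, x i = ∏ p, y p) (k : Fin n → ℤ) :
    ∃ N : ℕ, (Matrix.of fun a b : Fin n => expansionDiff x y (k a + (b : ℕ))).det *
        (vandermonde x).det =
      (-1) ^ N * (∏ i, x i) ^ ((n : ℤ) - m + (n - 1)) * (∏ i, ∏ p, (1 - x i / y p)) *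
        alternant x k := by
  obtain ⟨N, hN⟩ := prod_prod_erase_sub x
  refine ⟨n * m + N, ?_⟩
  set A : Fin n → K := fun i => (∏ p, (1 - y p / x i)) / ∏ j ∈ univ.erase i, (1 - x j / x i)
    with hA
  have h1 : (Matrix.of fun a b : Fin n => expansionDiff x y (k a + (b : ℕ))) =
      (Matrix.of fun a i => x i ^ k a) * diagonal A * vandermonde x := by
    ext a b
    rw [Matrix.mul_apply, of_apply, expansionDiff_eq hinj hx hy hxy]
    refine sum_congr rfl fun i _ => ?_
    rw [mul_diagonal, of_apply, Matrix.vandermonde_apply, zpow_add₀ (hx i), zpow_natCast]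
    ring
  have hV : (vandermonde x).det ≠ 0 := Matrix.det_vandermonde_ne_zero_iff.2 hinj
  have h0 : ∏ i, x i ≠ 0 := prod_ne_zero_iff.2 fun i _ => hx i
  have h2 : ∏ i, ∏ j ∈ univ.erase i, (1 - x j / x i) =
      (-1) ^ N * (vandermonde x).det ^ 2 * (∏ i, x i) ^ (-((n : ℤ) - 1)) := by
    rw [← hN, zpow_neg, ← div_eq_mul_inv]
    rcases Nat.eq_zero_or_pos n with hn | hn
    · subst hn
      simp
    have h3 : (n : ℤ) - 1 = ((n - 1 : ℕ) : ℤ) := by omega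
    rw [h3, zpow_natCast, ← prod_pow, ← prod_div_distrib]
    refine prod_congr rfl fun i _ => ?_
    have h4 : (n - 1) = (univ.erase i).card := by simp
    rw [h4, ← prod_const, ← prod_div_distrib]
    exact prod_congr rfl fun j _ => one_sub_div (hx i)
  have h5 : ((-1 : K) ^ N) * (-1) ^ N = 1 := by rw [← mul_pow]; simp
  have hs : ((-1 : K) ^ N) ≠ 0 := pow_ne_zero _ (by simp)
  rw [h1, det_mul, det_mul, det_diagonal, hA, prod_div_distrib, h2, prod_prod_one_sub_div hx hy hxy,
    zpow_neg, zpow_add₀ h0, pow_add, alternant]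
  have h6 : (∏ i, x i) ^ ((n : ℤ) - 1) ≠ 0 := zpow_ne_zero _ h0
  field_simp
  linear_combination (-(Matrix.of fun a i => x i ^ k a).det * ∏ i, ∏ p, (1 - x i / y p)) * h5

theorem alternant_shift {x : Fin n → K} (hx : ∀ i, x i ≠ 0) (k : Fin n → ℤ) (z : ℤ) :
    alternant x (fun a => k a + z) = (∏ i, x i) ^ z * alternant x k := by
  rw [alternant, alternant, ← prod_zpow, ← Matrix.det_mul_row]
  congr 1
  ext a i
  simp [zpow_add₀ (hx i), mul_comm]

theorem alternant_mul_esymm {x : Fin n → K} (hx : ∀ i, x i ≠ 0) (k : Fin n → ℤ) (r : ℕ) :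
    alternant x k * ∑ t ∈ powersetCard r univ, ∏ i ∈ t, x i =
      ∑ t ∈ powersetCard r univ,
        alternant x (fun a => k a + if a ∈ t then 1 else 0) := by
  classical
  simp only [alternant, Matrix.det_apply', of_apply]
  rw [sum_mul, sum_comm]
  refine sum_congr rfl fun σ _ => ?_
  rw [← mul_sum, mul_assoc]
  congr 1
  rw [mul_sum]
  refine sum_equiv σ.finsetCongr (fun t => by simp [mem_powersetCard]) fun t _ => ?_
  simp only [zpow_add₀ (hx _), prod_mul_distrib]
  congr 1
  rw [← prod_subset (subset_univ t)]
  · refine prod_congr rfl fun i hi => ?_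
    rw [if_pos (by simpa using hi), zpow_one]
  · intro i _ hi
    rw [if_neg (by simpa using hi), zpow_zero]

end Determinants

section Symmetric
open MvPolynomial

theorem map_esymmAlgHom {σ R S : Type} [Fintype σ] [CommRing R] [CommRing S] (f : R →+* S) {n : ℕ}
    (q : MvPolynomial (Fin n) R) :
    map f (esymmAlgHom σ R n q) = (esymmAlgHom σ S n (map f q) : MvPolynomial σ S) := by
  rw [esymmAlgHom_apply, esymmAlgHom_apply]
  induction q using MvPolynomial.induction_on with
  | C a => simp
  | add p q hp hq => simp only [map_add, hp, hq]
  | mul_X p i hp => simp only [map_mul, hp, aeval_X, map_X, map_esymm]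

theorem exists_esymm_expansion {σ R : Type} [Fintype σ] [CommRing R] {P : MvPolynomial σ R}
    (hP : P.IsSymmetric) : ∃ q : MvPolynomial (Fin (Fintype.card σ)) R,
      (esymmAlgHom σ R (Fintype.card σ) q : MvPolynomial σ R) = P := by
  obtain ⟨q, hq⟩ := esymmAlgHom_surjective R (σ := σ) le_rfl ⟨P, hP⟩
  exact ⟨q, congrArg Subtype.val hq⟩

theorem mem_of_expansion {σ R B : Type} [Fintype σ] [CommRing R] [CommRing B] (S : Subring B)
    (φ : MvPolynomial σ R →+* B) (hS : ∀ r, φ (esymm σ R r) ∈ S) {n : ℕ}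
    (q : MvPolynomial (Fin n) R) (hq : ∀ d, φ (C (coeff d q)) ∈ S) :
    φ (esymmAlgHom σ R n q) ∈ S := by
  rw [esymmAlgHom_apply, aeval_def, eval₂_eq', map_sum]
  refine sum_mem fun d _ => ?_
  rw [map_mul, map_prod]
  refine mul_mem (hq d) (prod_mem fun i _ => ?_)
  rw [map_pow]
  exact pow_mem (hS _) _

theorem mem_of_isSymmetric {τ B : Type} [Fintype τ] [CommRing B] (S : Subring B)
    (φ : MvPolynomial τ ℤ →+* B) (hS : ∀ r, φ (esymm τ ℤ r) ∈ S) {P : MvPolynomial τ ℤ}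
    (hP : P.IsSymmetric) : φ P ∈ S := by
  obtain ⟨q, rfl⟩ := exists_esymm_expansion hP
  refine mem_of_expansion S φ hS q fun d => ?_
  rw [eq_intCast C, map_intCast]
  exact intCast_mem _ _

theorem mem_of_sum_symmetric {σ τ B : Type} [Fintype σ] [Fintype τ] [CommRing B] (S : Subring B)
    (φ : MvPolynomial (σ ⊕ τ) ℤ →+* B) (hl : ∀ r, φ (rename inl (esymm σ ℤ r)) ∈ S)
    (hr : ∀ r, φ (rename inr (esymm τ ℤ r)) ∈ S) {P : MvPolynomial (σ ⊕ τ) ℤ}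
    (hP : ∀ (a : Equiv.Perm σ) (b : Equiv.Perm τ), rename (Equiv.sumCongr a b) P = P) :
    φ P ∈ S := by
  let e := sumAlgEquiv ℤ σ τ
  let ψ : MvPolynomial σ (MvPolynomial τ ℤ) →+* B := φ.comp e.symm.toRingEquiv.toRingHom
  have hψ : ∀ Q, ψ Q = φ (e.symm Q) := fun Q => rfl
  have h1 : ∀ (a : Equiv.Perm σ) Q, e (rename (Equiv.sumCongr a 1) Q) = rename a (e Q) := by
    intro a Q
    induction Q using MvPolynomial.induction_on with
    | C z => simp [e]
    | add p q hp hq => simp only [map_add, hp, hq]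
    | mul_X p i hp => rcases i with i | i <;> simp [map_mul, hp, e]
  have h2 : ∀ (b : Equiv.Perm τ) Q, e (rename (Equiv.sumCongr 1 b) Q) =
      map (rename b).toRingHom (e Q) := by
    intro b Q
    induction Q using MvPolynomial.induction_on with
    | C z => simp [e]
    | add p q hp hq => simp only [map_add, hp, hq]
    | mul_X p i hp => rcases i with i | i <;> simp [map_mul, hp, e]
  have hsym : (e P).IsSymmetric := fun a => by rw [← h1, hP]
  obtain ⟨q, hq⟩ := exists_esymm_expansion hsym
  have hq2 : ∀ b : Equiv.Perm τ, map (rename b).toRingHom q = q := by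
    intro b
    apply esymmAlgHom_injective (σ := σ) (R := MvPolynomial τ ℤ) le_rfl
    apply Subtype.ext
    rw [← map_esymmAlgHom, hq, ← h2, hP]
  have h3 : φ P = ψ (esymmAlgHom σ (MvPolynomial τ ℤ) (Fintype.card σ) q) := by
    rw [hq, hψ, AlgEquiv.symm_apply_apply]
  rw [h3]
  refine mem_of_expansion S ψ (fun r => ?_) q fun d => ?_
  · have : e (rename inl (esymm σ ℤ r)) = esymm σ (MvPolynomial τ ℤ) r := by
      simp [e, esymm, map_sum, map_prod]
    rw [← this, hψ, AlgEquiv.symm_apply_apply]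
    exact hl r
  · have h4 : ∀ c, e (rename inr c) = C c := fun c =>
      AlgHom.congr_fun (sumAlgEquiv_comp_rename_inr ℤ σ τ) c
    rw [← h4, hψ, AlgEquiv.symm_apply_apply]
    refine mem_of_isSymmetric S (φ.comp (rename inr).toRingHom) hr fun b => ?_
    conv_rhs => rw [← hq2 b]
    rw [coeff_map]
    rfl

end Symmetric

section Kac

variable {n m : ℕ}

/-- The coefficients of the difference of the two expansions of the generating function. -/
def diffCoeff (n m : ℕ) (k : ℤ) : ZP n m :=
  (if 0 ≤ k then hk n m k.toNat else 0) -
    (-1) ^ (n + m) * (if k ≤ m - n then hkStar n m ((m : ℤ) - n - k).toNat else 0)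

theorem diffCoeff_mem (k : ℤ) : diffCoeff n m k ∈ hRing n m := by
  refine sub_mem ?_ (mul_mem (pow_mem (neg_mem (one_mem _)) _) ?_)
  · split_ifs
    exacts [hk_mem_hRing _, zero_mem _]
  · split_ifs
    exacts [hkStar_mem_hRing _, zero_mem _]

/-- The fraction field of `ℤ[P₀]`. -/
abbrev FracZP (n m : ℕ) : Type := FractionRing (ZP n m)

/-- `e^l` in the fraction field. -/
def fracEx (l : P0 n m) : FracZP n m := algebraMap (ZP n m) (FracZP n m) (ex l)

theorem fracEx_add (l l' : P0 n m) : fracEx (l + l') = fracEx l * fracEx l' := by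
  rw [fracEx, ex_add, map_mul]; rfl

theorem fracEx_zero : fracEx (0 : P0 n m) = 1 := by
  rw [fracEx, ex_zero, map_one]

theorem fracEx_ne_zero (l : P0 n m) : fracEx l ≠ 0 := by
  intro h
  have := fracEx_add l (-l)
  rw [h, zero_mul, add_neg_cancel, fracEx_zero] at this
  exact one_ne_zero this

theorem fracEx_neg (l : P0 n m) : fracEx (-l) = (fracEx l)⁻¹ := by
  rw [← mul_eq_one_iff_eq_inv₀ (fracEx_ne_zero l), ← fracEx_add, neg_add_cancel, fracEx_zero]

/-- `l ↦ e^l` as a homomorphism to the units of the fraction field. -/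
def fracExHom (n m : ℕ) : Multiplicative (P0 n m) →* FracZP n m where
  toFun l := fracEx l.toAdd
  map_one' := fracEx_zero
  map_mul' _ _ := fracEx_add _ _

theorem fracEx_zsmul (z : ℤ) (l : P0 n m) : fracEx (z • l) = fracEx l ^ z := by
  have := map_zpow' (fracExHom n m) (fun x => fracEx_neg x.toAdd) (ofAdd l) z
  exact this

theorem fracEx_sum {ι : Type} (s : Finset ι) (f : ι → P0 n m) :
    fracEx (∑ i ∈ s, f i) = ∏ i ∈ s, fracEx (f i) :=
  map_prod (fracExHom n m) (fun i => ofAdd (f i)) s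

theorem fracEx_injective : Injective (fracEx (n := n) (m := m)) := by
  intro a b h
  have := IsFractionRing.injective (ZP n m) (FracZP n m) h
  exact of_injective this

theorem wt_inl_injective : Injective fun i : Fin n => (wt (inl i) : P0 n m) := by
  intro i j h
  by_contra hij
  have h1 := LinearMap.congr_fun (congrArg Subtype.val h) (corootL i j)
  change (wt (inl i)).1 (corootL i j) = (wt (inl j)).1 (corootL i j) at h1
  rw [wt_apply, wt_apply] at h1
  simp [corootL, hij, Ne.symm hij] at h1
  norm_num at h1

theorem sum_wt : ∑ i : Fin n, (wt (inl i) : P0 n m) = ∑ p : Fin m, wt (inr p) := by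
  apply Subtype.ext
  ext h
  have h1 : ∀ {ι : Type} (s : Finset ι) (f : ι → P0 n m), (∑ i ∈ s, f i).1 h = ∑ i ∈ s, (f i).1 h := by
    intro ι s f
    rw [← LinearMap.sum_apply]
    congr 1
    exact map_sum (P0 n m).subtype f s
  rw [h1, h1]
  exact mem_cartan h

theorem algebraMap_diffCoeff (k : ℤ) : algebraMap (ZP n m) (FracZP n m) (diffCoeff n m k) =
    expansionDiff (fun i : Fin n => fracEx (wt (inl i)))
      (fun p : Fin m => fracEx (wt (inr p))) k := by
  have h1 : ∀ k, algebraMap (ZP n m) (FracZP n m) (hk n m k) =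
      hCoeff (fun i : Fin n => fracEx (wt (inl i))) (fun p : Fin m => fracEx (wt (inr p))) k :=
    fun k => map_hCoeff _ _ _ k
  have h2 : ∀ k, algebraMap (ZP n m) (FracZP n m) (hkStar n m k) =
      hCoeff (fun i : Fin n => (fracEx (wt (inl i)))⁻¹)
        (fun p : Fin m => (fracEx (wt (inr p)))⁻¹) k := by
    intro k
    simp only [← fracEx_neg]
    exact map_hCoeff _ _ _ k
  rw [expansionDiff, Pi.sub_apply, Pi.smul_apply, seqZero, seqInfty, diffCoeff, map_sub, map_mul,
    map_pow, map_neg, map_one, smul_eq_mul, apply_ite (algebraMap (ZP n m) (FracZP n m)),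
    apply_ite (algebraMap (ZP n m) (FracZP n m)), h1, h2, map_zero]
  rfl

/-- The alternant `det (x_i ^ k_a)` in `ℤ[P₀]`. -/
def alt (n m : ℕ) (k : Fin n → ℤ) : ZP n m :=
  (Matrix.of fun a i => (ex (k a • wt (inl i)) : ZP n m)).det

theorem algebraMap_alt (k : Fin n → ℤ) : algebraMap (ZP n m) (FracZP n m) (alt n m k) =
    alternant (fun i : Fin n => fracEx (wt (inl i))) k := by
  rw [alt, RingHom.map_det, alternant]
  congr 1
  ext a i
  exact fracEx_zsmul _ _

theorem algebraMap_alt_delta : algebraMap (ZP n m) (FracZP n m) (alt n m fun a => (a : ℕ)) =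
    (vandermonde fun i : Fin n => (fracEx (wt (inl i)) : FracZP n m)).det := by
  rw [algebraMap_alt, alternant, ← Matrix.det_transpose]
  congr 1

theorem alt_delta_ne_zero : alt n m (fun a => (a : ℕ)) ≠ 0 := by
  intro h
  have h1 := algebraMap_alt_delta (n := n) (m := m)
  rw [h, map_zero] at h1
  exact Matrix.det_vandermonde_ne_zero_iff.2
    (fracEx_injective.comp (wt_inl_injective (n := n) (m := m))) h1.symm

theorem kacFactor_mul_alt (k : Fin n → ℤ) :
    ∃ z ∈ hRing n m, kacFactor n m * alt n m k = alt n m (fun a => (a : ℕ)) * z := by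
  set x : Fin n → FracZP n m := fun i => fracEx (wt (inl i)) with hx
  set y : Fin m → FracZP n m := fun i => fracEx (wt (inr i)) with hy
  have hx0 : ∀ i, x i ≠ 0 := fun i => fracEx_ne_zero _
  have hy0 : ∀ i, y i ≠ 0 := fun i => fracEx_ne_zero _
  have hxy : ∏ i, x i = ∏ p, y p := by rw [hx, hy, ← fracEx_sum, ← fracEx_sum, sum_wt]
  set c : ℤ := (n : ℤ) - m + (n - 1) with hc
  have hinj : Injective x := fracEx_injective.comp wt_inl_injective
  obtain ⟨N, hN⟩ := det_expansionDiff hinj hx0 hy0 hxy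
    (fun a => k a + (-c))
  refine ⟨(-1) ^ N * (Matrix.of fun a b : Fin n => diffCoeff n m (k a + (-c) + (b : ℕ))).det, ?_, ?_⟩
  · refine mul_mem (pow_mem (neg_mem (one_mem _)) _) ?_
    rw [Matrix.det_apply]
    refine sum_mem fun σ _ => ?_
    rw [Units.smul_def]
    exact zsmul_mem (prod_mem fun i _ => diffCoeff_mem _) _
  · apply IsFractionRing.injective (ZP n m) (FracZP n m)
    have hd : algebraMap (ZP n m) (FracZP n m)
        (Matrix.of fun a b : Fin n => diffCoeff n m (k a + (-c) + (b : ℕ))).det =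
          (Matrix.of fun a b : Fin n => expansionDiff x y (k a + (-c) + (b : ℕ))).det := by
      rw [RingHom.map_det]
      congr 1
      ext a b
      exact algebraMap_diffCoeff _
    have hkac : algebraMap (ZP n m) (FracZP n m) (kacFactor n m) = ∏ i, ∏ p, (1 - x i / y p) := by
      rw [kacFactor, map_prod]
      refine prod_congr rfl fun i _ => ?_
      rw [map_prod]
      refine prod_congr rfl fun p _ => ?_
      rw [map_sub, map_one]
      change 1 - fracEx _ = _
      rw [sub_eq_add_neg (wt _) (wt _), fracEx_add, fracEx_neg, div_eq_mul_inv]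
    have h0 : ∏ i, x i ≠ 0 := prod_ne_zero_iff.2 fun i _ => hx0 i
    rw [map_mul, map_mul, map_mul, algebraMap_alt, algebraMap_alt_delta, hd, hkac, map_pow, map_neg,
      map_one]
    change _ = (vandermonde x).det * _
    have hN' := hN.trans (congrArg _ (alternant_shift hx0 k (-c)))
    rw [zpow_neg] at hN'
    have h1 : (∏ i, x i) ^ c * ((∏ i, x i) ^ c)⁻¹ = 1 := mul_inv_cancel₀ (zpow_ne_zero _ h0)
    have h2 : ((-1 : FracZP n m) ^ N) * (-1) ^ N = 1 := by rw [← mul_pow]; simp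
    have h3 := congrArg (fun z => (-1) ^ N * z) hN'
    change _ * alternant x k = _
    linear_combination -h3 - (∏ i, ∏ p, (1 - x i / y p)) * alternant x k * h2 * ((∏ i, x i) ^ c * ((∏ i, x i) ^ c)⁻¹) - (∏ i, ∏ p, (1 - x i / y p)) * alternant x k * h1

/-- The span of the alternants over the ring generated by the `h_k`, `h_k^*`. -/
def altSpan (n m : ℕ) : Submodule (hRing n m) (ZP n m) :=
  Submodule.span (hRing n m) (Set.range (alt n m))

/-- The multipliers of the span of the alternants. -/
def altStab (n m : ℕ) : Subring (ZP n m) where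
  carrier := {z | ∀ g ∈ altSpan n m, z * g ∈ altSpan n m}
  mul_mem' ha hb _ hg := by rw [mul_assoc]; exact ha _ (hb _ hg)
  one_mem' _ hg := by rwa [one_mul]
  add_mem' ha hb _ hg := by rw [add_mul]; exact add_mem (ha _ hg) (hb _ hg)
  zero_mem' _ _ := by rw [zero_mul]; exact zero_mem _
  neg_mem' ha _ hg := by rw [neg_mul]; exact neg_mem (ha _ hg)

theorem mem_altStab {z : ZP n m} (h : ∀ k, z * alt n m k ∈ altSpan n m) : z ∈ altStab n m := by
  intro g hg
  induction hg using Submodule.span_induction with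
  | mem g hg => obtain ⟨k, rfl⟩ := hg; exact h k
  | zero => rw [mul_zero]; exact zero_mem _
  | add a b _ _ ha hb => rw [mul_add]; exact add_mem ha hb
  | smul c a _ ha => rw [mul_smul_comm]; exact Submodule.smul_mem _ _ ha

theorem hRing_le_altStab : hRing n m ≤ altStab n m :=
  fun z hz _ hg => Submodule.smul_mem (altSpan n m) ⟨z, hz⟩ hg

theorem alt_mem (k : Fin n → ℤ) : alt n m k ∈ altSpan n m := Submodule.subset_span ⟨k, rfl⟩

theorem ex_mem_altStab (z : ℤ) : ex (z • ∑ i : Fin n, wt (inl i)) ∈ altStab n m := by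
  refine mem_altStab fun k => ?_
  have : ex (z • ∑ i : Fin n, wt (inl i)) * alt n m k = alt n m (fun a => k a + z) := by
    apply IsFractionRing.injective (ZP n m) (FracZP n m)
    rw [map_mul, algebraMap_alt, algebraMap_alt, alternant_shift (fun i => fracEx_ne_zero _)]
    change fracEx _ * _ = _
    rw [fracEx_zsmul, fracEx_sum]
  rw [this]
  exact alt_mem _

theorem esymm_inl_mem_altStab (r : ℕ) : ∑ t ∈ powersetCard r (univ : Finset (Fin n)),
    ∏ i ∈ t, (ex (wt (inl i)) : ZP n m) ∈ altStab n m := by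
  classical
  refine mem_altStab fun k => ?_
  have : (∑ t ∈ powersetCard r (univ : Finset (Fin n)),
      ∏ i ∈ t, (ex (wt (inl i)) : ZP n m)) * alt n m k =
        ∑ t ∈ powersetCard r univ,
          alt n m (fun a => k a + if a ∈ t then 1 else 0) := by
    apply IsFractionRing.injective (ZP n m) (FracZP n m)
    rw [map_mul, map_sum, map_sum, mul_comm, algebraMap_alt]
    simp only [map_prod, algebraMap_alt]
    exact alternant_mul_esymm (fun i => fracEx_ne_zero _) k r
  rw [this]
  exact sum_mem fun t _ => alt_mem _

theorem coeff_prod_one_sub {B : Type} [CommRing B] {n : ℕ} (u : Fin n → B) (r : ℕ) :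
    PowerSeries.coeff r (∏ i, (1 - PowerSeries.C (u i) * PowerSeries.X)) =
      (-1) ^ r * ∑ t ∈ powersetCard r univ, ∏ i ∈ t, u i := by
  classical
  have h1 : ∀ i, 1 - PowerSeries.C (u i) * PowerSeries.X =
      1 + (PowerSeries.C (-u i)) * PowerSeries.X := fun i => by
    rw [map_neg]; ring
  simp only [h1, prod_one_add, map_sum, prod_mul_distrib, prod_const, ← map_prod,
    PowerSeries.coeff_C_mul_X_pow]
  rw [← sum_filter, mul_sum]
  refine sum_congr ?_ fun t ht => ?_
  · ext t
    simp [mem_powersetCard, eq_comm]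
  · rw [prod_neg, (mem_powersetCard.1 ht).2]

theorem esymm_inr_mem_altStab (r : ℕ) : ∑ t ∈ powersetCard r (univ : Finset (Fin m)),
    ∏ p ∈ t, (ex (wt (inr p)) : ZP n m) ∈ altStab n m := by
  have h := congrArg (PowerSeries.coeff r) (hSeries_mul
    (fun i : Fin n => (ex (wt (inl i)) : ZP n m)) (fun p : Fin m => ex (wt (inr p))))
  rw [coeff_prod_one_sub, PowerSeries.coeff_mul] at h
  have h2 : ((-1 : ZP n m) ^ r) * (-1) ^ r = 1 := by rw [← mul_pow]; simp
  have h3 := congrArg (fun z => (-1) ^ r * z) h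
  simp only [← mul_assoc, h2, one_mul] at h3
  rw [← h3]
  refine mul_mem (pow_mem (neg_mem (one_mem _)) _) (sum_mem fun a _ => mul_mem ?_ ?_)
  · exact hRing_le_altStab (hk_mem_hRing _)
  · rw [coeff_prod_one_sub]
    exact mul_mem (pow_mem (neg_mem (one_mem _)) _) (esymm_inl_mem_altStab _)

/-- Exponents of monomials as exponents of Laurent monomials. -/
def natExp (n m : ℕ) : (Idx n m →₀ ℕ) →+ (Idx n m → ℤ) where
  toFun d j := d j
  map_zero' := rfl
  map_add' _ _ := funext fun _ => by simp

/-- Polynomials as Laurent polynomials. -/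
def polyToLaurent (n m : ℕ) : MvPolynomial (Idx n m) ℤ →+* Laurent n m :=
  mapDomainRingHom ℤ (natExp n m)

theorem polyToLaurent_X (j : Idx n m) : polyToLaurent n m (MvPolynomial.X j) = var j := by
  change polyToLaurent n m (ex (Finsupp.single j 1)) = _
  simp only [polyToLaurent, ex, var, mapDomainRingHom_apply, mapDomain_single]
  congr 1
  funext i
  simp [natExp, Finsupp.single_apply, Pi.single_apply, eq_comm]

theorem polyToLaurent_injective : Injective (polyToLaurent n m) := by
  apply mapDomain_injective
  intro a b h
  ext j
  have h1 : ((a j : ℕ) : ℤ) = b j := congrFun h j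
  exact_mod_cast h1

theorem polyToLaurent_rename (w : Weyl n m) (P : MvPolynomial (Idx n m) ℤ) :
    polyToLaurent n m (MvPolynomial.rename w.perm P) =
      mapDomainRingHom ℤ (weylLattice w) (polyToLaurent n m P) := by
  induction P using MvPolynomial.induction_on with
  | C z => rw [eq_intCast MvPolynomial.C]; simp
  | add p q hp hq => simp only [map_add, hp, hq]
  | mul_X p i hp => rw [map_mul, map_mul, hp, MvPolynomial.rename_X, polyToLaurent_X, map_mul,
      map_mul, polyToLaurent_X, var_weyl]

theorem exists_polyToLaurent (g : Laurent n m) :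
    ∃ (N : ℕ) (P : MvPolynomial (Idx n m) ℤ), polyToLaurent n m P = ex (fun _ => (N : ℤ)) * g := by
  classical
  set N : ℕ := ∑ k ∈ g.coeff.support, ∑ j, (k j).natAbs with hN
  refine ⟨N, mapDomain
    (fun k : Idx n m → ℤ => Finsupp.equivFunOnFinite.symm fun j => (k j + (N : ℤ)).toNat) g, ?_⟩
  have h2 : ∀ (c : Idx n m → ℤ) (g : Laurent n m),
      ex c * g = mapDomain (fun k => c + k) g := by
    intro c g
    induction g using AddMonoidAlgebra.induction_linear with
    | zero => simp
    | add a b ha hb => rw [mul_add, ha, hb, mapDomain_add]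
    | single k c => simp
  rw [h2]
  change mapDomain _ (mapDomain _ g) = _
  apply coeff_injective
  refine Finsupp.mapDomain_comp.symm.trans (Finsupp.mapDomain_congr fun k hk => ?_)
  funext j
  have h3 : (k j).natAbs ≤ N :=
    (single_le_sum (f := fun j => (k j).natAbs) (fun _ _ => Nat.zero_le _)
      (mem_univ j)).trans (single_le_sum (f := fun k : Idx n m → ℤ => ∑ j, (k j).natAbs)
        (fun _ _ => Nat.zero_le _) hk)
  change (((k j + N).toNat : ℕ) : ℤ) = N + k j
  omega

theorem toZP_mem_altStab {g : Laurent n m} (hg : g ∈ LaurentInv n m) :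
    toZP n m g ∈ altStab n m := by
  obtain ⟨N, P, hP⟩ := exists_polyToLaurent g
  have hvar : ∀ j, toZP n m (var j) = ex (wt j) := fun j => by
    rw [var, toZP, mapDomainRingHom_ex, latticeHom_single]
  have h1 : toZP n m (polyToLaurent n m P) ∈ altStab n m := by
    refine mem_of_sum_symmetric (altStab n m) ((toZP n m).comp (polyToLaurent n m)) (fun r => ?_)
      (fun r => ?_) fun a b => ?_
    · have := esymm_inl_mem_altStab (n := n) (m := m) r
      simpa [MvPolynomial.esymm, map_sum, map_prod, polyToLaurent_X, hvar] using this
    · have := esymm_inr_mem_altStab (n := n) (m := m) r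
      simpa [MvPolynomial.esymm, map_sum, map_prod, polyToLaurent_X, hvar] using this
    · apply polyToLaurent_injective
      refine (polyToLaurent_rename (a, b) P).trans ?_
      rw [hP, map_mul, mem_LaurentInv.1 hg, mapDomainRingHom_ex]
      rfl
  have h2 : latticeHom n m (fun _ => (N : ℤ)) = (2 * N : ℤ) • ∑ i : Fin n, wt (inl i) := by
    change ∑ j, (N : ℤ) • wt j = _
    rw [← smul_sum, Fintype.sum_sum_type, ← sum_wt, ← two_smul ℤ (∑ i, _), smul_smul, mul_comm]
  rw [hP, map_mul] at h1
  have h3 : toZP n m (ex fun _ => (N : ℤ)) = ex ((2 * N : ℤ) • ∑ i : Fin n, wt (inl i)) := by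
    rw [toZP, mapDomainRingHom_ex, h2]
  rw [h3] at h1
  have h4 := mul_mem (ex_mem_altStab (n := n) (m := m) (-(2 * N))) h1
  rwa [← mul_assoc, neg_smul, ex_neg_mul_ex, one_mul] at h4

theorem kacFactor_mul_mem_hRing {g : Laurent n m} (hg : g ∈ LaurentInv n m) :
    kacFactor n m * toZP n m g ∈ hRing n m := by
  have h1 : ∀ f ∈ altSpan n m, ∃ z ∈ hRing n m,
      kacFactor n m * f = alt n m (fun a => (a : ℕ)) * z := by
    intro f hf
    induction hf using Submodule.span_induction with
    | mem g hg => obtain ⟨k, rfl⟩ := hg; exact kacFactor_mul_alt k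
    | zero => exact ⟨0, zero_mem _, by simp⟩
    | add a b _ _ ha hb =>
      obtain ⟨z, hz, hz'⟩ := ha
      obtain ⟨w, hw, hw'⟩ := hb
      exact ⟨z + w, add_mem hz hw, by rw [mul_add, hz', hw', mul_add]⟩
    | smul c a _ ha =>
      obtain ⟨z, hz, hz'⟩ := ha
      refine ⟨c * z, mul_mem c.2 hz, ?_⟩
      rw [mul_smul_comm, hz']
      change c.1 * _ = _
      ring
  obtain ⟨z, hz, hz'⟩ := h1 _ (toZP_mem_altStab hg _ (alt_mem fun a => (a : ℕ)))
  have : kacFactor n m * toZP n m g = z := by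
    apply mul_left_cancel₀ (alt_delta_ne_zero (n := n) (m := m))
    rw [← hz']
    ring
  rwa [this]

end Kac

section Restriction

variable {n m : ℕ}

/-- Extension by zero of elements of the Cartan subalgebra. -/
def cartanExt (n m : ℕ) : cartan n m →ₗ[ℂ] cartan (n + 1) (m + 1) where
  toFun h := ⟨Sum.elim (Fin.snoc (α := fun _ => ℂ) (fun i => h.1 (inl i)) 0)
    (Fin.snoc (α := fun _ => ℂ) (fun p => h.1 (inr p)) 0), by
      change ∑ i : Fin (n + 1), Sum.elim _ _ (inl i) = ∑ i : Fin (m + 1), Sum.elim _ _ (inr i)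
      simp only [Sum.elim_inl, Sum.elim_inr]
      simp only [Fin.sum_univ_castSucc, Fin.snoc_castSucc, Fin.snoc_last, add_zero]
      exact mem_cartan h⟩
  map_add' a b := by
    apply Subtype.ext
    funext k
    rcases k with k | k <;> refine Fin.lastCases ?_ (fun k => ?_) k <;> simp
  map_smul' a b := by
    apply Subtype.ext
    funext k
    rcases k with k | k <;> refine Fin.lastCases ?_ (fun k => ?_) k <;> simp

theorem cartanExt_inl (h : cartan n m) (i : Fin n) :
    (cartanExt n m h).1 (inl i.castSucc) = h.1 (inl i) := by simp [cartanExt]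

theorem cartanExt_inr (h : cartan n m) (i : Fin m) :
    (cartanExt n m h).1 (inr i.castSucc) = h.1 (inr i) := by simp [cartanExt]

theorem cartanExt_inl_last (h : cartan n m) :
    (cartanExt n m h).1 (inl (Fin.last n)) = 0 := by simp [cartanExt]

theorem cartanExt_inr_last (h : cartan n m) :
    (cartanExt n m h).1 (inr (Fin.last m)) = 0 := by simp [cartanExt]

theorem cartan_ext_castSucc {h h' : cartan (n + 1) (m + 1)}
    (h1 : ∀ i : Fin n, h.1 (inl i.castSucc) = h'.1 (inl i.castSucc))
    (h2 : h.1 (inl (Fin.last n)) = h'.1 (inl (Fin.last n)))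
    (h3 : ∀ i : Fin m, h.1 (inr i.castSucc) = h'.1 (inr i.castSucc))
    (h4 : h.1 (inr (Fin.last m)) = h'.1 (inr (Fin.last m))) : h = h' := by
  apply Subtype.ext
  funext k
  rcases k with k | k
  · exact Fin.lastCases h2 h1 k
  · exact Fin.lastCases h4 h3 k

theorem cartanExt_corootL (i j : Fin n) :
    cartanExt n m (corootL i j) = corootL i.castSucc j.castSucc := by
  apply cartan_ext_castSucc <;> intros <;>
    simp [cartanExt_inl, cartanExt_inr, cartanExt_inl_last, cartanExt_inr_last, corootL,
      Pi.single_apply, (Fin.castSucc_ne_last _).symm]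

theorem cartanExt_corootR (i j : Fin m) :
    cartanExt n m (corootR i j) = corootR i.castSucc j.castSucc := by
  apply cartan_ext_castSucc <;> intros <;>
    simp [cartanExt_inl, cartanExt_inr, cartanExt_inl_last, cartanExt_inr_last, corootR,
      Pi.single_apply, (Fin.castSucc_ne_last _).symm]

theorem cartanExt_isoH (i : Fin n) (p : Fin m) :
    cartanExt n m (isoH i p) = isoH i.castSucc p.castSucc := by
  apply cartan_ext_castSucc <;> intros <;>
    simp [cartanExt_inl, cartanExt_inr, cartanExt_inl_last, cartanExt_inr_last, isoH,
      Pi.single_apply, (Fin.castSucc_ne_last _).symm]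

/-- Restriction of weights to the Cartan subalgebra of `sl(n,m)`. -/
def resWeight (n m : ℕ) : P0 (n + 1) (m + 1) →+ P0 n m where
  toFun l := ⟨l.1.comp (cartanExt n m), fun i j => by
    rw [LinearMap.comp_apply, cartanExt_corootL]; exact l.2.1 _ _, fun i j => by
    rw [LinearMap.comp_apply, cartanExt_corootR]; exact l.2.2 _ _⟩
  map_zero' := rfl
  map_add' _ _ := rfl

theorem resWeight_apply (l : P0 (n + 1) (m + 1)) (h : cartan n m) :
    (resWeight n m l).1 h = l.1 (cartanExt n m h) := rfl

theorem P0_ext {l l' : P0 n m} (h : ∀ x, l.1 x = l'.1 x) : l = l' :=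
  Subtype.ext (LinearMap.ext h)

theorem resWeight_inl (i : Fin n) : resWeight n m (wt (inl i.castSucc)) = wt (inl i) :=
  P0_ext fun h => cartanExt_inl h i

theorem resWeight_inr (i : Fin m) : resWeight n m (wt (inr i.castSucc)) = wt (inr i) :=
  P0_ext fun h => cartanExt_inr h i

theorem resWeight_inl_last : resWeight n m (wt (inl (Fin.last n))) = 0 :=
  P0_ext fun h => cartanExt_inl_last h

theorem resWeight_inr_last : resWeight n m (wt (inr (Fin.last m))) = 0 :=
  P0_ext fun h => cartanExt_inr_last h

/-- The restriction homomorphism, setting the last `x` and the last `y` equal to `1`. -/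
def res (n m : ℕ) : ZP (n + 1) (m + 1) →+* ZP n m :=
  mapDomainRingHom ℤ (resWeight n m)

theorem res_hk (k : ℕ) : res n m (hk (n + 1) (m + 1) k) = hk n m k := by
  rw [hk, map_hCoeff, hCoeff_castSucc]
  · simp only [res, mapDomainRingHom_ex, resWeight_inl, resWeight_inr]
    rfl
  · simp only [res, mapDomainRingHom_ex, resWeight_inl_last, resWeight_inr_last]

theorem res_hkStar (k : ℕ) : res n m (hkStar (n + 1) (m + 1) k) = hkStar n m k := by
  rw [hkStar, map_hCoeff, hCoeff_castSucc]
  · simp only [res, mapDomainRingHom_ex, map_neg, resWeight_inl, resWeight_inr]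
    rfl
  · simp only [res, mapDomainRingHom_ex, map_neg, resWeight_inl_last, resWeight_inr_last]

theorem exists_res_eq {z : ZP n m} (hz : z ∈ hRing n m) :
    ∃ z' ∈ hRing (n + 1) (m + 1), res n m z' = z := by
  have : hRing n m ≤ (hRing (n + 1) (m + 1)).map (res n m) := by
    rw [hRing, Subring.closure_le]
    rintro _ (⟨k, rfl⟩ | ⟨k, rfl⟩)
    · exact ⟨_, hk_mem_hRing k, res_hk k⟩
    · exact ⟨_, hkStar_mem_hRing k, res_hkStar k⟩
  obtain ⟨z', hz', h⟩ := this hz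
  exact ⟨z', hz', h⟩

theorem resWeight_latticeHom (k : Idx (n + 1) (m + 1) → ℤ) : resWeight n m (latticeHom _ _ k) =
    latticeHom n m (fun j => k (Sum.map Fin.castSucc Fin.castSucc j)) := by
  refine P0_ext fun h => ?_
  rw [resWeight_apply, latticeHom_apply, latticeHom_apply, Fintype.sum_sum_type,
    Fintype.sum_sum_type, Fin.sum_univ_castSucc, Fin.sum_univ_castSucc, cartanExt_inl_last,
    cartanExt_inr_last]
  simp only [cartanExt_inl, cartanExt_inr, mul_zero, add_zero]
  rfl

/-- Extension of permutations fixing the last indices. -/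
def weylExt (w : Weyl n m) : Weyl (n + 1) (m + 1) :=
  (w.1.viaFintypeEmbedding Fin.castSuccEmb, w.2.viaFintypeEmbedding Fin.castSuccEmb)

theorem viaFintypeEmbedding_castSucc (σ : Equiv.Perm (Fin n)) (i : Fin n) :
    σ.viaFintypeEmbedding Fin.castSuccEmb i.castSucc = (σ i).castSucc :=
  Equiv.Perm.viaFintypeEmbedding_apply_image σ Fin.castSuccEmb i

theorem viaFintypeEmbedding_last (σ : Equiv.Perm (Fin n)) :
    σ.viaFintypeEmbedding Fin.castSuccEmb (Fin.last n) = Fin.last n :=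
  Equiv.Perm.viaFintypeEmbedding_apply_notMem_range σ Fin.castSuccEmb (by
    rintro ⟨i, hi⟩
    exact Fin.castSucc_ne_last i hi)

theorem weylCartan_cartanExt (w : Weyl n m) (h : cartan n m) :
    weylCartan (weylExt w) (cartanExt n m h) = cartanExt n m (weylCartan w h) := by
  apply cartan_ext_castSucc
  · intro i
    change (cartanExt n m h).1 (inl (w.1.viaFintypeEmbedding _ _)) = _
    rw [viaFintypeEmbedding_castSucc, cartanExt_inl, cartanExt_inl]
    rfl
  · change (cartanExt n m h).1 (inl (w.1.viaFintypeEmbedding _ _)) = _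
    rw [viaFintypeEmbedding_last, cartanExt_inl_last, cartanExt_inl_last]
  · intro i
    change (cartanExt n m h).1 (inr (w.2.viaFintypeEmbedding _ _)) = _
    rw [viaFintypeEmbedding_castSucc, cartanExt_inr, cartanExt_inr]
    rfl
  · change (cartanExt n m h).1 (inr (w.2.viaFintypeEmbedding _ _)) = _
    rw [viaFintypeEmbedding_last, cartanExt_inr_last, cartanExt_inr_last]

theorem cartanExt_mem_ker {i : Fin n} {p : Fin m} {h : cartan n m}
    (hh : h ∈ ker (root i p).1) :
    cartanExt n m h ∈ ker (root i.castSucc p.castSucc).1 := by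
  rw [mem_ker, root_apply] at hh ⊢
  rw [cartanExt_inl, cartanExt_inr, hh]

theorem mapDomainRingHom_comp_apply {R M N O : Type} [CommRing R] [AddCommGroup M] [AddCommGroup N]
    [AddCommGroup O] (φ : M →+ N) (ψ : N →+ O) (f : AddMonoidAlgebra R M) :
    mapDomainRingHom R ψ (mapDomainRingHom R φ f) =
      mapDomainRingHom R (ψ.comp φ) f :=
  mapDomain_mapDomain _ _ f

theorem res_mem_Jzero {f : ZP (n + 1) (m + 1)} (hf : f ∈ Jzero (n + 1) (m + 1)) :
    res n m f ∈ Jzero n m := by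
  rw [mem_Jzero_iff, mem_J_iff] at hf ⊢
  obtain ⟨⟨hinv, hwall⟩, hlat⟩ := hf
  refine ⟨⟨mem_ZPinv.2 fun w => ?_, fun i p l hl => ?_⟩, mem_latticeRing.2 fun l hl => ?_⟩
  · conv_rhs => rw [← mem_ZPinv.1 hinv (weylExt w)]
    rw [res, mapDomainRingHom_comp_apply, mapDomainRingHom_comp_apply]
    congr 2
    ext l : 1
    refine P0_ext fun h => ?_
    change l.1 (cartanExt n m (weylCartan w h)) = l.1 (weylCartan (weylExt w) (cartanExt n m h))
    rw [weylCartan_cartanExt]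
  · let r : Module.Dual ℂ (ker (root (n := n + 1) (m := m + 1) i.castSucc p.castSucc).1) →+
        Module.Dual ℂ (ker (root (n := n) (m := m) i p).1) :=
      { toFun := fun μ => μ.comp ((cartanExt n m).restrict fun h hh => cartanExt_mem_ker hh)
        map_zero' := rfl
        map_add' := fun _ _ => rfl }
    have h1 : wallRes i p (res n m f) = mapDomainRingHom ℤ r
        (wallRes i.castSucc p.castSucc f) := by
      rw [res, wallRes, wallRes, mapDomainRingHom_comp_apply, mapDomainRingHom_comp_apply]
      rfl
    rw [h1] at hl
    obtain ⟨μ, hμ, hμl⟩ := exists_coeff_ne_zero_of_mapDomain hl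
    obtain ⟨l', -, rfl⟩ := exists_coeff_ne_zero_of_mapDomain hμ
    have h2 := hwall _ _ l' hμ
    have h3 : wallHom i p (resWeight n m l') = wallHom i p l := hμl
    rw [← wallHom_apply_isoH h3, resWeight_apply, cartanExt_isoH, h2]
  · obtain ⟨l', hl', rfl⟩ := exists_coeff_ne_zero_of_mapDomain hl
    obtain ⟨k, rfl⟩ := mem_latticeRing.1 hlat l' hl'
    exact ⟨_, (resWeight_latticeHom k).symm⟩

theorem mapDomain_eq_zero_of_injOn {R M N : Type} [CommRing R] [AddCommGroup M] [AddCommGroup N]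
    (φ : M →+ N) {f : AddMonoidAlgebra R M}
    (hφ : ∀ l l', f.coeff l ≠ 0 → f.coeff l' ≠ 0 → φ l = φ l' → l = l')
    (h : mapDomainRingHom R φ f = 0) : f = 0 := by
  have h1 : Finsupp.mapDomain φ f.coeff = Finsupp.mapDomain φ 0 := by
    rw [Finsupp.mapDomain_zero]
    exact congrArg AddMonoidAlgebra.coeff h
  have := Finsupp.mapDomain_injOn (f.coeff.support : Set M) (fun l hl l' hl' =>
    hφ l l' (mem_support_iff.1 hl) (mem_support_iff.1 hl'))
    (show f.coeff ∈ _ from fun _ h => h) (show (0 : M →₀ R) ∈ _ by simp) h1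
  exact coeff_injective this

theorem exists_cartanExt_add (h : cartan (n + 1) (m + 1))
    (hh : h ∈ ker (root (Fin.last n) (Fin.last m)).1) :
    ∃ (h' : cartan n m) (c : ℂ), h = cartanExt n m h' + c • isoH (Fin.last n) (Fin.last m) := by
  rw [mem_ker, root_apply, sub_eq_zero] at hh
  refine ⟨⟨fun j => h.1 (Sum.map Fin.castSucc Fin.castSucc j), ?_⟩, h.1 (inl (Fin.last n)), ?_⟩
  · have := mem_cartan h
    rw [Fin.sum_univ_castSucc, Fin.sum_univ_castSucc, hh] at this
    exact add_right_cancel this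
  · apply cartan_ext_castSucc
    · intro i
      simp [cartanExt_inl, isoH, Fin.castSucc_ne_last]
    · simp [cartanExt_inl_last, isoH]
    · intro i
      simp [cartanExt_inr, isoH, Fin.castSucc_ne_last]
    · simp [cartanExt_inr_last, isoH, hh]

theorem wallRes_last_eq_zero {f : ZP (n + 1) (m + 1)} (hf : f ∈ J (n + 1) (m + 1))
    (h : res n m f = 0) : wallRes (Fin.last n) (Fin.last m) f = 0 := by
  have hmem : ∀ h : cartan n m,
      cartanExt n m h ∈ ker (root (Fin.last n) (Fin.last m)).1 := fun h => by
    rw [mem_ker, root_apply, cartanExt_inl_last, cartanExt_inr_last, sub_zero]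
  let r : Module.Dual ℂ (ker (root (n := n + 1) (m := m + 1) (Fin.last n) (Fin.last m)).1) →+
      Module.Dual ℂ (cartan n m) :=
    { toFun := fun μ => μ.comp ((cartanExt n m).codRestrict _ hmem)
      map_zero' := rfl
      map_add' := fun _ _ => rfl }
  apply mapDomain_eq_zero_of_injOn r
  · intro μ μ' hμ hμ' e
    obtain ⟨l, -, rfl⟩ := exists_coeff_ne_zero_of_mapDomain hμ
    obtain ⟨l', -, rfl⟩ := exists_coeff_ne_zero_of_mapDomain hμ'
    have h1 := (mem_J_iff.1 hf).2 _ _ l hμ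
    have h2 := (mem_J_iff.1 hf).2 _ _ l' hμ'
    ext ⟨x, hx⟩
    obtain ⟨x', c, rfl⟩ := exists_cartanExt_add x hx
    change l.1 (cartanExt n m x' + c • isoH _ _) = l'.1 (cartanExt n m x' + c • isoH _ _)
    rw [map_add, map_add, map_smul, map_smul, h1, h2]
    congr 1
    exact LinearMap.congr_fun e x'
  · have h1 := congrArg (mapDomainRingHom ℤ (P0 n m).subtype) h
    rw [map_zero, res, mapDomainRingHom_comp_apply] at h1
    rw [wallRes, mapDomainRingHom_comp_apply]
    exact h1

theorem root_dvd_of_root_dvd {f : ZP n m} (hf : f ∈ ZPinv n m) {i j : Fin n} {p q : Fin m} {N : ℕ}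
    (h : (ex (root i p) - 1 : ZP n m) ^ N ∣ f) : (ex (root j q) - 1 : ZP n m) ^ N ∣ f := by
  have h1 := map_dvd (mapDomainRingHom ℤ
    (weylWeight ((Equiv.swap i j, Equiv.swap p q) : Weyl n m))) h
  rw [mem_ZPinv.1 hf, map_pow, map_sub, map_one, mapDomainRingHom_ex, weylWeight_root] at h1
  simpa using h1

theorem mem_hRing_of_res_eq_zero (hnm : (n + 1, m + 1) ≠ (2, 2)) (h1 : (n + 1, m + 1) ≠ (1, 1))
    {f : ZP (n + 1) (m + 1)} (hf : f ∈ Jzero (n + 1) (m + 1)) (h : res n m f = 0) :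
    f ∈ hRing (n + 1) (m + 1) := by
  obtain ⟨hJ, hl⟩ := mem_Jzero_iff.1 hf
  have hinv := (mem_J_iff.1 hJ).1
  obtain ⟨g, hg, rfl⟩ := exists_kacFactor_mul hnm h1 (by omega) hinv hl fun i p => by
    rw [wallRes_eq_zero_iff, ← pow_one (ex _ - 1)]
    refine root_dvd_of_root_dvd (i := Fin.last n) (p := Fin.last m) hinv ?_
    rw [pow_one]
    exact (wallRes_eq_zero_iff _ _ _).1 (wallRes_last_eq_zero hJ h)
  exact kacFactor_mul_mem_hRing hg

theorem mem_hRing_of_res_mem_hRing (hnm : (n + 1, m + 1) ≠ (2, 2)) (h1 : (n + 1, m + 1) ≠ (1, 1))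
    {f : ZP (n + 1) (m + 1)} (hf : f ∈ Jzero (n + 1) (m + 1)) (h : res n m f ∈ hRing n m) :
    f ∈ hRing (n + 1) (m + 1) := by
  obtain ⟨z, hz, hz'⟩ := exists_res_eq h
  have h2 := mem_hRing_of_res_eq_zero hnm h1 (sub_mem hf (hRing_le_Jzero hz))
    (by rw [map_sub, hz', sub_self])
  simpa using add_mem h2 hz

theorem mem_hRing_of_isEmpty (h0 : 0 < n + m) (h : n = 0 ∨ m = 0) {f : ZP n m}
    (hf : f ∈ Jzero n m) : f ∈ hRing n m := by
  obtain ⟨hJ, hl⟩ := mem_Jzero_iff.1 hf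
  obtain ⟨g, hg, rfl⟩ := exists_kacFactor_mul (by rw [Ne, Prod.mk.injEq]; omega)
    (by rw [Ne, Prod.mk.injEq]; omega) h0 (mem_J_iff.1 hJ).1 hl fun i p => by
      have := i.2; have := p.2; omega
  exact kacFactor_mul_mem_hRing hg

theorem eq_intCast_of_mem_Jzero_one_one {f : ZP 1 1} (hf : f ∈ Jzero 1 1) :
    ∃ c : ℤ, f = (c : ZP 1 1) := by
  obtain ⟨hJ, -⟩ := mem_Jzero_iff.1 hf
  have hinj : Injective (wallHom (n := 1) (m := 1) 0 0) := by
    rw [injective_iff_map_eq_zero]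
    intro l hl
    obtain ⟨z, rfl⟩ := (wallHom_eq_zero_iff _ _ l).1 hl
    rw [root_eq_zero rfl rfl, smul_zero]
  have h1 : ∀ l, f.coeff l ≠ 0 → l = 0 := by
    intro l hl
    have h2 : (wallRes 0 0 f).coeff (wallHom 0 0 l) = f.coeff l :=
      Finsupp.mapDomain_apply hinj _ _
    have h3 := (mem_J_iff.1 hJ).2 0 0 l (by rwa [h2])
    refine P0_ext fun h => ?_
    have h4 : h = h.1 (inl 0) • isoH 0 0 := by
      have := mem_cartan h
      simp only [univ_unique, sum_singleton, Fin.default_eq_zero] at this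
      apply Subtype.ext
      funext k
      rcases k with k | k <;> fin_cases k <;> simp [isoH, this]
    rw [h4, map_smul, h3, smul_zero]
    rfl
  classical
  refine ⟨f.coeff 0, ?_⟩
  change f = single 0 (f.coeff 0)
  ext l
  rw [coeff_single, Finsupp.single_apply]
  split_ifs with hl
  · rw [hl]
  · by_contra h
    exact hl (h1 l h).symm

end Restriction

section Slopes

variable {k : ℕ}

/-- Restriction of weights to the diagonal `x = y`. -/
def diagWeight (k : ℕ) : P0 k k →+ (Fin k → ℂ) where
  toFun l i := l.1 (isoH i i)
  map_zero' := rfl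
  map_add' _ _ := rfl

/-- The integer `l (E_ii - E_jj)`. -/
def pairL (i j : Fin k) : P0 k k →+ ℤ where
  toFun l := (l.2.1 i j).choose
  map_zero' := by
    have h := ((0 : P0 k k).2.1 i j).choose_spec
    have h0 : (0 : P0 k k).1 (corootL i j) = 0 := rfl
    have h1 := h.symm.trans h0
    exact_mod_cast h1
  map_add' a b := by
    have h := ((a + b : P0 k k).2.1 i j).choose_spec
    have ha := (a.2.1 i j).choose_spec
    have hb := (b.2.1 i j).choose_spec
    have h2 : (a + b : P0 k k).1 (corootL i j) = a.1 (corootL i j) + b.1 (corootL i j) := rfl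
    rw [h, ha, hb] at h2
    exact_mod_cast h2

theorem pairL_cast (i j : Fin k) (l : P0 k k) : ((pairL i j l : ℤ) : ℂ) = l.1 (corootL i j) :=
  (l.2.1 i j).choose_spec.symm

/-- The derivative of `f` along `E_ii - E_jj`, restricted to the diagonal. -/
def slope (i j : Fin k) (f : ZP k k) : AddMonoidAlgebra ℤ (Fin k → ℂ) :=
  mapDomainRingHom ℤ (diagWeight k) (expDeriv (pairL i j) f)

/-- Restriction to the diagonal. -/
def diagRes (k : ℕ) : ZP k k →+* AddMonoidAlgebra ℤ (Fin k → ℂ) :=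
  mapDomainRingHom ℤ (diagWeight k)

theorem slope_add (i j : Fin k) (f g : ZP k k) : slope i j (f + g) = slope i j f + slope i j g := by
  rw [slope, map_add, map_add]; rfl

theorem slope_mul (i j : Fin k) (f g : ZP k k) :
    slope i j (f * g) = slope i j f * diagRes k g + diagRes k f * slope i j g := by
  rw [slope, expDeriv_mul, map_add, map_mul, map_mul]; rfl

theorem slope_single (i j : Fin k) (l : P0 k k) (c : ℤ) : slope i j (single l c) =
    single (diagWeight k l) (pairL i j l * c) := by
  rw [slope, expDeriv_single]
  exact mapDomain_single

theorem slope_zero (i j : Fin k) : slope i j (0 : ZP k k) = 0 := by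
  rw [slope, map_zero, map_zero]

/-- The slope as an additive map. -/
def slopeHom (i j : Fin k) : ZP k k →+ AddMonoidAlgebra ℤ (Fin k → ℂ) where
  toFun := slope i j
  map_zero' := slope_zero i j
  map_add' := slope_add i j

theorem pairL_add (i j r : Fin k) (l : P0 k k) : pairL i j l + pairL j r l = pairL i r l := by
  have : ((pairL i j l + pairL j r l : ℤ) : ℂ) = (pairL i r l : ℤ) := by
    rw [Int.cast_add, pairL_cast, pairL_cast, pairL_cast, ← map_add]
    congr 1
    apply Subtype.ext
    change _ - _ + (_ - _) = _ - _
    abel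
  exact_mod_cast this

theorem slope_add_slope (i j r : Fin k) (f : ZP k k) :
    slope i j f + slope j r f = slope i r f := by
  induction f using AddMonoidAlgebra.induction_linear with
  | zero => simp only [slope_zero, add_zero]
  | add a b ha hb => rw [slope_add, slope_add, slope_add, ← ha, ← hb]; abel
  | single l c =>
    rw [slope_single, slope_single, slope_single, ← single_add, ← add_mul, pairL_add]

theorem slope_coeff_eq_zero {f : ZP k k} (hf : f ∈ J k k) {i j r : Fin k} (hi : r ≠ i) (hj : r ≠ j)
    {ν : Fin k → ℂ} (hν : (slope i j f).coeff ν ≠ 0) : ν r = 0 := by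
  have hmem : ∀ i : Fin k, isoH i i ∈ ker (root r r).1 := fun i =>
    isoH_mem_ker i r i r Iff.rfl
  let θ : Module.Dual ℂ (ker (root (n := k) (m := k) r r).1) →+ (Fin k → ℂ) :=
    { toFun := fun μ i => μ ⟨isoH i i, hmem i⟩
      map_zero' := rfl
      map_add' := fun _ _ => rfl }
  have h1 : slope i j f = mapDomainRingHom ℤ θ
      (mapDomainRingHom ℤ (wallHom r r) (expDeriv (pairL i j) f)) := by
    rw [mapDomainRingHom_comp_apply]; rfl
  rw [h1] at hν
  obtain ⟨μ, hμ, rfl⟩ := exists_coeff_ne_zero_of_mapDomain hν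
  obtain ⟨l, -, rfl⟩ := exists_coeff_ne_zero_of_mapDomain hμ
  rw [coeff_mapDomain_expDeriv] at hμ
  · exact (mem_J_iff.1 hf).2 r r l (right_ne_zero_of_mul hμ)
  · intro l hl
    have hc : corootL i j ∈ ker (root (n := k) (m := k) r r).1 := by
      rw [mem_ker, root_corootL, if_neg hi, if_neg hj, sub_zero]
    have : ((pairL i j l : ℤ) : ℂ) = 0 := by
      rw [pairL_cast]
      exact LinearMap.congr_fun hl ⟨_, hc⟩
    exact_mod_cast this

theorem slope_swap {f : ZP k k} (hf : f ∈ ZPinv k k) (i j : Fin k) (ν : Fin k → ℂ) :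
    (slope i j f).coeff (ν ∘ Equiv.swap i j) = -(slope i j f).coeff ν := by
  let w : Weyl k k := (Equiv.swap i j, Equiv.swap i j)
  let e : (Fin k → ℂ) →+ (Fin k → ℂ) :=
    { toFun := fun ν => ν ∘ Equiv.swap i j
      map_zero' := rfl
      map_add' := fun _ _ => rfl }
  have he : Injective e := fun a b h => by
    funext x
    have := congrFun h (Equiv.swap i j x)
    simpa [e] using this
  have h1 : ∀ g : ZP k k, slope i j (mapDomainRingHom ℤ (weylWeight w) g) =
      - mapDomainRingHom ℤ e (slope i j g) := by
    intro g
    induction g using AddMonoidAlgebra.induction_linear with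
    | zero => simp only [slope_zero, map_zero, neg_zero]
    | add a b ha hb => rw [map_add, slope_add, slope_add, ha, hb, map_add]; abel
    | single l c =>
      have h2 : pairL i j (weylWeight w l) = - pairL i j l := by
        have : ((pairL i j (weylWeight w l) : ℤ) : ℂ) = (-pairL i j l : ℤ) := by
          rw [Int.cast_neg, pairL_cast, pairL_cast]
          change l.1 (weylCartan w (corootL i j)) = _
          rw [weylCartan_corootL, ← map_neg]
          congr 1
          apply Subtype.ext
          simp [w, corootL]
        exact_mod_cast this
      have h3 : diagWeight k (weylWeight w l) = e (diagWeight k l) := by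
        funext x
        change l.1 (weylCartan w (isoH x x)) = l.1 (isoH _ _)
        congr 1
        apply Subtype.ext
        funext y
        rcases y with y | y <;> simp [weylCartan, isoH, Weyl.perm, w, Pi.single_apply,
          Equiv.swap_apply_eq_iff]
      rw [mapDomainRingHom_apply, mapDomain_single, slope_single, slope_single,
        mapDomainRingHom_apply, mapDomain_single, h2, h3, neg_mul, single_neg]
  have h4 := h1 f
  rw [mem_ZPinv.1 hf] at h4
  have h5 : (mapDomainRingHom ℤ e (slope i j f)).coeff (e ν) =
      (slope i j f).coeff ν := Finsupp.mapDomain_apply he _ _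
  rw [← h5]
  conv_lhs => rw [h4]
  rfl

theorem slope_res (i j : Fin k) (f : ZP (k + 1) (k + 1)) (h : slope i.castSucc j.castSucc f = 0) :
    slope i j (res k k f) = 0 := by
  let e : (Fin (k + 1) → ℂ) →+ (Fin k → ℂ) :=
    { toFun := fun ν i => ν i.castSucc
      map_zero' := rfl
      map_add' := fun _ _ => rfl }
  have h1 : ∀ f, slope i j (res k k f) =
      mapDomainRingHom ℤ e (slope i.castSucc j.castSucc f) := by
    intro f
    induction f using AddMonoidAlgebra.induction_linear with
    | zero => simp only [slope_zero, map_zero]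
    | add a b ha hb => rw [map_add, slope_add, slope_add, ha, hb, map_add]
    | single l c =>
      have h2 : pairL i j (resWeight k k l) = pairL i.castSucc j.castSucc l := by
        have : ((pairL i j (resWeight k k l) : ℤ) : ℂ) = pairL i.castSucc j.castSucc l := by
          rw [pairL_cast, pairL_cast, resWeight_apply, cartanExt_corootL]
        exact_mod_cast this
      have h3 : diagWeight k (resWeight k k l) = e (diagWeight (k + 1) l) := by
        funext x
        change (resWeight k k l).1 (isoH x x) = l.1 (isoH _ _)
        rw [resWeight_apply, cartanExt_isoH]
      rw [res, mapDomainRingHom_apply, mapDomain_single, slope_single, slope_single,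
        mapDomainRingHom_apply, mapDomain_single, h2, h3]
  rw [h1, h, map_zero]

/-- First-order expansion of `f` at the diagonal in the direction `E_ii - E_jj`. -/
def diagJet (i j : Fin k) : ZP k k →+* DualNumber (AddMonoidAlgebra ℤ (Fin k → ℂ)) where
  toFun f := TrivSqZeroExt.inl (diagRes k f) + TrivSqZeroExt.inr (slope i j f)
  map_one' := by
    have : slope i j (1 : ZP k k) = 0 := by
      rw [one_def, slope_single, map_zero (pairL i j), zero_mul, single_zero]
    rw [map_one, this]
    simp
  map_zero' := by rw [map_zero, slope_zero]; simp
  map_add' f g := by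
    rw [map_add, slope_add]
    ext <;> simp
  map_mul' f g := by
    rw [map_mul, slope_mul]
    ext
    · simp
    · simp [mul_comm, add_comm]

theorem snd_diagJet (i j : Fin k) (f : ZP k k) : (diagJet i j f).snd = slope i j f := by
  simp [diagJet]

theorem diagJet_ex (i j : Fin k) (l : P0 k k) : diagJet i j (ex l) =
    TrivSqZeroExt.inl (ex (diagWeight k l)) *
      (1 + TrivSqZeroExt.inr (pairL i j l : AddMonoidAlgebra ℤ (Fin k → ℂ))) := by
  change TrivSqZeroExt.inl (mapDomainRingHom ℤ (diagWeight k) (ex l)) +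
    TrivSqZeroExt.inr (slope i j (ex l)) = _
  rw [mapDomainRingHom_ex, slope_single, mul_add, mul_one, mul_one]
  congr 1
  rw [TrivSqZeroExt.inl_mul_inr, smul_eq_mul, mul_comm, ← zsmul_eq_mul, smul_single, smul_eq_mul,
    mul_one]

theorem hCoeff_jet {B : Type} [CommRing B] {e z₀ z₁ z₂ : B} (he : e * e = 0) (a : ℕ) :
    hCoeff ![z₀ * (1 + e), z₁ * (1 - e), z₂] ![z₀, z₁, z₂] a =
      (if a = 0 then 1 else 0) + e * (z₀ ^ a - z₁ ^ a) := by
  have h : (1 + PowerSeries.C e * (PowerSeries.mk (fun a => z₀ ^ a) - PowerSeries.mk (fun a => z₁ ^ a))) =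
      hSeries ![z₀ * (1 + e), z₁ * (1 - e), z₂] ![z₀, z₁, z₂] := by
    apply eq_hSeries
    have h0 := mk_pow_mul z₀
    have h1 := mk_pow_mul z₁
    have h2 : PowerSeries.C e * PowerSeries.C e = 0 := by rw [← map_mul, he, map_zero]
    simp only [Fin.prod_univ_three, Matrix.cons_val_zero, Matrix.cons_val_one, Matrix.cons_val,
      map_mul, map_add, map_sub, map_one]
    generalize PowerSeries.mk (fun a => z₀ ^ a) = G₀ at *
    generalize PowerSeries.mk (fun a => z₁ ^ a) = G₁ at *
    generalize PowerSeries.C e = E at *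
    generalize PowerSeries.C z₀ = Z₀ at *
    generalize PowerSeries.C z₁ = Z₁ at *
    generalize PowerSeries.C z₂ = Z₂ at *
    generalize (PowerSeries.X : PowerSeries B) = X at *
    linear_combination (1 - Z₂ * X) * E * (1 - Z₁ * X) * h0 - (1 - Z₂ * X) * E * (1 - Z₀ * X) * h1 +
      (1 - Z₂ * X) * (-(Z₀ * Z₁ * X ^ 2) + (G₀ - G₁) * (-Z₀ * X * (1 - Z₁ * X) + Z₁ * X * (1 - Z₀ * X)) - E * (G₀ - G₁) * (Z₀ * Z₁ * X ^ 2)) * h2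
  rw [← coeff_hSeries, ← h]
  simp [PowerSeries.coeff_one]

/-- The weight `s z_i` on the diagonal. -/
def axis (i : Fin k) (s : ℤ) : Fin k → ℂ := Pi.single i (s : ℂ)

theorem axis_nsmul (i : Fin k) (s : ℤ) (a : ℕ) : a • axis i s = axis i (a * s) := by
  funext x
  simp [axis, Pi.single_apply]

theorem ex_pow {M : Type} [AddCommGroup M] (l : M) (a : ℕ) :
    (ex l : AddMonoidAlgebra ℤ M) ^ a = ex (a • l) := by
  rw [single_pow, one_pow]

theorem slope_hCoeff (s : ℤ) (a : ℕ) :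
    slope 0 1 (hCoeff (fun i : Fin 3 => (ex (s • wt (inl i)) : ZP 3 3))
      (fun p : Fin 3 => ex (s • wt (inr p))) a) =
      s • (ex (axis 0 (a * s)) - ex (axis 1 (a * s))) := by
  rw [← snd_diagJet, map_hCoeff]
  let e : DualNumber (AddMonoidAlgebra ℤ (Fin 3 → ℂ)) := TrivSqZeroExt.inr (s : AddMonoidAlgebra ℤ (Fin 3 → ℂ))
  let z : Fin 3 → DualNumber (AddMonoidAlgebra ℤ (Fin 3 → ℂ)) := fun i =>
    TrivSqZeroExt.inl (ex (axis i s))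
  have hd : ∀ i : Fin 3, diagWeight 3 (s • wt (inl i)) = axis i s := by
    intro i
    funext x
    change s • (wt (inl i)).1 (isoH x x) = _
    rw [wt_apply]
    simp [isoH, axis, Pi.single_apply, eq_comm]
  have hd' : ∀ i : Fin 3, diagWeight 3 (s • wt (inr i)) = axis i s := by
    intro i
    funext x
    change s • (wt (inr i)).1 (isoH x x) = _
    rw [wt_apply]
    simp [isoH, axis, Pi.single_apply, eq_comm]
  have hp : ∀ i : Fin 3, pairL 0 1 (wt (inl i)) = ![1, -1, 0] i := by
    intro i
    have : ((pairL 0 1 (wt (inl i)) : ℤ) : ℂ) = ((![1, -1, 0] i : ℤ) : ℂ) := by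
      rw [pairL_cast, wt_apply]
      fin_cases i <;> simp [corootL]
    exact_mod_cast this
  have hp' : ∀ i : Fin 3, pairL 0 1 (wt (inr i)) = 0 := by
    intro i
    have : ((pairL 0 1 (wt (inr i)) : ℤ) : ℂ) = 0 := by
      rw [pairL_cast, wt_apply]
      simp [corootL]
    exact_mod_cast this
  have hu : (fun i : Fin 3 => diagJet 0 1 (ex (s • wt (inl i)))) =
      ![z 0 * (1 + e), z 1 * (1 - e), z 2] := by
    funext i
    rw [diagJet_ex, hd, map_zsmul, hp]
    fin_cases i
    · simp [z, e]
    · simp [z, e, sub_eq_add_neg]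
    · simp [z]
  have hv : (fun i : Fin 3 => diagJet 0 1 (ex (s • wt (inr i)))) = ![z 0, z 1, z 2] := by
    funext i
    rw [diagJet_ex, hd', map_zsmul, hp']
    fin_cases i <;> simp [z]
  rw [hu, hv, hCoeff_jet (by simp [e])]
  have h1 : ∀ i, z i ^ a = TrivSqZeroExt.inl (ex (axis i (a * s))) := by
    intro i
    have h2 : z i ^ a = TrivSqZeroExt.inl (ex (axis i s) ^ a) :=
      (map_pow (TrivSqZeroExt.inlHom _ _) (ex (axis i s)) a).symm
    rw [h2, ex_pow, axis_nsmul]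
  rw [h1, h1, ← TrivSqZeroExt.inl_sub, TrivSqZeroExt.inr_mul_inl, TrivSqZeroExt.snd_add,
    TrivSqZeroExt.snd_inr, op_smul_eq_mul, ← zsmul_eq_mul]
  split_ifs <;> simp

/-- The slopes of elements of the ring generated by the `h_k`, `h_k^*`. -/
def slopeSubgroup : AddSubgroup (AddMonoidAlgebra ℤ (Fin 3 → ℂ)) :=
  (hRing 3 3).toAddSubgroup.map (slopeHom 0 1)

theorem axis_mem_slopeSubgroup (s : ℤ) :
    (ex (axis 0 s) - ex (axis 1 s) : AddMonoidAlgebra ℤ (Fin 3 → ℂ)) ∈ slopeSubgroup := by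
  rcases Int.eq_nat_or_neg s with ⟨a, rfl | rfl⟩
  · refine ⟨_, hk_mem_hRing a, ?_⟩
    have := slope_hCoeff 1 a
    simp only [one_smul, mul_one] at this
    exact this
  · refine ⟨_, neg_mem (hkStar_mem_hRing a), ?_⟩
    have := slope_hCoeff (-1) a
    simp only [neg_smul, one_smul, mul_neg, mul_one] at this
    rw [map_neg]
    refine (congrArg Neg.neg this).trans (neg_neg _)

theorem slope_mem_slopeSubgroup {f : ZP 3 3} (hf : f ∈ Jzero 3 3) :
    slope 0 1 f ∈ slopeSubgroup := by
  classical
  obtain ⟨hJ, hl⟩ := mem_Jzero_iff.1 hf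
  have hinv := (mem_J_iff.1 hJ).1
  set c := slope 0 1 f with hc
  have h2 : ∀ ν, c.coeff ν ≠ 0 → ν 2 = 0 := fun ν hν =>
    slope_coeff_eq_zero hJ (by decide) (by decide) hν
  have hsw : ∀ ν, c.coeff (ν ∘ Equiv.swap 0 1) = -c.coeff ν := slope_swap hinv 0 1
  have h01 : ∀ ν, c.coeff ν ≠ 0 → ν 0 = 0 ∨ ν 1 = 0 := by
    intro ν hν
    by_contra! h
    have h3 : (slope 1 2 f).coeff ν = 0 := by
      by_contra h4
      exact h.1 (slope_coeff_eq_zero hJ (by decide) (by decide) h4)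
    have h4 : (slope 0 2 f).coeff ν = 0 := by
      by_contra h4
      exact h.2 (slope_coeff_eq_zero hJ (by decide) (by decide) h4)
    rw [← slope_add_slope 0 1 2, coeff_add, Finsupp.add_apply, h3, add_zero] at h4
    exact hν h4
  have h00 : ∀ ν, c.coeff ν ≠ 0 → ν 0 = 0 → ν 1 ≠ 0 := by
    intro ν hν h0 h1
    have : ν ∘ Equiv.swap 0 1 = ν := by
      funext x
      fin_cases x <;> simp [h0, h1, Equiv.swap_apply_of_ne_of_ne]
    have h3 := hsw ν
    rw [this] at h3
    exact hν (by omega)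
  have hint : ∀ ν, c.coeff ν ≠ 0 → ∃ z : Fin 3 → ℤ, ν = fun i => (z i : ℂ) := by
    intro ν hν
    obtain ⟨l, hl', rfl⟩ := exists_coeff_ne_zero_of_mapDomain hν
    have hl'' : f.coeff l ≠ 0 := by
      intro h0
      apply hl'
      have := coeff_mapDomain_expDeriv (AddMonoidHom.id (P0 3 3)) (pairL 0 1)
        (fun l hl => by rw [show l = 0 from hl, map_zero]) f l
      simpa [h0] using this
    obtain ⟨k, rfl⟩ := mem_latticeRing.1 hl l hl''
    exact ⟨fun i => k (inl i) + k (inr i), funext fun i => by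
      push_cast
      exact latticeHom_isoH k i i⟩
  have hsum : c = ∑ ν ∈ c.coeff.support with ν 1 = 0,
      c.coeff ν • (ex ν - ex (ν ∘ Equiv.swap 0 1) : AddMonoidAlgebra ℤ (Fin 3 → ℂ)) := by
    have h3 : c = ∑ ν ∈ c.coeff.support, c.coeff ν • (ex ν : AddMonoidAlgebra ℤ (Fin 3 → ℂ)) := by
      conv_lhs => rw [← sum_coeff_single c]
      refine sum_congr rfl fun ν _ => ?_
      rw [smul_single, smul_eq_mul, mul_one]
    conv_lhs => rw [h3]
    rw [← sum_filter_add_sum_filter_not _ (fun ν => ν 1 = 0)]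
    simp only [smul_sub]
    rw [sum_sub_distrib, sub_eq_add_neg]
    congr 1
    rw [← sum_neg_distrib]
    refine sum_nbij' (fun ν => ν ∘ Equiv.swap 0 1) (fun ν => ν ∘ Equiv.swap 0 1) ?_ ?_ ?_ ?_ ?_
    · intro ν hν
      rw [mem_filter, mem_support_iff] at hν ⊢
      refine ⟨by rw [hsw]; exact neg_ne_zero.2 hν.1, ?_⟩
      simpa using (h01 ν hν.1).resolve_right hν.2
    · intro ν hν
      rw [mem_filter, mem_support_iff] at hν ⊢
      refine ⟨by rw [hsw]; exact neg_ne_zero.2 hν.1, fun h => ?_⟩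
      exact h00 ν hν.1 (by simpa using h) hν.2
    · intro ν _
      funext x
      simp
    · intro ν _
      funext x
      simp
    · intro ν _
      rw [hsw, neg_smul, neg_neg, Function.comp_assoc]
      congr 2
      funext x
      simp
  rw [hsum]
  refine sum_mem fun ν hν => zsmul_mem ?_ _
  rw [mem_filter, mem_support_iff] at hν
  obtain ⟨z, hz⟩ := hint ν hν.1
  have e1 : ν = axis 0 (z 0) := by
    funext x
    fin_cases x
    · simp [axis, hz]
    · simpa [axis] using hν.2
    · simpa [axis] using h2 ν hν.1
  have e2 : ν ∘ Equiv.swap 0 1 = axis 1 (z 0) := by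
    funext x
    fin_cases x
    · simpa [axis] using hν.2
    · simp [axis, hz]
    · simpa [axis, Equiv.swap_apply_of_ne_of_ne] using h2 ν hν.1
  rw [e2, e1]
  exact axis_mem_slopeSubgroup _

theorem diagWeight_two_eq_zero_iff (l : P0 2 2) :
    diagWeight 2 l = 0 ↔ ∃ z : ℤ, l = z • root 0 0 := by
  rw [← wallHom_eq_zero_iff]
  constructor
  · intro h
    ext ⟨x, hx⟩
    rw [mem_ker, root_apply, sub_eq_zero] at hx
    have hs := mem_cartan x
    rw [Fin.sum_univ_two, Fin.sum_univ_two, hx] at hs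
    have hs := add_left_cancel hs
    have : x = x.1 (inl 0) • isoH 0 0 + x.1 (inl 1) • isoH 1 1 := by
      apply Subtype.ext
      funext k
      rcases k with k | k <;> fin_cases k <;> simp [isoH, hx, hs]
    change l.1 x = 0
    rw [this, map_add, map_smul, map_smul]
    have h0 : l.1 (isoH 0 0) = 0 := congrFun h 0
    have h1 : l.1 (isoH 1 1) = 0 := congrFun h 1
    rw [h0, h1, smul_zero, smul_zero, add_zero]
  · intro h
    funext i
    exact LinearMap.congr_fun h ⟨isoH i i, isoH_mem_ker i 0 i 0 Iff.rfl⟩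

theorem sq_dvd_of_slope_eq_zero {g : ZP 2 2} (h1 : (ex (root 0 0) - 1 : ZP 2 2) ∣ g)
    (h2 : slope 0 1 g = 0) : (ex (root 0 0) - 1 : ZP 2 2) ^ 2 ∣ g := by
  obtain ⟨q, rfl⟩ := h1
  rw [pow_two]
  refine mul_dvd_mul_left _ ?_
  rw [← mapDomain_eq_zero_iff_dvd (diagWeight 2) (root 0 0) diagWeight_two_eq_zero_iff]
  have h3 : diagWeight 2 (root 0 0) = 0 := (diagWeight_two_eq_zero_iff _).2 ⟨1, (one_smul _ _).symm⟩
  have h4 : pairL 0 1 (root 0 0 : P0 2 2) = 1 := by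
    have : ((pairL 0 1 (root 0 0 : P0 2 2) : ℤ) : ℂ) = 1 := by
      rw [pairL_cast, root_corootL]
      simp
    exact_mod_cast this
  have h5 : diagJet 0 1 (ex (root 0 0) - 1 : ZP 2 2) = TrivSqZeroExt.inr 1 := by
    rw [map_sub, map_one, diagJet_ex, h3, h4, ex_zero]
    simp
  have h6 := congrArg TrivSqZeroExt.snd (map_mul (diagJet 0 1) (ex (root 0 0) - 1 : ZP 2 2) q)
  rw [snd_diagJet, h2, h5] at h6
  simp [diagJet] at h6
  exact h6.symm

theorem root_one_one : (root 1 1 : P0 2 2) = -root 0 0 := by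
  have h := sum_wt (n := 2) (m := 2)
  rw [Fin.sum_univ_two, Fin.sum_univ_two] at h
  rw [root, root, neg_sub, sub_eq_sub_iff_add_eq_add, add_comm, h]

theorem root_one_zero : (root 1 0 : P0 2 2) = -root 0 1 := by
  have h := sum_wt (n := 2) (m := 2)
  rw [Fin.sum_univ_two, Fin.sum_univ_two] at h
  rw [root, root, neg_sub, sub_eq_sub_iff_add_eq_add, add_comm, h, add_comm]

theorem kacFactor_two_dvd {g : ZP 2 2} (h0 : (ex (root 0 0) - 1 : ZP 2 2) ^ 2 ∣ g)
    (h1 : (ex (root 0 1) - 1 : ZP 2 2) ^ 2 ∣ g) : kacFactor 2 2 ∣ g := by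
  have hne : ∀ z : ℤ, (root 0 0 : P0 2 2) ≠ z • root 0 1 := by
    intro z h
    have e1 := LinearMap.congr_fun (congrArg Subtype.val h) (corootL 0 1)
    have e2 := LinearMap.congr_fun (congrArg Subtype.val h) (corootR 0 1)
    change _ = z • (root 0 1).1 _ at e1 e2
    rw [root_corootL, root_corootL] at e1
    rw [root_corootR, root_corootR] at e2
    simp at e1 e2
    rw [← e1] at e2
    norm_num at e2
  have hp : wallRes 0 1 (ex (root 0 0) - 1 : ZP 2 2) ≠ 0 := by
    intro h
    rw [wallRes, map_sub, map_one, mapDomainRingHom_ex] at h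
    refine ex_sub_one_ne_zero (fun h' => ?_) h
    obtain ⟨z, hz⟩ := (wallHom_eq_zero_iff _ _ _).1 h'
    exact hne z hz
  have hcancel : ∀ q : ZP 2 2, (ex (root 0 1) - 1 : ZP 2 2) ∣ (ex (root 0 0) - 1) ^ 2 * q →
      (ex (root 0 1) - 1 : ZP 2 2) ∣ q := by
    intro q hq
    rw [← wallRes_eq_zero_iff, map_mul, map_pow] at hq
    rw [← wallRes_eq_zero_iff]
    exact (mul_eq_zero.1 hq).resolve_left (pow_ne_zero _ hp)
  have h01 : (ex (root 0 1) - 1 : ZP 2 2) ≠ 0 := ex_sub_one_ne_zero (root_ne_zero (by decide) _ _)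
  obtain ⟨q, rfl⟩ := h0
  obtain ⟨q', rfl⟩ := hcancel q ((dvd_pow_self _ two_ne_zero).trans h1)
  obtain ⟨q'', rfl⟩ := hcancel q' (by
    rw [pow_two (ex (root 0 1) - 1), mul_left_comm] at h1
    exact (mul_dvd_mul_iff_left h01).1 h1)
  refine ⟨ex (root 0 0) * ex (root 0 1) * q'', ?_⟩
  rw [kacFactor_eq, Fintype.prod_prod_type, Fin.prod_univ_two, Fin.prod_univ_two, Fin.prod_univ_two,
    root_one_one, root_one_zero]
  have e1 := ex_neg_mul_ex (R := ℤ) (root 0 0 : P0 2 2)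
  have e2 := ex_neg_mul_ex (R := ℤ) (root 0 1 : P0 2 2)
  generalize (ex (root 0 0) : ZP 2 2) = a at *
  generalize (ex (root 0 1) : ZP 2 2) = b at *
  generalize (ex (-root 0 0) : ZP 2 2) = a' at *
  generalize (ex (-root 0 1) : ZP 2 2) = b' at *
  have : (1 - a) * (1 - b) * ((1 - b') * (1 - a')) * (a * b * q'') =
    (1 - a) * (1 - b) * ((b - b' * b) * (a - a' * a)) * q'' := by ring
  rw [this, e1, e2]
  ring

theorem mem_hRing_three_three {f : ZP 3 3} (hf : f ∈ Jzero 3 3) : f ∈ hRing 3 3 := by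
  obtain ⟨z, hz, hz'⟩ := slope_mem_slopeSubgroup hf
  have hfz := sub_mem hf (hRing_le_Jzero hz)
  have hs : slope 0 1 (f - z) = 0 := by
    have : slopeHom 0 1 (f - z) = 0 := by
      rw [map_sub, hz']
      exact sub_self _
    exact this
  have hg := res_mem_Jzero hfz
  have hs2 : slope 0 1 (res 2 2 (f - z)) = 0 := slope_res 0 1 _ hs
  obtain ⟨c, hc⟩ := eq_intCast_of_mem_Jzero_one_one (res_mem_Jzero hg)
  have hg' := sub_mem hg (intCast_mem (Jzero 2 2) c)
  set g : ZP 2 2 := res 2 2 (f - z) - (c : ℤ) with hgdef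
  have hs3 : slope 0 1 g = 0 := by
    have h1 : slopeHom 0 1 (c : ZP 2 2) = 0 := by
      refine (slope_single 0 1 (0 : P0 2 2) c).trans ?_
      rw [map_zero (pairL 0 1), zero_mul, single_zero]
    have : slopeHom 0 1 g = 0 := by
      rw [hgdef, map_sub, h1, sub_zero]
      exact hs2
    exact this
  obtain ⟨hJ, hl⟩ := mem_Jzero_iff.1 hg'
  have hinv := (mem_J_iff.1 hJ).1
  have hd : (ex (root 0 0) - 1 : ZP 2 2) ∣ g := by
    have h1 := (wallRes_eq_zero_iff _ _ _).1 (wallRes_last_eq_zero hJ (by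
      rw [hgdef, map_sub, hc, map_intCast, sub_self]))
    rw [← pow_one (ex _ - 1)] at h1 ⊢
    exact root_dvd_of_root_dvd hinv h1
  have hd2 := sq_dvd_of_slope_eq_zero hd hs3
  obtain ⟨q, hq, hq'⟩ := exists_of_kacFactor_dvd (by decide) (by decide) hinv hl
    (kacFactor_two_dvd hd2 (root_dvd_of_root_dvd hinv hd2))
  have hgm : res 2 2 (f - z) ∈ hRing 2 2 := by
    have : res 2 2 (f - z) = g + (c : ℤ) := by rw [hgdef]; ring
    rw [this, hq']
    exact add_mem (kacFactor_mul_mem_hRing hq) (intCast_mem _ _)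
  have := mem_hRing_of_res_mem_hRing (by decide) (by decide) hfz hgm
  simpa using add_mem this hz

theorem Jzero_eq_hRing {n m : ℕ} (h0 : 0 < n + m) (hnm : (n, m) ≠ (2, 2)) :
    Jzero n m = hRing n m := by
  refine le_antisymm (fun f hf => ?_) hRing_le_Jzero
  induction n generalizing m with
  | zero => exact mem_hRing_of_isEmpty h0 (Or.inl rfl) hf
  | succ n ih =>
    rcases m with _ | m
    · exact mem_hRing_of_isEmpty h0 (Or.inr rfl) hf
    by_cases h1 : (n, m) = (0, 0)
    · obtain ⟨rfl, rfl⟩ := Prod.mk.inj h1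
      obtain ⟨c, rfl⟩ := eq_intCast_of_mem_Jzero_one_one hf
      exact intCast_mem _ _
    by_cases h2 : (n, m) = (2, 2)
    · obtain ⟨rfl, rfl⟩ := Prod.mk.inj h2
      exact mem_hRing_three_three hf
    have h3 : 0 < n + m := by
      by_contra h
      exact h1 (by rw [Prod.mk.injEq]; omega)
    exact mem_hRing_of_res_mem_hRing hnm (by
      intro h
      rw [Prod.mk.injEq] at h
      omega) hf (ih h3 h2 _ (res_mem_Jzero hf))

end Slopes

/-! ### Constructions of superalgebras -/

section Superalgebras

theorem parity_cases (i : ZMod 2) : i = 0 ∨ i = 1 := by revert i; decide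

theorem parity_add_self (i : ZMod 2) : i + i = 0 := by revert i; decide

theorem parity_add_of_ne {i j : ZMod 2} (h : i ≠ j) : j + i = 1 := by revert i j; decide

theorem sgn_one : sgn 1 = -1 := by simp [sgn]

theorem sgn_mul_self (i : ZMod 2) : sgn i * sgn i = 1 := by
  rcases parity_cases i with rfl | rfl <;> simp [sgn_zero, sgn_one]

theorem sgn_mul_sgn_inv (i : ZMod 2) (x : ℂ) : sgn i * (sgn i * x) = x := by
  rw [← mul_assoc, sgn_mul_self, one_mul]

theorem eq_zero_of_eq_neg {E : Type} [AddCommGroup E] [Module ℂ E] {a : E} (h : a = -a) :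
    a = 0 := by
  have h2 : (2 : ℂ) • a = 0 := by
    rw [two_smul]
    nth_rewrite 2 [h]
    rw [add_neg_cancel]
  exact (smul_eq_zero.1 h2).resolve_left two_ne_zero

section Involution

variable {A : Type} [Ring A] [Algebra ℂ A] (σ : A →ₐ[ℂ] A)

/-- The eigenspaces of an involution. -/
def invGrade (i : ZMod 2) : Submodule ℂ A := ker (σ.toLinearMap - sgn i • LinearMap.id)

theorem mem_invGrade {i : ZMod 2} {a : A} : a ∈ invGrade σ i ↔ σ a = sgn i • a := by
  rw [invGrade, mem_ker]
  simp [sub_eq_zero]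

/-- The projection onto an eigenspace of an involution. -/
def invProj (hσ : ∀ a, σ (σ a) = a) (i : ZMod 2) : A →ₗ[ℂ] invGrade σ i :=
  LinearMap.codRestrict _ ((1 / 2 : ℂ) • (LinearMap.id + sgn i • σ.toLinearMap)) fun a => by
    rw [mem_invGrade]
    simp only [LinearMap.smul_apply, LinearMap.add_apply, LinearMap.id_apply, map_smul, map_add,
      AlgHom.toLinearMap_apply, hσ, smul_add, smul_smul]
    rw [add_comm]
    congr 2
    · rw [mul_comm]
    · rw [mul_left_comm, sgn_mul_self, mul_one]

theorem coe_invProj (hσ : ∀ a, σ (σ a) = a) (i : ZMod 2) (a : A) :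
    (invProj σ hσ i a : A) = (1 / 2 : ℂ) • (a + sgn i • σ a) := rfl

theorem invProj_of_mem (hσ : ∀ a, σ (σ a) = a) {i : ZMod 2} (j : ZMod 2) {a : A}
    (ha : a ∈ invGrade σ i) : (invProj σ hσ j a : A) = if i = j then a else 0 := by
  rw [coe_invProj, (mem_invGrade σ).1 ha, smul_smul, ← sgn_add]
  split_ifs with h
  · subst h
    rw [parity_add_self, sgn_zero, one_smul, ← two_smul ℂ a, smul_smul]
    norm_num
  · rw [parity_add_of_ne h, sgn_one, neg_smul, one_smul, add_neg_cancel, smul_zero]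

/-- The grading by the eigenspaces of an involution. -/
@[reducible]
def invGradedAlgebra (hσ : ∀ a, σ (σ a) = a) : GradedAlgebra (invGrade σ) where
  one_mem := by rw [mem_invGrade, map_one, sgn_zero, one_smul]
  mul_mem i j a b ha hb := by
    rw [mem_invGrade] at *
    rw [map_mul, ha, hb, smul_mul_smul_comm, sgn_add]
  toDecomposition := DirectSum.Decomposition.ofLinearMap (invGrade σ)
    ((DirectSum.lof ℂ (ZMod 2) (fun i => invGrade σ i) 0).comp (invProj σ hσ 0) +
      (DirectSum.lof ℂ (ZMod 2) (fun i => invGrade σ i) 1).comp (invProj σ hσ 1))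
    (by
      ext a
      simp only [LinearMap.comp_apply, LinearMap.add_apply, map_add, DirectSum.coeLinearMap_lof,
        coe_invProj, sgn_zero, sgn_one, LinearMap.id_apply, one_smul, neg_smul, smul_add, smul_neg]
      rw [add_add_add_comm, add_neg_cancel, add_zero, ← add_smul]
      norm_num)
    (by
      ext i a : 2
      rw [LinearMap.comp_apply, LinearMap.comp_apply, DirectSum.coeLinearMap_lof,
        LinearMap.add_apply, LinearMap.comp_apply, LinearMap.comp_apply]
      have h : ∀ j, invProj σ hσ j (a : A) = if h : i = j then h ▸ a else 0 := by
        intro j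
        apply Subtype.ext
        rw [invProj_of_mem σ hσ j a.2]
        split_ifs with h
        · subst h; rfl
        · rfl
      rw [h, h]
      rcases parity_cases i with rfl | rfl <;> simp)

end Involution

/-- The superalgebra defined by an involution. -/
abbrev SAlg.ofInvolution (A : Type) [Ring A] [Algebra ℂ A] (σ : A →ₐ[ℂ] A)
    (hσ : ∀ a, σ (σ a) = a)
    (hcomm : ∀ (i j : ZMod 2) (a b : A), σ a = sgn i • a → σ b = sgn j • b →
      a * b = sgn (i * j) • (b * a)) : SAlg :=
  letI := invGradedAlgebra σ hσ
  { carrier := A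
    grade := invGrade σ
    comm := fun i j a b ha hb => hcomm i j a b ((mem_invGrade σ).1 ha) ((mem_invGrade σ).1 hb) }

/-- A commutative algebra as a purely even superalgebra. -/
abbrev evenSAlg (R : Type) [CommRing R] [Algebra ℂ R] : SAlg :=
  SAlg.ofInvolution R (AlgHom.id ℂ R) (fun _ => rfl) fun i j a b ha hb => by
    rw [AlgHom.id_apply] at ha hb
    rcases parity_cases i with rfl | rfl
    · rw [zero_mul, sgn_zero, one_smul, mul_comm]
    · rw [sgn_one, neg_one_smul] at ha
      rw [eq_zero_of_eq_neg ha, zero_mul, mul_zero, smul_zero]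

theorem mem_evenSAlg_zero {R : Type} [CommRing R] [Algebra ℂ R] (a : R) :
    a ∈ (evenSAlg R).grade 0 := by
  rw [mem_invGrade, sgn_zero, one_smul]
  rfl

variable (A : SAlg)

theorem SAlg.induction {A : SAlg} {p : A → Prop} (h : ∀ i, ∀ a ∈ A.grade i, p a)
    (hadd : ∀ a b, p a → p b → p (a + b)) (a : A) : p a := by
  induction a using DirectSum.Decomposition.inductionOn A.grade with
  | zero => exact h 0 0 (zero_mem _)
  | homogeneous a => exact h _ a a.2
  | add a b ha hb => exact hadd a b ha hb

/-- The grading involution, `a ↦ a₀ - a₁`, as a linear map. -/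
def SAlg.signLin : A →ₗ[ℂ] A := 2 • GradedAlgebra.proj A.grade 0 - LinearMap.id

theorem SAlg.signLin_of_mem {i : ZMod 2} {a : A} (ha : a ∈ A.grade i) :
    A.signLin a = sgn i • a := by
  rw [SAlg.signLin, LinearMap.sub_apply, LinearMap.smul_apply, GradedAlgebra.proj_apply,
    LinearMap.id_apply]
  rcases parity_cases i with rfl | rfl
  · rw [DirectSum.decompose_of_mem_same A.grade ha, sgn_zero, one_smul, two_smul, add_sub_cancel_right]
  · rw [DirectSum.decompose_of_mem_ne A.grade ha (by decide), sgn_one, smul_zero, zero_sub,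
      neg_one_smul]

/-- The `q`-th power of the grading involution. -/
def SAlg.sg (q : ZMod 2) : A →ₐ[ℂ] A :=
  AlgHom.ofLinearMap (if q = 0 then LinearMap.id else A.signLin)
    (by
      split_ifs
      · rfl
      · rw [A.signLin_of_mem (SetLike.GradedOne.one_mem (A := A.grade)), sgn_zero, one_smul])
    (by
      split_ifs
      · intro a b; rfl
      · intro a b
        induction a using SAlg.induction with
        | hadd a a' ha ha' => rw [add_mul, map_add, ha, ha', map_add, add_mul]
        | h i a ha =>
          induction b using SAlg.induction with
          | hadd b b' hb hb' => rw [mul_add, map_add, hb, hb', map_add, mul_add]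
          | h j b hb =>
            rw [A.signLin_of_mem (SetLike.mul_mem_graded ha hb), A.signLin_of_mem ha,
              A.signLin_of_mem hb, smul_mul_smul_comm, sgn_add])

theorem SAlg.sg_of_mem (q : ZMod 2) {i : ZMod 2} {a : A} (ha : a ∈ A.grade i) :
    A.sg q a = sgn (q * i) • a := by
  rcases parity_cases q with rfl | rfl
  · rw [zero_mul, sgn_zero, one_smul]
    rfl
  · rw [one_mul]
    exact A.signLin_of_mem ha

theorem SAlg.sg_zero (a : A) : A.sg 0 a = a := rfl

theorem SAlg.sg_sg (q r : ZMod 2) (a : A) : A.sg q (A.sg r a) = A.sg (q + r) a := by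
  induction a using SAlg.induction with
  | hadd a b ha hb => simp only [map_add, ha, hb]
  | h i a ha => rw [A.sg_of_mem r ha, map_smul, A.sg_of_mem q ha, A.sg_of_mem _ ha, smul_smul,
      ← sgn_add, add_mul, add_comm]

theorem SAlg.sg_self (q : ZMod 2) (a : A) : A.sg q (A.sg q a) = a := by
  rw [A.sg_sg, parity_add_self, A.sg_zero]

theorem SAlg.mem_grade_iff {i : ZMod 2} {a : A} : a ∈ A.grade i ↔ A.sg 1 a = sgn i • a := by
  constructor
  · intro h
    rw [A.sg_of_mem 1 h, one_mul]
  · intro h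
    have h1 : A.sg 1 a = (2 : ℕ) • ((DirectSum.decompose A.grade a 0 : A.grade 0) : A) - a := rfl
    rw [h] at h1
    rcases parity_cases i with rfl | rfl
    · rw [sgn_zero, one_smul, eq_sub_iff_add_eq, ← two_nsmul] at h1
      have h2 : a = (DirectSum.decompose A.grade a 0 : A.grade 0) := by
        rw [← sub_eq_zero]
        refine eq_zero_of_eq_neg ?_
        rw [eq_neg_iff_add_eq_zero, ← two_nsmul, smul_sub, h1, sub_self]
      rw [h2]
      exact SetLike.coe_mem _
    · rw [sgn_one, neg_one_smul, eq_sub_iff_add_eq, neg_add_cancel] at h1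
      have h2 : ((DirectSum.decompose A.grade a 0 : A.grade 0) : A) = 0 := by
        refine eq_zero_of_eq_neg ?_
        rw [eq_neg_iff_add_eq_zero, ← two_nsmul, ← h1]
      have h3 : a = (DirectSum.decompose A.grade a 0 : A.grade 0) +
          (DirectSum.decompose A.grade a 1 : A.grade 1) := by
        clear h h1 h2
        induction a using SAlg.induction with
        | hadd a b ha hb =>
          rw [DirectSum.decompose_add, DirectSum.add_apply, DirectSum.add_apply, Submodule.coe_add,
            Submodule.coe_add, add_add_add_comm, ← ha, ← hb]
        | h i a ha =>
          rcases parity_cases i with rfl | rfl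
          · rw [DirectSum.decompose_of_mem_same A.grade ha,
              DirectSum.decompose_of_mem_ne A.grade ha (by decide), add_zero]
          · rw [DirectSum.decompose_of_mem_same A.grade ha,
              DirectSum.decompose_of_mem_ne A.grade ha (by decide), zero_add]
      rw [h3, h2, zero_add]
      exact SetLike.coe_mem _

theorem SAlg.mul_eq_of_mem {q : ZMod 2} {x : A} (hx : x ∈ A.grade q) (a : A) :
    x * a = A.sg q a * x := by
  induction a using SAlg.induction with
  | hadd a b ha hb => rw [mul_add, ha, hb, map_add, add_mul]
  | h i a ha => rw [A.comm q i x a hx ha, A.sg_of_mem q ha, smul_mul_assoc]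

theorem SAlg.Hom.map_sg {A B : SAlg} (f : SAlg.Hom A B) (q : ZMod 2) (a : A) :
    f.toAlgHom (A.sg q a) = B.sg q (f.toAlgHom a) := by
  induction a using SAlg.induction with
  | hadd a b ha hb => simp only [map_add, ha, hb]
  | h i a ha => rw [A.sg_of_mem q ha, B.sg_of_mem q (f.map_grade i a ha), map_smul]

/-- Composition of homomorphisms. -/
def SAlg.Hom.comp {A B C : SAlg} (g : SAlg.Hom B C) (f : SAlg.Hom A B) : SAlg.Hom A C where
  toAlgHom := g.toAlgHom.comp f.toAlgHom
  map_grade i a ha := g.map_grade i _ (f.map_grade i a ha)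

/-- Homomorphisms from purely even superalgebras. -/
def SAlg.Hom.ofEven {R : Type} [CommRing R] [Algebra ℂ R] {B : SAlg} (f : R →ₐ[ℂ] B)
    (hf : ∀ a, f a ∈ B.grade 0) : SAlg.Hom (evenSAlg R) B where
  toAlgHom := f
  map_grade i a ha := by
    rcases parity_cases i with rfl | rfl
    · exact hf a
    · have h : a = sgn 1 • a := (mem_invGrade _).1 ha
      rw [sgn_one, neg_one_smul] at h
      rw [eq_zero_of_eq_neg h, map_zero]
      exact zero_mem _

theorem SAlg.mul_comm_of_mem {q : ZMod 2} {x : A} (hx : x ∈ A.grade q) (a : A) :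
    a * x = x * A.sg q a := by
  rw [A.mul_eq_of_mem hx, A.sg_self]

theorem SAlg.mul_self_of_odd {x : A} (hx : x ∈ A.grade 1) : x * x = 0 := by
  refine eq_zero_of_eq_neg ?_
  conv_lhs => rw [A.comm 1 1 x x hx hx]
  rw [mul_one, sgn_one, neg_one_smul]

/-! #### Adjoining an element of square zero -/

/-- The algebra `A ⊕ η A` with `η² = 0`, where `η` has parity `q`. -/
@[ext]
structure NilExt (A : SAlg) (q : ZMod 2) where
  fst : A
  snd : A

namespace NilExt

variable {A : SAlg} {q : ZMod 2}

/-- The underlying pair. -/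
def equivProd : NilExt A q ≃ A × A where
  toFun x := (x.fst, x.snd)
  invFun x := ⟨x.1, x.2⟩

instance : AddCommGroup (NilExt A q) := equivProd.addCommGroup

instance : Module ℂ (NilExt A q) := equivProd.module ℂ

instance : Mul (NilExt A q) := ⟨fun x y => ⟨x.1 * y.1, x.2 * y.1 + A.sg q x.1 * y.2⟩⟩

instance : One (NilExt A q) := ⟨⟨1, 0⟩⟩

theorem mul_fst (x y : NilExt A q) : (x * y).1 = x.1 * y.1 := rfl
theorem mul_snd (x y : NilExt A q) : (x * y).2 = x.2 * y.1 + A.sg q x.1 * y.2 := rfl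
theorem one_fst : (1 : NilExt A q).1 = 1 := rfl
theorem one_snd : (1 : NilExt A q).2 = 0 := rfl
theorem zero_fst : (0 : NilExt A q).1 = 0 := rfl
theorem zero_snd : (0 : NilExt A q).2 = 0 := rfl
theorem add_fst (x y : NilExt A q) : (x + y).1 = x.1 + y.1 := rfl
theorem add_snd (x y : NilExt A q) : (x + y).2 = x.2 + y.2 := rfl
theorem smul_fst (c : ℂ) (x : NilExt A q) : (c • x).1 = c • x.1 := rfl
theorem smul_snd (c : ℂ) (x : NilExt A q) : (c • x).2 = c • x.2 := rfl

instance : Ring (NilExt A q) :=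
  { (inferInstance : AddCommGroup (NilExt A q)) with
    mul := (· * ·)
    one := 1
    mul_assoc := fun x y z => by
      apply NilExt.ext
      · exact mul_assoc _ _ _
      · simp only [mul_snd, mul_fst, map_mul, add_mul, mul_add, mul_assoc, add_assoc]
    one_mul := fun x => by
      apply NilExt.ext <;> simp [mul_fst, mul_snd, one_fst, one_snd]
    mul_one := fun x => by
      apply NilExt.ext <;> simp [mul_fst, mul_snd, one_fst, one_snd]
    zero_mul := fun x => by
      apply NilExt.ext <;> simp [mul_fst, mul_snd, zero_fst, zero_snd]
    mul_zero := fun x => by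
      apply NilExt.ext <;> simp [mul_fst, mul_snd, zero_fst, zero_snd]
    left_distrib := fun x y z => by
      apply NilExt.ext
      · exact mul_add _ _ _
      · simp only [mul_snd, add_fst, add_snd, mul_add]; abel
    right_distrib := fun x y z => by
      apply NilExt.ext
      · exact add_mul _ _ _
      · simp only [mul_snd, add_fst, add_snd, add_mul, map_add]; abel }

instance : Algebra ℂ (NilExt A q) :=
  Algebra.ofModule
    (fun c x y => by
      apply NilExt.ext <;> simp [mul_fst, mul_snd, smul_fst, smul_snd])
    (fun c x y => by
      apply NilExt.ext <;> simp [mul_fst, mul_snd, smul_fst, smul_snd])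

/-- The grading involution. -/
def inv (A : SAlg) (q : ZMod 2) : NilExt A q →ₐ[ℂ] NilExt A q :=
  AlgHom.ofLinearMap
    { toFun := fun x => ⟨A.sg 1 x.1, sgn q • A.sg 1 x.2⟩
      map_add' := fun x y => by
        apply NilExt.ext <;> simp [add_fst, add_snd]
      map_smul' := fun c x => by
        apply NilExt.ext
        · simp [smul_fst]
        · simp only [smul_snd, map_smul, RingHom.id_apply]
          exact smul_comm _ _ _ }
    (by apply NilExt.ext <;> simp [one_fst, one_snd])
    (fun x y => by
      apply NilExt.ext
      · simp [mul_fst]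
      · simp only [LinearMap.coe_mk, AddHom.coe_mk, mul_snd, mul_fst, map_add, map_mul, smul_add,
          smul_mul_assoc, mul_smul_comm, A.sg_sg]
        rw [add_comm 1 q])

theorem inv_fst (x : NilExt A q) : (inv A q x).1 = A.sg 1 x.1 := rfl
theorem inv_snd (x : NilExt A q) : (inv A q x).2 = sgn q • A.sg 1 x.2 := rfl

theorem inv_eq_iff {x : NilExt A q} {i : ZMod 2} :
    inv A q x = sgn i • x ↔ x.1 ∈ A.grade i ∧ x.2 ∈ A.grade (q + i) := by
  rw [A.mem_grade_iff, A.mem_grade_iff, sgn_add]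
  constructor
  · intro h
    refine ⟨congrArg NilExt.fst h, ?_⟩
    have h2 : sgn q • A.sg 1 x.2 = sgn i • x.2 := congrArg NilExt.snd h
    rw [mul_smul, ← h2, smul_smul, sgn_mul_self, one_smul]
  · rintro ⟨h1, h2⟩
    apply NilExt.ext
    · exact h1
    · rw [inv_snd, h2, smul_smul, sgn_mul_sgn_inv]
      rfl

end NilExt

/-- The superalgebra `A[η]` with `η² = 0`, where `η` has parity `q`. -/
abbrev SAlg.nil (A : SAlg) (q : ZMod 2) : SAlg :=
  SAlg.ofInvolution (NilExt A q) (NilExt.inv A q)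
    (fun a => by
      apply NilExt.ext
      · simp [NilExt.inv_fst, A.sg_self]
      · simp [NilExt.inv_snd, A.sg_self, smul_smul, sgn_mul_self])
    (fun i j x y hx hy => by
      rw [NilExt.inv_eq_iff] at hx hy
      obtain ⟨ha, hb⟩ := hx
      obtain ⟨hc, hd⟩ := hy
      apply NilExt.ext
      · exact A.comm i j _ _ ha hc
      · rw [NilExt.smul_snd, NilExt.mul_snd, NilExt.mul_snd, A.sg_of_mem q ha, A.sg_of_mem q hc,
          A.comm _ _ _ _ hb hc, smul_mul_assoc, smul_mul_assoc, A.comm _ _ _ _ ha hd, smul_smul,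
          smul_add, smul_smul, ← sgn_add, ← sgn_add, add_comm]
        have e1 : ∀ q i j : ZMod 2, q * i + i * (q + j) = i * j := by decide
        have e2 : ∀ q i j : ZMod 2, (q + i) * j = i * j + q * j := by decide
        rw [e1, e2])

variable {A} {q : ZMod 2}

theorem SAlg.mem_nil_grade {x : A.nil q} {i : ZMod 2} :
    x ∈ (A.nil q).grade i ↔ x.1 ∈ A.grade i ∧ x.2 ∈ A.grade (q + i) :=
  (mem_invGrade _).trans NilExt.inv_eq_iff

/-- The inclusion of `A` into `A[η]`. -/
def SAlg.nilInc (A : SAlg) (q : ZMod 2) : SAlg.Hom A (A.nil q) where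
  toAlgHom := AlgHom.ofLinearMap (B := NilExt A q)
    { toFun := fun a => ⟨a, 0⟩
      map_add' := fun a b => by apply NilExt.ext <;> simp [NilExt.add_fst, NilExt.add_snd]
      map_smul' := fun c a => by apply NilExt.ext <;> simp [NilExt.smul_fst, NilExt.smul_snd] }
    rfl
    (fun x y => by apply NilExt.ext <;> simp [NilExt.mul_fst, NilExt.mul_snd])
  map_grade i a ha := SAlg.mem_nil_grade.2 ⟨ha, zero_mem _⟩

/-- The element `η` of `A[η]`. -/
def SAlg.eta (A : SAlg) (q : ZMod 2) : A.nil q := NilExt.mk 0 1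

theorem SAlg.eta_mem : A.eta q ∈ (A.nil q).grade q :=
  SAlg.mem_nil_grade.2 ⟨zero_mem _, by
    rw [parity_add_self]; exact SetLike.GradedOne.one_mem (A := A.grade)⟩

theorem SAlg.eta_mul_inc (a : A) : A.eta q * (A.nilInc q).toAlgHom a = NilExt.mk 0 a := by
  apply NilExt.ext
  · exact zero_mul a
  · change 1 * a + A.sg q 0 * 0 = a
    rw [one_mul, mul_zero, add_zero]

theorem SAlg.eta_mul_eta : A.eta q * A.eta q = 0 := by
  apply NilExt.ext
  · exact zero_mul (0 : A)
  · change 1 * 0 + A.sg q 0 * 1 = (0 : A)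
    rw [mul_zero, map_zero, zero_mul, add_zero]

theorem SAlg.nil_eq (x : A.nil q) :
    x = (A.nilInc q).toAlgHom x.1 + A.eta q * (A.nilInc q).toAlgHom x.2 := by
  rw [SAlg.eta_mul_inc]
  apply NilExt.ext
  · exact (add_zero x.1).symm
  · exact (zero_add x.2).symm

/-- The homomorphism from `A[η]` defined by a homomorphism from `A` and the image of `η`. -/
def SAlg.nilLift {B : SAlg} (f : SAlg.Hom A B) (y : B) (hy : y ∈ B.grade q) (hyy : y * y = 0) :
    SAlg.Hom (A.nil q) B where
  toAlgHom := AlgHom.ofLinearMap (A := NilExt A q)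
    { toFun := fun x => f.toAlgHom x.1 + y * f.toAlgHom x.2
      map_add' := fun a b => by simp only [NilExt.add_fst, NilExt.add_snd, map_add, mul_add]; abel
      map_smul' := fun c a => by
        simp only [NilExt.smul_fst, NilExt.smul_snd, map_smul, mul_smul_comm, smul_add,
          RingHom.id_apply] }
    (by simp [NilExt.one_fst, NilExt.one_snd])
    (fun a b => by
      simp only [LinearMap.coe_mk, AddHom.coe_mk, NilExt.mul_fst, NilExt.mul_snd, map_mul, map_add,
        f.map_sg, mul_add, add_mul]
      have h1 : f.toAlgHom a.1 * (y * f.toAlgHom b.2) =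
          y * (B.sg q (f.toAlgHom a.1) * f.toAlgHom b.2) := by
        rw [← mul_assoc, B.mul_comm_of_mem hy, mul_assoc]
      have h2 : y * f.toAlgHom a.2 * (y * f.toAlgHom b.2) = 0 := by
        rw [mul_assoc, ← mul_assoc (f.toAlgHom a.2), B.mul_comm_of_mem hy, ← mul_assoc, ← mul_assoc,
          hyy, zero_mul, zero_mul]
      rw [h1, h2]
      simp only [mul_assoc]
      abel)
  map_grade i a ha := by
    obtain ⟨h1, h2⟩ := SAlg.mem_nil_grade.1 ha
    refine add_mem (f.map_grade _ _ h1) ?_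
    have := SetLike.mul_mem_graded hy (f.map_grade _ _ h2)
    rwa [← add_assoc, parity_add_self, zero_add] at this

theorem SAlg.nilLift_apply {B : SAlg} (f : SAlg.Hom A B) (y : B) (hy : y ∈ B.grade q)
    (hyy : y * y = 0) (x : A.nil q) :
    (SAlg.nilLift f y hy hyy).toAlgHom x = f.toAlgHom x.1 + y * f.toAlgHom x.2 := rfl

theorem SAlg.nilLift_eta {B : SAlg} (f : SAlg.Hom A B) (y : B) (hy : y ∈ B.grade q)
    (hyy : y * y = 0) : (SAlg.nilLift f y hy hyy).toAlgHom (A.eta q) = y := by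
  rw [SAlg.nilLift_apply]
  change f.toAlgHom 0 + y * f.toAlgHom 1 = y
  rw [map_zero, map_one, mul_one, zero_add]

theorem SAlg.nilInc_fst (a : A) : ((A.nilInc q).toAlgHom a).1 = a := rfl

theorem SAlg.nilInc_snd (a : A) : ((A.nilInc q).toAlgHom a).2 = 0 := rfl

/-- The unique homomorphism from `ℂ`. -/
def SAlg.ofComplex (A : SAlg) : SAlg.Hom complexSAlg A where
  toAlgHom := Algebra.ofId ℂ A
  map_grade i a ha := by
    rcases parity_cases i with rfl | rfl
    · rw [Algebra.ofId_apply, Algebra.algebraMap_eq_smul_one]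
      exact Submodule.smul_mem _ _ (SetLike.GradedOne.one_mem (A := A.grade))
    · rw [eq_zero_of_mem_complexGrade (by decide) ha, map_zero]
      exact zero_mem _

end Superalgebras

/-! ### The points of `SL(n,m)` -/

section Points

/-- The inclusion of the even part. -/
def SAlg.evenHom (A : SAlg) : A.grade 0 →+* A where
  toFun := Subtype.val
  map_one' := rfl
  map_mul' _ _ := rfl
  map_zero' := rfl
  map_add' _ _ := rfl

theorem SAlg.evenHom_apply {A : SAlg} (a : A.grade 0) : A.evenHom a = (a : A) := rfl

theorem SAlg.even_coe {A : SAlg} (a : A.grade 0) : A.even (a : A) = a := by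
  rw [SAlg.even, DirectSum.decompose_coe, DirectSum.of_eq_same]

theorem SAlg.one_mem (A : SAlg) : (1 : A) ∈ A.grade 0 := SetLike.GradedOne.one_mem (A := A.grade)

variable {n m : ℕ} {A : SAlg}

/-- The supermatrix `(1 b; 0 1)`. -/
def uPlus (b : Matrix (Fin n) (Fin m) A) : SMat n m A := fromBlocks 1 b 0 1

/-- The supermatrix `(1 0; c 1)`. -/
def uMinus (c : Matrix (Fin m) (Fin n) A) : SMat n m A :=
  fromBlocks 1 0 c 1

/-- The supermatrix `(a 0; 0 d)`. -/
def dg (a : SqMat n (A.grade 0)) (d : SqMat m (A.grade 0)) :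
    SMat n m A :=
  fromBlocks (a.map A.evenHom) 0 0 (d.map A.evenHom)

/-- Matrices with odd entries. -/
def IsOddMat {ι κ : Type} (b : Matrix ι κ A) : Prop := ∀ i j, b i j ∈ A.grade 1

theorem exists_map_evenHom {ι κ : Type} {x : Matrix ι κ A} (hx : ∀ i j, x i j ∈ A.grade 0) :
    ∃ y : Matrix ι κ (A.grade 0), y.map A.evenHom = x :=
  ⟨Matrix.of fun i j => ⟨x i j, hx i j⟩, rfl⟩

theorem mul_mem_grade {i j k : ZMod 2} {x y : A} (hx : x ∈ A.grade i) (hy : y ∈ A.grade j)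
    (h : i + j = k) : x * y ∈ A.grade k := h ▸ SetLike.mul_mem_graded hx hy

theorem mul_mem_matrix {ι κ μ : Type} [Fintype κ] {i j k : ZMod 2} {x : Matrix ι κ A}
    {y : Matrix κ μ A} (hx : ∀ r s, x r s ∈ A.grade i) (hy : ∀ r s, y r s ∈ A.grade j)
    (h : i + j = k) (r : ι) (s : μ) : (x * y) r s ∈ A.grade k := by
  rw [Matrix.mul_apply]
  exact sum_mem fun t _ => mul_mem_grade (hx r t) (hy t s) h

theorem map_evenHom_mem {ι κ : Type} (a : Matrix ι κ (A.grade 0)) (i : ι) (j : κ) :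
    a.map A.evenHom i j ∈ A.grade 0 := (a i j).2

theorem map_inv_mul {k : ℕ} {d : SqMat k (A.grade 0)} (hd : IsUnit d.det) :
    d⁻¹.map A.evenHom * d.map A.evenHom = 1 := by
  rw [← Matrix.map_mul, Matrix.nonsing_inv_mul _ hd, Matrix.map_one _ (map_zero _) (map_one _)]

theorem map_mul_inv {k : ℕ} {d : SqMat k (A.grade 0)} (hd : IsUnit d.det) :
    d.map A.evenHom * d⁻¹.map A.evenHom = 1 := by
  rw [← Matrix.map_mul, mul_nonsing_inv _ hd, Matrix.map_one _ (map_zero _) (map_one _)]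

theorem uPlus_mul_dg_mul_uMinus (b : Matrix (Fin n) (Fin m) A) (c : Matrix (Fin m) (Fin n) A)
    (a : SqMat n (A.grade 0)) (d : SqMat m (A.grade 0)) :
    uPlus b * dg a d * uMinus c =
      fromBlocks (a.map A.evenHom + b * d.map A.evenHom * c) (b * d.map A.evenHom)
        (d.map A.evenHom * c) (d.map A.evenHom) := by
  simp [uPlus, dg, uMinus, fromBlocks_multiply]

theorem blockD_fromBlocks (x : SqMat n A) (y : Matrix (Fin n) (Fin m) A)
    (z : Matrix (Fin m) (Fin n) A) (d : SqMat m (A.grade 0)) :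
    blockD A (fromBlocks x y z (d.map A.evenHom)) = d := by
  ext p q
  simp [blockD, SAlg.evenHom_apply, SAlg.even_coe]

theorem schurComplement_fromBlocks (x : SqMat n A) (y : Matrix (Fin n) (Fin m) A)
    (z : Matrix (Fin m) (Fin n) A) (d : SqMat m (A.grade 0)) :
    schurComplement A (fromBlocks x y z (d.map A.evenHom)) =
      (x - y * d⁻¹.map A.evenHom * z).map A.even := by
  ext1 i j
  rw [schurComplement, blockD_fromBlocks, of_apply, map_apply, Matrix.sub_apply, Matrix.mul_apply]
  congr 2
  simp only [Matrix.mul_apply, sum_mul]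
  rw [sum_comm]
  rfl

/-- Supermatrices that factor as `(1 b; 0 1) (a 0; 0 d) (1 0; c 1)` with `det a = det d`. -/
def IsFactored (g : SMat n m A) : Prop :=
  ∃ (b : Matrix (Fin n) (Fin m) A) (c : Matrix (Fin m) (Fin n) A)
    (a : SqMat n (A.grade 0)) (d : SqMat m (A.grade 0)),
    IsOddMat b ∧ IsOddMat c ∧ IsUnit d.det ∧ a.det = d.det ∧ g = uPlus b * dg a d * uMinus c

theorem uPlus_add (b b' : Matrix (Fin n) (Fin m) A) : uPlus (b + b') = uPlus b * uPlus b' := by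
  simp [uPlus, fromBlocks_multiply, add_comm]

theorem uMinus_add (c c' : Matrix (Fin m) (Fin n) A) : uMinus (c + c') = uMinus c * uMinus c' := by
  simp [uMinus, fromBlocks_multiply]

theorem uPlus_zero : uPlus (0 : Matrix (Fin n) (Fin m) A) = 1 := fromBlocks_one

theorem uMinus_zero : uMinus (0 : Matrix (Fin m) (Fin n) A) = 1 := fromBlocks_one

theorem dg_one : dg (1 : SqMat n (A.grade 0))
    (1 : SqMat m (A.grade 0)) = 1 := by
  rw [dg, Matrix.map_one _ (map_zero _) (map_one _), Matrix.map_one _ (map_zero _) (map_one _),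
    fromBlocks_one]

theorem dg_mul (a a' : SqMat n (A.grade 0))
    (d d' : SqMat m (A.grade 0)) : dg (a * a') (d * d') = dg a d * dg a' d' := by
  simp [dg, fromBlocks_multiply, Matrix.map_mul]

theorem isUnit_of_mul_eq_one_and {M : Type} [Monoid M] {a b : M} (h : a * b = 1)
    (h' : b * a = 1) : IsUnit a := ⟨⟨a, b, h, h'⟩, rfl⟩

theorem isUnit_uPlus (b : Matrix (Fin n) (Fin m) A) : IsUnit (uPlus b) :=
  isUnit_of_mul_eq_one_and (b := uPlus (-b))
    (by rw [← uPlus_add, add_neg_cancel, uPlus_zero])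
    (by rw [← uPlus_add, neg_add_cancel, uPlus_zero])

theorem isUnit_uMinus (b : Matrix (Fin m) (Fin n) A) : IsUnit (uMinus b) :=
  isUnit_of_mul_eq_one_and (b := uMinus (-b))
    (by rw [← uMinus_add, add_neg_cancel, uMinus_zero])
    (by rw [← uMinus_add, neg_add_cancel, uMinus_zero])

theorem isUnit_dg {a : SqMat n (A.grade 0)}
    {d : SqMat m (A.grade 0)} (ha : IsUnit a.det) (hd : IsUnit d.det) :
    IsUnit (dg a d) :=
  isUnit_of_mul_eq_one_and (b := dg a⁻¹ d⁻¹)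
    (by rw [← dg_mul, mul_nonsing_inv _ ha, mul_nonsing_inv _ hd, dg_one])
    (by rw [← dg_mul, Matrix.nonsing_inv_mul _ ha, Matrix.nonsing_inv_mul _ hd, dg_one])

theorem mem_SLPoints_iff {g : SMat n m A} : g ∈ SLPoints n m A ↔ IsFactored g := by
  constructor
  · rintro ⟨he, -, hB⟩
    obtain ⟨d, hd⟩ := exists_map_evenHom (x := g.toBlocks₂₂) fun p q => he (inr p) (inr q)
    have hb : IsOddMat g.toBlocks₁₂ := fun i p => he (inl i) (inr p)
    have hc : IsOddMat g.toBlocks₂₁ := fun p i => he (inr p) (inl i)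
    have hg : g = fromBlocks g.toBlocks₁₁ g.toBlocks₁₂ g.toBlocks₂₁ (d.map A.evenHom) := by
      rw [hd, Matrix.fromBlocks_toBlocks]
    have hdu : IsUnit d.det := by
      by_contra h
      rw [hg, berezinian, blockD_fromBlocks, Ring.inverse_non_unit _ h, mul_zero] at hB
      have := subsingleton_of_zero_eq_one hB
      exact h (isUnit_of_subsingleton _)
    have hdi := map_evenHom_mem d⁻¹
    obtain ⟨a, ha⟩ := exists_map_evenHom
      (x := g.toBlocks₁₁ - g.toBlocks₁₂ * d⁻¹.map A.evenHom * g.toBlocks₂₁) fun i j =>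
        sub_mem (he (inl i) (inl j))
          (mul_mem_matrix (mul_mem_matrix hb hdi (add_zero 1)) hc (parity_add_self 1) i j)
    refine ⟨g.toBlocks₁₂ * d⁻¹.map A.evenHom, d⁻¹.map A.evenHom * g.toBlocks₂₁, a, d,
      mul_mem_matrix hb hdi (add_zero 1), mul_mem_matrix hdi hc (zero_add 1), hdu, ?_, ?_⟩
    · rw [hg, berezinian, blockD_fromBlocks, schurComplement_fromBlocks, ← ha] at hB
      have : (a.map A.evenHom).map A.even = a := by
        ext1 i j
        exact SAlg.even_coe _
      rw [this] at hB
      have h2 := congrArg (· * d.det) hB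
      simpa [mul_assoc, Ring.inverse_mul_cancel _ hdu] using h2
    · rw [uPlus_mul_dg_mul_uMinus, ha]
      conv_lhs => rw [hg]
      congr 1
      · rw [Matrix.mul_assoc g.toBlocks₁₂ (d⁻¹.map A.evenHom) (d.map A.evenHom), map_inv_mul hdu,
          Matrix.mul_one, ← Matrix.mul_assoc, sub_add_cancel]
      · rw [Matrix.mul_assoc, map_inv_mul hdu, Matrix.mul_one]
      · rw [← Matrix.mul_assoc, map_mul_inv hdu, Matrix.one_mul]
  · rintro ⟨b, c, a, d, hb, hc, hd, had, rfl⟩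
    have hd0 := map_evenHom_mem d
    have ha0 := map_evenHom_mem a
    refine ⟨?_, ((isUnit_uPlus b).mul (isUnit_dg (had ▸ hd) hd)).mul (isUnit_uMinus c), ?_⟩
    · rw [uPlus_mul_dg_mul_uMinus]
      rintro (i | p) (j | q)
      · exact add_mem (ha0 i j) (mul_mem_matrix (mul_mem_matrix hb hd0 (add_zero 1)) hc
          (parity_add_self 1) i j)
      · exact mul_mem_matrix hb hd0 (add_zero 1) i q
      · exact mul_mem_matrix hd0 hc (zero_add 1) p j
      · exact hd0 p q
    · rw [uPlus_mul_dg_mul_uMinus, berezinian, blockD_fromBlocks, schurComplement_fromBlocks]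
      have : (a.map A.evenHom + b * d.map A.evenHom * c -
          b * d.map A.evenHom * d⁻¹.map A.evenHom * (d.map A.evenHom * c)).map A.even = a := by
        rw [Matrix.mul_assoc b _ (d⁻¹.map A.evenHom), map_mul_inv hd, Matrix.mul_one,
          ← Matrix.mul_assoc, add_sub_cancel_right]
        ext1 i j
        exact SAlg.even_coe _
      rw [this, had, Ring.mul_inverse_cancel _ hd]

theorem IsFactored.one : IsFactored (1 : SMat n m A) :=
  ⟨0, 0, 1, 1, fun _ _ => zero_mem _, fun _ _ => zero_mem _, by simp, by simp, by
    rw [uPlus_zero, uMinus_zero, dg_one, one_mul, one_mul]⟩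

theorem IsFactored.uPlus_mul {b : Matrix (Fin n) (Fin m) A} (hb : IsOddMat b)
    {g : SMat n m A} (hg : IsFactored g) : IsFactored (uPlus b * g) := by
  obtain ⟨b', c, a, d, hb', hc, hd, had, rfl⟩ := hg
  exact ⟨b + b', c, a, d, fun i j => add_mem (hb i j) (hb' i j), hc, hd, had, by
    rw [uPlus_add]; simp only [mul_assoc]⟩

theorem dg_mul_uPlus {a : SqMat n (A.grade 0)}
    {d : SqMat m (A.grade 0)} (hd : IsUnit d.det) (b : Matrix (Fin n) (Fin m) A) :
    dg a d * uPlus b = uPlus (a.map A.evenHom * b * d⁻¹.map A.evenHom) * dg a d := by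
  simp [dg, uPlus, fromBlocks_multiply, Matrix.mul_assoc, map_inv_mul hd]

theorem uMinus_mul_dg {a : SqMat n (A.grade 0)}
    {d : SqMat m (A.grade 0)} (hd : IsUnit d.det) (c : Matrix (Fin m) (Fin n) A) :
    uMinus c * dg a d = dg a d * uMinus (d⁻¹.map A.evenHom * c * a.map A.evenHom) := by
  simp only [dg, uMinus, fromBlocks_multiply, Matrix.mul_one, Matrix.one_mul, Matrix.mul_zero,
    Matrix.zero_mul, add_zero, zero_add]
  rw [← Matrix.mul_assoc, ← Matrix.mul_assoc, map_mul_inv hd, Matrix.one_mul]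

theorem IsFactored.dg_mul {a : SqMat n (A.grade 0)}
    {d : SqMat m (A.grade 0)} (hd : IsUnit d.det) (had : a.det = d.det)
    {g : SMat n m A} (hg : IsFactored g) : IsFactored (dg a d * g) := by
  obtain ⟨b, c, a', d', hb, hc, hd', had', rfl⟩ := hg
  refine ⟨a.map A.evenHom * b * d⁻¹.map A.evenHom, c, a * a', d * d', ?_, hc, ?_, ?_, ?_⟩
  · exact mul_mem_matrix (mul_mem_matrix (map_evenHom_mem a) hb (zero_add 1))
      (map_evenHom_mem d⁻¹) (add_zero 1)
  · rw [det_mul]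
    exact hd.mul hd'
  · rw [det_mul, det_mul, had, had']
  · rw [SuperSL.dg_mul, ← mul_assoc, ← mul_assoc, dg_mul_uPlus hd]
    simp only [mul_assoc]

theorem IsFactored.mul_uMinus {c : Matrix (Fin m) (Fin n) A} (hc : IsOddMat c)
    {g : SMat n m A} (hg : IsFactored g) : IsFactored (g * uMinus c) := by
  obtain ⟨b, c', a, d, hb, hc', hd, had, rfl⟩ := hg
  exact ⟨b, c' + c, a, d, hb, fun i j => add_mem (hc' i j) (hc i j), hd, had, by
    rw [uMinus_add]; simp only [mul_assoc]⟩

theorem IsFactored.mul_dg {a : SqMat n (A.grade 0)}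
    {d : SqMat m (A.grade 0)} (hd : IsUnit d.det) (had : a.det = d.det)
    {g : SMat n m A} (hg : IsFactored g) : IsFactored (g * dg a d) := by
  obtain ⟨b, c, a', d', hb, hc, hd', had', rfl⟩ := hg
  refine ⟨b, d⁻¹.map A.evenHom * c * a.map A.evenHom, a' * a, d' * d, hb, ?_, ?_, ?_, ?_⟩
  · exact mul_mem_matrix (mul_mem_matrix (map_evenHom_mem d⁻¹) hc (zero_add 1))
      (map_evenHom_mem a) (add_zero 1)
  · rw [det_mul]
    exact hd'.mul hd
  · rw [det_mul, det_mul, had, had']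
  · rw [SuperSL.dg_mul, mul_assoc, uMinus_mul_dg hd]
    simp only [mul_assoc]

theorem det_one_add_vecMulVec_single {R : Type} [CommRing R] {k : ℕ} (p : Fin k) (x : Fin k → R) :
    (1 + vecMulVec (Pi.single p 1) x).det = 1 + x p := by
  rw [Matrix.vecMulVec_eq Unit, Matrix.det_one_add_replicateCol_mul_replicateRow, dotProduct_single,
    mul_one]

theorem det_one_add_vecMulVec_single' {R : Type} [CommRing R] {k : ℕ} (p : Fin k) (x : Fin k → R) :
    (1 + vecMulVec x (Pi.single p 1)).det = 1 + x p := by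
  rw [Matrix.vecMulVec_eq Unit, Matrix.det_one_add_replicateCol_mul_replicateRow, single_dotProduct,
    one_mul]

theorem isFactored_single_mul_uPlus {ξ : A} (hξ : ξ ∈ A.grade 1) (p : Fin m) (i : Fin n)
    {b : Matrix (Fin n) (Fin m) A} (hb : IsOddMat b) :
    IsFactored (uMinus (Matrix.single p i ξ) * uPlus b) := by
  have hξb : ∀ q, ξ * b i q ∈ A.grade 0 := fun q => mul_mem_grade hξ (hb i q) (parity_add_self 1)
  have hbξ : ∀ j, b j p * ξ ∈ A.grade 0 := fun j => mul_mem_grade (hb j p) hξ (parity_add_self 1)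
  set c : Matrix (Fin m) (Fin n) A := Matrix.single p i ξ with hc
  have hcodd : IsOddMat c := by
    intro q j
    rw [hc, Matrix.single_apply]
    split_ifs
    · exact hξ
    · exact zero_mem _
  have hξξ : ∀ x : A, ξ * x * ξ = 0 := by
    intro x
    rw [mul_assoc, A.mul_comm_of_mem hξ, ← mul_assoc, A.mul_self_of_odd hξ, zero_mul]
  have hcbc : c * b * c = 0 := by
    rw [hc, Matrix.single_mul_mul_single, hξξ, Matrix.single_zero]
  set d : SqMat m (A.grade 0) := 1 +
    vecMulVec (Pi.single p 1) (fun q => (⟨ξ * b i q, hξb q⟩ : A.grade 0)) with hd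
  set a : SqMat n (A.grade 0) := 1 +
    vecMulVec (fun j => -(⟨b j p * ξ, hbξ j⟩ : A.grade 0)) (Pi.single i 1) with ha
  have hdm : d.map A.evenHom = 1 + c * b := by
    ext r q
    simp only [hd, map_apply, Matrix.add_apply, map_add, hc]
    congr 1
    · rw [one_apply, one_apply]
      split_ifs <;> simp
    · by_cases h : r = p
      · subst h
        simp [vecMulVec_apply, SAlg.evenHom_apply]
      · simp [vecMulVec_apply, h]
  have ham : a.map A.evenHom = 1 - b * c := by
    ext r q
    simp only [ha, map_apply, Matrix.add_apply, map_add, hc, Matrix.sub_apply, sub_eq_add_neg]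
    congr 1
    · rw [one_apply, one_apply]
      split_ifs <;> simp
    · by_cases h : q = i
      · subst h
        simp [vecMulVec_apply, SAlg.evenHom_apply]
      · simp [vecMulVec_apply, h]
  have hddet : d.det = 1 + ⟨ξ * b i p, hξb p⟩ := by
    rw [hd, det_one_add_vecMulVec_single]
  have hadet : a.det = 1 + ⟨ξ * b i p, hξb p⟩ := by
    rw [ha, det_one_add_vecMulVec_single']
    congr 1
    apply Subtype.ext
    change -(b i p * ξ) = ξ * b i p
    rw [A.comm 1 1 ξ _ hξ (hb i p), mul_one, sgn_one, neg_one_smul]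
  have hunit : IsUnit d.det := by
    rw [hddet]
    refine IsUnit.of_mul_eq_one (1 - ⟨ξ * b i p, hξb p⟩) ?_
    have : (⟨ξ * b i p, hξb p⟩ : A.grade 0) * ⟨ξ * b i p, hξb p⟩ = 0 := by
      apply Subtype.ext
      change ξ * b i p * (ξ * b i p) = 0
      rw [← mul_assoc, hξξ, zero_mul]
    linear_combination -this
  have hdc : d.map A.evenHom * c = c := by
    rw [hdm, Matrix.add_mul, Matrix.one_mul, hcbc, add_zero]
  refine ⟨b * d⁻¹.map A.evenHom, c, a, d, mul_mem_matrix hb (map_evenHom_mem d⁻¹) (add_zero 1),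
    hcodd, hunit, hadet.trans hddet.symm, ?_⟩
  rw [uPlus_mul_dg_mul_uMinus, Matrix.mul_assoc b, map_inv_mul hunit, Matrix.mul_one, hdc, ham,
    sub_add_cancel, hdm, uMinus, uPlus, fromBlocks_multiply]
  simp [add_comm]

theorem IsFactored.uMinus_mul {c : Matrix (Fin m) (Fin n) A} (hc : IsOddMat c)
    {g : SMat n m A} (hg : IsFactored g) : IsFactored (uMinus c * g) := by
  have key : ∀ c : Matrix (Fin m) (Fin n) A, IsOddMat c →
      ∀ g : SMat n m A, IsFactored g → IsFactored (uMinus c * g) := by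
    intro c hc
    rw [Matrix.matrix_eq_sum_single c]
    refine sum_induction _ (fun c => ∀ g : SMat n m A, IsFactored g →
      IsFactored (uMinus c * g)) ?_ ?_ ?_
    · intro x y hx hy g hg
      rw [uMinus_add, mul_assoc]
      exact hx _ (hy _ hg)
    · intro g hg
      rwa [uMinus_zero, one_mul]
    · intro p _
      refine sum_induction _ (fun c => ∀ g : SMat n m A, IsFactored g →
        IsFactored (uMinus c * g)) ?_ ?_ ?_
      · intro x y hx hy g hg
        rw [uMinus_add, mul_assoc]
        exact hx _ (hy _ hg)
      · intro g hg
        rwa [uMinus_zero, one_mul]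
      · rintro i _ g ⟨b, c', a, d, hb, hc', hd, had, rfl⟩
        have h := ((isFactored_single_mul_uPlus (hc p i) p i hb).mul_dg hd had).mul_uMinus hc'
        simpa only [mul_assoc] using h
  exact key c hc g hg

theorem SLPoints.mul_mem {g h : SMat n m A} (hg : g ∈ SLPoints n m A)
    (hh : h ∈ SLPoints n m A) : g * h ∈ SLPoints n m A := by
  rw [mem_SLPoints_iff] at *
  obtain ⟨b, c, a, d, hb, hc, hd, had, rfl⟩ := hg
  rw [mul_assoc, mul_assoc]
  exact (((hh.uMinus_mul hc).dg_mul hd had).uPlus_mul hb)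

theorem SLPoints.one_mem : (1 : SMat n m A) ∈ SLPoints n m A :=
  mem_SLPoints_iff.2 IsFactored.one

theorem uPlus_mem {b : Matrix (Fin n) (Fin m) A} (hb : IsOddMat b) : uPlus b ∈ SLPoints n m A := by
  rw [mem_SLPoints_iff, ← mul_one (uPlus b)]
  exact IsFactored.one.uPlus_mul hb

theorem uMinus_mem {b : Matrix (Fin m) (Fin n) A} (hb : IsOddMat b) :
    uMinus b ∈ SLPoints n m A := by
  rw [mem_SLPoints_iff, ← mul_one (uMinus b)]
  exact IsFactored.one.uMinus_mul hb

theorem dg_mem {a : SqMat n (A.grade 0)}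
    {d : SqMat m (A.grade 0)} (hd : IsUnit d.det) (had : a.det = d.det) :
    dg a d ∈ SLPoints n m A := by
  rw [mem_SLPoints_iff, ← mul_one (dg a d)]
  exact IsFactored.one.dg_mul hd had

theorem one_add_single_inl (i j : Fin n) (x : A.grade 0) :
    (1 + Matrix.single (inl i) (inl j) (x : A) : SMat n m A) =
      dg (transvection i j x) 1 := by
  rw [dg, Matrix.map_one _ (map_zero _) (map_one _), transvection]
  ext (r | r) (s | s) <;> simp [one_apply, Matrix.single_apply, SAlg.evenHom_apply]
  split_ifs <;> simp

theorem one_add_single_inr (i j : Fin m) (x : A.grade 0) :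
    (1 + Matrix.single (inr i) (inr j) (x : A) : SMat n m A) =
      dg 1 (transvection i j x) := by
  rw [dg, Matrix.map_one _ (map_zero _) (map_one _), transvection]
  ext (r | r) (s | s) <;> simp [one_apply, Matrix.single_apply, SAlg.evenHom_apply]
  split_ifs <;> simp

theorem uPlus_single (i : Fin n) (p : Fin m) (x : A) :
    uPlus (Matrix.single i p x) = 1 + Matrix.single (inl i) (inr p) x := by
  rw [uPlus]
  ext (r | r) (s | s) <;> simp [one_apply, Matrix.single_apply]

theorem uMinus_single (i : Fin n) (p : Fin m) (x : A) :
    uMinus (Matrix.single p i x) = 1 + Matrix.single (inr p) (inl i) x := by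
  rw [uMinus]
  ext (r | r) (s | s) <;> simp [one_apply, Matrix.single_apply]

theorem isOddMat_single {ι κ : Type} [DecidableEq ι] [DecidableEq κ] (i : ι) (j : κ) {x : A}
    (hx : x ∈ A.grade 1) : IsOddMat (Matrix.single i j x) := by
  intro r s
  rw [Matrix.single_apply]
  split_ifs
  · exact hx
  · exact zero_mem _

theorem one_add_single_mem {i j : Idx n m} (hij : i ≠ j) {x : A}
    (hx : x ∈ A.grade (stdParity i + stdParity j)) : 1 + Matrix.single i j x ∈ SLPoints n m A := by
  rcases i with i | i <;> rcases j with j | j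
  · have h0 : x ∈ A.grade 0 := hx
    have hij' : i ≠ j := fun h => hij (congrArg _ h)
    rw [show x = ((⟨x, h0⟩ : A.grade 0) : A) from rfl, one_add_single_inl]
    exact dg_mem (by simp) (by rw [Matrix.det_transvection_of_ne _ _ hij', det_one])
  · rw [← uPlus_single]
    exact uPlus_mem (isOddMat_single _ _ hx)
  · rw [← uMinus_single]
    exact uMinus_mem (isOddMat_single _ _ hx)
  · have h0 : x ∈ A.grade 0 := hx
    have hij' : i ≠ j := fun h => hij (congrArg _ h)
    rw [show x = ((⟨x, h0⟩ : A.grade 0) : A) from rfl, one_add_single_inr]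
    exact dg_mem (by rw [Matrix.det_transvection_of_ne _ _ hij']; exact isUnit_one)
      (by rw [Matrix.det_transvection_of_ne _ _ hij', det_one])

theorem diagonal_eq_dg (t : Idx n m → A.grade 0) :
    (diagonal (fun j => (t j : A)) : SMat n m A) =
      dg (diagonal fun i => t (inl i)) (diagonal fun i => t (inr i)) := by
  rw [dg]
  ext (r | r) (s | s) <;> simp [Matrix.diagonal_apply, SAlg.evenHom_apply] <;>
    split_ifs <;> simp

theorem diagonal_mem {t : Idx n m → A.grade 0} (hu : IsUnit (∏ p, t (inr p)))
    (ht : ∏ i, t (inl i) = ∏ p, t (inr p)) :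
    diagonal (fun j => (t j : A)) ∈ SLPoints n m A := by
  rw [diagonal_eq_dg]
  exact dg_mem (by rwa [det_diagonal]) (by rw [det_diagonal, det_diagonal, ht])

/-- The restriction of a homomorphism to the even parts. -/
def SAlg.Hom.evenMap {A B : SAlg} (f : SAlg.Hom A B) : A.grade 0 →+* B.grade 0 where
  toFun a := ⟨f.toAlgHom a, f.map_grade 0 a a.2⟩
  map_one' := Subtype.ext (map_one f.toAlgHom)
  map_mul' _ _ := Subtype.ext (map_mul f.toAlgHom _ _)
  map_zero' := Subtype.ext (map_zero f.toAlgHom)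
  map_add' _ _ := Subtype.ext (map_add f.toAlgHom _ _)

theorem dg_map {A B : SAlg} (f : SAlg.Hom A B) (a : SqMat n (A.grade 0))
    (d : SqMat m (A.grade 0)) :
    (dg a d).map f.toAlgHom = dg (a.map f.evenMap) (d.map f.evenMap) := by
  rw [dg, dg]
  ext (r | r) (s | s) <;> simp <;> rfl

theorem SLPoints.map_mem {A B : SAlg} (f : SAlg.Hom A B) {g : SMat n m A}
    (hg : g ∈ SLPoints n m A) : g.map f.toAlgHom ∈ SLPoints n m B := by
  rw [mem_SLPoints_iff] at hg
  obtain ⟨b, c, a, d, hb, hc, hd, had, rfl⟩ := hg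
  rw [Matrix.map_mul, Matrix.map_mul, dg_map]
  have h1 : (uPlus b).map f.toAlgHom = uPlus (b.map f.toAlgHom) := by
    rw [uPlus, uPlus, fromBlocks_map]
    rw [Matrix.map_one _ (map_zero _) (map_one _), Matrix.map_one _ (map_zero _) (map_one _),
      Matrix.map_zero _ (map_zero _)]
  have h2 : (uMinus c).map f.toAlgHom = uMinus (c.map f.toAlgHom) := by
    rw [uMinus, uMinus, fromBlocks_map]
    rw [Matrix.map_one _ (map_zero _) (map_one _), Matrix.map_one _ (map_zero _) (map_one _),
      Matrix.map_zero _ (map_zero _)]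
  rw [h1, h2]
  have h3 : ∀ {k : ℕ} (x : SqMat k (A.grade 0)),
      (x.map f.evenMap).det = f.evenMap x.det := fun x => (RingHom.map_det f.evenMap x).symm
  refine SLPoints.mul_mem (SLPoints.mul_mem (uPlus_mem fun i j => f.map_grade 1 _ (hb i j))
    (dg_mem ?_ ?_)) (uMinus_mem fun i j => f.map_grade 1 _ (hc i j))
  · rw [h3]
    exact hd.map _
  · rw [h3, h3, had]

end Points

/-! ### Complex matrices with a scalar from an algebra -/

section ScalarMatrices

variable {ι κ μ : Type} {A : Type} [Ring A] [Algebra ℂ A]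

/-- The matrix `y B`, for `y` in a `ℂ`-algebra and a complex matrix `B`. -/
def sm (y : A) (B : Matrix ι κ ℂ) : Matrix ι κ A := B.map fun c => c • y

theorem sm_apply (y : A) (B : Matrix ι κ ℂ) (i : ι) (j : κ) : sm y B i j = B i j • y := rfl

theorem sm_mul [Fintype κ] (y z : A) (B : Matrix ι κ ℂ) (C : Matrix κ μ ℂ) :
    sm y B * sm z C = sm (y * z) (B * C) := by
  ext i j
  simp only [Matrix.mul_apply, sm_apply, smul_mul_smul_comm, sum_smul]

theorem sm_add (y : A) (B C : Matrix ι κ ℂ) : sm y (B + C) = sm y B + sm y C := by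
  ext i j; simp [sm_apply, add_smul]

theorem sm_sub (y : A) (B C : Matrix ι κ ℂ) : sm y (B - C) = sm y B - sm y C := by
  ext i j; simp [sm_apply, sub_smul]

theorem sm_smul (c : ℂ) (y : A) (B : Matrix ι κ ℂ) : sm (c • y) B = sm y (c • B) := by
  ext i j
  simp [sm_apply, smul_smul, mul_comm]

theorem sm_zero (y : A) : sm y (0 : Matrix ι κ ℂ) = 0 := by
  ext i j; simp [sm_apply, zero_smul]

theorem zero_sm (B : Matrix ι κ ℂ) : sm (0 : A) B = 0 := by
  ext i j; simp [sm_apply, smul_zero]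

theorem sm_one_one [DecidableEq ι] : sm (1 : A) (1 : Matrix ι ι ℂ) = 1 := by
  ext i j
  rw [sm_apply, one_apply, one_apply]
  split_ifs <;> simp

theorem map_algebraMap_eq_sm (B : Matrix ι κ ℂ) : B.map (algebraMap ℂ A) = sm 1 B := by
  ext i j
  rw [map_apply, sm_apply, Algebra.algebraMap_eq_smul_one]

theorem sm_map {C : Type} [Ring C] [Algebra ℂ C] (f : A →ₐ[ℂ] C) (y : A) (B : Matrix ι κ ℂ) :
    (sm y B).map f = sm (f y) B := by
  ext i j
  simp [sm_apply]

theorem sm_single [DecidableEq ι] [DecidableEq κ] (y : A) (i : ι) (j : κ) :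
    sm y (Matrix.single i j 1) = Matrix.single i j y := by
  ext r s
  rw [sm_apply, Matrix.single_apply, Matrix.single_apply]
  split_ifs <;> simp

theorem sm_diagonal [DecidableEq ι] (y : A) (h : ι → ℂ) :
    sm y (diagonal h) = diagonal fun i => h i • y := by
  ext r s
  rw [sm_apply, Matrix.diagonal_apply, Matrix.diagonal_apply]
  split_ifs <;> simp

theorem one_add_map [DecidableEq ι] {C : Type} [Ring C] [Algebra ℂ C] (f : A →ₐ[ℂ] C)
    (M : Matrix ι ι A) : (1 + M).map f = 1 + M.map f := by
  rw [Matrix.map_add _ (map_add f), Matrix.map_one _ (map_zero f) (map_one f)]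

end ScalarMatrices

/-! ### The character lattice -/

section Lattice

variable {n m : ℕ}

/-- The lattice spanned by the weights `ε_i`, `δ_p`. -/
abbrev MLat (n m : ℕ) : Type := (latticeHom n m).range

/-- The projection of `ℤ^{n+m}` onto the lattice. -/
def toMLat (n m : ℕ) : (Idx n m → ℤ) →+ MLat n m := (latticeHom n m).rangeRestrict

theorem coe_toMLat (k : Idx n m → ℤ) : (toMLat n m k : P0 n m) = latticeHom n m k := rfl

theorem toMLat_surjective : Function.Surjective (toMLat n m) :=
  (latticeHom n m).rangeRestrict_surjective

/-- `ε_i`, `δ_p` as elements of the lattice. -/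
def wtM (j : Idx n m) : MLat n m := toMLat n m (Pi.single j 1)

theorem coe_wtM (j : Idx n m) : (wtM j : P0 n m) = wt j := latticeHom_single j

theorem toMLat_eq_sum (k : Idx n m → ℤ) : toMLat n m k = ∑ j, k j • wtM j := by
  apply Subtype.ext
  change latticeHom n m k = (latticeHom n m).range.subtype (∑ j, k j • wtM j)
  rw [map_sum]
  simp only [map_zsmul, AddSubgroup.subtype_apply, coe_wtM]
  rfl

theorem sum_wtM : ∑ i : Fin n, (wtM (inl i) : MLat n m) = ∑ p : Fin m, wtM (inr p) := by
  apply Subtype.ext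
  change (latticeHom n m).range.subtype _ = (latticeHom n m).range.subtype _
  rw [map_sum, map_sum]
  simp only [AddSubgroup.subtype_apply, coe_wtM, sum_wt]

/-- The homomorphism from the lattice given by the images of the `ε_i`, `δ_p`. -/
def MLat.lift {G : Type} [AddCommGroup G] (t : Idx n m → G)
    (ht : ∑ i, t (inl i) = ∑ p, t (inr p)) : MLat n m →+ G :=
  (toMLat n m).liftOfSurjective toMLat_surjective
    ⟨{ toFun := fun k => ∑ j, k j • t j
       map_zero' := by simp
       map_add' := fun a b => by simp [add_smul, sum_add_distrib] }, by
      intro k hk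
      have h1 : latticeHom n m k = 0 := congrArg Subtype.val hk
      obtain ⟨z, rfl⟩ := (latticeHom_eq_zero_iff k).1 h1
      change ∑ j, (z • berExp n m) j • t j = 0
      simp [berExp, Fintype.sum_sum_type, ← smul_sum, ht]⟩

theorem MLat.lift_toMLat {G : Type} [AddCommGroup G] (t : Idx n m → G)
    (ht : ∑ i, t (inl i) = ∑ p, t (inr p)) (k : Idx n m → ℤ) :
    MLat.lift t ht (toMLat n m k) = ∑ j, k j • t j :=
  AddMonoidHom.liftOfRightInverse_comp_apply _ _ _ _ _

theorem MLat.lift_wtM {G : Type} [AddCommGroup G] (t : Idx n m → G)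
    (ht : ∑ i, t (inl i) = ∑ p, t (inr p)) (j : Idx n m) :
    MLat.lift t ht (wtM j) = t j := by
  classical
  rw [wtM, MLat.lift_toMLat]
  simp [Pi.single_apply]

end Lattice

/-! ### The torus -/

section Torus

variable {n m : ℕ}

/-- The coordinate ring of the maximal torus. -/
abbrev TorusRing (n m : ℕ) : Type := AddMonoidAlgebra ℂ (MLat n m)

/-- The homomorphism from the coordinate ring of the torus defined by a character. -/
def torusHom {A : SAlg} (χ : Multiplicative (MLat n m) →* A) (hχ : ∀ x, χ x ∈ A.grade 0) :
    SAlg.Hom (evenSAlg (TorusRing n m)) A :=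
  SAlg.Hom.ofEven (lift ℂ A (MLat n m) χ) fun f => by
    rw [lift_apply]
    exact sum_mem fun l _ => Submodule.smul_mem _ _ (hχ _)

theorem torusHom_apply {A : SAlg} (χ : Multiplicative (MLat n m) →* A)
    (hχ : ∀ x, χ x ∈ A.grade 0) (f : TorusRing n m) :
    (torusHom χ hχ).toAlgHom f = f.coeff.sum fun l c => c • χ (ofAdd l) :=
  lift_apply _ _

theorem torusHom_ex {A : SAlg} (χ : Multiplicative (MLat n m) →* A)
    (hχ : ∀ x, χ x ∈ A.grade 0) (l : MLat n m) :
    (torusHom χ hχ).toAlgHom (ex l) = χ (ofAdd l) := by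
  refine (lift_single _ _ _).trans ?_
  rw [one_smul]

theorem prod_ex {ι : Type} {M : Type} [AddCommGroup M] (s : Finset ι) (f : ι → M) :
    ∏ i ∈ s, (ex (f i) : AddMonoidAlgebra ℂ M) = ex (∑ i ∈ s, f i) := by
  classical
  induction s using Finset.induction_on with
  | empty => rfl
  | insert a s ha ih => rw [prod_insert ha, sum_insert ha, ih, ex_add]

theorem diagonal_mem_of_ringHom {A : SAlg} {R : Type} [CommRing R] (f : R →+* A)
    (hf : ∀ r, f r ∈ A.grade 0) (t : Idx n m → R) (hu : IsUnit (∏ p, t (inr p)))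
    (ht : ∏ i, t (inl i) = ∏ p, t (inr p)) :
    diagonal (fun j => f (t j)) ∈ SLPoints n m A := by
  let f₀ : R →+* A.grade 0 :=
    { toFun := fun r => ⟨f r, hf r⟩
      map_one' := Subtype.ext (map_one f)
      map_mul' := fun _ _ => Subtype.ext (map_mul f _ _)
      map_zero' := Subtype.ext (map_zero f)
      map_add' := fun _ _ => Subtype.ext (map_add f _ _) }
  refine diagonal_mem (t := fun j => f₀ (t j)) ?_ ?_
  · rw [← map_prod]
    exact hu.map f₀
  · rw [← map_prod, ← map_prod, ht]

theorem univTorus_mem :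
    (diagonal (fun j => (ex (wtM j) : TorusRing n m)) :
      SMat n m (evenSAlg (TorusRing n m))) ∈
        SLPoints n m (evenSAlg (TorusRing n m)) := by
  refine diagonal_mem_of_ringHom (A := evenSAlg (TorusRing n m)) (RingHom.id (TorusRing n m))
    (fun r => mem_evenSAlg_zero r) (fun j => ex (wtM j)) ?_ ?_
  · rw [prod_ex]
    refine IsUnit.of_mul_eq_one (ex (-∑ i, wtM (inr i))) ?_
    rw [← ex_add, add_neg_cancel]
    rfl
  · rw [prod_ex, prod_ex, sum_wtM]

theorem torus_mem {A : SAlg} (χ : Multiplicative (MLat n m) →* A) (hχ : ∀ x, χ x ∈ A.grade 0) :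
    diagonal (fun j => χ (ofAdd (wtM j))) ∈ SLPoints n m A := by
  have h := SLPoints.map_mem (torusHom χ hχ) univTorus_mem
  rw [Matrix.diagonal_map (map_zero _)] at h
  convert h using 2
  exact funext fun j => (torusHom_ex χ hχ (wtM j)).symm

/-- The point of the torus defined by a character of the lattice. -/
def torusPt {A : SAlg} (χ : Multiplicative (MLat n m) →* A) (hχ : ∀ x, χ x ∈ A.grade 0) :
    SLPoints n m A := ⟨_, torus_mem χ hχ⟩

variable (V : SLRep n m)

/-- The action of the universal point of the torus. -/
def SLRep.actT : Matrix V.ι V.ι (TorusRing n m) :=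
  V.act (evenSAlg (TorusRing n m)) ⟨_, univTorus_mem⟩

/-- The projection onto a weight space. -/
def SLRep.wproj (l : MLat n m) : Matrix V.ι V.ι ℂ := Matrix.of fun i j => (V.actT i j).coeff l

open Classical in
/-- A finite set of weights that contains all weights of the representation. -/
def SLRep.wts : Finset (MLat n m) :=
  univ.biUnion fun ij : V.ι × V.ι => (V.actT ij.1 ij.2).coeff.support

theorem SLRep.wproj_eq_zero {l : MLat n m} (h : l ∉ V.wts) : V.wproj l = 0 := by
  classical
  ext i j
  by_contra h'
  refine h (mem_biUnion.2 ⟨(i, j), mem_univ _, mem_support_iff.2 h'⟩)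

theorem SLRep.act_torus {A : SAlg} (χ : Multiplicative (MLat n m) →* A)
    (hχ : ∀ x, χ x ∈ A.grade 0) (g : SLPoints n m A)
    (hg : g.1 = diagonal (fun j => χ (ofAdd (wtM j)))) :
    V.act A g = ∑ l ∈ V.wts, sm (χ (ofAdd l)) (V.wproj l) := by
  have h := V.act_natural _ A (torusHom χ hχ) ⟨_, univTorus_mem⟩ g (by
    rw [hg, Matrix.diagonal_map (map_zero _)]
    exact congrArg diagonal (funext fun j => (torusHom_ex χ hχ (wtM j)).symm))
  classical
  rw [h]
  ext i j
  rw [map_apply, torusHom_apply, Matrix.sum_apply]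
  refine Finsupp.sum_of_support_subset _ ?_ _ (by simp)
  intro l hl
  exact mem_biUnion.2 ⟨(i, j), mem_univ _, hl⟩

theorem SLRep.sum_wproj : ∑ l ∈ V.wts, V.wproj l = 1 := by
  have h := V.act_torus (A := complexSAlg) 1 (fun x => mem_complexGrade_zero _) ⟨1, SLPoints.one_mem⟩
    (by simp)
  rw [V.act_one _ _ rfl] at h
  ext i j
  have h' := congrFun (congrFun h i) j
  rw [Matrix.sum_apply] at h'
  rw [h', Matrix.sum_apply]
  refine sum_congr rfl fun l _ => ?_
  change V.wproj l i j = V.wproj l i j * 1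
  rw [mul_one]

/-- The character of the lattice given by a homomorphism to another group. -/
def expChar {M G : Type} [AddCommGroup M] [AddCommGroup G] (φ : M →+ G) :
    Multiplicative M →* AddMonoidAlgebra ℂ G :=
  (of ℂ G).comp (AddMonoidHom.toMultiplicative φ)

theorem expChar_apply {M G : Type} [AddCommGroup M] [AddCommGroup G] (φ : M →+ G) (l : M) :
    expChar φ (ofAdd l) = ex (φ l) := rfl

theorem coeff_sum_sm_ex {ι κ M G : Type} [AddCommGroup G] [DecidableEq G] (S : Finset M)
    (φ : M → G) (F : M → Matrix ι κ ℂ) (x : G) (i : ι) (j : κ) :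
    ((∑ l ∈ S, sm (ex (φ l) : AddMonoidAlgebra ℂ G) (F l)) i j).coeff x =
      ∑ l ∈ S, if φ l = x then F l i j else 0 := by
  rw [Matrix.sum_apply]
  have : ∀ (s : Finset M) (f : M → AddMonoidAlgebra ℂ G), (∑ l ∈ s, f l).coeff x =
      ∑ l ∈ s, (f l).coeff x := by
    intro s f
    exact map_sum ((Finsupp.applyAddHom x).comp coeffAddEquiv.toAddMonoidHom) f s
  rw [this]
  refine sum_congr rfl fun l _ => ?_
  rw [sm_apply, coeff_smul, Finsupp.smul_apply, coeff_single, Finsupp.single_apply]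
  split_ifs <;> simp

theorem SLRep.wproj_mul (l l' : MLat n m) [Decidable (l = l')] :
    V.wproj l * V.wproj l' = if l = l' then V.wproj l else 0 := by
  classical
  let G := MLat n m × MLat n m
  let B := evenSAlg (AddMonoidAlgebra ℂ G)
  let φ₁ : MLat n m →+ G := AddMonoidHom.inl _ _
  let φ₂ : MLat n m →+ G := AddMonoidHom.inr _ _
  let φ₃ : MLat n m →+ G := (AddMonoidHom.id _).prod (AddMonoidHom.id _)
  have hφ : ∀ (φ : MLat n m →+ G) x, (expChar φ x : B) ∈ B.grade 0 := fun φ x => mem_evenSAlg_zero _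
  have h1 := V.act_torus (A := B) (expChar φ₁) (hφ φ₁) (torusPt _ (hφ φ₁)) rfl
  have h2 := V.act_torus (A := B) (expChar φ₂) (hφ φ₂) (torusPt _ (hφ φ₂)) rfl
  have h3 := V.act_torus (A := B) (expChar φ₃) (hφ φ₃) (torusPt _ (hφ φ₃)) rfl
  have h4 := V.act_mul B (torusPt _ (hφ φ₁)) (torusPt _ (hφ φ₂)) (torusPt _ (hφ φ₃)) (by
    change (diagonal fun j => (ex (φ₃ (wtM j)) : AddMonoidAlgebra ℂ G)) =
      (diagonal fun j => (ex (φ₁ (wtM j)) : AddMonoidAlgebra ℂ G)) *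
        diagonal fun j => (ex (φ₂ (wtM j)) : AddMonoidAlgebra ℂ G)
    rw [diagonal_mul_diagonal]
    simp only [← ex_add]
    congr 1
    funext j
    congr 1
    exact Prod.ext (add_zero _).symm (zero_add _).symm)
  rw [h1, h2, h3, sum_mul_sum, ← sum_product'] at h4
  have h5 : ∀ x : MLat n m × MLat n m, sm (A := AddMonoidAlgebra ℂ G) (expChar φ₁ (ofAdd x.1)) (V.wproj x.1) *
      sm (A := AddMonoidAlgebra ℂ G) (expChar φ₂ (ofAdd x.2)) (V.wproj x.2) = sm (ex x) (V.wproj x.1 * V.wproj x.2) := by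
    intro x
    rw [sm_mul, expChar_apply, expChar_apply, ← ex_add]
    congr 2
    exact Prod.ext (add_zero _) (zero_add _)
  have h6 : ∑ l ∈ V.wts, sm (A := AddMonoidAlgebra ℂ G) (ex (φ₃ l)) (V.wproj l) =
      ∑ x ∈ V.wts ×ˢ V.wts, sm (ex x) (V.wproj x.1 * V.wproj x.2) :=
    h4.trans (sum_congr rfl fun x _ => h5 x)
  ext i j
  have h7 := (coeff_sum_sm_ex V.wts (fun l => φ₃ l) V.wproj (l, l') i j).symm.trans
    ((congrArg (fun f : Matrix V.ι V.ι (AddMonoidAlgebra ℂ G) => (f i j).coeff (l, l')) h6).trans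
      (coeff_sum_sm_ex (V.wts ×ˢ V.wts) (fun x => x) (fun x => V.wproj x.1 * V.wproj x.2)
        (l, l') i j))
  rw [sum_ite_eq'] at h7
  have h8 : (if (l, l') ∈ V.wts ×ˢ V.wts then (V.wproj l * V.wproj l') i j else 0) =
      (V.wproj l * V.wproj l') i j := by
    split_ifs with h
    · rfl
    · rw [mem_product, not_and_or] at h
      rcases h with h | h <;> rw [V.wproj_eq_zero h] <;> simp
  rw [h8] at h7
  rw [← h7]
  by_cases h : l = l'
  · subst h
    rw [if_pos rfl, sum_eq_single l]
    · exact if_pos rfl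
    · intro b _ hb
      exact if_neg fun h => hb (congrArg Prod.fst h)
    · intro h
      rw [V.wproj_eq_zero h]
      simp
  · rw [if_neg h]
    refine sum_eq_zero fun b _ => if_neg fun hb => h ?_
    exact (congrArg Prod.fst hb).symm.trans (congrArg Prod.snd hb)

theorem SLRep.wproj_even {l : MLat n m} {i j : V.ι} (h : V.wproj l i j ≠ 0) : V.par i = V.par j := by
  by_contra hp
  apply h
  have h1 := V.act_even (evenSAlg (TorusRing n m)) ⟨_, univTorus_mem⟩ i j
  rw [show V.par i + V.par j = 1 from parity_add_of_ne (Ne.symm hp), mem_invGrade, sgn_one,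
    neg_one_smul] at h1
  have h2 : V.actT i j = 0 := eq_zero_of_eq_neg h1
  rw [SLRep.wproj, of_apply, h2]
  rfl

end Torus

/-! ### The action of the Lie superalgebra -/

section LieAction

variable {n m : ℕ}

/-- The homogeneous elements `B` of parity `q` of the Lie superalgebra: `1 + η B` is a point of
`SL(n,m)`, where `η² = 0`. -/
def IsSl (q : ZMod 2) (B : SMat n m ℂ) : Prop :=
  (1 + sm (complexSAlg.eta q) B : SMat n m (complexSAlg.nil q)) ∈
    SLPoints n m (complexSAlg.nil q)

theorem one_add_sm_map {A : SAlg} {q : ZMod 2} {y : A} (hy : y ∈ A.grade q) (hyy : y * y = 0)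
    {ι : Type} [DecidableEq ι] (B : Matrix ι ι ℂ) :
    (1 + sm (complexSAlg.eta q) B : Matrix ι ι (complexSAlg.nil q)).map
      (SAlg.nilLift A.ofComplex y hy hyy).toAlgHom = 1 + sm y B := by
  rw [one_add_map, sm_map, SAlg.nilLift_eta]

theorem IsSl.mem {q : ZMod 2} {B : SMat n m ℂ} (h : IsSl q B) {A : SAlg} {y : A}
    (hy : y ∈ A.grade q) (hyy : y * y = 0) : 1 + sm y B ∈ SLPoints n m A := by
  rw [← one_add_sm_map hy hyy]
  exact SLPoints.map_mem _ h

variable (V : SLRep n m)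

open Classical in
/-- The action of the Lie superalgebra: `1 + η B` acts by `1 + η d(B)`. -/
def SLRep.d (q : ZMod 2) (B : SMat n m ℂ) : Matrix V.ι V.ι ℂ :=
  if h : IsSl q B then Matrix.of fun i j => (V.act (complexSAlg.nil q) ⟨_, h⟩ i j).snd else 0

theorem SLRep.act_eta {q : ZMod 2} {B : SMat n m ℂ} (h : IsSl q B) :
    V.act (complexSAlg.nil q) ⟨_, h⟩ = 1 + sm (complexSAlg.eta q) (V.d q B) := by
  have h0 := V.act_natural (complexSAlg.nil q) complexSAlg
    (SAlg.nilLift complexSAlg.ofComplex 0 (zero_mem _) (mul_zero _)) ⟨_, h⟩ ⟨1, SLPoints.one_mem⟩ (by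
      rw [one_add_sm_map, zero_sm, add_zero])
  rw [V.act_one _ _ rfl] at h0
  ext1 i j
  have h1 : (1 : Matrix V.ι V.ι ℂ) i j = (V.act (complexSAlg.nil q) ⟨_, h⟩ i j).fst := by
    have h2 := congrFun (congrFun h0 i) j
    rw [map_apply, SAlg.nilLift_apply, zero_mul, add_zero] at h2
    exact h2
  have h3 : V.d q B i j = (V.act (complexSAlg.nil q) ⟨_, h⟩ i j).snd := by
    rw [SLRep.d, dif_pos h, of_apply]
  rw [Matrix.add_apply, sm_apply, h3]
  apply NilExt.ext
  · rw [← h1]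
    change _ = NilExt.fst ((1 : Matrix V.ι V.ι (NilExt complexSAlg q)) i j) +
      (V.act (complexSAlg.nil q) ⟨_, h⟩ i j).snd • (0 : ℂ)
    rw [smul_zero, add_zero, one_apply, one_apply]
    split_ifs <;> rfl
  · change _ = NilExt.snd ((1 : Matrix V.ι V.ι (NilExt complexSAlg q)) i j) +
      (V.act (complexSAlg.nil q) ⟨_, h⟩ i j).snd * (1 : ℂ)
    rw [mul_one, one_apply]
    split_ifs
    · exact (zero_add _).symm
    · exact (zero_add _).symm

theorem SLRep.act_one_add_sm {q : ZMod 2} {B : SMat n m ℂ} (h : IsSl q B)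
    {A : SAlg} {y : A} (hy : y ∈ A.grade q) (hyy : y * y = 0) (g : SLPoints n m A)
    (hg : g.1 = 1 + sm y B) : V.act A g = 1 + sm y (V.d q B) := by
  rw [V.act_natural _ A (SAlg.nilLift A.ofComplex y hy hyy) ⟨_, h⟩ g
    (by rw [hg, one_add_sm_map]), V.act_eta h, one_add_sm_map]

theorem SLRep.d_parity {q : ZMod 2} {B : SMat n m ℂ} {i j : V.ι}
    (h : V.d q B i j ≠ 0) : V.par i + V.par j = q := by
  by_cases hB : IsSl q B
  · rw [SLRep.d, dif_pos hB, of_apply] at h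
    have h1 := (SAlg.mem_nil_grade.1 (V.act_even (complexSAlg.nil q) ⟨_, hB⟩ i j)).2
    by_contra hne
    refine h (eq_zero_of_mem_complexGrade (fun h0 => hne ?_) h1)
    have : ∀ a b : ZMod 2, a + b = 0 → b = a := by decide
    exact this _ _ h0
  · rw [SLRep.d, dif_neg hB] at h
    exact absurd rfl h

theorem commutator_identity {ι : Type} [Fintype ι] [DecidableEq ι] {A : SAlg} {p q : ZMod 2}
    {y z : A} (hy : y ∈ A.grade p) (hz : z ∈ A.grade q) (hyy : y * y = 0) (hzz : z * z = 0)
    (B C D : Matrix ι ι ℂ) :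
    (1 + sm y B) * (1 + sm z C) - (1 + sm z C) * (1 + sm y B) * (1 + sm (y * z) D) =
      sm (y * z) (B * C - sgn (p * q) • (C * B) - D) := by
  have hzy : z * y = sgn (p * q) • (y * z) := by rw [A.comm q p z y hz hy, mul_comm]
  have h1 : y * (y * z) = 0 := by rw [← mul_assoc, hyy, zero_mul]
  have h2 : z * (y * z) = 0 := by rw [← mul_assoc, hzy, smul_mul_assoc, mul_assoc, hzz, mul_zero,
    smul_zero]
  have h3 : z * y * (y * z) = 0 := by rw [mul_assoc, h1, mul_zero]
  simp only [mul_add, add_mul, mul_one, one_mul, sm_mul, h1, h2, h3, zero_sm, sm_sub, ← sm_smul,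
    ← hzy]
  abel

theorem SLRep.d_bracket {p q : ZMod 2} {B C : SMat n m ℂ} (hB : IsSl p B)
    (hC : IsSl q C) (hD : IsSl (p + q) (B * C - sgn (p * q) • (C * B))) :
    V.d (p + q) (B * C - sgn (p * q) • (C * B)) =
      V.d p B * V.d q C - sgn (p * q) • (V.d q C * V.d p B) := by
  let A₁ := complexSAlg.nil p
  let A := A₁.nil q
  let y : A := (A₁.nilInc q).toAlgHom (complexSAlg.eta p)
  let z : A := A₁.eta q
  have hy : y ∈ A.grade p := (A₁.nilInc q).map_grade _ _ SAlg.eta_mem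
  have hz : z ∈ A.grade q := SAlg.eta_mem
  have hyy : y * y = 0 := by
    change (A₁.nilInc q).toAlgHom _ * (A₁.nilInc q).toAlgHom _ = 0
    rw [← map_mul, SAlg.eta_mul_eta, map_zero]
  have hzz : z * z = 0 := SAlg.eta_mul_eta
  have hyz : y * z ∈ A.grade (p + q) := mul_mem_grade hy hz rfl
  have hyzyz : y * z * (y * z) = 0 := by
    rw [mul_assoc, ← mul_assoc z, A.mul_comm_of_mem hy, mul_assoc, ← mul_assoc y, hyy, zero_mul]
  set D := B * C - sgn (p * q) • (C * B) with hDdef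
  let g₁ : SLPoints n m A := ⟨_, hB.mem hy hyy⟩
  let g₂ : SLPoints n m A := ⟨_, hC.mem hz hzz⟩
  let g₃ : SLPoints n m A := ⟨_, hD.mem hyz hyzyz⟩
  have e : g₁.1 * g₂.1 = g₂.1 * g₁.1 * g₃.1 := by
    rw [← sub_eq_zero]
    change (1 + sm y B) * (1 + sm z C) - (1 + sm z C) * (1 + sm y B) * (1 + sm (y * z) D) = 0
    rw [commutator_identity hy hz hyy hzz, ← hDdef, sub_self, sm_zero]
  let k : SLPoints n m A := ⟨_, SLPoints.mul_mem g₁.2 g₂.2⟩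
  let k' : SLPoints n m A := ⟨_, SLPoints.mul_mem g₂.2 g₁.2⟩
  have e1 := V.act_mul A g₁ g₂ k rfl
  have e2 := V.act_mul A k' g₃ k e
  rw [V.act_mul A g₂ g₁ k' rfl, e1, V.act_one_add_sm hB hy hyy g₁ rfl,
    V.act_one_add_sm hC hz hzz g₂ rfl, V.act_one_add_sm hD hyz hyzyz g₃ rfl, ← sub_eq_zero,
    commutator_identity hy hz hyy hzz] at e2
  have hne : (y * z).snd.snd ≠ 0 := by
    have h1 : y * z = z * (A₁.nilInc q).toAlgHom (A₁.sg q (complexSAlg.eta p)) := by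
      rw [A.mul_comm_of_mem hz, SAlg.Hom.map_sg]
    rw [h1, SAlg.eta_mul_inc, A₁.sg_of_mem q SAlg.eta_mem]
    change sgn (q * p) * 1 ≠ 0
    rw [mul_one]
    exact sgn_ne_zero _
  rw [eq_comm, ← sub_eq_zero]
  ext i j
  have h4 := congrFun (congrFun e2 i) j
  rw [sm_apply] at h4
  have h5 : (V.d p B * V.d q C - sgn (p * q) • (V.d q C * V.d p B) - V.d (p + q) D) i j *
      (y * z).snd.snd = 0 := congrArg (fun x : A => x.snd.snd) h4
  exact (mul_eq_zero.1 h5).resolve_right hne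

theorem isSl_single {i j : Idx n m} (hij : i ≠ j) :
    IsSl (stdParity i + stdParity j) (Matrix.single i j 1) := by
  rw [IsSl, sm_single]
  exact one_add_single_mem hij SAlg.eta_mem

/-- The root vectors. -/
def SLRep.X (i j : Idx n m) : Matrix V.ι V.ι ℂ := V.d (stdParity i + stdParity j) (Matrix.single i j 1)

theorem SLRep.act_one_add_single {i j : Idx n m} (hij : i ≠ j) {A : SAlg} {y : A}
    (hy : y ∈ A.grade (stdParity i + stdParity j)) (hyy : y * y = 0) (g : SLPoints n m A)
    (hg : g.1 = 1 + Matrix.single i j y) : V.act A g = 1 + sm y (V.X i j) :=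
  V.act_one_add_sm (isSl_single hij) hy hyy g (by rw [hg, sm_single])

theorem SLRep.wproj_mul_X {i j : Idx n m} (hij : i ≠ j) (l : MLat n m) :
    V.wproj (l + (wtM i - wtM j)) * V.X i j = V.X i j * V.wproj l := by
  classical
  set q := stdParity i + stdParity j with hq
  set α : MLat n m := wtM i - wtM j with hα
  let R := evenSAlg (TorusRing n m)
  let A := R.nil q
  let inc := (R.nilInc q).toAlgHom
  let χ : Multiplicative (MLat n m) →* A :=
    (inc : R →* A).comp (of ℂ (MLat n m))
  have hχ0 : ∀ r : TorusRing n m, inc r ∈ A.grade 0 := fun r =>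
    (R.nilInc q).map_grade 0 _ (mem_evenSAlg_zero r)
  have hχ : ∀ x, χ x ∈ A.grade 0 := fun x => hχ0 _
  let z : A := R.eta q
  have hz : z ∈ A.grade q := SAlg.eta_mem
  have hzz : z * z = 0 := SAlg.eta_mul_eta
  have hcom : ∀ r : TorusRing n m, inc r * z = z * inc r := fun r => by
    rw [A.mul_eq_of_mem (hχ0 r), A.sg_zero]
  have hy : inc (ex α) * z ∈ A.grade q := mul_mem_grade (hχ0 _) hz (zero_add q)
  have hyy : inc (ex α) * z * (inc (ex α) * z) = 0 := by
    rw [hcom, mul_assoc, ← mul_assoc (inc _), hcom, mul_assoc, ← mul_assoc z, hzz, zero_mul]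
  let t : SLPoints n m A := torusPt χ hχ
  let g₁ : SLPoints n m A := ⟨_, one_add_single_mem hij hz⟩
  let g₂ : SLPoints n m A := ⟨_, one_add_single_mem hij hy⟩
  have e : t.1 * g₁.1 = g₂.1 * t.1 := by
    change diagonal (fun j => inc (ex (wtM j))) * (1 + Matrix.single i j z) =
      (1 + Matrix.single i j (inc (ex α) * z)) * diagonal (fun j => inc (ex (wtM j)))
    rw [mul_add, add_mul, mul_one, one_mul]
    congr 1
    ext1 r s
    rw [Matrix.diagonal_mul, mul_diagonal, Matrix.single_apply, Matrix.single_apply]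
    split_ifs with h
    · obtain ⟨rfl, rfl⟩ := h
      rw [mul_assoc, ← hcom, ← mul_assoc, ← map_mul, ← ex_add, hα, sub_add_cancel]
    · rw [mul_zero, zero_mul]
  let k : SLPoints n m A := ⟨_, SLPoints.mul_mem t.2 g₁.2⟩
  have e1 := V.act_mul A t g₁ k rfl
  rw [V.act_mul A g₂ t k e, V.act_one_add_single hij hz hzz g₁ rfl,
    V.act_one_add_single hij hy hyy g₂ rfl, V.act_torus χ hχ t rfl, mul_add, add_mul, one_mul,
    mul_one, add_left_cancel_iff, mul_sum, sum_mul] at e1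
  simp only [sm_mul] at e1
  have hs : ∀ (x : MLat n m → MLat n m) (F : MLat n m → Matrix V.ι V.ι ℂ),
      (∑ l ∈ V.wts, sm (A := A) (inc (ex (x l)) * z) (F l)).map (fun a : A => NilExt.snd a) =
        ∑ l ∈ V.wts, sm (ex (x l) : TorusRing n m) (F l) := by
    intro x F
    ext1 r s
    rw [map_apply, Matrix.sum_apply, Matrix.sum_apply]
    let sndHom : A →+ TorusRing n m := ⟨⟨fun a : A => NilExt.snd a, rfl⟩, fun _ _ => rfl⟩
    refine (map_sum sndHom _ _).trans (sum_congr rfl fun l _ => ?_)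
    rw [sm_apply, sm_apply, hcom]
    change F l r s • NilExt.snd (z * inc (ex (x l))) = _
    rw [SAlg.eta_mul_inc]
  have e3 : ∀ l : MLat n m, inc (ex α) * z * χ (ofAdd l) = inc (ex (l + α)) * z := by
    intro l
    change inc (ex α) * z * inc (ex l) = _
    rw [mul_assoc, ← hcom, ← mul_assoc, ← map_mul, ← ex_add, add_comm]
  have e4 : ∀ l : MLat n m, χ (ofAdd l) * z = inc (ex l) * z := fun _ => rfl
  simp only [e3, e4] at e1
  have e5 := congrArg (fun M : Matrix V.ι V.ι A => M.map (fun a : A => NilExt.snd a)) e1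
  have e6 := (hs (fun l => l + α) (fun l => V.X i j * V.wproj l)).symm.trans
    (e5.trans (hs (fun l => l) (fun l => V.wproj l * V.X i j)))
  ext r s
  have e7 := congrArg (fun M : Matrix V.ι V.ι (TorusRing n m) => (M r s).coeff (l + α)) e6
  have e8 := (coeff_sum_sm_ex V.wts (fun l => l + α) (fun l => V.X i j * V.wproj l) (l + α) r s).symm.trans
    (e7.trans (coeff_sum_sm_ex V.wts (fun l => l) (fun l => V.wproj l * V.X i j) (l + α) r s))
  simp only [add_left_inj] at e8
  rw [sum_ite_eq', sum_ite_eq'] at e8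
  have h1 : (if l ∈ V.wts then (V.X i j * V.wproj l) r s else 0) = (V.X i j * V.wproj l) r s := by
    split_ifs with h
    · rfl
    · rw [V.wproj_eq_zero h]; simp
  have h2 : (if l + α ∈ V.wts then (V.wproj (l + α) * V.X i j) r s else 0) =
      (V.wproj (l + α) * V.X i j) r s := by
    split_ifs with h
    · rfl
    · rw [V.wproj_eq_zero h]; simp
  rw [h1, h2] at e8
  exact e8.symm

/-- The character `l ↦ 1 + l(h) η`. -/
def infChar (h : cartan n m) : Multiplicative (MLat n m) →* complexSAlg.nil 0 where
  toFun l := NilExt.mk (1 : ℂ) ((Multiplicative.toAdd l).1.1 h)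
  map_one' := rfl
  map_mul' a b := by
    apply NilExt.ext
    · exact (mul_one (1 : ℂ)).symm
    · change _ = (_ : ℂ) * 1 + 1 * _
      rw [mul_one, one_mul]
      rfl

theorem infChar_mem (h : cartan n m) (x) : infChar h x ∈ (complexSAlg.nil 0).grade 0 :=
  SAlg.mem_nil_grade.2 ⟨mem_complexGrade_zero _, mem_complexGrade_zero _⟩

theorem one_add_sm_diagonal (h : cartan n m) :
    (1 + sm (complexSAlg.eta 0) (diagonal h.1) :
      SMat n m (complexSAlg.nil 0)) =
        diagonal (fun j => infChar h (ofAdd (wtM j))) := by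
  rw [sm_diagonal, ← diagonal_one, Matrix.diagonal_add]
  congr 1
  funext j
  apply NilExt.ext
  · change (1 : ℂ) + h.1 j * 0 = 1
    rw [mul_zero, add_zero]
  · change (0 : ℂ) + h.1 j * 1 = (wtM j : P0 n m).1 h
    rw [coe_wtM, wt_apply, mul_one, zero_add]

theorem isSl_diagonal (h : cartan n m) : IsSl 0 (diagonal h.1 : SMat n m ℂ) := by
  rw [IsSl, one_add_sm_diagonal]
  exact torus_mem _ (infChar_mem h)

theorem SLRep.d_diagonal (h : cartan n m) :
    V.d 0 (diagonal h.1) = ∑ l ∈ V.wts, (l : P0 n m).1 h • V.wproj l := by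
  have h1 := V.act_torus (infChar h) (infChar_mem h) ⟨_, isSl_diagonal h⟩ (one_add_sm_diagonal h)
  rw [V.act_eta] at h1
  ext i j
  have h2 := congrArg NilExt.snd (congrFun (congrFun h1 i) j)
  have h3 : NilExt.snd ((1 + sm (complexSAlg.eta 0) (V.d 0 (diagonal h.1)) :
      Matrix V.ι V.ι (complexSAlg.nil 0)) i j) = V.d 0 (diagonal h.1) i j := by
    rw [Matrix.add_apply, one_apply]
    change (if i = j then (1 : NilExt complexSAlg 0) else 0).snd + V.d 0 (diagonal h.1) i j * 1 = _
    split_ifs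
    · exact (zero_add _).trans (mul_one _)
    · exact (zero_add _).trans (mul_one _)
  rw [h3] at h2
  rw [h2, Matrix.sum_apply, Matrix.sum_apply]
  let sndHom : (complexSAlg.nil 0) →+ ℂ := ⟨⟨fun a => NilExt.snd a, rfl⟩, fun _ _ => rfl⟩
  refine (map_sum sndHom _ _).trans (sum_congr rfl fun l _ => ?_)
  exact mul_comm (V.wproj l i j) ((l : P0 n m).1 h)

end LieAction

/-! ### One-parameter subgroups -/

section OneParameter

variable {n m : ℕ} (V : SLRep n m)

/-- The translation `p ↦ p + η p'` of polynomials. -/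
def polyTranslate : SAlg.Hom (evenSAlg (Polynomial ℂ)) ((evenSAlg (Polynomial ℂ)).nil 0) :=
  SAlg.Hom.ofEven (AlgHom.ofLinearMap (B := NilExt (evenSAlg (Polynomial ℂ)) 0)
    { toFun := fun p : Polynomial ℂ => ⟨p, Polynomial.derivative p⟩
      map_add' := fun p q => by
        apply NilExt.ext
        · rfl
        · exact map_add Polynomial.derivative p q
      map_smul' := fun c p => by
        apply NilExt.ext
        · rfl
        · exact Polynomial.derivative_smul c p }
    (by
      apply NilExt.ext
      · rfl
      · exact Polynomial.derivative_one)
    (fun p q => by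
      apply NilExt.ext
      · rfl
      · exact Polynomial.derivative_mul))
    (fun a => SAlg.mem_nil_grade.2 ⟨mem_evenSAlg_zero _, mem_evenSAlg_zero _⟩)

/-- Evaluation of polynomials at an even element. -/
def polyEval {A : SAlg} (y : A) (hy : y ∈ A.grade 0) : SAlg.Hom (evenSAlg (Polynomial ℂ)) A :=
  SAlg.Hom.ofEven (Polynomial.aeval y) fun p => by
    rw [Polynomial.aeval_eq_sum_range]
    refine sum_mem fun k _ => Submodule.smul_mem _ _ ?_
    have := SetLike.pow_mem_graded (A := A.grade) k hy
    rwa [smul_zero] at this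

theorem polyEval_apply {A : SAlg} (y : A) (hy : y ∈ A.grade 0) (p : Polynomial ℂ) :
    (polyEval y hy).toAlgHom p = Polynomial.aeval y p := rfl

theorem univ_one_add_single_mem {i j : Idx n m} (hij : i ≠ j)
    (hpar : stdParity i + stdParity j = 0) :
    (1 + Matrix.single i j (Polynomial.X : Polynomial ℂ) :
      SMat n m (evenSAlg (Polynomial ℂ))) ∈
      SLPoints n m (evenSAlg (Polynomial ℂ)) :=
  one_add_single_mem hij (by rw [hpar]; exact mem_evenSAlg_zero _)

variable {i j : Idx n m} (hij : i ≠ j) (hpar : stdParity i + stdParity j = 0)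

theorem one_add_single_map {A B : SAlg} (f : SAlg.Hom A B) (x : A) :
    (1 + Matrix.single i j x : SMat n m A).map f.toAlgHom =
      1 + Matrix.single i j (f.toAlgHom x) := by
  rw [one_add_map, Matrix.map_single]

/-- The action of a one-parameter subgroup. -/
def SLRep.expMat : Matrix V.ι V.ι (Polynomial ℂ) :=
  V.act (evenSAlg (Polynomial ℂ)) ⟨_, univ_one_add_single_mem hij hpar⟩

/-- The coefficients of the action of a one-parameter subgroup. -/
def SLRep.expCoeff (k : ℕ) : Matrix V.ι V.ι ℂ := (V.expMat hij hpar).map fun p => p.coeff k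

theorem SLRep.act_even_root {A : SAlg} {y : A} (hy : y ∈ A.grade 0) (g : SLPoints n m A)
    (hg : g.1 = 1 + Matrix.single i j y) :
    ∃ N : ℕ, V.act A g = ∑ k ∈ range N, sm (y ^ k) (V.expCoeff hij hpar k) := by
  have h := V.act_natural _ A (polyEval y hy) ⟨_, univ_one_add_single_mem hij hpar⟩ g (by
    rw [hg, one_add_single_map, polyEval_apply, Polynomial.aeval_X])
  refine ⟨univ.sup (fun rs : V.ι × V.ι => (V.expMat hij hpar rs.1 rs.2).natDegree) + 1, ?_⟩
  rw [h]
  ext1 r s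
  rw [map_apply, polyEval_apply, Matrix.sum_apply]
  refine (Polynomial.aeval_eq_sum_range' (p := V.expMat hij hpar r s) (n := univ.sup
    (fun rs : V.ι × V.ι => (V.expMat hij hpar rs.1 rs.2).natDegree) + 1) ?_ y).trans ?_
  · exact Nat.lt_succ_of_le (le_sup
      (f := fun rs : V.ι × V.ι => (V.expMat hij hpar rs.1 rs.2).natDegree) (mem_univ (r, s)))
  · rfl

theorem SLRep.expCoeff_zero : V.expCoeff hij hpar 0 = 1 := by
  have h := V.act_natural _ complexSAlg (polyEval (A := complexSAlg) (0 : ℂ) (zero_mem _))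
    ⟨_, univ_one_add_single_mem hij hpar⟩ ⟨1, SLPoints.one_mem⟩ (by
    rw [one_add_single_map, polyEval_apply, Polynomial.aeval_X, Matrix.single_zero, add_zero])
  rw [V.act_one _ _ rfl] at h
  rw [h]
  ext1 r s
  rw [map_apply, polyEval_apply]
  refine Eq.trans ?_ (Polynomial.coe_aeval_eq_eval (R := ℂ) 0 ▸ rfl :
    Polynomial.eval 0 (V.expMat hij hpar r s) = _)
  rw [← Polynomial.coeff_zero_eq_eval_zero]
  rfl

theorem SLRep.expCoeff_succ (k : ℕ) :
    ((k : ℂ) + 1) • V.expCoeff hij hpar (k + 1) = V.X i j * V.expCoeff hij hpar k := by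
  let R := evenSAlg (Polynomial ℂ)
  let A := R.nil 0
  let inc := (R.nilInc 0).toAlgHom
  let z : A := R.eta 0
  have hz : z ∈ A.grade (stdParity i + stdParity j) := by rw [hpar]; exact SAlg.eta_mem
  have hX : inc (Polynomial.X : Polynomial ℂ) ∈ A.grade (stdParity i + stdParity j) := by
    rw [hpar]
    exact (R.nilInc 0).map_grade 0 _ (mem_evenSAlg_zero _)
  let g₁ : SLPoints n m A := ⟨_, one_add_single_mem hij hz⟩
  let g₂ : SLPoints n m A := ⟨_, one_add_single_mem hij hX⟩
  let k₀ : SLPoints n m A := ⟨_, SLPoints.mul_mem g₁.2 g₂.2⟩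
  have h1 := V.act_natural _ A polyTranslate ⟨_, univ_one_add_single_mem hij hpar⟩ k₀ (by
    rw [one_add_single_map]
    change (1 + Matrix.single i j z) * (1 + Matrix.single i j (inc (Polynomial.X : Polynomial ℂ))) = _
    rw [mul_add, add_mul, add_mul, one_mul, one_mul, mul_one,
      single_mul_single_of_ne (h := Ne.symm hij), add_zero, add_assoc, ← Matrix.single_add]
    congr 2
    apply NilExt.ext
    · exact zero_add _
    · exact (add_zero _).trans Polynomial.derivative_X.symm)
  have h2 := V.act_natural _ A (R.nilInc 0) ⟨_, univ_one_add_single_mem hij hpar⟩ g₂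
    (one_add_single_map _ _).symm
  rw [V.act_mul A g₁ g₂ k₀ rfl, h2, V.act_one_add_single hij hz SAlg.eta_mul_eta g₁ rfl, add_mul,
    one_mul] at h1
  ext r s
  have h3 := congrArg NilExt.snd (congrFun (congrFun h1 r) s)
  have h4 : Polynomial.derivative (V.expMat hij hpar r s) =
      ∑ t, V.X i j r t • V.expMat hij hpar t s := by
    refine h3.symm.trans ?_
    rw [Matrix.add_apply, Matrix.mul_apply]
    refine (zero_add _).trans ?_
    let sndHom : A →+ Polynomial ℂ := ⟨⟨fun a => NilExt.snd a, rfl⟩, fun _ _ => rfl⟩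
    refine (map_sum sndHom _ _).trans (sum_congr rfl fun t _ => ?_)
    rw [sm_apply, smul_mul_assoc]
    change V.X i j r t • NilExt.snd (R.eta 0 * (R.nilInc 0).toAlgHom (V.expMat hij hpar t s)) = _
    rw [SAlg.eta_mul_inc]
  have h5 := congrArg (fun p => Polynomial.coeff p k) h4
  simp only [Polynomial.coeff_derivative, Polynomial.finsetSum_coeff, Polynomial.coeff_smul] at h5
  rw [Matrix.smul_apply, Matrix.mul_apply, smul_eq_mul, mul_comm]
  exact h5

end OneParameter

/-! ### Generation of the points of `SL(n,m)` -/

section Generation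

variable {n m : ℕ}

theorem fromBlocks_mem {A : SAlg} {R : Type} [CommRing R] (f : R →+* A)
    (hf : ∀ r, f r ∈ A.grade 0) (a : SqMat n R) (d : SqMat m R)
    (hd : IsUnit d.det) (had : a.det = d.det) :
    (fromBlocks (a.map f) 0 0 (d.map f) : SMat n m A) ∈
      SLPoints n m A := by
  let f₀ : R →+* A.grade 0 :=
    { toFun := fun r => ⟨f r, hf r⟩
      map_one' := Subtype.ext (map_one f)
      map_mul' := fun _ _ => Subtype.ext (map_mul f _ _)
      map_zero' := Subtype.ext (map_zero f)
      map_add' := fun _ _ => Subtype.ext (map_add f _ _) }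
  have h1 : (d.map f₀).det = f₀ d.det := (RingHom.map_det f₀ d).symm
  have h2 : (a.map f₀).det = f₀ a.det := (RingHom.map_det f₀ a).symm
  refine dg_mem (a := a.map f₀) (d := d.map f₀) ?_ ?_
  · rw [h1]
    exact hd.map f₀
  · rw [h1, h2, had]

/-- The block diagonal points over a commutative ring. -/
abbrev evenBlocks {R : Type} [CommRing R] [Algebra ℂ R] (a : SqMat n R)
    (d : SqMat m R) : SMat n m (evenSAlg R) :=
  fromBlocks a 0 0 d

theorem evenBlocks_mem {R : Type} [CommRing R] [Algebra ℂ R] (a : SqMat n R)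
    (d : SqMat m R) (hd : IsUnit d.det) (had : a.det = d.det) :
    evenBlocks a d ∈ SLPoints n m (evenSAlg R) :=
  fromBlocks_mem (A := evenSAlg R) (RingHom.id R) (fun r => mem_evenSAlg_zero r) a d hd had

theorem evenBlocks_mul {R : Type} [CommRing R] [Algebra ℂ R] (a a' : SqMat n R)
    (d d' : SqMat m R) :
    evenBlocks (a * a') (d * d') = evenBlocks a d * evenBlocks a' d' := by
  refine Eq.trans ?_ (fromBlocks_multiply (α := R) a 0 0 d a' 0 0 d').symm
  rw [Matrix.mul_zero, Matrix.zero_mul, Matrix.zero_mul, Matrix.mul_zero, Matrix.mul_zero,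
    Matrix.zero_mul, add_zero, add_zero, zero_add, zero_add]

variable {Q : ∀ A : SAlg, SMat n m A → Prop}

theorem generation_field
    (hmul : ∀ (A : SAlg) (g h : SMat n m A), g ∈ SLPoints n m A →
      h ∈ SLPoints n m A → Q A g → Q A h → Q A (g * h))
    (hroot : ∀ (A : SAlg) (i j : Idx n m) (x : A), i ≠ j →
      x ∈ A.grade (stdParity i + stdParity j) → Q A (1 + Matrix.single i j x))
    (hdiag : ∀ (A : SAlg) (R : Type) [CommRing R] (f : R →+* A) (_ : ∀ r, f r ∈ A.grade 0)
      (t : Idx n m → R), IsUnit (∏ p, t (inr p)) → ∏ i, t (inl i) = ∏ p, t (inr p) →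
      Q A (diagonal fun j => f (t j)))
    (K : Type) [Field K] [Algebra ℂ K] (a : SqMat n K) (d : SqMat m K)
    (hd : d.det ≠ 0) (had : a.det = d.det) : Q (evenSAlg K) (evenBlocks a d) := by
  let P : SMat n m (evenSAlg K) → Prop := fun g =>
    g ∈ SLPoints n m (evenSAlg K) ∧ Q _ g
  have hP : ∀ g h, P g → P h → P (g * h) := fun g h hg hh =>
    ⟨SLPoints.mul_mem hg.1 hh.1, hmul _ g h hg.1 hh.1 hg.2 hh.2⟩
  have hPdiag : ∀ t : Idx n m → K, (∏ p, t (inr p)) ≠ 0 →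
      ∏ i, t (inl i) = ∏ p, t (inr p) →
      P (evenBlocks (diagonal fun i => t (inl i)) (diagonal fun i => t (inr i))) := by
    intro t h1 h2
    have h3 : evenBlocks (diagonal fun i => t (inl i))
        (diagonal fun i => t (inr i)) =
          diagonal (fun j => (RingHom.id K (t j) : evenSAlg K)) := by
      refine (Matrix.fromBlocks_diagonal _ _).trans (congrArg diagonal (funext fun j => ?_))
      rcases j with j | j <;> rfl
    refine ⟨evenBlocks_mem _ _ (by rw [det_diagonal]; exact h1.isUnit)
      (by rw [det_diagonal, det_diagonal, h2]), ?_⟩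
    rw [h3]
    exact hdiag (evenSAlg K) K (RingHom.id K) (fun r => mem_evenSAlg_zero r) t h1.isUnit h2
  have hP1 : P (evenBlocks 1 1) := by
    have := hPdiag 1 (by simp) (by simp)
    simpa using this
  have hPl : ∀ t : TransvectionStruct (Fin n) K, P (evenBlocks t.toMatrix 1) := by
    intro t
    have h3 : evenBlocks t.toMatrix (1 : SqMat m K) =
        1 + Matrix.single (inl t.i) (inl t.j) (t.c : evenSAlg K) := by
      ext1 r s
      rcases r with r | r <;> rcases s with s | s <;>
        simp [evenBlocks, TransvectionStruct.toMatrix, transvection, one_apply, Matrix.single_apply]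
    refine ⟨evenBlocks_mem _ _ (by simp) (by simp), ?_⟩
    rw [h3]
    exact hroot _ _ _ _ (fun h => t.hij (Sum.inl_injective h)) (mem_evenSAlg_zero _)
  have hPr : ∀ t : TransvectionStruct (Fin m) K, P (evenBlocks 1 t.toMatrix) := by
    intro t
    have h3 : evenBlocks (1 : SqMat n K) t.toMatrix =
        1 + Matrix.single (inr t.i) (inr t.j) (t.c : evenSAlg K) := by
      ext1 r s
      rcases r with r | r <;> rcases s with s | s <;>
        simp [evenBlocks, TransvectionStruct.toMatrix, transvection, one_apply, Matrix.single_apply]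
    refine ⟨evenBlocks_mem _ _ (by simp) (by simp), ?_⟩
    rw [h3]
    exact hroot _ _ _ _ (fun h => t.hij (Sum.inr_injective h)) (mem_evenSAlg_zero _)
  have hLl : ∀ L : List (TransvectionStruct (Fin n) K),
      P (evenBlocks (L.map TransvectionStruct.toMatrix).prod 1) := by
    intro L
    induction L with
    | nil => simpa using hP1
    | cons t L ih =>
      rw [List.map_cons, List.prod_cons, ← one_mul (1 : SqMat m K), evenBlocks_mul]
      exact hP _ _ (hPl t) ih
  have hLr : ∀ L : List (TransvectionStruct (Fin m) K),
      P (evenBlocks 1 (L.map TransvectionStruct.toMatrix).prod) := by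
    intro L
    induction L with
    | nil => simpa using hP1
    | cons t L ih =>
      rw [List.map_cons, List.prod_cons, ← one_mul (1 : SqMat n K), evenBlocks_mul]
      exact hP _ _ (hPr t) ih
  obtain ⟨L, L', D, ha⟩ := Matrix.Pivot.exists_list_transvec_mul_diagonal_mul_list_transvec a
  obtain ⟨M, M', E, hdd⟩ := Matrix.Pivot.exists_list_transvec_mul_diagonal_mul_list_transvec d
  have hdetD : a.det = ∏ i, D i := by
    rw [ha, det_mul, det_mul]
    simp
  have hdetE : d.det = ∏ i, E i := by
    rw [hdd, det_mul, det_mul]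
    simp
  have hDE := hPdiag (Sum.elim D E) (by simpa [← hdetE] using hd)
    (by simp only [Sum.elim_inl, Sum.elim_inr]; rw [← hdetD, ← hdetE, had])
  simp only [Sum.elim_inl, Sum.elim_inr] at hDE
  have e : evenBlocks a d = evenBlocks (L.map TransvectionStruct.toMatrix).prod 1 *
      evenBlocks 1 (M.map TransvectionStruct.toMatrix).prod *
      evenBlocks (diagonal D) (diagonal E) *
      (evenBlocks (L'.map TransvectionStruct.toMatrix).prod 1 *
        evenBlocks 1 (M'.map TransvectionStruct.toMatrix).prod) := by
    rw [← evenBlocks_mul, ← evenBlocks_mul, ← evenBlocks_mul, ← evenBlocks_mul, Matrix.mul_one,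
      Matrix.one_mul, Matrix.one_mul, Matrix.mul_one, ← ha, ← hdd]
  rw [e]
  exact (hP _ _ (hP _ _ (hP _ _ (hLl L) (hLr M)) hDE) (hP _ _ (hLl L') (hLr M'))).2

/-- The polynomial ring in the entries of a pair of square matrices. -/
abbrev GenRing (n m : ℕ) : Type := MvPolynomial ((Fin n × Fin n) ⊕ (Fin m × Fin m)) ℂ

/-- The first generic matrix. -/
def genA (n m : ℕ) : SqMat n (GenRing n m) :=
  Matrix.of fun i j => MvPolynomial.X (inl (i, j))

/-- The second generic matrix. -/
def genD (n m : ℕ) : SqMat m (GenRing n m) :=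
  Matrix.of fun i j => MvPolynomial.X (inr (i, j))

/-- The product of the determinants of the generic matrices. -/
def genDet (n m : ℕ) : GenRing n m := (genA n m).det * (genD n m).det

/-- The specialization of the generic matrices. -/
def genSpec {R : Type} [CommRing R] (f : ℂ →+* R) (a : SqMat n R)
    (d : SqMat m R) : GenRing n m →+* R :=
  MvPolynomial.eval₂Hom f (Sum.elim (fun x => a x.1 x.2) (fun x => d x.1 x.2))

variable {R : Type} [CommRing R] (f : ℂ →+* R) (a : SqMat n R) (d : SqMat m R)

theorem genA_map : (genA n m).map (genSpec f a d) = a := by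
  ext i j
  simp [genA, genSpec]

theorem genD_map : (genD n m).map (genSpec f a d) = d := by
  ext i j
  simp [genD, genSpec]

theorem genSpec_genDet : genSpec f a d (genDet n m) = a.det * d.det := by
  rw [genDet, map_mul, RingHom.map_det, RingHom.map_det]
  exact congrArg₂ (· * ·) (congrArg Matrix.det (genA_map f a d)) (congrArg Matrix.det (genD_map f a d))

theorem genDet_ne_zero : genDet n m ≠ 0 := by
  intro h
  have h1 := genSpec_genDet (n := n) (m := m) (RingHom.id ℂ) 1 1
  rw [h, map_zero, det_one, det_one] at h1
  norm_num at h1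

/-- The coordinate ring of `GL(n) × GL(m)`. -/
abbrev GenLoc (n m : ℕ) : Type := Localization.Away (genDet n m)

instance : IsDomain (GenLoc n m) :=
  IsLocalization.isDomain_localization (powers_le_nonZeroDivisors_of_noZeroDivisors genDet_ne_zero)

theorem generation (p₀ : Fin m)
    (hmul : ∀ (A : SAlg) (g h : SMat n m A), g ∈ SLPoints n m A →
      h ∈ SLPoints n m A → Q A g → Q A h → Q A (g * h))
    (hmap : ∀ (A B : SAlg) (f : SAlg.Hom A B) (g : SMat n m A),
      g ∈ SLPoints n m A → Q A g → Q B (g.map f.toAlgHom))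
    (hrefl : ∀ (A B : SAlg) (f : SAlg.Hom A B) (g : SMat n m A),
      Injective f.toAlgHom → g ∈ SLPoints n m A → Q B (g.map f.toAlgHom) → Q A g)
    (hroot : ∀ (A : SAlg) (i j : Idx n m) (x : A), i ≠ j →
      x ∈ A.grade (stdParity i + stdParity j) → Q A (1 + Matrix.single i j x))
    (hdiag : ∀ (A : SAlg) (R : Type) [CommRing R] (f : R →+* A) (_ : ∀ r, f r ∈ A.grade 0)
      (t : Idx n m → R), IsUnit (∏ p, t (inr p)) → ∏ i, t (inl i) = ∏ p, t (inr p) →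
      Q A (diagonal fun j => f (t j)))
    (A : SAlg) (g : SMat n m A) (hg : g ∈ SLPoints n m A) : Q A g := by
  have hQ1 : Q A 1 := by
    have := hdiag A (A.grade 0) A.evenHom (fun r => r.2) 1 (by simp) (by simp)
    simpa using this
  obtain ⟨b, c, a, d, hb, hc, hd, had, rfl⟩ := mem_SLPoints_iff.1 hg
  let P : SMat n m A → Prop := fun g => g ∈ SLPoints n m A ∧ Q A g
  have hP : ∀ {g h}, P g → P h → P (g * h) := fun hg hh =>
    ⟨SLPoints.mul_mem hg.1 hh.1, hmul A _ _ hg.1 hh.1 hg.2 hh.2⟩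
  have hP1 : P 1 := ⟨SLPoints.one_mem, hQ1⟩
  have hplus : P (uPlus b) := by
    rw [Matrix.matrix_eq_sum_single b]
    have hadd : ∀ x y : Matrix (Fin n) (Fin m) A, P (uPlus x) → P (uPlus y) → P (uPlus (x + y)) :=
      fun x y hx hy => uPlus_add x y ▸ hP hx hy
    have h0 : P (uPlus (0 : Matrix (Fin n) (Fin m) A)) := uPlus_zero ▸ hP1
    refine sum_induction _ (fun x => P (uPlus x)) hadd h0 fun i _ =>
      sum_induction _ (fun x => P (uPlus x)) hadd h0 fun p _ =>
        ⟨uPlus_mem (isOddMat_single _ _ (hb i p)), ?_⟩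
    rw [uPlus_single]
    exact hroot A _ _ _ (by simp) (hb i p)
  have hminus : P (uMinus c) := by
    rw [Matrix.matrix_eq_sum_single c]
    have hadd : ∀ x y : Matrix (Fin m) (Fin n) A,
        P (uMinus x) → P (uMinus y) → P (uMinus (x + y)) :=
      fun x y hx hy => uMinus_add x y ▸ hP hx hy
    have h0 : P (uMinus (0 : Matrix (Fin m) (Fin n) A)) := uMinus_zero ▸ hP1
    refine sum_induction _ (fun x => P (uMinus x)) hadd h0 fun i _ =>
      sum_induction _ (fun x => P (uMinus x)) hadd h0 fun p _ =>
        ⟨uMinus_mem (isOddMat_single _ _ (hc i p)), ?_⟩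
    rw [uMinus_single]
    exact hroot A _ _ _ (by simp) (hc i p)
  have hdg : P (dg a d) := by
    refine ⟨dg_mem hd had, ?_⟩
    let R := GenLoc n m
    let a₁ : SqMat n R := (genA n m).map (algebraMap (GenRing n m) R)
    let d₁ : SqMat m R := (genD n m).map (algebraMap (GenRing n m) R)
    have hdeta : a₁.det = algebraMap (GenRing n m) R (genA n m).det := (RingHom.map_det _ _).symm
    have hdetd : d₁.det = algebraMap (GenRing n m) R (genD n m).det := (RingHom.map_det _ _).symm
    have hu : IsUnit (a₁.det * d₁.det) := by
      rw [hdeta, hdetd, ← map_mul]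
      exact IsLocalization.Away.algebraMap_isUnit (genDet n m)
    have hua : IsUnit a₁.det := isUnit_of_mul_isUnit_left hu
    have hud : IsUnit d₁.det := isUnit_of_mul_isUnit_right hu
    let s : R := a₁.det * Ring.inverse d₁.det
    let d₂ : SqMat m R := d₁ * diagonal (Pi.mulSingle p₀ s)
    have hd₂ : d₂.det = a₁.det := by
      rw [det_mul, det_diagonal, prod_pi_mulSingle', if_pos (mem_univ _)]
      change d₁.det * (a₁.det * Ring.inverse d₁.det) = a₁.det
      rw [mul_left_comm, Ring.mul_inverse_cancel _ hud, mul_one]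
    have hmem : evenBlocks a₁ d₂ ∈ SLPoints n m (evenSAlg R) :=
      evenBlocks_mem _ _ (hd₂ ▸ hua) hd₂.symm
    have huniv : Q (evenSAlg R) (evenBlocks a₁ d₂) := by
      let K := FractionRing R
      let f : SAlg.Hom (evenSAlg R) (evenSAlg K) :=
        SAlg.Hom.ofEven (B := evenSAlg K) (IsScalarTower.toAlgHom ℂ R K) fun _ => mem_evenSAlg_zero _
      refine hrefl _ _ f _ (IsFractionRing.injective R K) hmem ?_
      have e : (evenBlocks a₁ d₂).map f.toAlgHom =
          evenBlocks (a₁.map (algebraMap R K)) (d₂.map (algebraMap R K)) := by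
        refine (fromBlocks_map _ _ _ _ _).trans ?_
        rw [Matrix.map_zero _ (map_zero _), Matrix.map_zero _ (map_zero _)]
        rfl
      rw [e]
      have hK : ∀ {k : ℕ} (x : SqMat k R),
          (x.map (algebraMap R K)).det = algebraMap R K x.det := fun x => (RingHom.map_det _ x).symm
      refine generation_field hmul hroot hdiag K _ _ ?_ ?_
      · rw [hK, hd₂]
        exact (hua.map (algebraMap R K)).ne_zero
      · rw [hK, hK, hd₂]
    let c₀ : ℂ →+* A.grade 0 :=
      { toFun := fun z => ⟨algebraMap ℂ A z, by
          rw [Algebra.algebraMap_eq_smul_one]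
          exact Submodule.smul_mem _ _ A.one_mem⟩
        map_one' := Subtype.ext (map_one _)
        map_mul' := fun _ _ => Subtype.ext (map_mul _ _ _)
        map_zero' := Subtype.ext (map_zero _)
        map_add' := fun _ _ => Subtype.ext (map_add _ _ _) }
    have hspec : IsUnit (genSpec c₀ a d (genDet n m)) := by
      rw [genSpec_genDet, had]
      exact hd.mul hd
    let ψ : R →+* A.grade 0 := IsLocalization.Away.lift (genDet n m) hspec
    have hψ : ∀ x, ψ (algebraMap (GenRing n m) R x) = genSpec c₀ a d x := fun x =>
      IsLocalization.Away.lift_eq (genDet n m) hspec x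
    let ψ' : R →ₐ[ℂ] A :=
      { A.evenHom.comp ψ with
        commutes' := fun z => by
          change ((ψ (algebraMap ℂ R z) : A.grade 0) : A) = _
          rw [IsScalarTower.algebraMap_apply ℂ (GenRing n m) R, hψ, MvPolynomial.algebraMap_eq,
            genSpec, MvPolynomial.coe_eval₂Hom, MvPolynomial.eval₂_C]
          rfl }
    let F : SAlg.Hom (evenSAlg R) A := SAlg.Hom.ofEven ψ' fun x => (ψ x).2
    have h := hmap _ A F _ hmem huniv
    have ea : a₁.map ψ = a := by
      refine Eq.trans ?_ (genA_map c₀ a d)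
      ext1 i j
      exact hψ _
    have ed : d₁.map ψ = d := by
      refine Eq.trans ?_ (genD_map c₀ a d)
      ext1 i j
      exact hψ _
    have edet : ψ s = 1 := by
      have h1 : ψ a₁.det = a.det := (RingHom.map_det ψ a₁).trans (congrArg Matrix.det ea)
      have h2 : ψ d₁.det = d.det := (RingHom.map_det ψ d₁).trans (congrArg Matrix.det ed)
      have h3 : ψ s * ψ d₁.det = ψ a₁.det := by
        rw [← map_mul]
        congr 1
        change a₁.det * Ring.inverse d₁.det * d₁.det = _
        rw [mul_assoc, Ring.inverse_mul_cancel _ hud, mul_one]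
      rw [h1, h2, had] at h3
      exact hd.mul_right_cancel (h3.trans (one_mul _).symm)
    have ed₂ : d₂.map ψ = d := by
      rw [Matrix.map_mul, ed, Matrix.diagonal_map (map_zero ψ)]
      have : (fun k => ψ (Pi.mulSingle (M := fun _ => R) p₀ s k)) = fun _ => 1 := by
        funext k
        by_cases hk : k = p₀
        · subst hk
          rw [Pi.mulSingle_eq_same, edet]
        · rw [Pi.mulSingle_eq_of_ne hk, map_one]
      rw [this, diagonal_one, Matrix.mul_one]
    have e : (evenBlocks a₁ d₂).map F.toAlgHom = dg a d := by
      refine (fromBlocks_map _ _ _ _ _).trans ?_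
      rw [Matrix.map_zero _ (map_zero _), Matrix.map_zero _ (map_zero _), dg]
      congr 1
      · conv_rhs => rw [← ea]
        rfl
      · conv_rhs => rw [← ed₂]
        rfl
    rwa [e] at h
  exact (hP (hP hplus hdg) hminus).2

end Generation

/-! ### Subrepresentations and quotients -/

section Splittings

variable {n m : ℕ}

theorem isEvenMat_mul {ι κ μ : Type} [Fintype κ] {A : SAlg} {p : ι → ZMod 2} {q : κ → ZMod 2}
    {r : μ → ZMod 2} {x : Matrix ι κ A} {y : Matrix κ μ A} (hx : IsEvenMat A p q x)
    (hy : IsEvenMat A q r y) : IsEvenMat A p r (x * y) := by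
  intro i j
  rw [Matrix.mul_apply]
  refine sum_mem fun k _ => mul_mem_grade (hx i k) (hy k j) ?_
  have : ∀ a b c : ZMod 2, a + b + (b + c) = a + c := by decide
  exact this _ _ _

/-- Parity preserving complex matrices. -/
def IsEvenC {ι κ : Type} (p : ι → ZMod 2) (q : κ → ZMod 2) (S : Matrix ι κ ℂ) : Prop :=
  ∀ i j, S i j ≠ 0 → p i = q j

theorem IsEvenC.isEvenMat {ι κ : Type} {p : ι → ZMod 2} {q : κ → ZMod 2} {S : Matrix ι κ ℂ}
    (h : IsEvenC p q S) (A : SAlg) : IsEvenMat A p q (sm 1 S) := by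
  intro i j
  rw [sm_apply]
  by_cases h0 : S i j = 0
  · rw [h0, zero_smul]
    exact zero_mem _
  · rw [h i j h0, parity_add_self]
    exact Submodule.smul_mem _ _ A.one_mem

/-- A decomposition of a superspace with a homogeneous basis into two superspaces. -/
structure GradedSplit {ι : Type} [Fintype ι] [DecidableEq ι] (par : ι → ZMod 2) where
  κ₁ : Type
  κ₂ : Type
  [fin₁ : Fintype κ₁]
  [fin₂ : Fintype κ₂]
  [dec₁ : DecidableEq κ₁]
  [dec₂ : DecidableEq κ₂]
  par₁ : κ₁ → ZMod 2
  par₂ : κ₂ → ZMod 2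
  S : Matrix ι κ₁ ℂ
  S' : Matrix κ₁ ι ℂ
  T : Matrix κ₂ ι ℂ
  T' : Matrix ι κ₂ ℂ
  evenS : IsEvenC par par₁ S
  evenS' : IsEvenC par₁ par S'
  evenT : IsEvenC par₂ par T
  evenT' : IsEvenC par par₂ T'
  hS : S' * S = 1
  hT : T * T' = 1
  hadd : S * S' + T' * T = 1

attribute [instance] GradedSplit.fin₁ GradedSplit.fin₂ GradedSplit.dec₁ GradedSplit.dec₂

section

variable {ι : Type} [Fintype ι] [DecidableEq ι] {par : ι → ZMod 2} (sp : GradedSplit par)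

theorem GradedSplit.hTS : sp.T * sp.S = 0 := by
  have h : sp.T * (sp.S * sp.S' + sp.T' * sp.T) * sp.S = sp.T * sp.S := by
    rw [sp.hadd, Matrix.mul_one]
  rw [Matrix.mul_add, Matrix.add_mul, ← Matrix.mul_assoc, Matrix.mul_assoc _ sp.S' sp.S, sp.hS,
    Matrix.mul_one, ← Matrix.mul_assoc, sp.hT, Matrix.one_mul] at h
  simpa using h

/-- The subspace. -/
def GradedSplit.W : Submodule ℂ (ι → ℂ) := LinearMap.range sp.S.mulVecLin

theorem GradedSplit.mem_W {v : ι → ℂ} : v ∈ sp.W ↔ sp.T.mulVec v = 0 := by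
  constructor
  · rintro ⟨u, rfl⟩
    rw [mulVecLin_apply, mulVec_mulVec, sp.hTS, zero_mulVec]
  · intro h
    refine ⟨sp.S'.mulVec v, ?_⟩
    rw [mulVecLin_apply, mulVec_mulVec]
    have h1 : (sp.S * sp.S' + sp.T' * sp.T).mulVec v = v := by rw [sp.hadd, one_mulVec]
    rwa [Matrix.add_mulVec, ← mulVec_mulVec v sp.T', h, mulVec_zero, add_zero] at h1

theorem GradedSplit.stable_iff {M : Matrix ι ι ℂ} :
    sp.T * M * sp.S = 0 ↔ ∀ v ∈ sp.W, M.mulVec v ∈ sp.W := by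
  constructor
  · rintro h _ ⟨u, rfl⟩
    rw [sp.mem_W, mulVecLin_apply, mulVec_mulVec, mulVec_mulVec, h, zero_mulVec]
  · intro h
    apply ext_of_mulVec_single
    intro k
    rw [zero_mulVec, ← mulVec_mulVec, ← mulVec_mulVec, ← sp.mem_W]
    exact h _ ⟨_, rfl⟩

/-- The projection onto the vectors of given parity. -/
def parityProj (par : ι → ZMod 2) (q : ZMod 2) : (ι → ℂ) →ₗ[ℂ] (ι → ℂ) where
  toFun v i := if par i = q then v i else 0
  map_add' v w := by
    funext i
    simp only [Pi.add_apply]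
    split_ifs <;> simp
  map_smul' c v := by
    funext i
    simp

theorem parityProj_apply (par : ι → ZMod 2) (q : ZMod 2) (v : ι → ℂ) (i : ι) :
    parityProj par q v i = if par i = q then v i else 0 := rfl

theorem parityProj_add (par : ι → ZMod 2) (v : ι → ℂ) :
    parityProj par 0 v + parityProj par 1 v = v := by
  funext i
  rw [Pi.add_apply, parityProj_apply, parityProj_apply]
  rcases parity_cases (par i) with h | h <;> simp [h]

/-- Homogeneous vectors. -/
def IsHomog (par : ι → ZMod 2) (q : ZMod 2) (v : ι → ℂ) : Prop := ∀ i, v i ≠ 0 → par i = q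

theorem isHomog_parityProj (par : ι → ZMod 2) (q : ZMod 2) (v : ι → ℂ) :
    IsHomog par q (parityProj par q v) := by
  intro i h
  rw [parityProj_apply] at h
  by_contra h'
  exact h (if_neg h')

theorem IsHomog.parityProj_eq {par : ι → ZMod 2} {q : ZMod 2} {v : ι → ℂ} (h : IsHomog par q v)
    (r : ZMod 2) : parityProj par r v = if q = r then v else 0 := by
  funext i
  rw [parityProj_apply]
  by_cases h0 : v i = 0
  · split_ifs <;> simp [h0]
  · rw [h i h0]
    split_ifs <;> rfl

/-- Graded subspaces. -/
def IsGradedSub (par : ι → ZMod 2) (W : Submodule ℂ (ι → ℂ)) : Prop :=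
  ∀ v ∈ W, ∀ q, parityProj par q v ∈ W

theorem exists_gradedSplit {W : Submodule ℂ (ι → ℂ)} (hW : IsGradedSub par W) :
    ∃ sp : GradedSplit par, sp.W = W := by
  classical
  let s : Set (ι → ℂ) := {v | v ∈ W ∧ ∃ q, IsHomog par q v}
  let t : Set (ι → ℂ) := {v | ∃ q, IsHomog par q v}
  obtain ⟨b, hbs, hbspan, hbli⟩ := exists_linearIndependent ℂ s
  obtain ⟨b', hb't, hbb', htb', hb'li⟩ := exists_linearIndepOn_id_extension (K := ℂ) (s := b)
    (t := t) hbli (fun v hv => (hbs hv).2)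
  have hspans : Submodule.span ℂ s = W := by
    apply le_antisymm
    · exact Submodule.span_le.2 fun v hv => hv.1
    · intro v hv
      rw [← parityProj_add par v]
      exact add_mem (Submodule.subset_span ⟨hW v hv 0, 0, isHomog_parityProj _ _ _⟩)
        (Submodule.subset_span ⟨hW v hv 1, 1, isHomog_parityProj _ _ _⟩)
  have hspant : ⊤ ≤ Submodule.span ℂ (Set.range (Subtype.val : b' → ι → ℂ)) := by
    rw [Subtype.range_coe]
    intro v _
    rw [← parityProj_add par v]
    exact add_mem (htb' ⟨0, isHomog_parityProj _ _ _⟩) (htb' ⟨1, isHomog_parityProj _ _ _⟩)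
  let B : Module.Basis b' ℂ (ι → ℂ) := Module.Basis.mk hb'li hspant
  have hB : ∀ x, B x = (x : ι → ℂ) := fun x => Module.Basis.mk_apply hb'li hspant x
  have : Fintype b' := Module.Basis.fintypeIndexOfRankLtAleph0 B (Module.rank_lt_aleph0 ℂ _)
  choose p hp using fun x : b' => hb't x.2
  have hrepr : ∀ (j : ι) (x : b'), B.repr (Pi.single j 1) x ≠ 0 → p x = par j := by
    intro j x hx
    by_contra hne
    apply hx
    have h1 : IsHomog par (par j) (Pi.single j (1 : ℂ)) := by
      intro i hi
      by_cases hij : i = j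
      · rw [hij]
      · exact absurd (Pi.single_eq_of_ne hij 1) hi
    have h2 : (Pi.single j (1 : ℂ) : ι → ℂ) =
        ∑ x, (if p x = par j then B.repr (Pi.single j 1) x else 0) • B x := by
      have h3 := h1.parityProj_eq (par j)
      rw [if_pos rfl] at h3
      conv_lhs => rw [← h3, ← B.sum_repr (Pi.single j 1), map_sum]
      refine sum_congr rfl fun x _ => ?_
      rw [map_smul, hB, (hp x).parityProj_eq]
      split_ifs <;> simp
    rw [h2, B.repr_sum_self, if_neg hne]
  have hsum : ∀ (k' : b') (k : b'), ∑ i, B.repr (Pi.single i 1) k * (k' : ι → ℂ) i =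
      if k = k' then 1 else 0 := by
    intro k' k
    have h1 : (k' : ι → ℂ) = ∑ i, (k' : ι → ℂ) i • Pi.single i (1 : ℂ) := by
      funext j
      simp [Finset.sum_apply, Pi.single_apply]
    have h2 : B.repr (k' : ι → ℂ) k = if k = k' then 1 else 0 := by
      rw [← hB k', B.repr_self, Finsupp.single_apply]
      simp [eq_comm]
    rw [← h2]
    conv_rhs => rw [h1]
    rw [map_sum, Finsupp.finsetSum_apply]
    refine sum_congr rfl fun i _ => ?_
    rw [map_smul, Finsupp.smul_apply, smul_eq_mul, mul_comm]
  let sp : GradedSplit par :=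
    { κ₁ := {x : b' // (x : ι → ℂ) ∈ b}
      κ₂ := {x : b' // (x : ι → ℂ) ∉ b}
      par₁ := fun x => p x.1
      par₂ := fun x => p x.1
      S := Matrix.of fun i x => (x.1 : ι → ℂ) i
      S' := Matrix.of fun x i => B.repr (Pi.single i 1) x.1
      T := Matrix.of fun x i => B.repr (Pi.single i 1) x.1
      T' := Matrix.of fun i x => (x.1 : ι → ℂ) i
      evenS := fun i x h => hp x.1 i h
      evenS' := fun x i h => hrepr i x.1 h
      evenT := fun x i h => hrepr i x.1 h
      evenT' := fun i x h => hp x.1 i h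
      hS := by
        ext k k'
        rw [Matrix.mul_apply]
        refine (hsum k'.1 k.1).trans ?_
        rw [one_apply]
        simp only [Subtype.ext_iff]
      hT := by
        ext k k'
        rw [Matrix.mul_apply]
        refine (hsum k'.1 k.1).trans ?_
        rw [one_apply]
        simp only [Subtype.ext_iff]
      hadd := by
        ext i j
        rw [Matrix.add_apply, Matrix.mul_apply, Matrix.mul_apply]
        refine (Fintype.sum_subtype_add_sum_subtype (fun x : b' => (x : ι → ℂ) ∈ b)
          (fun x : b' => (x : ι → ℂ) i * B.repr (Pi.single j 1) x)).trans ?_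
        have h1 := congrFun (B.sum_repr (Pi.single j 1)) i
        rw [Finset.sum_apply] at h1
        refine Eq.trans ?_ (h1.trans (by simp [Pi.single_apply, one_apply]))
        refine sum_congr rfl fun x _ => ?_
        rw [hB, Pi.smul_apply, smul_eq_mul, mul_comm] }
  refine ⟨sp, ?_⟩
  rw [GradedSplit.W, Matrix.range_mulVecLin, ← hspans, ← hbspan]
  congr 1
  ext v
  constructor
  · rintro ⟨k, rfl⟩
    exact k.2
  · intro hv
    exact ⟨⟨⟨v, hbb' hv⟩, hv⟩, rfl⟩

end

variable {V : SLRep n m} (sp : GradedSplit V.par)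

theorem GradedSplit.sm_hadd (A : SAlg) :
    sm (1 : A) sp.S * sm (1 : A) sp.S' + sm (1 : A) sp.T' * sm (1 : A) sp.T = 1 := by
  rw [sm_mul, sm_mul, mul_one, ← sm_add, sp.hadd, sm_one_one]

/-- Stability of the subspace under the action of all points. -/
def GradedSplit.Stable : Prop :=
  ∀ (A : SAlg) (g : SLPoints n m A), sm (1 : A) sp.T * V.act A g * sm (1 : A) sp.S = 0

theorem GradedSplit.act_mul_S (h : sp.Stable) (A : SAlg) (g : SLPoints n m A) :
    V.act A g * sm (1 : A) sp.S = sm (1 : A) sp.S * (sm (1 : A) sp.S' * V.act A g * sm (1 : A) sp.S) := by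
  have h1 : (sm (1 : A) sp.S * sm (1 : A) sp.S' + sm (1 : A) sp.T' * sm (1 : A) sp.T) * (V.act A g * sm (1 : A) sp.S) =
      V.act A g * sm (1 : A) sp.S := by rw [sp.sm_hadd, Matrix.one_mul]
  rw [← h1, Matrix.add_mul]
  simp only [Matrix.mul_assoc]
  rw [← Matrix.mul_assoc (sm (1 : A) sp.T), h A g, Matrix.mul_zero, add_zero]

theorem GradedSplit.T_mul_act (h : sp.Stable) (A : SAlg) (g : SLPoints n m A) :
    sm (1 : A) sp.T * V.act A g = sm (1 : A) sp.T * V.act A g * sm (1 : A) sp.T' * sm (1 : A) sp.T := by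
  have h1 : (sm (1 : A) sp.T * V.act A g) * (sm (1 : A) sp.S * sm (1 : A) sp.S' + sm (1 : A) sp.T' * sm (1 : A) sp.T) =
      sm (1 : A) sp.T * V.act A g := by rw [sp.sm_hadd, Matrix.mul_one]
  conv_lhs => rw [← h1, Matrix.mul_add]
  rw [← Matrix.mul_assoc, h A g, Matrix.zero_mul, zero_add, ← Matrix.mul_assoc]

/-- The subrepresentation. -/
def GradedSplit.sub (h : sp.Stable) : SLRep n m where
  ι := sp.κ₁
  par := sp.par₁
  act A g := sm (1 : A) sp.S' * V.act A g * sm (1 : A) sp.S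
  act_even A g := isEvenMat_mul (isEvenMat_mul (sp.evenS'.isEvenMat A) (V.act_even A g))
    (sp.evenS.isEvenMat A)
  act_one A g hg := by
    rw [V.act_one A g hg, Matrix.mul_one, sm_mul, sp.hS, mul_one, sm_one_one]
  act_mul A g g' k hk := by
    rw [V.act_mul A g g' k hk, ← Matrix.mul_assoc (sm (1 : A) sp.S'),
      Matrix.mul_assoc _ (V.act A g'), sp.act_mul_S h, ← Matrix.mul_assoc]
  act_natural A B f g g' hg := by
    rw [V.act_natural A B f g g' hg, Matrix.map_mul, Matrix.map_mul, sm_map, sm_map, map_one]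

/-- The quotient representation. -/
def GradedSplit.quot (h : sp.Stable) : SLRep n m where
  ι := sp.κ₂
  par := sp.par₂
  act A g := sm (1 : A) sp.T * V.act A g * sm (1 : A) sp.T'
  act_even A g := isEvenMat_mul (isEvenMat_mul (sp.evenT.isEvenMat A) (V.act_even A g))
    (sp.evenT'.isEvenMat A)
  act_one A g hg := by
    rw [V.act_one A g hg, Matrix.mul_one, sm_mul, sp.hT, mul_one, sm_one_one]
  act_mul A g g' k hk := by
    rw [V.act_mul A g g' k hk, ← Matrix.mul_assoc (sm (1 : A) sp.T)]
    conv_lhs => rw [sp.T_mul_act h]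
    simp only [Matrix.mul_assoc]
  act_natural A B f g g' hg := by
    rw [V.act_natural A B f g g' hg, Matrix.map_mul, Matrix.map_mul, sm_map, sm_map, map_one]

/-- The inclusion of the subrepresentation. -/
def GradedSplit.incl (h : sp.Stable) : SLRep.Hom (sp.sub h) V where
  mat := sp.S
  even := sp.evenS
  comm A g := by
    change V.act A g * sp.S.map (algebraMap ℂ A) =
      sp.S.map (algebraMap ℂ A) * (sm (1 : A) sp.S' * V.act A g * sm (1 : A) sp.S)
    rw [map_algebraMap_eq_sm]
    exact sp.act_mul_S h A g

/-- The projection onto the quotient. -/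
def GradedSplit.proj (h : sp.Stable) : SLRep.Hom V (sp.quot h) where
  mat := sp.T
  even := sp.evenT
  comm A g := by
    change sm (1 : A) sp.T * V.act A g * sm (1 : A) sp.T' * sp.T.map (algebraMap ℂ A) =
      sp.T.map (algebraMap ℂ A) * V.act A g
    rw [map_algebraMap_eq_sm]
    exact (sp.T_mul_act h A g).symm

theorem GradedSplit.mulVec_S_injective : Injective sp.S.mulVec := by
  intro u v huv
  have h1 := congrArg sp.S'.mulVec huv
  rwa [mulVec_mulVec, mulVec_mulVec, sp.hS, one_mulVec, one_mulVec] at h1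

theorem GradedSplit.shortExact (h : sp.Stable) : SLRep.IsShortExact (sp.incl h) (sp.proj h) := by
  have h1 : ∀ w : sp.κ₂ → ℂ, sp.T.mulVec (sp.T'.mulVec w) = w := fun w => by
    rw [mulVec_mulVec, sp.hT, one_mulVec]
  exact ⟨sp.mulVec_S_injective, fun v => sp.mem_W.symm, fun w => ⟨_, h1 w⟩⟩

theorem GradedSplit.T_expCoeff_S {i j : Idx n m} (hij : i ≠ j)
    (hpar : stdParity i + stdParity j = 0) (hX : sp.T * V.X i j * sp.S = 0) (k : ℕ) :
    sp.T * V.expCoeff hij hpar k * sp.S = 0 := by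
  rw [sp.stable_iff] at *
  induction k with
  | zero =>
    intro v hv
    rwa [V.expCoeff_zero, one_mulVec]
  | succ k ih =>
    intro v hv
    have h := congrArg (fun M => M.mulVec v) (V.expCoeff_succ hij hpar k)
    simp only [smul_mulVec, ← mulVec_mulVec] at h
    have hk : (k : ℂ) + 1 ≠ 0 := by exact_mod_cast Nat.succ_ne_zero k
    rw [← inv_smul_smul₀ hk ((V.expCoeff hij hpar (k + 1)).mulVec v), h]
    exact Submodule.smul_mem _ _ (hX _ (ih v hv))

theorem GradedSplit.T_sm_S (A : SAlg) (y : A) {M : Matrix V.ι V.ι ℂ} (h : sp.T * M * sp.S = 0) :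
    sm (1 : A) sp.T * sm y M * sm (1 : A) sp.S = 0 := by
  rw [sm_mul, sm_mul, h, sm_zero]

theorem exists_torusChar {A : SAlg} {R : Type} [CommRing R] (f : R →+* A)
    (hf : ∀ r, f r ∈ A.grade 0) (t : Idx n m → R) (hu : IsUnit (∏ p, t (inr p)))
    (ht : ∏ i, t (inl i) = ∏ p, t (inr p)) :
    ∃ χ : Multiplicative (MLat n m) →* A, (∀ x, χ x ∈ A.grade 0) ∧
      ∀ j, χ (ofAdd (wtM j)) = f (t j) := by
  have hunit : ∀ j, IsUnit (t j) := by
    rintro (j | j)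
    · rw [← ht] at hu
      exact isUnit_of_dvd_unit (dvd_prod_of_mem (fun i => t (inl i)) (mem_univ j)) hu
    · exact isUnit_of_dvd_unit (dvd_prod_of_mem (fun i => t (inr i)) (mem_univ j)) hu
  let u : Idx n m → Rˣ := fun j => (hunit j).unit
  have hu' : ∑ i, Additive.ofMul (u (inl i)) = ∑ p, Additive.ofMul (u (inr p)) := by
    have h1 : ∏ i, u (inl i) = ∏ p, u (inr p) := by
      apply Units.ext
      rw [Units.coe_prod, Units.coe_prod]
      exact ht
    rw [← ofMul_prod, ← ofMul_prod, h1]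
  let ψ : MLat n m →+ Additive Rˣ := MLat.lift (fun j => Additive.ofMul (u j)) hu'
  refine ⟨(f : R →* A).comp ((Units.coeHom R).comp (AddMonoidHom.toMultiplicativeLeft ψ)),
    fun x => hf _, fun j => ?_⟩
  change f ((Additive.toMul (ψ (wtM j)) : Rˣ) : R) = f (t j)
  rw [MLat.lift_wtM]
  rfl

theorem GradedSplit.stable_of (p₀ : Fin m) (hX : ∀ i j, i ≠ j → sp.T * V.X i j * sp.S = 0)
    (hP : ∀ l, sp.T * V.wproj l * sp.S = 0) : sp.Stable := by
  have hTS : ∀ A : SAlg, sm (1 : A) sp.T * sm (1 : A) sp.S = 0 := fun A => by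
    rw [sm_mul, sp.hTS, sm_zero]
  have key := generation (n := n) (m := m)
    (Q := fun A g => ∀ h : g ∈ SLPoints n m A, sm (1 : A) sp.T * V.act A ⟨g, h⟩ * sm (1 : A) sp.S = 0) p₀
  refine fun A g => key ?_ ?_ ?_ ?_ ?_ A g.1 g.2 g.2
  · intro A g g' hg hg' h h' hgg
    rw [V.act_mul A ⟨g, hg⟩ ⟨g', hg'⟩ ⟨g * g', hgg⟩ rfl]
    have e : sm (1 : A) sp.T * (V.act A ⟨g, hg⟩ * V.act A ⟨g', hg'⟩) * sm (1 : A) sp.S =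
        sm (1 : A) sp.T * (V.act A ⟨g, hg⟩ * (sm (1 : A) sp.S * sm (1 : A) sp.S' + sm (1 : A) sp.T' * sm (1 : A) sp.T) *
          V.act A ⟨g', hg'⟩) * sm (1 : A) sp.S := by rw [sp.sm_hadd, Matrix.mul_one]
    rw [e]
    have h1 := h hg
    have h2 := h' hg'
    simp only [Matrix.mul_assoc, Matrix.mul_add, Matrix.add_mul] at h1 h2 ⊢
    rw [h2]
    simp only [← Matrix.mul_assoc] at h1 ⊢
    rw [h1]
    simp
  · intro A B f g hg h hgB
    rw [V.act_natural A B f ⟨g, hg⟩ ⟨_, hgB⟩ rfl]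
    have h1 := congrArg (fun M => M.map f.toAlgHom) (h hg)
    simp only [Matrix.map_mul, sm_map, map_one] at h1
    rw [h1, Matrix.map_zero _ (map_zero _)]
  · intro A B f g hf hg h hgA
    have h1 := h (SLPoints.map_mem f hg)
    rw [V.act_natural A B f ⟨g, hg⟩ ⟨_, SLPoints.map_mem f hg⟩ rfl] at h1
    have h2 : (sm (1 : A) sp.T * V.act A ⟨g, hg⟩ * sm (1 : A) sp.S).map f.toAlgHom =
        (0 : Matrix sp.κ₂ sp.κ₁ A).map f.toAlgHom := by
      rw [Matrix.map_mul, Matrix.map_mul, sm_map, sm_map, map_one, h1,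
        Matrix.map_zero _ (map_zero _)]
    exact Matrix.map_injective hf h2
  · intro A i j x hij hx hg
    rcases parity_cases (stdParity i + stdParity j) with hp | hp
    · obtain ⟨N, hN⟩ := V.act_even_root hij hp (hp ▸ hx) ⟨_, hg⟩ rfl
      rw [hN, Matrix.mul_sum, Matrix.sum_mul]
      exact sum_eq_zero fun k _ => sp.T_sm_S A _ (sp.T_expCoeff_S hij hp (hX i j hij) k)
    · rw [V.act_one_add_single hij hx (A.mul_self_of_odd (hp ▸ hx)) ⟨_, hg⟩ rfl, Matrix.mul_add,
        Matrix.add_mul, Matrix.mul_one, hTS, sp.T_sm_S A _ (hX i j hij), add_zero]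
  · intro A R _ f hf t hu ht hg
    obtain ⟨χ, hχ, hχt⟩ := exists_torusChar f hf t hu ht
    rw [V.act_torus χ hχ ⟨_, hg⟩ (congrArg diagonal (funext fun j => (hχt j).symm)),
      Matrix.mul_sum, Matrix.sum_mul]
    exact sum_eq_zero fun l _ => sp.T_sm_S A _ (hP l)

end Splittings

/-! ### Highest weights -/

section HighestWeight

variable {n m : ℕ}

theorem SLRep.Hom.comm_map {V W : SLRep n m} (F : SLRep.Hom V W) {A : SAlg} (g : SLPoints n m A)
    (θ : A →ₗ[ℂ] ℂ) : (W.act A g).map θ * F.mat = F.mat * (V.act A g).map θ := by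
  ext i j
  have h := congrArg θ (congrFun (congrFun (F.comm A g) i) j)
  rw [map_algebraMap_eq_sm, Matrix.mul_apply, Matrix.mul_apply, map_sum, map_sum] at h
  simpa only [Matrix.mul_apply, map_apply, sm_apply, mul_smul_comm, smul_mul_assoc, mul_one,
    one_mul, map_smul, smul_eq_mul, mul_comm] using h

theorem SLRep.Hom.X_comm {V W : SLRep n m} (F : SLRep.Hom V W) {i j : Idx n m} (hij : i ≠ j) :
    W.X i j * F.mat = F.mat * V.X i j := by
  let θ : (complexSAlg.nil (stdParity i + stdParity j)) →ₗ[ℂ] ℂ :=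
    ⟨⟨fun a => NilExt.snd a, fun _ _ => rfl⟩, fun _ _ => rfl⟩
  have h : ∀ U : SLRep n m, U.X i j = (U.act _ ⟨_, isSl_single hij⟩).map θ := fun U => by
    rw [SLRep.X, SLRep.d, dif_pos (isSl_single hij)]
    rfl
  rw [h, h]
  exact F.comm_map _ θ

theorem SLRep.Hom.wproj_comm {V W : SLRep n m} (F : SLRep.Hom V W) (l : MLat n m) :
    W.wproj l * F.mat = F.mat * V.wproj l :=
  F.comm_map (A := evenSAlg (TorusRing n m)) ⟨_, univTorus_mem⟩
    ⟨⟨fun a : TorusRing n m => a.coeff l, fun _ _ => rfl⟩, fun _ _ => rfl⟩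

/-- Composition of morphisms. -/
def SLRep.Hom.comp {U V W : SLRep n m} (G : SLRep.Hom V W) (F : SLRep.Hom U V) :
    SLRep.Hom U W where
  mat := G.mat * F.mat
  even i j h := by
    rw [Matrix.mul_apply] at h
    obtain ⟨k, -, hk⟩ := exists_ne_zero_of_sum_ne_zero h
    exact (G.even i k (left_ne_zero_of_mul hk)).trans (F.even k j (right_ne_zero_of_mul hk))
  comm A g := by
    rw [Matrix.map_mul, ← Matrix.mul_assoc, G.comm, Matrix.mul_assoc, F.comm, Matrix.mul_assoc]

/-- The direct sum. -/
def SLRep.sum (V W : SLRep n m) : SLRep n m where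
  ι := V.ι ⊕ W.ι
  par := Sum.elim V.par W.par
  act A g := fromBlocks (V.act A g) 0 0 (W.act A g)
  act_even A g := by
    rintro (i | i) (j | j)
    · exact V.act_even A g i j
    · exact zero_mem _
    · exact zero_mem _
    · exact W.act_even A g i j
  act_one A g hg := by rw [V.act_one A g hg, W.act_one A g hg, fromBlocks_one]
  act_mul A g h k hk := by
    rw [V.act_mul A g h k hk, W.act_mul A g h k hk, fromBlocks_multiply]
    simp
  act_natural A B f g g' hg := by
    rw [V.act_natural A B f g g' hg, W.act_natural A B f g g' hg, fromBlocks_map]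
    simp

/-- The first projection. -/
def SLRep.fst (V W : SLRep n m) : SLRep.Hom (V.sum W) V where
  mat := fromCols (1 : Matrix V.ι V.ι ℂ) (0 : Matrix V.ι W.ι ℂ)
  even := by
    rintro i (j | j) h
    · by_contra hne
      exact h (one_apply_ne fun e => hne (congrArg V.par e))
    · exact absurd rfl h
  comm A g := by
    change V.act A g * (fromCols (1 : Matrix V.ι V.ι ℂ) (0 : Matrix V.ι W.ι ℂ)).map
      (algebraMap ℂ A) = (fromCols (1 : Matrix V.ι V.ι ℂ) (0 : Matrix V.ι W.ι ℂ)).map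
        (algebraMap ℂ A) * fromBlocks (V.act A g) 0 0 (W.act A g)
    have h : (fromCols (1 : Matrix V.ι V.ι ℂ) (0 : Matrix V.ι W.ι ℂ)).map
        (algebraMap ℂ A) = fromCols 1 0 := by
      ext i (j | j) <;> simp [one_apply]
    rw [h, Matrix.mul_fromCols, Matrix.fromCols_mul_fromBlocks]
    simp

/-- The second projection. -/
def SLRep.snd (V W : SLRep n m) : SLRep.Hom (V.sum W) W where
  mat := fromCols (0 : Matrix W.ι V.ι ℂ) (1 : Matrix W.ι W.ι ℂ)
  even := by
    rintro i (j | j) h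
    · exact absurd rfl h
    · by_contra hne
      exact h (one_apply_ne fun e => hne (congrArg W.par e))
  comm A g := by
    change W.act A g * (fromCols (0 : Matrix W.ι V.ι ℂ) (1 : Matrix W.ι W.ι ℂ)).map
      (algebraMap ℂ A) = (fromCols (0 : Matrix W.ι V.ι ℂ) (1 : Matrix W.ι W.ι ℂ)).map
        (algebraMap ℂ A) * fromBlocks (V.act A g) 0 0 (W.act A g)
    have h : (fromCols (0 : Matrix W.ι V.ι ℂ) (1 : Matrix W.ι W.ι ℂ)).map
        (algebraMap ℂ A) = fromCols 0 1 := by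
      ext i (j | j) <;> simp [one_apply]
    rw [h, Matrix.mul_fromCols, Matrix.fromCols_mul_fromBlocks]
    simp

theorem SLRep.fst_mulVec (V W : SLRep n m) (v : V.ι → ℂ) (w : W.ι → ℂ) :
    (V.fst W).mat.mulVec (Sum.elim v w) = v := by
  refine (Matrix.fromCols_mulVec _ _ _).trans ?_
  rw [zero_mulVec, add_zero, one_mulVec]
  rfl

theorem SLRep.snd_mulVec (V W : SLRep n m) (v : V.ι → ℂ) (w : W.ι → ℂ) :
    (V.snd W).mat.mulVec (Sum.elim v w) = w := by
  refine (Matrix.fromCols_mulVec _ _ _).trans ?_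
  rw [zero_mulVec, zero_add, one_mulVec]
  rfl

theorem SLRep.sum_ext {V W : SLRep n m} {x y : (V.sum W).ι → ℂ}
    (h1 : (V.fst W).mat.mulVec x = (V.fst W).mat.mulVec y)
    (h2 : (V.snd W).mat.mulVec x = (V.snd W).mat.mulVec y) : x = y := by
  have h : ∀ z : (V.sum W).ι → ℂ,
      Sum.elim ((V.fst W).mat.mulVec z) ((V.snd W).mat.mulVec z) = z := fun z => by
    have hz : z = Sum.elim (fun i => z (inl i)) fun i => z (inr i) := by
      funext i; rcases i with i | i <;> rfl
    rw [hz, SLRep.fst_mulVec, SLRep.snd_mulVec]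
  rw [← h x, ← h y, h1, h2]

theorem IsEvenC.parityProj {ι κ : Type} [Fintype ι] [DecidableEq ι] [Fintype κ] [DecidableEq κ]
    {p : ι → ZMod 2} {q : κ → ZMod 2} {S : Matrix ι κ ℂ} (h : IsEvenC p q S) (r : ZMod 2)
    (v : κ → ℂ) : S.mulVec (SuperSL.parityProj q r v) = SuperSL.parityProj p r (S.mulVec v) := by
  funext i
  rw [parityProj_apply]
  simp only [Matrix.mulVec, dotProduct, parityProj_apply]
  by_cases hi : p i = r
  · rw [if_pos hi]
    refine sum_congr rfl fun j _ => ?_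
    by_cases h0 : S i j = 0
    · simp [h0]
    · rw [if_pos (by rw [← h i j h0, hi])]
  · rw [if_neg hi]
    refine sum_eq_zero fun j _ => ?_
    by_cases h0 : S i j = 0
    · simp [h0]
    · rw [if_neg (by rwa [← h i j h0]), mul_zero]

variable {V W : SLRep n m}

theorem SLRep.X_isHomog {q : ZMod 2} {v : V.ι → ℂ} (hv : IsHomog V.par q v) (i j : Idx n m) :
    IsHomog V.par (stdParity i + stdParity j + q) ((V.X i j).mulVec v) := by
  intro a ha
  obtain ⟨b, -, hb⟩ := exists_ne_zero_of_sum_ne_zero ha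
  rw [← hv b (right_ne_zero_of_mul hb), ← V.d_parity (left_ne_zero_of_mul hb), add_assoc,
    parity_add_self, add_zero]

theorem SLRep.wproj_wproj (l l' : MLat n m) [Decidable (l = l')] (v : V.ι → ℂ) :
    (V.wproj l).mulVec ((V.wproj l').mulVec v) = if l = l' then (V.wproj l).mulVec v else 0 := by
  rw [mulVec_mulVec, V.wproj_mul]
  split_ifs
  · rfl
  · rw [zero_mulVec]

theorem SLRep.wproj_X {i j : Idx n m} (hij : i ≠ j) {l : MLat n m} {v : V.ι → ℂ}
    (hv : (V.wproj l).mulVec v = v) :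
    (V.wproj (l + (wtM i - wtM j))).mulVec ((V.X i j).mulVec v) = (V.X i j).mulVec v := by
  rw [mulVec_mulVec, V.wproj_mul_X hij, ← mulVec_mulVec, hv]

theorem SLRep.d_zero (q : ZMod 2) : IsSl q (0 : SMat n m ℂ) ∧ V.d q 0 = 0 := by
  have h : IsSl q (0 : SMat n m ℂ) := by
    rw [IsSl, sm_zero, add_zero]
    exact SLPoints.one_mem
  refine ⟨h, ?_⟩
  rw [SLRep.d, dif_pos h, V.act_one _ ⟨_, h⟩
    (show 1 + sm (complexSAlg.eta q) 0 = 1 by rw [sm_zero, add_zero])]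
  ext i j
  rw [of_apply, one_apply]
  split_ifs <;> rfl

theorem SLRep.X_X_mem {D : Submodule ℂ (V.ι → ℂ)} {w : V.ι → ℂ} {l : MLat n m}
    (hw : (V.wproj l).mulVec w = w) (hwD : w ∈ D)
    (h1 : ∀ a b, a ≠ b → (V.X a b).mulVec w ∈ D) {i j a b : Idx n m} (hij : i ≠ j) (hab : a ≠ b)
    (h2 : (V.X a b).mulVec ((V.X i j).mulVec w) ∈ D) :
    (V.X i j).mulVec ((V.X a b).mulVec w) ∈ D := by
  classical
  have key : ∀ {i j a b : Idx n m} {B : SMat n m ℂ} (hij : i ≠ j) (hab : a ≠ b)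
      (q : ZMod 2), q = stdParity i + stdParity j + (stdParity a + stdParity b) →
      Matrix.single i j 1 * Matrix.single a b 1 -
        sgn ((stdParity i + stdParity j) * (stdParity a + stdParity b)) •
          (Matrix.single a b 1 * Matrix.single i j 1) = B → IsSl q B →
      (V.X i j).mulVec ((V.X a b).mulVec w) -
        sgn ((stdParity i + stdParity j) * (stdParity a + stdParity b)) •
          (V.X a b).mulVec ((V.X i j).mulVec w) = (V.d q B).mulVec w := by
    rintro i j a b B hij hab q rfl rfl hB
    rw [V.d_bracket (isSl_single hij) (isSl_single hab) hB, Matrix.sub_mulVec, smul_mulVec,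
      ← mulVec_mulVec, ← mulVec_mulVec]
    rfl
  by_cases hja : j = a
  · subst hja
    by_cases hib : i = b
    · subst hib
      let c : ℂ := sgn ((stdParity i + stdParity j) * (stdParity j + stdParity i))
      have hc : (Pi.single i 1 - c • Pi.single j 1 : Idx n m → ℂ) ∈ cartan n m := by
        have e3 : ((1 : ZMod 2) + 1) = 0 := by decide
        change ∑ r, (Pi.single i 1 - c • Pi.single j 1 : Idx n m → ℂ) (inl r) =
          ∑ r, (Pi.single i 1 - c • Pi.single j 1 : Idx n m → ℂ) (inr r)
        rcases i with i | i <;> rcases j with j | j <;>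
          simp [c, stdParity, Pi.single_apply, e3, sgn_zero, sgn_one]
      have h := key hij hab 0 (by
        have : ∀ a b : ZMod 2, 0 = a + b + (b + a) := by decide
        exact this _ _) (B := diagonal (Pi.single i 1 - c • Pi.single j 1)) (by
          rw [single_mul_single_same, single_mul_single_same]
          ext r s
          rw [Matrix.sub_apply, Matrix.smul_apply, Matrix.diagonal_apply, Matrix.single_apply,
            Matrix.single_apply]
          by_cases hrs : r = s
          · subst hrs
            simp [Pi.single_apply, c, eq_comm]
          · rw [if_neg (fun h => hrs (h.1.symm.trans h.2)),
              if_neg (fun h => hrs (h.1.symm.trans h.2)), if_neg hrs]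
            simp) (isSl_diagonal ⟨_, hc⟩)
      rw [V.d_diagonal ⟨_, hc⟩, sum_mulVec] at h
      rw [← sub_add_cancel ((V.X i j).mulVec ((V.X j i).mulVec w)), h]
      refine add_mem (sum_mem fun l' _ => ?_) (Submodule.smul_mem _ _ h2)
      rw [smul_mulVec, ← hw, V.wproj_wproj]
      split_ifs with hl
      · rw [hl, hw]
        exact Submodule.smul_mem _ _ hwD
      · rw [smul_zero]
        exact zero_mem _
    · have h := key hij hab (stdParity i + stdParity b) (by
        have : ∀ a b c : ZMod 2, a + c = a + b + (b + c) := by decide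
        exact this _ _ _) (B := Matrix.single i b 1) (by
          rw [single_mul_single_same, single_mul_single_of_ne _ _ _ _ (Ne.symm hib)]
          simp) (isSl_single hib)
      rw [← sub_add_cancel ((V.X i j).mulVec ((V.X j b).mulVec w)), h]
      exact add_mem (h1 i b hib) (Submodule.smul_mem _ _ h2)
  · by_cases hib : i = b
    · subst hib
      have h := key hab hij (stdParity a + stdParity j) (by
        have : ∀ a b c : ZMod 2, a + c = a + b + (b + c) := by decide
        exact this _ _ _) (B := Matrix.single a j 1) (by
          rw [single_mul_single_same, single_mul_single_of_ne _ _ _ _ hja]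
          simp) (isSl_single (Ne.symm hja))
      rw [sub_eq_iff_eq_add, ← sub_eq_iff_eq_add'] at h
      rw [← inv_smul_smul₀ (sgn_ne_zero _) ((V.X i j).mulVec ((V.X a i).mulVec w)), ← h]
      exact Submodule.smul_mem _ _ (sub_mem h2 (h1 a j (Ne.symm hja)))
    · have h := key hij hab _ rfl (B := 0) (by
          rw [single_mul_single_of_ne _ _ _ _ hja, single_mul_single_of_ne _ _ _ _ (Ne.symm hib)]
          simp) (V.d_zero _).1
      rw [(V.d_zero _).2, zero_mulVec, sub_eq_zero] at h
      rw [h]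
      exact Submodule.smul_mem _ _ h2

end HighestWeight

/-! ### Simple representations -/

section Simple

variable {n m : ℕ}

/-- Graded subspaces stable under the root vectors and the projections onto weight spaces. -/
def SLRep.IsSub (V : SLRep n m) (D : Submodule ℂ (V.ι → ℂ)) : Prop :=
  IsGradedSub V.par D ∧ (∀ i j, i ≠ j → ∀ v ∈ D, (V.X i j).mulVec v ∈ D) ∧
    ∀ l, ∀ v ∈ D, (V.wproj l).mulVec v ∈ D

/-- Simple representations. -/
def SLRep.IsSimple (V : SLRep n m) : Prop :=
  Nonempty V.ι ∧ ∀ D, V.IsSub D → D = ⊥ ∨ D = ⊤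

theorem SLRep.IsSub.exists_split {V : SLRep n m} {D : Submodule ℂ (V.ι → ℂ)} (h : V.IsSub D)
    (p₀ : Fin m) : ∃ sp : GradedSplit V.par, sp.W = D ∧ sp.Stable := by
  obtain ⟨sp, rfl⟩ := exists_gradedSplit h.1
  exact ⟨sp, rfl, sp.stable_of p₀ (fun i j hij => sp.stable_iff.2 (h.2.1 i j hij))
    fun l => sp.stable_iff.2 (h.2.2 l)⟩

theorem SLRep.IsSub.map {V W : SLRep n m} {D : Submodule ℂ (V.ι → ℂ)} (h : V.IsSub D)
    (F : SLRep.Hom V W) : W.IsSub (D.map F.mat.mulVecLin) := by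
  refine ⟨?_, ?_, ?_⟩
  · rintro _ ⟨v, hv, rfl⟩ q
    exact ⟨_, h.1 v hv q, IsEvenC.parityProj F.even q v⟩
  · rintro i j hij _ ⟨v, hv, rfl⟩
    refine ⟨_, h.2.1 i j hij v hv, ?_⟩
    rw [mulVecLin_apply, mulVecLin_apply, mulVec_mulVec, mulVec_mulVec, F.X_comm hij]
  · rintro l _ ⟨v, hv, rfl⟩
    refine ⟨_, h.2.2 l v hv, ?_⟩
    rw [mulVecLin_apply, mulVecLin_apply, mulVec_mulVec, mulVec_mulVec, F.wproj_comm]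

theorem SLRep.IsSub.inf_ker {V W : SLRep n m} {D : Submodule ℂ (V.ι → ℂ)} (h : V.IsSub D)
    (F : SLRep.Hom V W) : V.IsSub (D ⊓ ker F.mat.mulVecLin) := by
  refine ⟨?_, ?_, ?_⟩
  · rintro v ⟨hv, hv' : F.mat.mulVec v = 0⟩ q
    refine ⟨h.1 v hv q, ?_⟩
    change F.mat.mulVec _ = 0
    rw [IsEvenC.parityProj F.even, hv', map_zero]
  · rintro i j hij v ⟨hv, hv' : F.mat.mulVec v = 0⟩
    refine ⟨h.2.1 i j hij v hv, ?_⟩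
    change F.mat.mulVec _ = 0
    rw [mulVec_mulVec, ← F.X_comm hij, ← mulVec_mulVec, hv', mulVec_zero]
  · rintro l v ⟨hv, hv' : F.mat.mulVec v = 0⟩
    refine ⟨h.2.2 l v hv, ?_⟩
    change F.mat.mulVec _ = 0
    rw [mulVec_mulVec, ← F.wproj_comm, ← mulVec_mulVec, hv', mulVec_zero]

variable (ht : MLat n m →+ ℤ)

/-- Homogeneous singular vectors of weight `μ` and parity `q`. -/
structure SLRep.IsSingular (V : SLRep n m) (μ : MLat n m) (q : ZMod 2) (v : V.ι → ℂ) : Prop where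
  ne : v ≠ 0
  homog : IsHomog V.par q v
  wt : (V.wproj μ).mulVec v = v
  raise : ∀ i j, i ≠ j → 0 < ht (wtM i - wtM j) → (V.X i j).mulVec v = 0

/-- The vectors obtained from `v` by lowering operators. -/
inductive SLRep.IsWord (V : SLRep n m) (v : V.ι → ℂ) : (V.ι → ℂ) → Prop
  | base : SLRep.IsWord V v v
  | step {w : V.ι → ℂ} (i j : Idx n m) : i ≠ j → ht (wtM i - wtM j) < 0 →
      SLRep.IsWord V v w → SLRep.IsWord V v ((V.X i j).mulVec w)

/-- The subspace spanned by the vectors obtained from `v` by lowering operators. -/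
def SLRep.cyclic (V : SLRep n m) (v : V.ι → ℂ) : Submodule ℂ (V.ι → ℂ) :=
  Submodule.span ℂ {w | V.IsWord ht v w}

variable {ht} {V W : SLRep n m} {μ : MLat n m} {q : ZMod 2} {v : V.ι → ℂ}

theorem SLRep.IsSingular.word (h : V.IsSingular ht μ q v) {w : V.ι → ℂ} (hw : V.IsWord ht v w) :
    ∃ l r, (V.wproj l).mulVec w = w ∧ IsHomog V.par r w ∧ (l = μ ∧ w = v ∨ ht l < ht μ) := by
  induction hw with
  | base => exact ⟨μ, q, h.wt, h.homog, Or.inl ⟨rfl, rfl⟩⟩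
  | step i j hij hlt _ ih =>
    obtain ⟨l, r, h1, h2, h3⟩ := ih
    refine ⟨_, _, V.wproj_X hij h1, SLRep.X_isHomog h2 i j, Or.inr ?_⟩
    rw [map_add]
    rcases h3 with ⟨rfl, -⟩ | h3 <;> omega

theorem SLRep.X_mem_cyclic {i j : Idx n m} (hij : i ≠ j) (hlt : ht (wtM i - wtM j) < 0)
    {u : V.ι → ℂ} (hu : u ∈ V.cyclic ht v) : (V.X i j).mulVec u ∈ V.cyclic ht v := by
  have h : V.cyclic ht v ≤ (V.cyclic ht v).comap (V.X i j).mulVecLin :=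
    Submodule.span_le.2 fun w hw => Submodule.subset_span (SLRep.IsWord.step i j hij hlt hw)
  exact h hu

theorem SLRep.IsSingular.isSub (hht : ∀ i j, i ≠ j → ht (wtM i - wtM j) ≠ 0)
    (h : V.IsSingular ht μ q v) : V.IsSub (V.cyclic ht v) := by
  classical
  refine ⟨fun u hu r => ?_, fun i j hij u hu => ?_, fun l u hu => ?_⟩
  · have h1 : V.cyclic ht v ≤ (V.cyclic ht v).comap (parityProj V.par r) := by
      refine Submodule.span_le.2 fun w hw => ?_
      obtain ⟨l, r', -, h2, -⟩ := h.word hw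
      change parityProj V.par r w ∈ V.cyclic ht v
      rw [h2.parityProj_eq]
      split_ifs
      · exact Submodule.subset_span hw
      · exact zero_mem _
    exact h1 hu
  · have h1 : V.cyclic ht v ≤ (V.cyclic ht v).comap (V.X i j).mulVecLin := by
      refine Submodule.span_le.2 fun w hw => ?_
      change (V.X i j).mulVec w ∈ V.cyclic ht v
      induction hw generalizing i j with
      | base =>
        rcases lt_or_gt_of_ne (hht i j hij) with h0 | h0
        · exact SLRep.X_mem_cyclic hij h0 (Submodule.subset_span SLRep.IsWord.base)
        · rw [h.raise i j hij h0]
          exact zero_mem _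
      | step a b hab hlt hw ih =>
        obtain ⟨l, -, h2, -, -⟩ := h.word hw
        exact SLRep.X_X_mem h2 (Submodule.subset_span hw) (fun a b hab => ih a b hab) hij hab
          (SLRep.X_mem_cyclic hab hlt (ih i j hij))
    exact h1 hu
  · have h1 : V.cyclic ht v ≤ (V.cyclic ht v).comap (V.wproj l).mulVecLin := by
      refine Submodule.span_le.2 fun w hw => ?_
      obtain ⟨l', -, h2, -, -⟩ := h.word hw
      change (V.wproj l).mulVec w ∈ V.cyclic ht v
      rw [← h2, V.wproj_wproj]
      split_ifs with hl
      · rw [hl, h2]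
        exact Submodule.subset_span hw
      · exact zero_mem _
    exact h1 hu

theorem SLRep.IsSingular.wproj_cyclic (h : V.IsSingular ht μ q v) {u : V.ι → ℂ}
    (hu : u ∈ V.cyclic ht v) {l : MLat n m} (hl : ht μ ≤ ht l) :
    ∃ c : ℂ, (V.wproj l).mulVec u = c • v ∧ (l ≠ μ → c = 0) := by
  classical
  refine Submodule.span_induction (p := fun u _ => ∃ c : ℂ, (V.wproj l).mulVec u = c • v ∧
    (l ≠ μ → c = 0)) (fun w hw => ?_) ⟨0, by simp⟩ ?_ ?_ hu
  · obtain ⟨l', -, h2, -, h3⟩ := h.word hw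
    rcases h3 with ⟨rfl, rfl⟩ | h3
    · by_cases e : l = l'
      · exact ⟨1, by rw [e, h2, one_smul], fun h => absurd e h⟩
      · exact ⟨0, by rw [← h2, V.wproj_wproj, if_neg e, zero_smul], fun _ => rfl⟩
    · refine ⟨0, ?_, fun _ => rfl⟩
      rw [← h2, V.wproj_wproj, if_neg (fun e => by rw [e] at hl; omega), zero_smul]
  · rintro x y - - ⟨c, hc, hc'⟩ ⟨d, hd, hd'⟩
    exact ⟨c + d, by rw [Matrix.mulVec_add, hc, hd, add_smul], fun e => by rw [hc' e, hd' e, add_zero]⟩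
  · rintro a x - ⟨c, hc, hc'⟩
    exact ⟨a * c, by rw [mulVec_smul, hc, smul_smul], fun e => by rw [hc' e, mul_zero]⟩

theorem SLRep.IsSingular.mem_cyclic : v ∈ V.cyclic ht v := Submodule.subset_span SLRep.IsWord.base

theorem SLRep.IsSimple.cyclic_eq (hht : ∀ i j, i ≠ j → ht (wtM i - wtM j) ≠ 0)
    (hV : V.IsSimple) (h : V.IsSingular ht μ q v) : V.cyclic ht v = ⊤ :=
  (hV.2 _ (h.isSub hht)).resolve_left fun h0 =>
    h.ne ((Submodule.eq_bot_iff _).1 h0 v SLRep.IsSingular.mem_cyclic)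

theorem SLRep.exists_isSingular (ht : MLat n m →+ ℤ) (hV : Nonempty V.ι) :
    ∃ μ q v, V.IsSingular ht μ q v := by
  classical
  let s := V.wts.filter fun l => V.wproj l ≠ 0
  have hs : s.Nonempty := by
    by_contra h0
    rw [not_nonempty_iff_eq_empty, filter_eq_empty_iff] at h0
    have h1 := V.sum_wproj
    rw [sum_eq_zero fun l hl => not_not.1 (h0 hl)] at h1
    exact zero_ne_one h1
  obtain ⟨μ, hμ, hmax⟩ := s.exists_max_image ht hs
  have hzero : ∀ l, ht μ < ht l → V.wproj l = 0 := by
    intro l hl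
    by_contra h0
    have hls : l ∈ s := mem_filter.2 ⟨by_contra fun h1 => h0 (V.wproj_eq_zero h1), h0⟩
    exact absurd (hmax l hls) (not_le.2 hl)
  obtain ⟨u, hu⟩ : ∃ u, (V.wproj μ).mulVec u ≠ 0 := by
    by_contra! h0
    exact (mem_filter.1 hμ).2 (ext_of_mulVec_single fun i => by rw [h0, zero_mulVec])
  obtain ⟨q, hq⟩ : ∃ q, parityProj V.par q ((V.wproj μ).mulVec u) ≠ 0 := by
    by_contra! h0
    rw [← parityProj_add V.par ((V.wproj μ).mulVec u), h0, h0, add_zero] at hu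
    exact hu rfl
  have hwt : (V.wproj μ).mulVec (parityProj V.par q ((V.wproj μ).mulVec u)) =
      parityProj V.par q ((V.wproj μ).mulVec u) := by
    have he : IsEvenC V.par V.par (V.wproj μ) := fun _ _ => V.wproj_even
    rw [he.parityProj, V.wproj_wproj, if_pos rfl]
  refine ⟨μ, q, _, hq, isHomog_parityProj _ _ _, hwt, fun i j hij hpos => ?_⟩
  rw [← V.wproj_X hij hwt, hzero _ (by rw [map_add]; omega), zero_mulVec]

theorem SLRep.IsSimple.bijective_of_singular (hht : ∀ i j, i ≠ j → ht (wtM i - wtM j) ≠ 0)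
    {M : SLRep n m} (hV : V.IsSimple) (hW : W.IsSimple) (P : SLRep.Hom M V) (Q : SLRep.Hom M W)
    (hPQ : ∀ x, P.mat.mulVec x = 0 → Q.mat.mulVec x = 0 → x = 0) {x : M.ι → ℂ}
    (hx : M.IsSingular ht μ q x) (hP : P.mat.mulVec x ≠ 0) (hQ : Q.mat.mulVec x ≠ 0)
    (sp : GradedSplit M.par) (hsp : sp.W = M.cyclic ht x) (hst : sp.Stable) :
    Function.Bijective (P.comp (sp.incl hst)).mat.mulVec := by
  have hmul : ∀ u, (P.comp (sp.incl hst)).mat.mulVec u = P.mat.mulVec (sp.S.mulVec u) := fun u =>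
    (mulVec_mulVec u P.mat sp.S).symm
  have hD := hx.isSub hht
  constructor
  · rw [← Matrix.coe_mulVecLin, ← LinearMap.ker_eq_bot, LinearMap.ker_eq_bot']
    intro u hu
    rw [mulVecLin_apply, hmul] at hu
    have hy : sp.S.mulVec u ∈ M.cyclic ht x := hsp ▸ ⟨u, rfl⟩
    have hQ0 : Q.mat.mulVec (sp.S.mulVec u) = 0 := by
      rcases hW.2 _ ((hD.inf_ker P).map Q) with h | h
      · exact (Submodule.eq_bot_iff _).1 h _ ⟨_, ⟨hy, hu⟩, rfl⟩
      · exfalso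
        have hQx : Q.mat.mulVec x ∈ (⊤ : Submodule ℂ (W.ι → ℂ)) := trivial
        rw [← h] at hQx
        obtain ⟨y, ⟨hy, hPy : P.mat.mulVec y = 0⟩, hQy : Q.mat.mulVec y = _⟩ := hQx
        obtain ⟨c, hc, -⟩ := hx.wproj_cyclic hy le_rfl
        have h1 : c • P.mat.mulVec x = 0 := by
          rw [← mulVec_smul, ← hc, mulVec_mulVec, ← P.wproj_comm, ← mulVec_mulVec, hPy, mulVec_zero]
        rw [(smul_eq_zero.1 h1).resolve_right hP, zero_smul] at hc
        apply hQ
        rw [← hx.wt, mulVec_mulVec, ← Q.wproj_comm, ← mulVec_mulVec, ← hQy, mulVec_mulVec,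
          Q.wproj_comm, ← mulVec_mulVec, hc, mulVec_zero]
    have h1 := hPQ _ hu hQ0
    exact sp.mulVec_S_injective (h1.trans (mulVec_zero _).symm)
  · intro w
    have h1 : (M.cyclic ht x).map P.mat.mulVecLin = ⊤ :=
      (hV.2 _ (hD.map P)).resolve_left fun h0 =>
        hP ((Submodule.eq_bot_iff _).1 h0 _ ⟨x, SLRep.IsSingular.mem_cyclic, rfl⟩)
    have hw : w ∈ (⊤ : Submodule ℂ (V.ι → ℂ)) := trivial
    rw [← h1, ← hsp] at hw
    obtain ⟨_, ⟨u, rfl⟩, rfl⟩ := hw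
    exact ⟨u, hmul u⟩

theorem grothClass_eq_of_iso (F : SLRep.Hom V W) (hF : Function.Bijective F.mat.mulVec) :
    grothClass V = grothClass W :=
  ((grothCon n m).eq).2 (iso_mem_grothRel F hF)

theorem grothClass_of_exact {U : SLRep n m} {S : SLRep.Hom U V} {T : SLRep.Hom V W}
    (h : SLRep.IsShortExact S T) : grothClass V = grothClass U + grothClass W := by
  have h1 : FreeAbelianGroup.of U + FreeAbelianGroup.of W - FreeAbelianGroup.of V ∈ grothRel n m := by
    have h2 : FreeAbelianGroup.of U - FreeAbelianGroup.of V + FreeAbelianGroup.of W ∈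
        grothRel n m := AddSubgroup.subset_closure (Or.inl ⟨U, V, W, S, T, h, rfl⟩)
    rwa [sub_add_eq_add_sub] at h2
  exact (((grothCon n m).eq).2 h1).symm

theorem grothClass_parityShift (V : SLRep n m) : grothClass V.parityShift = -grothClass V := by
  have h1 : FreeAbelianGroup.of V + FreeAbelianGroup.of V.parityShift - 0 ∈ grothRel n m := by
    rw [sub_zero]
    exact AddSubgroup.subset_closure (Or.inr ⟨V, rfl⟩)
  exact eq_neg_of_add_eq_zero_right (((grothCon n m).eq).2 h1)

theorem SLRep.IsSimple.grothClass_eq (hht : ∀ i j, i ≠ j → ht (wtM i - wtM j) ≠ 0) (p₀ : Fin m)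
    (hV : V.IsSimple) (hW : W.IsSimple) (hv : V.IsSingular ht μ q v) {w : W.ι → ℂ}
    (hw : W.IsSingular ht μ q w) : grothClass V = grothClass W := by
  let P := V.fst W
  let Q := V.snd W
  obtain ⟨x, hP, hQ, hxq⟩ : ∃ x : (V.sum W).ι → ℂ, P.mat.mulVec x = v ∧ Q.mat.mulVec x = w ∧
      IsHomog (V.sum W).par q x := by
    refine ⟨Sum.elim v w, V.fst_mulVec W v w, V.snd_mulVec W v w, ?_⟩
    rintro (i | i) h
    · exact hv.homog i h
    · exact hw.homog i h
  have hx : (V.sum W).IsSingular ht μ q x := by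
    refine ⟨fun h0 => hv.ne ?_, hxq, ?_, fun i j hij hpos => ?_⟩
    · rw [← hP, h0, mulVec_zero]
    · apply SLRep.sum_ext
      · change P.mat.mulVec _ = P.mat.mulVec _
        rw [mulVec_mulVec, ← P.wproj_comm, ← mulVec_mulVec, hP, hv.wt]
      · change Q.mat.mulVec _ = Q.mat.mulVec _
        rw [mulVec_mulVec, ← Q.wproj_comm, ← mulVec_mulVec, hQ, hw.wt]
    · apply SLRep.sum_ext
      · change P.mat.mulVec _ = P.mat.mulVec _
        rw [mulVec_mulVec, ← P.X_comm hij, ← mulVec_mulVec, hP, hv.raise i j hij hpos, mulVec_zero]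
      · change Q.mat.mulVec _ = Q.mat.mulVec _
        rw [mulVec_mulVec, ← Q.X_comm hij, ← mulVec_mulVec, hQ, hw.raise i j hij hpos, mulVec_zero]
  have hPQ : ∀ x, P.mat.mulVec x = 0 → Q.mat.mulVec x = 0 → x = 0 := fun x h1 h2 =>
    SLRep.sum_ext (h1.trans (mulVec_zero _).symm) (h2.trans (mulVec_zero _).symm)
  obtain ⟨sp, hsp, hst⟩ := (hx.isSub hht).exists_split p₀
  rw [← grothClass_eq_of_iso _ (hV.bijective_of_singular hht hW P Q hPQ hx (by rw [hP]; exact hv.ne)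
      (by rw [hQ]; exact hw.ne) sp hsp hst),
    ← grothClass_eq_of_iso _ (hW.bijective_of_singular hht hV Q P (fun x h1 h2 => hPQ x h2 h1) hx
      (by rw [hQ]; exact hw.ne) (by rw [hP]; exact hv.ne) sp hsp hst)]

theorem GradedSplit.card_add {ι : Type} [Fintype ι] [DecidableEq ι] {par : ι → ZMod 2}
    (sp : GradedSplit par) : Fintype.card sp.κ₁ + Fintype.card sp.κ₂ = Fintype.card ι := by
  have h := congrArg Matrix.trace sp.hadd
  rw [Matrix.trace_add, Matrix.trace_mul_comm, sp.hS, Matrix.trace_mul_comm sp.T', sp.hT,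
    Matrix.trace_one, Matrix.trace_one, Matrix.trace_one] at h
  exact_mod_cast h

theorem grothClass_mem_closure_simple (p₀ : Fin m) (V : SLRep n m) :
    grothClass V ∈ AddSubgroup.closure {x | ∃ L : SLRep n m, L.IsSimple ∧ x = grothClass L} := by
  induction h : Fintype.card V.ι using Nat.strong_induction_on generalizing V with
  | _ N ih =>
    rcases isEmpty_or_nonempty V.ι with he | hne
    · have h1 := grothClass_eq_of_iso (SLRep.Hom.toZero V)
        ⟨fun a b _ => funext fun i => (he.false i).elim, fun a => ⟨0, funext fun i => Empty.elim i⟩⟩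
      have h2 : grothClass (SLRep.zero n m) = 0 :=
        ((grothCon n m).eq).2 (show FreeAbelianGroup.of _ - 0 ∈ grothRel n m by
          rw [sub_zero]; exact zero_mem_grothRel n m)
      rw [h1, h2]
      exact zero_mem _
    · by_cases hs : V.IsSimple
      · exact AddSubgroup.subset_closure ⟨V, hs, rfl⟩
      · obtain ⟨D, hD, h0, h1⟩ : ∃ D, V.IsSub D ∧ D ≠ ⊥ ∧ D ≠ ⊤ := by
          by_contra! hc
          exact hs ⟨hne, fun D hD => or_iff_not_imp_left.2 (hc D hD)⟩
        obtain ⟨sp, rfl, hst⟩ := hD.exists_split p₀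
        have hcard := sp.card_add
        have hκ₁ : 0 < Fintype.card sp.κ₁ := by
          rw [Fintype.card_pos_iff]
          by_contra he
          rw [not_nonempty_iff] at he
          refine h0 ((Submodule.eq_bot_iff _).2 ?_)
          rintro _ ⟨u, rfl⟩
          rw [Subsingleton.elim u 0, map_zero]
        have hκ₂ : 0 < Fintype.card sp.κ₂ := by
          rw [Fintype.card_pos_iff]
          by_contra he
          rw [not_nonempty_iff] at he
          exact h1 (eq_top_iff.2 fun v _ => sp.mem_W.2 (Subsingleton.elim _ _))
        rw [grothClass_of_exact (sp.shortExact hst)]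
        exact add_mem (ih (Fintype.card sp.κ₁) (by omega) (sp.sub hst) rfl)
          (ih (Fintype.card sp.κ₂) (by omega) (sp.quot hst) rfl)

end Simple

/-! ### Supercharacters -/

section Supercharacter

variable {n m : ℕ}

/-- The supertrace of a matrix over a commutative ring. -/
def str {ι R : Type} [Fintype ι] [CommRing R] [Algebra ℂ R] (p : ι → ZMod 2) (M : Matrix ι ι R) :
    R := ∑ i, sgn (p i) • M i i

section

variable {ι κ R : Type} [Fintype ι] [Fintype κ] [CommRing R] [Algebra ℂ R] {p : ι → ZMod 2}
  {q : κ → ZMod 2}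

theorem str_add (M N : Matrix ι ι R) : str p (M + N) = str p M + str p N := by
  simp only [str, Matrix.add_apply, smul_add, sum_add_distrib]

theorem str_smul (c : R) (M : Matrix ι ι R) : str p (c • M) = c * str p M := by
  simp only [str, Matrix.smul_apply, mul_sum, smul_eq_mul, mul_smul_comm]

theorem str_mul_comm (r : ZMod 2) {M : Matrix ι κ R} (hM : ∀ i j, M i j ≠ 0 → p i + q j = r)
    (N : Matrix κ ι R) : str p (M * N) = sgn r • str q (N * M) := by
  simp only [str, Matrix.mul_apply, smul_sum]
  rw [sum_comm]
  refine sum_congr rfl fun j _ => sum_congr rfl fun i _ => ?_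
  by_cases h : M i j = 0
  · simp [h]
  · have h1 : p i = r + q j := by rw [← hM i j h, add_assoc, parity_add_self, add_zero]
    rw [mul_comm (N j i), h1, sgn_add, mul_smul]

theorem str_mul_comm_of_even {M : Matrix ι κ R} (hM : ∀ i j, M i j ≠ 0 → p i = q j)
    (N : Matrix κ ι R) : str p (M * N) = str q (N * M) := by
  rw [str_mul_comm 0 (fun i j h => by rw [hM i j h, parity_add_self]), sgn_zero, one_smul]

theorem sm_ne_zero {A : Type} [Ring A] [Algebra ℂ A] {ι κ : Type} {y : A} {B : Matrix ι κ ℂ} {i : ι}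
    {j : κ} (h : sm y B i j ≠ 0) : B i j ≠ 0 := fun h0 => h (by rw [sm_apply, h0, zero_smul])

end

variable (V : SLRep n m)

/-- The supertrace of the universal point of the torus. -/
def SLRep.strT : TorusRing n m := str V.par V.actT

theorem SLRep.actT_eq : V.actT = ∑ l ∈ V.wts, sm (ex l : TorusRing n m) (V.wproj l) :=
  V.act_torus (A := evenSAlg (TorusRing n m)) (of ℂ (MLat n m))
    (fun _ => mem_evenSAlg_zero _) ⟨_, univTorus_mem⟩ rfl

theorem coeff_str_torus {ι : Type} [Fintype ι] (p : ι → ZMod 2) (M : Matrix ι ι (TorusRing n m))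
    (l : MLat n m) : (str p M).coeff l = str p (M.map fun a => a.coeff l) := by
  let θ : TorusRing n m →+ ℂ := ⟨⟨fun a => a.coeff l, rfl⟩, fun _ _ => rfl⟩
  exact map_sum θ (fun i => sgn (p i) • M i i) univ

theorem SLRep.coeff_strT (l : MLat n m) : V.strT.coeff l = str V.par (V.wproj l) :=
  coeff_str_torus _ _ _

theorem SLRep.strT_mul (V W : SLRep n m) : (V * W).strT = V.strT * W.strT := by
  refine (Fintype.sum_prod_type (α₁ := V.ι) (α₂ := W.ι) _).trans ?_
  rw [SLRep.strT, SLRep.strT, str, str, sum_mul_sum]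
  refine sum_congr rfl fun i _ => sum_congr rfl fun k _ => ?_
  change sgn (V.par i + W.par k) • (sgn ((V.par i + V.par i) * W.par k) •
    (V.actT i i * W.actT k k)) = _
  rw [parity_add_self, zero_mul, sgn_zero, one_smul, sgn_add, smul_mul_smul_comm]

theorem SLRep.strT_parityShift : V.parityShift.strT = -V.strT := by
  rw [SLRep.strT, SLRep.strT, str, str, ← sum_neg_distrib]
  refine sum_congr rfl fun i _ => ?_
  change sgn (V.par i + 1) • V.actT i i = _
  rw [sgn_add, sgn_one, mul_neg_one, neg_smul]

theorem exists_splitting {ι κ μ : Type} [Fintype ι] [Fintype κ] [Fintype μ] [DecidableEq ι]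
    [DecidableEq κ] [DecidableEq μ] {S : Matrix ι κ ℂ} {T : Matrix μ ι ℂ}
    (h1 : Injective S.mulVec) (h2 : Function.Exact S.mulVec T.mulVec)
    (h3 : Function.Surjective T.mulVec) :
    ∃ (S' : Matrix κ ι ℂ) (T' : Matrix ι μ ℂ), S' * S = 1 ∧ T * T' = 1 ∧ S * S' + T' * T = 1 := by
  obtain ⟨g, hg⟩ := T.mulVecLin.exists_rightInverse_of_surjective (LinearMap.range_eq_top.2 h3)
  obtain ⟨r, hr⟩ := S.mulVecLin.exists_leftInverse_of_injective (LinearMap.ker_eq_bot.2 h1)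
  let T' := LinearMap.toMatrix' g
  let R := LinearMap.toMatrix' r
  have hT : T * T' = 1 := by
    have := congrArg LinearMap.toMatrix' hg
    rwa [LinearMap.toMatrix'_comp, LinearMap.toMatrix'_id, ← Matrix.toLin'_apply',
      LinearMap.toMatrix'_toLin'] at this
  have hR : R * S = 1 := by
    have := congrArg LinearMap.toMatrix' hr
    rwa [LinearMap.toMatrix'_comp, LinearMap.toMatrix'_id, ← Matrix.toLin'_apply',
      LinearMap.toMatrix'_toLin'] at this
  have hTS : T * S = 0 := ext_of_mulVec_single fun i => by
    rw [← mulVec_mulVec, zero_mulVec]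
    exact (h2 _).2 ⟨_, rfl⟩
  refine ⟨R * (1 - T' * T), T', ?_, hT, ?_⟩
  · rw [Matrix.mul_assoc, Matrix.sub_mul, Matrix.mul_assoc, hTS, Matrix.mul_zero, sub_zero,
      Matrix.one_mul, hR]
  · have h : S * (R * (1 - T' * T)) = 1 - T' * T := ext_of_mulVec_single fun i => by
      obtain ⟨u, hu⟩ := (h2 ((1 - T' * T).mulVec (Pi.single i 1))).1 (by
        rw [mulVec_mulVec, Matrix.mul_sub, ← Matrix.mul_assoc, hT, Matrix.mul_one, Matrix.one_mul,
          sub_self, zero_mulVec])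
      rw [← mulVec_mulVec, ← mulVec_mulVec, ← hu, mulVec_mulVec _ R, hR, one_mulVec]
    rw [h, sub_add_cancel]

theorem SLRep.strT_of_exact {U V W : SLRep n m} {S : SLRep.Hom U V} {T : SLRep.Hom V W}
    (h : SLRep.IsShortExact S T) : V.strT = U.strT + W.strT := by
  obtain ⟨S', T', h1, h2, h3⟩ := exists_splitting h.1 h.2.1 h.2.2
  have e : V.actT = V.actT * sm (1 : TorusRing n m) S.mat * sm (1 : TorusRing n m) S' + V.actT * sm (1 : TorusRing n m) T' * sm (1 : TorusRing n m) T.mat := by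
    rw [Matrix.mul_assoc, Matrix.mul_assoc, ← Matrix.mul_add, sm_mul, sm_mul, mul_one, ← sm_add, h3,
      sm_one_one, Matrix.mul_one]
  have eS : V.actT * sm (1 : TorusRing n m) S.mat = sm (1 : TorusRing n m) S.mat * U.actT := by
    rw [← map_algebraMap_eq_sm]
    exact S.comm _ _
  have eT : W.actT * sm (1 : TorusRing n m) T.mat = sm (1 : TorusRing n m) T.mat * V.actT := by
    rw [← map_algebraMap_eq_sm]
    exact T.comm _ _
  have hS : ∀ i j, sm (1 : TorusRing n m) S.mat i j ≠ 0 → V.par i = U.par j :=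
    fun i j h => S.even i j (sm_ne_zero h)
  have hT : ∀ i j, sm (1 : TorusRing n m) T.mat i j ≠ 0 → W.par i = V.par j :=
    fun i j h => T.even i j (sm_ne_zero h)
  rw [SLRep.strT, e, str_add, eS, Matrix.mul_assoc, str_mul_comm_of_even hS, Matrix.mul_assoc,
    sm_mul, h1, ← str_mul_comm_of_even hT, ← Matrix.mul_assoc, ← eT, Matrix.mul_assoc, sm_mul, h2,
    mul_one, sm_one_one, sm_one_one, Matrix.mul_one, Matrix.mul_one]
  rfl

/-! Weight spaces -/

theorem prod_eq_of_diagonal_mem {t : Idx n m → ℂ}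
    (h : (diagonal t : SMat n m complexSAlg) ∈ SLPoints n m complexSAlg) :
    ∏ i, t (inl i) = ∏ p, t (inr p) := by
  obtain ⟨b, c, a, d, hb, hc, -, had, he⟩ := mem_SLPoints_iff.1 h
  have h1 : (1 : ZMod 2) ≠ 0 := by decide
  have hb0 : b = 0 := Matrix.ext fun i j => eq_zero_of_mem_complexGrade h1 (hb i j)
  have hc0 : c = 0 := Matrix.ext fun i j => eq_zero_of_mem_complexGrade h1 (hc i j)
  rw [hb0, hc0, uPlus, uMinus, fromBlocks_one, Matrix.one_mul, Matrix.mul_one] at he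
  have ha : a.map (complexSAlg.evenHom) = diagonal fun i => t (inl i) := by
    ext i j
    have := congrFun (congrFun he (inl i)) (inl j)
    rw [Matrix.diagonal_apply] at this ⊢
    simpa [dg] using this.symm
  have hd : d.map (complexSAlg.evenHom) = diagonal fun i => t (inr i) := by
    ext i j
    have := congrFun (congrFun he (inr i)) (inr j)
    rw [Matrix.diagonal_apply] at this ⊢
    simpa [dg] using this.symm
  let f : complexSAlg.grade 0 →+* ℂ := complexSAlg.evenHom
  have ha' := f.map_det a
  have hd' := f.map_det d
  rw [had, hd'] at ha'
  have e1 : f.mapMatrix a = diagonal fun i => t (inl i) := ha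
  have e2 : f.mapMatrix d = diagonal fun i => t (inr i) := hd
  rw [e1, e2, det_diagonal, det_diagonal] at ha'
  exact ha'.symm

theorem SLRep.mem_weightSpace {k : Idx n m → ℤ} {v : V.ι → ℂ} :
    v ∈ V.weightSpace k ↔ (V.wproj (toMLat n m k)).mulVec v = v := by
  classical
  have hact : ∀ (χ : Multiplicative (MLat n m) →* ℂ) (g : SLPoints n m complexSAlg),
      g.1 = diagonal (fun j => χ (ofAdd (wtM j))) →
      V.actC g = ∑ l ∈ V.wts, χ (ofAdd l) • V.wproj l := by
    intro χ g hg
    refine (V.act_torus (A := complexSAlg) χ (fun _ => mem_complexGrade_zero _) g hg).trans ?_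
    refine sum_congr rfl fun l _ => Matrix.ext fun i j => ?_
    exact mul_comm _ _
  have hχ : ∀ (χ : Multiplicative (MLat n m) →* ℂ), χ (ofAdd (toMLat n m k)) =
      ∏ j, χ (ofAdd (wtM j)) ^ k j := by
    intro χ
    rw [toMLat_eq_sum, ofAdd_sum, map_prod]
    refine prod_congr rfl fun j _ => ?_
    rw [ofAdd_zsmul]
    exact map_zpow' χ (fun x => eq_inv_of_mul_eq_one_left (by rw [← map_mul, inv_mul_cancel, map_one]))
      _ _
  constructor
  · intro hv
    have hz : ∀ l, l ≠ toMLat n m k → (V.wproj l).mulVec v = 0 := by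
      intro l hl
      obtain ⟨h, hh⟩ : ∃ h : cartan n m, ((l - toMLat n m k : MLat n m) : P0 n m).1 h ≠ 0 := by
        by_contra! h0
        exact hl (sub_eq_zero.1 (Subtype.ext (Subtype.ext (LinearMap.ext h0))))
      set z := ((l - toMLat n m k : MLat n m) : P0 n m).1 h with hzdef
      let χ : Multiplicative (MLat n m) →* ℂ :=
        { toFun := fun l => Complex.exp ((Multiplicative.toAdd l).1.1 (z⁻¹ • h))
          map_one' := Complex.exp_zero
          map_mul' := fun a b => Complex.exp_add _ _ }
      let g : SLPoints n m complexSAlg := torusPt (A := complexSAlg) χ fun _ => mem_complexGrade_zero _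
      let t : Idx n m → ℂˣ := fun j => Units.mk0 (χ (ofAdd (wtM j))) (Complex.exp_ne_zero _)
      have h1 : (V.actC g).mulVec v = χ (ofAdd (toMLat n m k)) • v := by
        rw [hχ]
        exact hv t g rfl
      have h2 := congrArg (V.wproj l).mulVec h1
      rw [hact χ g rfl, sum_mulVec, Matrix.mulVec_sum, mulVec_smul,
        sum_congr rfl (fun l' _ => by
          rw [smul_mulVec, mulVec_smul, V.wproj_wproj])] at h2
      have h3 : ∑ x ∈ V.wts, χ (ofAdd x) •
          (if l = x then (V.wproj l).mulVec v else 0) =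
            χ (ofAdd l) • (V.wproj l).mulVec v := by
        by_cases hl' : l ∈ V.wts
        · rw [sum_eq_single_of_mem l hl' fun x _ hx => by rw [if_neg (Ne.symm hx), smul_zero],
            if_pos rfl]
        · rw [V.wproj_eq_zero hl']
          simp
      rw [h3, ← sub_eq_zero, ← sub_smul] at h2
      refine (smul_eq_zero.1 h2).resolve_left fun h4 => ?_
      have h5 : χ (ofAdd l) =
          χ (ofAdd (toMLat n m k)) * Complex.exp 1 := by
        have : Complex.exp 1 = χ (ofAdd (l - toMLat n m k)) := by
          change _ = Complex.exp (((l - toMLat n m k : MLat n m) : P0 n m).1 (z⁻¹ • h))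
          rw [map_smul, ← hzdef, smul_eq_mul, inv_mul_cancel₀ hh]
        rw [this, ← map_mul, ← ofAdd_add, add_sub_cancel]
      rw [h5, sub_eq_zero] at h4
      have h6 : Complex.exp 1 = 1 :=
        mul_left_cancel₀ (Complex.exp_ne_zero _) (h4.trans (mul_one _).symm)
      have h7 := congrArg (fun x : ℂ => ‖x‖) h6
      simp only [Complex.norm_exp, Complex.one_re, norm_one] at h7
      exact absurd (Real.exp_eq_one_iff 1 |>.1 h7) one_ne_zero
    have h1 : (∑ l ∈ V.wts, V.wproj l).mulVec v = v := by rw [V.sum_wproj, one_mulVec]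
    rw [sum_mulVec] at h1
    by_cases hk : toMLat n m k ∈ V.wts
    · rwa [sum_eq_single_of_mem _ hk fun l _ hl => hz l hl] at h1
    · rw [sum_eq_zero fun l hl => hz l fun e => hk (e ▸ hl)] at h1
      rw [← h1, mulVec_zero]
  · intro hv t g hg
    have hprod : ∏ i, (t (inl i) : ℂ) = ∏ p, (t (inr p) : ℂ) :=
      prod_eq_of_diagonal_mem (t := fun j => (t j : ℂ)) (hg ▸ g.2)
    obtain ⟨χ, -, hχt⟩ := exists_torusChar (A := complexSAlg) (RingHom.id ℂ)
      (fun r => mem_complexGrade_zero r) (fun j => (t j : ℂ))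
      (by rw [← Units.coe_prod]; exact Units.isUnit _) hprod
    have hχt' : ∀ j, χ (ofAdd (wtM j)) = (t j : ℂ) := hχt
    have h1 : V.actC g = ∑ l ∈ V.wts, χ (ofAdd l) • V.wproj l :=
      hact χ g (hg.trans (congrArg diagonal (funext fun j => (hχt' j).symm)))
    have h2 := hχ χ
    simp only [hχt'] at h2
    rw [h1, ← h2]
    nth_rewrite 1 [← hv]
    rw [sum_mulVec]
    simp only [smul_mulVec, V.wproj_wproj]
    by_cases hk : toMLat n m k ∈ V.wts
    · rw [sum_eq_single_of_mem _ hk fun l _ hl => by rw [if_neg hl, smul_zero], if_pos rfl, hv]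
    · rw [sum_eq_zero fun l hl => by
        rw [if_neg fun e : l = toMLat n m k => hk (e ▸ hl), smul_zero], ← hv,
        V.wproj_eq_zero hk, zero_mulVec, smul_zero]

theorem SLRep.weightSdim_eq (k : Idx n m → ℤ) :
    (V.weightSdim k : ℂ) = str V.par (V.wproj (toMLat n m k)) := by
  set P := V.wproj (toMLat n m k) with hP
  have he : IsEvenC V.par V.par P := fun _ _ => V.wproj_even
  have key : ∀ q, (Module.finrank ℂ (V.weightSpace k ⊓ V.component q : Submodule ℂ (V.ι → ℂ)) : ℂ) =
      ∑ i, if V.par i = q then P i i else 0 := by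
    intro q
    have hproj : LinearMap.IsProj (V.weightSpace k ⊓ V.component q)
        ((parityProj V.par q).comp P.mulVecLin) := by
      refine ⟨fun x => ⟨V.mem_weightSpace.2 ?_, fun j hj => if_neg hj⟩, fun x hx => ?_⟩
      · change P.mulVec (parityProj V.par q (P.mulVec x)) = parityProj V.par q (P.mulVec x)
        classical
        rw [he.parityProj, hP, V.wproj_wproj, if_pos rfl]
      · have h1 : P.mulVec x = x := V.mem_weightSpace.1 hx.1
        have h2 : IsHomog V.par q x := fun i hi => by_contra fun h => hi (hx.2 i h)
        change parityProj V.par q (P.mulVec x) = x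
        rw [h1, h2.parityProj_eq, if_pos rfl]
    rw [← hproj.trace, LinearMap.trace_eq_matrix_trace ℂ (Pi.basisFun ℂ V.ι), Matrix.trace]
    refine sum_congr rfl fun i _ => ?_
    rw [Matrix.diag_apply, LinearMap.toMatrix_apply, Pi.basisFun_repr, Pi.basisFun_apply,
      LinearMap.comp_apply, parityProj_apply, mulVecLin_apply, Matrix.mulVec_single_one]
    rfl
  rw [SLRep.weightSdim, Int.cast_sub, Int.cast_natCast, Int.cast_natCast, key, key,
    ← sum_sub_distrib, str]
  refine sum_congr rfl fun i _ => ?_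
  rcases parity_cases (V.par i) with h | h <;> simp [h, sgn_zero, sgn_one]

end Supercharacter

section SupercharacterRing

variable {n m : ℕ}

theorem coeff_toCP (f : ZP n m) (l : P0 n m) : (toCP n m f).coeff l = (f.coeff l : ℂ) := by
  simp [toCP]

theorem toCP_single (l : P0 n m) (c : ℤ) :
    toCP n m (single l c) = single l (c : ℂ) := by
  simp [toCP]

theorem toCP_injective : Injective (toCP n m) := by
  intro f g h
  ext l
  have := congrArg (fun f => f.coeff l) h
  simpa only [coeff_toCP, Int.cast_inj] using this

/-- The inclusion of the coordinate ring of the torus into `ℂ[P₀]`. -/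
def torusToCP (n m : ℕ) : TorusRing n m →+* CP n m :=
  mapDomainRingHom ℂ (latticeHom n m).range.subtype

theorem torusToCP_single (l : MLat n m) (c : ℂ) :
    torusToCP n m (single l c) = single (l : P0 n m) c := by
  simp [torusToCP]

theorem str_sm {ι R : Type} [Fintype ι] [CommRing R] [Algebra ℂ R] (p : ι → ZMod 2) (y : R)
    (B : Matrix ι ι ℂ) : str p (sm y B) = str p B • y := by
  simp only [str, sm_apply, sum_smul, smul_smul, smul_eq_mul]

theorem str_sum {ι R s : Type} [Fintype ι] [CommRing R] [Algebra ℂ R] (p : ι → ZMod 2)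
    (S : Finset s) (M : s → Matrix ι ι R) : str p (∑ x ∈ S, M x) = ∑ x ∈ S, str p (M x) := by
  simp only [str, Matrix.sum_apply, smul_sum]
  exact sum_comm

theorem smul_ex {M : Type} (c : ℂ) (l : M) :
    c • (ex l : AddMonoidAlgebra ℂ M) = single l c := by
  rw [smul_single, smul_eq_mul, mul_one]

variable (V : SLRep n m)

theorem SLRep.strT_eq :
    V.strT = ∑ l ∈ V.wts, single l (str V.par (V.wproj l)) := by
  rw [SLRep.strT, V.actT_eq, str_sum]
  simp only [str_sm, smul_ex]

/-- The supercharacter. -/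
def SLRep.sch : ZP n m :=
  ∑ l ∈ V.wts, single (l : P0 n m)
    (V.weightSdim (Function.surjInv toMLat_surjective l))

theorem SLRep.toCP_sch : toCP n m V.sch = torusToCP n m V.strT := by
  rw [V.strT_eq, SLRep.sch, map_sum, map_sum]
  refine sum_congr rfl fun l _ => ?_
  rw [toCP_single, torusToCP_single, V.weightSdim_eq, Function.surjInv_eq toMLat_surjective]

theorem coeff_torusToCP (f : TorusRing n m) (l : MLat n m) :
    (torusToCP n m f).coeff (l : P0 n m) = f.coeff l :=
  Finsupp.mapDomain_apply Subtype.val_injective f.coeff l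

theorem coeff_torusToCP_of_notMem (f : TorusRing n m) {l : P0 n m}
    (h : l ∉ Set.range (latticeHom n m)) : (torusToCP n m f).coeff l = 0 :=
  Finsupp.mapDomain_of_notMem_range f.coeff l (by
    rintro ⟨⟨_, k, rfl⟩, rfl⟩
    exact h ⟨k, rfl⟩)

theorem SLRep.isSupercharacter_sch : V.IsSupercharacter V.sch := by
  constructor
  · intro k
    have h : ((V.sch.coeff (latticeHom n m k) : ℤ) : ℂ) = (V.weightSdim k : ℂ) := by
      rw [← coeff_toCP, V.toCP_sch, V.weightSdim_eq, ← coe_toMLat, coeff_torusToCP, V.coeff_strT]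
    exact_mod_cast h
  · intro l hl
    have h : ((V.sch.coeff l : ℤ) : ℂ) = 0 := by
      rw [← coeff_toCP, V.toCP_sch, coeff_torusToCP_of_notMem _ hl]
    exact_mod_cast h

theorem exists_monomial {N : ℕ} (z : Fin N) (R : Type) [CommRing R] (σ : Equiv.Perm (Fin N)) :
    ∃ a : SqMat N R, a.det = 1 ∧
      ∀ t : Fin N → R, diagonal t * a = a * diagonal fun j => t (σ j) := by
  let c : R := ((Equiv.Perm.sign σ⁻¹ : ℤ) : R)
  let a₀ : SqMat N R := σ⁻¹.toPEquiv.toMatrix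
  refine ⟨a₀ * diagonal (Function.update 1 z c), ?_, fun t => ?_⟩
  · have h1 : a₀.det = c := Matrix.det_permutation σ⁻¹
    have h2 : (Equiv.Perm.sign σ⁻¹ : ℤ) * (Equiv.Perm.sign σ⁻¹ : ℤ) = 1 := by
      rw [← Units.val_mul, Int.units_mul_self, Units.val_one]
    rw [det_mul, det_diagonal, prod_update_of_mem (mem_univ z), h1]
    simp only [Pi.one_apply, prod_const_one, mul_one, c]
    rw [← Int.cast_mul, h2, Int.cast_one]
  · have h1 : diagonal t * a₀ = a₀ * diagonal fun j => t (σ j) := by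
      ext i j
      rw [Matrix.diagonal_mul, mul_diagonal, mul_comm]
      change a₀ i j * t i = a₀ i j * t (σ j)
      by_cases h : σ⁻¹ i = j
      · rw [show σ j = i by rw [← h]; exact σ.apply_symm_apply i]
      · have h0 : a₀ i j = 0 := by
          simp only [a₀, PEquiv.toMatrix_apply, Equiv.toPEquiv_apply, Option.mem_def,
            Option.some.injEq, if_neg h]
        rw [h0, zero_mul, zero_mul]
    rw [← Matrix.mul_assoc, h1, Matrix.mul_assoc, Matrix.mul_assoc, diagonal_mul_diagonal,
      diagonal_mul_diagonal]
    simp only [mul_comm]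

theorem SLRep.sch_mem_ZPinv (hn : 1 ≤ n) (hm : 1 ≤ m) : V.sch ∈ ZPinv n m := by
  refine mem_ZPinv.2 fun w => toCP_injective ?_
  have hw : ∀ l : MLat n m, weylWeight w l ∈ (latticeHom n m).range := by
    rintro ⟨_, k, rfl⟩
    exact ⟨_, (weylWeight_latticeHom w k).symm⟩
  let ψ : MLat n m →+ MLat n m :=
    ((weylWeight w).comp (latticeHom n m).range.subtype).codRestrict _ hw
  have hψ : ∀ l : MLat n m, (ψ l : P0 n m) = weylWeight w l := fun _ => rfl
  have h1 : toCP n m (mapDomainRingHom ℤ (weylWeight w) V.sch) =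
      torusToCP n m (mapDomainRingHom ℂ ψ V.strT) := by
    rw [V.strT_eq, SLRep.sch]
    simp only [map_sum, mapDomainRingHom_apply, mapDomain_single]
    refine sum_congr rfl fun l _ => ?_
    rw [toCP_single, torusToCP_single, V.weightSdim_eq, Function.surjInv_eq toMLat_surjective, hψ]
  rw [h1, V.toCP_sch]
  congr 1
  let R := TorusRing n m
  obtain ⟨a, ha, hat⟩ := exists_monomial (⟨0, hn⟩ : Fin n) R w.1
  obtain ⟨d, hd, hdt⟩ := exists_monomial (⟨0, hm⟩ : Fin m) R w.2
  have ha' : IsUnit a.det := ha ▸ isUnit_one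
  have hd' : IsUnit d.det := hd ▸ isUnit_one
  let g : SLPoints n m (evenSAlg R) := ⟨evenBlocks a d, evenBlocks_mem a d hd' (by rw [ha, hd])⟩
  let g' : SLPoints n m (evenSAlg R) := ⟨evenBlocks a⁻¹ d⁻¹, evenBlocks_mem _ _
    (by rw [det_nonsing_inv, hd, Ring.inverse_one]; exact isUnit_one)
    (by rw [det_nonsing_inv, det_nonsing_inv, ha, hd])⟩
  have hgg : (1 : SMat n m (evenSAlg R)) = g.1 * g'.1 := by
    rw [← evenBlocks_mul, mul_nonsing_inv a ha', mul_nonsing_inv d hd']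
    exact fromBlocks_one.symm
  let t : SLPoints n m (evenSAlg R) := ⟨_, univTorus_mem⟩
  let t' : SLPoints n m (evenSAlg R) := torusPt (A := evenSAlg R) (expChar ψ) fun _ => mem_evenSAlg_zero _
  have htg : t.1 * g.1 = g.1 * t'.1 := by
    have e1 : t.1 = evenBlocks (diagonal fun i => (ex (wtM (inl i)) : R))
        (diagonal fun p => (ex (wtM (inr p)) : R)) := by
      change diagonal _ = fromBlocks _ 0 0 _
      rw [Matrix.fromBlocks_diagonal]
      congr 1
      funext j
      rcases j with j | j <;> rfl
    have hψw : ∀ j, ψ (wtM j) = wtM (w.perm j) := fun j => Subtype.ext (by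
      rw [hψ, coe_wtM, coe_wtM, weylWeight_wt])
    have e2 : t'.1 = evenBlocks (diagonal fun i => (ex (wtM (inl (w.1 i))) : R))
        (diagonal fun p => (ex (wtM (inr (w.2 p))) : R)) := by
      change diagonal _ = fromBlocks _ 0 0 _
      rw [Matrix.fromBlocks_diagonal]
      congr 1
      funext j
      rw [expChar_apply, hψw]
      rcases j with j | j <;> rfl
    rw [e1, e2, ← evenBlocks_mul, ← evenBlocks_mul, hat, hdt]
  let k : SLPoints n m (evenSAlg R) := ⟨_, SLPoints.mul_mem t.2 g.2⟩
  have e1 := V.act_mul _ t g k rfl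
  rw [V.act_mul _ g t' k htg] at e1
  have e2 := V.act_mul _ g g' ⟨1, SLPoints.one_mem⟩ hgg
  rw [V.act_one _ _ rfl] at e2
  have e2' : V.act _ g' * V.act _ g = 1 := (mul_eq_one_comm (M := Matrix V.ι V.ι R)).1 e2.symm
  have e3 : V.act _ t' = ∑ l ∈ V.wts, sm (ex (ψ l) : R) (V.wproj l) :=
    V.act_torus (A := evenSAlg R) (expChar ψ) (fun _ => mem_evenSAlg_zero _) t' rfl
  have hev : ∀ i j, (V.act _ g : Matrix V.ι V.ι R) i j ≠ 0 → V.par i = V.par j := by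
    intro i j h
    by_contra hp
    have h1 := V.act_even (evenSAlg R) g i j
    rw [show V.par i + V.par j = 1 from parity_add_of_ne (Ne.symm hp), mem_invGrade, sgn_one,
      neg_one_smul] at h1
    exact h (eq_zero_of_eq_neg h1)
  have e4 : str V.par (V.act _ t' : Matrix V.ι V.ι R) = V.strT := by
    have e5 : (V.act _ t' : Matrix V.ι V.ι R) = V.act _ g' * (V.actT * V.act _ g) := by
      refine Eq.trans ?_ (congrArg (fun M => V.act _ g' * M) e1)
      rw [← Matrix.mul_assoc, e2', Matrix.one_mul]
    rw [e5, ← Matrix.mul_assoc, ← str_mul_comm_of_even hev, ← Matrix.mul_assoc]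
    refine (congrArg (fun M => str V.par (M * V.actT)) e2.symm).trans ?_
    exact congrArg (str V.par) (Matrix.one_mul _)
  refine Eq.trans ?_ e4
  rw [e3, str_sum, V.strT_eq, map_sum]
  refine sum_congr rfl fun l _ => ?_
  rw [str_sm, smul_ex, mapDomainRingHom_apply, mapDomain_single]

theorem SLRep.actT_mul_X {i j : Idx n m} (hij : i ≠ j) :
    V.actT * sm 1 (V.X i j) = (ex (wtM i - wtM j) : TorusRing n m) • (sm 1 (V.X i j) * V.actT) := by
  ext a b l
  let θ : TorusRing n m →+ ℂ := ⟨⟨fun a => a.coeff l, rfl⟩, fun _ _ => rfl⟩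
  let θ' : TorusRing n m →+ ℂ :=
    ⟨⟨fun a => a.coeff (-(wtM i - wtM j) + l), rfl⟩, fun _ _ => rfl⟩
  have h := congrFun (congrFun (V.wproj_mul_X hij (-(wtM i - wtM j) + l)) a) b
  rw [add_comm (-(wtM i - wtM j)) l, neg_add_cancel_right, Matrix.mul_apply, Matrix.mul_apply] at h
  rw [Matrix.smul_apply, smul_eq_mul, coeff_single_mul_apply, one_mul, Matrix.mul_apply,
    Matrix.mul_apply]
  refine (map_sum θ _ _).trans (Eq.trans ?_ (map_sum θ' _ _).symm)
  refine (sum_congr rfl fun c _ => ?_).trans (h.trans (sum_congr rfl fun c _ => ?_))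
  · rw [sm_apply, mul_smul_comm, mul_one]
    exact mul_comm _ _
  · rw [sm_apply, smul_mul_assoc, one_mul, add_comm l]
    rfl

theorem SLRep.sch_wall (i : Fin n) (p : Fin m) : Diso i p (toCP n m V.sch) ∈
    Ideal.span {(ex (wt (inl i) - wt (inr p)) - 1 : CP n m)} := by
  classical
  set a : Idx n m := inl i
  set b : Idx n m := inr p
  have hab : a ≠ b := by simp [a, b]
  have hpar : stdParity a + stdParity b = 1 := by simp [a, b, stdParity]
  have hpar' : stdParity b + stdParity a = 1 := by rw [add_comm, hpar]
  have hbr : V.X a b * V.X b a + V.X b a * V.X a b =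
      ∑ l ∈ V.wts, (l : P0 n m).1 (isoH i p) • V.wproj l := by
    have hD : Matrix.single a b 1 * Matrix.single b a 1 -
        sgn ((stdParity a + stdParity b) * (stdParity b + stdParity a)) •
          (Matrix.single b a 1 * Matrix.single a b 1) =
          diagonal (isoH i p : cartan n m).1 := by
      rw [hpar, hpar', mul_one, sgn_one, single_mul_single_same, single_mul_single_same,
        neg_one_smul, sub_neg_eq_add, isoH]
      simp only [mul_one, ← Matrix.diagonal_single, Matrix.diagonal_add]
      rfl
    have h0 : stdParity a + stdParity b + (stdParity b + stdParity a) = 0 := by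
      rw [hpar, hpar']; decide
    have h1 := V.d_bracket (isSl_single hab) (isSl_single hab.symm) (by
      rw [h0, hD]
      exact isSl_diagonal _)
    rw [hD, h0, V.d_diagonal, hpar, hpar', mul_one, sgn_one, neg_one_smul, sub_neg_eq_add] at h1
    rw [h1, SLRep.X, SLRep.X, hpar, hpar']
  let α : MLat n m := wtM a - wtM b
  let F : TorusRing n m := str V.par (V.actT * sm 1 (V.X a b) * sm 1 (V.X b a))
  have hF : str V.par (V.actT * sm 1 (V.X b a) * sm 1 (V.X a b)) = -(ex (-α) * F) := by
    have hX : ∀ r s, sm (1 : TorusRing n m) (V.X a b) r s ≠ 0 → V.par r + V.par s = 1 :=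
      fun r s h => (V.d_parity (sm_ne_zero h)).trans hpar
    have e := str_mul_comm 1 hX (V.actT * sm 1 (V.X b a))
    rw [sgn_one, neg_one_smul, eq_neg_iff_add_eq_zero, add_comm, ← eq_neg_iff_add_eq_zero] at e
    rw [e]
    congr 1
    have e1 : sm (1 : TorusRing n m) (V.X a b) * V.actT =
        (ex (-α) : TorusRing n m) • (V.actT * sm 1 (V.X a b)) := by
      rw [V.actT_mul_X hab, smul_smul, ex_neg_mul_ex, one_smul]
    rw [← Matrix.mul_assoc, e1, Matrix.smul_mul, str_smul]
  have hsum : ∑ l ∈ V.wts, single l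
      ((l : P0 n m).1 (isoH i p) * str V.par (V.wproj l)) = F - ex (-α) * F := by
    rw [sub_eq_add_neg, ← hF, ← str_add, Matrix.mul_assoc, Matrix.mul_assoc, ← Matrix.mul_add,
      sm_mul, sm_mul, ← sm_add, hbr, mul_one, V.actT_eq, sum_mul, str_sum]
    refine sum_congr rfl fun l hl => ?_
    rw [sm_mul, mul_one, Matrix.mul_sum, sum_eq_single_of_mem l hl, Matrix.mul_smul, V.wproj_mul,
      if_pos rfl, str_sm, smul_ex]
    · congr 1
      simp only [str, Matrix.smul_apply, mul_sum, smul_eq_mul, mul_left_comm]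
    · intro l' _ hl'
      rw [Matrix.mul_smul, V.wproj_mul, if_neg (Ne.symm hl'), smul_zero]
  have h2 : Diso i p (toCP n m V.sch) = torusToCP n m (F - ex (-α) * F) := by
    rw [V.toCP_sch, ← hsum, V.strT_eq, map_sum, map_sum, map_sum]
    refine sum_congr rfl fun l _ => ?_
    rw [torusToCP_single, torusToCP_single, Diso, expDeriv_single]
    rfl
  rw [h2, Ideal.mem_span_singleton]
  have h3 : F - ex (-α) * F = (ex α - 1) * (ex (-α) * F) := by
    rw [sub_mul, one_mul, ← mul_assoc, ← ex_add, add_neg_cancel, ex_zero, one_mul]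
  have h4 : (α : P0 n m) = wt a - wt b := by
    rw [← coe_wtM, ← coe_wtM]
    rfl
  rw [h3, map_mul, map_sub, map_one, torusToCP_single, h4]
  exact dvd_mul_right _ _

theorem SLRep.sch_mem_Jzero (hn : 1 ≤ n) (hm : 1 ≤ m) : V.sch ∈ Jzero n m := by
  refine mem_Jzero_iff.2 ⟨⟨V.sch_mem_ZPinv hn hm, fun i p => V.sch_wall i p⟩,
    mem_latticeRing.2 fun l hl => ?_⟩
  by_contra h
  exact hl (V.isSupercharacter_sch.2 l h)

theorem SLRep.sch_eq_of_strT {V : SLRep n m} {f : ZP n m} (h : torusToCP n m V.strT = toCP n m f) :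
    V.sch = f := toCP_injective (V.toCP_sch.trans h)

theorem SLRep.sch_mul (V W : SLRep n m) : (V * W).sch = V.sch * W.sch :=
  SLRep.sch_eq_of_strT (by rw [SLRep.strT_mul, map_mul, map_mul, V.toCP_sch, W.toCP_sch])

theorem SLRep.sch_parityShift : V.parityShift.sch = -V.sch :=
  SLRep.sch_eq_of_strT (by rw [SLRep.strT_parityShift, map_neg, map_neg, V.toCP_sch])

theorem SLRep.sch_of_exact {U V W : SLRep n m} {S : SLRep.Hom U V} {T : SLRep.Hom V W}
    (h : SLRep.IsShortExact S T) : V.sch = U.sch + W.sch :=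
  SLRep.sch_eq_of_strT (by rw [SLRep.strT_of_exact h, map_add, map_add, U.toCP_sch, W.toCP_sch])

end SupercharacterRing

/-! ### The supercharacter map -/

section SupercharacterMap

variable {n m : ℕ}

theorem exists_separating (N K : ℕ) (hN : 2 ≤ N) : ∃ (u : Fin N → ℤ) (v : Fin K → ℤ),
    Injective u ∧ Injective v ∧ (∀ i p, u i ≠ v p) ∧ ∑ i, u i = ∑ p, v p := by
  obtain ⟨N, rfl⟩ : ∃ N', N = N' + 1 + 1 := ⟨N - 2, by omega⟩
  let v : Fin K → ℤ := fun p => p + 1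
  let u' : Fin (N + 1) → ℤ := fun i => -(i + 1)
  have hv : ∀ p, 0 < v p := fun p => by simp only [v]; omega
  have hu' : ∀ i, u' i < 0 := fun p => by simp only [u']; omega
  have hvs : ∀ p, v p ≤ ∑ p, v p := fun p =>
    single_le_sum (fun q _ => (hv q).le) (mem_univ p)
  have hs : ∑ i, u' i < 0 :=
    sum_neg (fun i _ => hu' i) univ_nonempty
  have hv0 : 0 ≤ ∑ p, v p := sum_nonneg fun q _ => (hv q).le
  refine ⟨Fin.cons (∑ p, v p - ∑ i, u' i) u', v, ?_, fun p q h => ?_, fun i p => ?_, ?_⟩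
  · refine Fin.cons_injective_iff.2 ⟨?_, fun i j h => ?_⟩
    · rintro ⟨i, hi⟩
      have := hu' i
      omega
    · simp only [u'] at h
      exact Fin.ext (by omega)
  · simp only [v] at h
    exact Fin.ext (by omega)
  · refine Fin.cases ?_ (fun i => ?_) i
    · have := hvs p
      rw [Fin.cons_zero]
      omega
    · have h1 := hv p
      have h2 := hu' i
      rw [Fin.cons_succ]
      omega
  · rw [Fin.sum_univ_succ]
    simp

theorem exists_height (hn : 1 ≤ n) (hm : 1 ≤ m) (h1 : (n, m) ≠ (1, 1)) :
    ∃ ht : MLat n m →+ ℤ, ∀ i j, i ≠ j → ht (wtM i - wtM j) ≠ 0 := by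
  have key : ∀ (u : Fin n → ℤ) (v : Fin m → ℤ), Injective u → Injective v →
      (∀ i p, u i ≠ v p) → ∑ i, u i = ∑ p, v p →
      ∃ ht : MLat n m →+ ℤ, ∀ i j, i ≠ j → ht (wtM i - wtM j) ≠ 0 := by
    intro u v hu hv huv hs
    have hs' : ∑ i, Sum.elim u v (inl i) = ∑ p, Sum.elim u v (inr p) := hs
    refine ⟨MLat.lift (Sum.elim u v) hs', fun i j hij => ?_⟩
    rw [map_sub, MLat.lift_wtM, MLat.lift_wtM, sub_ne_zero]
    rcases i with i | i <;> rcases j with j | j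
    · exact fun h => hij (congrArg _ (hu h))
    · exact huv i j
    · exact (huv j i).symm
    · exact fun h => hij (congrArg _ (hv h))
  by_cases h2 : 2 ≤ n
  · obtain ⟨u, v, hu, hv, huv, hs⟩ := exists_separating n m h2
    exact key u v hu hv huv hs
  · have h3 : 2 ≤ m := by
      by_contra h3
      exact h1 (Prod.ext (show n = 1 by omega) (show m = 1 by omega))
    obtain ⟨u, v, hu, hv, huv, hs⟩ := exists_separating m n h3
    exact key v u hv hu (fun i p => (huv p i).symm) hs.symm

/-- The supercharacter on the free group on the representations. -/
def schFree (n m : ℕ) : FreeAbelianGroup (SLRep n m) →+ ZP n m := FreeAbelianGroup.lift SLRep.sch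

theorem schFree_of (V : SLRep n m) : schFree n m (FreeAbelianGroup.of V) = V.sch :=
  FreeAbelianGroup.lift_apply_of _ _

theorem schFree_mul (x y : FreeAbelianGroup (SLRep n m)) :
    schFree n m (x * y) = schFree n m x * schFree n m y := by
  induction x using FreeAbelianGroup.induction_on with
  | zero => simp
  | neg U ih => rw [neg_mul, map_neg, ih, map_neg, neg_mul]
  | add a b ha hb => rw [add_mul, map_add, ha, hb, map_add, add_mul]
  | of U =>
    induction y using FreeAbelianGroup.induction_on with
    | zero => simp
    | neg V ih => rw [mul_neg, map_neg, ih, map_neg, mul_neg]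
    | add a b ha hb => rw [mul_add, map_add, ha, hb, map_add, mul_add]
    | of V => rw [FreeAbelianGroup.of_mul_of, schFree_of, schFree_of, schFree_of, SLRep.sch_mul]

theorem schFree_eq_zero {x : FreeAbelianGroup (SLRep n m)} (hx : x ∈ grothRel n m) :
    schFree n m x = 0 := by
  induction hx using AddSubgroup.closure_induction with
  | zero => exact map_zero _
  | add a b _ _ ha hb => rw [map_add, ha, hb, add_zero]
  | neg a _ ha => rw [map_neg, ha, neg_zero]
  | mem a ha =>
    rcases ha with ⟨U, V, W, S, T, h, rfl⟩ | ⟨V, rfl⟩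
    · rw [map_add, map_sub, schFree_of, schFree_of, schFree_of, SLRep.sch_of_exact h]
      abel
    · rw [map_add, schFree_of, schFree_of, SLRep.sch_parityShift, add_neg_cancel]

/-- The supercharacter on the Grothendieck ring. -/
def schMap (n m : ℕ) : GrothSL n m →+ ZP n m where
  toFun x := Quotient.liftOn x (schFree n m) fun a b h => by
    rw [← sub_eq_zero, ← map_sub]
    exact schFree_eq_zero h
  map_zero' := map_zero (schFree n m)
  map_add' x y := Quotient.inductionOn₂ x y fun a b => map_add (schFree n m) a b

theorem schMap_class (V : SLRep n m) : schMap n m (grothClass V) = V.sch := schFree_of V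

theorem schMap_mul (x y : GrothSL n m) : schMap n m (x * y) = schMap n m x * schMap n m y :=
  Quotient.inductionOn₂ x y schFree_mul

theorem GrothSL.induction {p : GrothSL n m → Prop} (hof : ∀ V, p (grothClass V)) (h0 : p 0)
    (hneg : ∀ x, p x → p (-x)) (hadd : ∀ x y, p x → p y → p (x + y)) (x : GrothSL n m) : p x := by
  refine Quotient.inductionOn x fun a => ?_
  induction a using FreeAbelianGroup.induction_on with
  | zero => exact h0
  | of V => exact hof V
  | neg V ih => exact hneg _ ih
  | add a b ha hb => exact hadd _ _ ha hb

theorem SLRep.coeff_sch (V : SLRep n m) (l : MLat n m) :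
    (V.sch.coeff (l : P0 n m) : ℂ) = str V.par (V.wproj l) := by
  rw [← coeff_toCP, V.toCP_sch, coeff_torusToCP, V.coeff_strT]

variable {ht : MLat n m →+ ℤ} {V : SLRep n m} {μ : MLat n m} {q : ZMod 2} {v : V.ι → ℂ}

theorem SLRep.IsSimple.coeff_sch_ne (hht : ∀ i j, i ≠ j → ht (wtM i - wtM j) ≠ 0)
    (hV : V.IsSimple) (h : V.IsSingular ht μ q v) {l : MLat n m} (hl : ht μ ≤ ht l)
    (hne : l ≠ μ) : V.sch.coeff (l : P0 n m) = 0 := by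
  have h0 : V.wproj l = 0 := ext_of_mulVec_single fun i => by
    obtain ⟨c, hc, hc'⟩ := h.wproj_cyclic (u := Pi.single i 1)
      (by rw [hV.cyclic_eq hht h]; trivial) hl
    rw [hc, hc' hne, zero_smul, zero_mulVec]
  have h1 := V.coeff_sch l
  rw [h0, str] at h1
  simpa using h1

theorem SLRep.IsSimple.coeff_sch_self (hht : ∀ i j, i ≠ j → ht (wtM i - wtM j) ≠ 0)
    (hV : V.IsSimple) (h : V.IsSingular ht μ 0 v) : V.sch.coeff (μ : P0 n m) = 1 := by
  have h0 : ∀ j, ∃ c : ℂ, (V.wproj μ).mulVec (Pi.single j 1) = c • v := fun j => by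
    obtain ⟨c, hc, -⟩ := h.wproj_cyclic (u := Pi.single j 1)
      (by rw [hV.cyclic_eq hht h]; trivial) le_rfl
    exact ⟨c, hc⟩
  choose c hc using h0
  have hP : ∀ i j, V.wproj μ i j = c j * v i := fun i j => by
    have := congrFun (hc j) i
    rwa [Matrix.mulVec_single_one] at this
  obtain ⟨i, hi⟩ : ∃ i, v i ≠ 0 := by
    by_contra! h0
    exact h.ne (funext h0)
  have h1 : (∑ j, c j * v j) * v i = v i := by
    have := congrFun h.wt i
    simp only [Matrix.mulVec, dotProduct, hP] at this
    rw [sum_mul]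
    refine Eq.trans (sum_congr rfl fun j _ => ?_) this
    ring
  have h2 : str V.par (V.wproj μ) = ∑ j, c j * v j := by
    refine sum_congr rfl fun j _ => ?_
    rw [hP]
    by_cases hj : v j = 0
    · rw [hj, mul_zero, smul_zero]
    · rw [h.homog j hj, sgn_zero, one_smul]
  have h3 := V.coeff_sch μ
  rw [h2, mul_right_cancel₀ hi (h1.trans (one_mul _).symm)] at h3
  exact_mod_cast h3

theorem schMap_injective (hn : 1 ≤ n) (hm : 1 ≤ m) (h1 : (n, m) ≠ (1, 1)) :
    Injective (schMap n m) := by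
  obtain ⟨ht, hht⟩ := exists_height hn hm h1
  let p₀ : Fin m := ⟨0, hm⟩
  let Λ := {μ : MLat n m // ∃ V : SLRep n m, V.IsSimple ∧ ∃ v, V.IsSingular ht μ 0 v}
  choose L hL v hv using fun μ : Λ => μ.2
  have hgen : ∀ x : GrothSL n m, x ∈ AddSubgroup.closure (Set.range fun μ => grothClass (L μ)) := by
    refine GrothSL.induction (fun V => ?_) (zero_mem _) (fun _ => neg_mem) (fun _ _ => add_mem)
    refine (AddSubgroup.closure_le _).2 ?_ (grothClass_mem_closure_simple p₀ V)
    rintro _ ⟨V, hV, rfl⟩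
    obtain ⟨μ, q, v', hv'⟩ := SLRep.exists_isSingular ht hV.1
    rcases parity_cases q with rfl | rfl
    · rw [hV.grothClass_eq hht p₀ (hL ⟨μ, V, hV, v', hv'⟩) hv' (hv ⟨μ, V, hV, v', hv'⟩)]
      exact AddSubgroup.subset_closure ⟨_, rfl⟩
    · have hgr : ∀ D, IsGradedSub V.parityShift.par D → IsGradedSub V.par D := by
        intro D hD u hu q
        have : parityProj V.par q u = parityProj V.parityShift.par (q + 1) u := funext fun i => by
          change (if V.par i = q then u i else 0) = if V.par i + 1 = q + 1 then u i else 0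
          simp only [add_left_inj]
        rw [this]
        exact hD u hu _
      have hV' : V.parityShift.IsSimple := ⟨hV.1, fun D hD => hV.2 D ⟨hgr D hD.1, hD.2⟩⟩
      have hv'' : V.parityShift.IsSingular ht μ 0 v' :=
        ⟨hv'.ne, fun i hi => by
          change V.par i + 1 = 0
          rw [hv'.homog i hi, parity_add_self], hv'.wt, hv'.raise⟩
      have e := hV'.grothClass_eq hht p₀ (hL ⟨μ, _, hV', v', hv''⟩) hv'' (hv ⟨μ, _, hV', v', hv''⟩)
      rw [grothClass_parityShift, neg_eq_iff_eq_neg] at e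
      rw [e]
      exact neg_mem (AddSubgroup.subset_closure ⟨_, rfl⟩)
  refine (injective_iff_map_eq_zero _).2 fun x hx => ?_
  obtain ⟨c, rfl⟩ := AddSubgroup.exists_finsupp_of_mem_closure_range _ _ (hgen x)
  by_cases hc : c.support.Nonempty
  · exfalso
    obtain ⟨μ, hμ, hmax⟩ := c.support.exists_max_image (fun μ => ht μ.1) hc
    rw [Finsupp.sum, map_sum] at hx
    let θ : ZP n m →+ ℤ := ⟨⟨fun a => a.coeff (μ.1 : P0 n m), rfl⟩, fun _ _ => rfl⟩
    have h2 := congrArg θ hx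
    rw [map_sum, map_zero, sum_eq_single_of_mem μ hμ] at h2
    · rw [map_zsmul, map_zsmul, schMap_class] at h2
      have h3 : θ (L μ).sch = 1 := (hL μ).coeff_sch_self hht (hv μ)
      rw [h3, smul_eq_mul, mul_one] at h2
      exact mem_support_iff.1 hμ h2
    · intro ν hν hne
      have h3 : θ (L ν).sch = 0 := (hL ν).coeff_sch_ne hht (hv ν) (hmax ν hν)
        fun e => hne (Subtype.ext e.symm)
      rw [map_zsmul, map_zsmul, schMap_class, h3, smul_zero]
  · rw [not_nonempty_iff_eq_empty, Finsupp.support_eq_empty] at hc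
    rw [hc, Finsupp.sum_zero_index]

/-- A subring of `ℤ[P₀]` generated by supercharacters consists of virtual supercharacters. -/
theorem exists_ringEquiv (hn : 1 ≤ n) (hm : 1 ≤ m) (h1 : (n, m) ≠ (1, 1))
    {s : Set (ZP n m)} (hs : Jzero n m = Subring.closure s)
    (hsch : ∀ f ∈ s, ∃ V : SLRep n m, V.sch = f) (h1' : ∃ V : SLRep n m, V.sch = 1) :
    ∃ φ : GrothSL n m ≃+* Jzero n m,
      ∀ V : SLRep n m, V.IsSupercharacter (φ (grothClass V) : ZP n m) := by
  have hmem : ∀ x, schMap n m x ∈ Jzero n m := by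
    refine GrothSL.induction (fun V => ?_) ?_ (fun x hx => ?_) (fun x y hx hy => ?_)
    · rw [schMap_class]
      exact V.sch_mem_Jzero hn hm
    · rw [map_zero]
      exact zero_mem _
    · rw [map_neg]
      exact neg_mem hx
    · rw [map_add]
      exact add_mem hx hy
  have hsurj : ∀ f ∈ Jzero n m, ∃ x, schMap n m x = f := by
    intro f hf
    rw [hs] at hf
    induction hf using Subring.closure_induction with
    | mem f hf =>
      obtain ⟨V, hV⟩ := hsch f hf
      exact ⟨grothClass V, (schMap_class V).trans hV⟩
    | zero => exact ⟨0, map_zero _⟩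
    | one =>
      obtain ⟨V, hV⟩ := h1'
      exact ⟨grothClass V, (schMap_class V).trans hV⟩
    | add f g _ _ hf hg =>
      obtain ⟨x, rfl⟩ := hf
      obtain ⟨y, rfl⟩ := hg
      exact ⟨x + y, map_add _ _ _⟩
    | neg f _ hf =>
      obtain ⟨x, rfl⟩ := hf
      exact ⟨-x, map_neg _ _⟩
    | mul f g _ _ hf hg =>
      obtain ⟨x, rfl⟩ := hf
      obtain ⟨y, rfl⟩ := hg
      exact ⟨x * y, schMap_mul _ _⟩
  let e : GrothSL n m ≃ Jzero n m := Equiv.ofBijective (fun x => ⟨schMap n m x, hmem x⟩)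
    ⟨fun x y h => schMap_injective hn hm h1 (congrArg Subtype.val h), fun f => by
      obtain ⟨x, hx⟩ := hsurj f f.2
      exact ⟨x, Subtype.ext hx⟩⟩
  refine ⟨{ e with
    map_mul' := fun x y => Subtype.ext (schMap_mul x y)
    map_add' := fun x y => Subtype.ext (map_add (schMap n m) x y) }, fun V => ?_⟩
  change V.IsSupercharacter (schMap n m (grothClass V))
  rw [schMap_class]
  exact V.isSupercharacter_sch

end SupercharacterMap

/-! ### Free supercommutative extensions and symmetric powers -/

/-- The free supercommutative algebras over superalgebras `A` on generators `e_j` of given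
parities, with a basis over `A` of monomials, which are given as words in the generators. -/
structure FreeExt (J : Type) [DecidableEq J] (par : J → ZMod 2) where
  Mon : Type
  word : Mon → List J
  S : SAlg → SAlg
  inc : ∀ A, SAlg.Hom A (S A)
  gen : ∀ A, J → S A
  gen_mem : ∀ A j, gen A j ∈ (S A).grade (par j)
  coeff : ∀ A, S A →+ (Mon → A)
  coeff_mono_self : ∀ A I a,
    coeff A (((word I).map (gen A)).prod * (inc A).toAlgHom a) I = a
  coeff_mono_ne : ∀ A I I' a, I ≠ I' →
    coeff A (((word I).map (gen A)).prod * (inc A).toAlgHom a) I' = 0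
  expand : ∀ A x, x ∈ AddSubgroup.closure
    {y | ∃ I a, y = ((word I).map (gen A)).prod * (inc A).toAlgHom a}
  exists_lift : ∀ {A B : SAlg} (f : SAlg.Hom A B) (y : J → B), (∀ j, y j ∈ B.grade (par j)) →
    ∃ F : SAlg.Hom (S A) B, (∀ a, F.toAlgHom ((inc A).toAlgHom a) = f.toAlgHom a) ∧
      ∀ j, F.toAlgHom (gen A j) = y j
  count_le : ∀ I j, par j = 1 → (word I).count j ≤ 1
  count_injective : ∀ I I', (∀ j, (word I).count j = (word I').count j) → I = I'
  count_surjective : ∀ l : J → ℕ, (∀ j, par j = 1 → l j ≤ 1) → ∃ I, ∀ j, (word I).count j = l j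

namespace FreeExt

variable {J : Type} [DecidableEq J] {par : J → ZMod 2} (D : FreeExt J par) {A B : SAlg}

/-- The monomials. -/
def mono (A : SAlg) (I : D.Mon) : D.S A := ((D.word I).map (D.gen A)).prod

/-- The parity of a monomial. -/
def mpar (I : D.Mon) : ZMod 2 := ((D.word I).map par).sum

theorem induction {p : D.S A → Prop} (hm : ∀ I a, p (D.mono A I * (D.inc A).toAlgHom a))
    (hadd : ∀ x y, p x → p y → p (x + y)) (hneg : ∀ x, p x → p (-x)) (h0 : p 0) (x : D.S A) :
    p x := by
  induction D.expand A x using AddSubgroup.closure_induction with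
  | mem y hy =>
    obtain ⟨I, a, rfl⟩ := hy
    exact hm I a
  | zero => exact h0
  | add y z _ _ hy hz => exact hadd y z hy hz
  | neg y _ hy => exact hneg y hy

theorem hom_ext {F G : D.S A →ₐ[ℂ] B}
    (hi : ∀ a, F ((D.inc A).toAlgHom a) = G ((D.inc A).toAlgHom a))
    (hg : ∀ j, F (D.gen A j) = G (D.gen A j)) (x : D.S A) : F x = G x := by
  induction x using D.induction with
  | hm I a =>
    rw [map_mul, map_mul, hi, mono, map_list_prod, map_list_prod, List.map_map, List.map_map]
    congr 2
    exact List.map_congr_left fun j _ => hg j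
  | hadd x y hx hy => rw [map_add, map_add, hx, hy]
  | hneg x hx => rw [map_neg, map_neg, hx]
  | h0 => rw [map_zero, map_zero]

theorem coeff_mul_inc (x : D.S A) (b : A) (I : D.Mon) :
    D.coeff A (x * (D.inc A).toAlgHom b) I = D.coeff A x I * b := by
  induction x using D.induction with
  | hm I' a =>
    rw [mul_assoc, ← map_mul]
    by_cases h : I' = I
    · subst h
      exact (D.coeff_mono_self A I' _).trans (congrArg (· * b) (D.coeff_mono_self A I' a).symm)
    · refine (D.coeff_mono_ne A I' I _ h).trans ?_
      rw [show D.coeff A (D.mono A I' * (D.inc A).toAlgHom a) I = 0 from D.coeff_mono_ne A I' I a h,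
        zero_mul]
  | hadd x y hx hy => rw [add_mul, map_add, Pi.add_apply, hx, hy, map_add, Pi.add_apply, add_mul]
  | hneg x hx => rw [neg_mul, map_neg, Pi.neg_apply, hx, map_neg, Pi.neg_apply, neg_mul]
  | h0 => rw [zero_mul, map_zero, Pi.zero_apply, zero_mul]

theorem coeff_mono (I I' : D.Mon) [Decidable (I = I')] :
    D.coeff A (D.mono A I) I' = if I = I' then 1 else 0 := by
  rw [← mul_one (D.mono A I), ← map_one (D.inc A).toAlgHom]
  split_ifs with h
  · exact h ▸ D.coeff_mono_self A I 1
  · exact D.coeff_mono_ne A I I' 1 h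

theorem exists_expansion (x : D.S A) : ∃ s : Finset D.Mon, ∀ t, s ⊆ t →
    x = ∑ I ∈ t, D.mono A I * (D.inc A).toAlgHom (D.coeff A x I) := by
  classical
  induction x using D.induction with
  | hm I a =>
    refine ⟨{I}, fun t ht => ?_⟩
    rw [sum_eq_single_of_mem I (ht (mem_singleton_self I))]
    · congr 2
      exact (D.coeff_mono_self A I a).symm
    · intro I' _ h
      rw [show D.coeff A (D.mono A I * (D.inc A).toAlgHom a) I' = 0 from
        D.coeff_mono_ne A I I' a (Ne.symm h), map_zero, mul_zero]
  | hadd x y hx hy =>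
    obtain ⟨s, hs⟩ := hx
    obtain ⟨s', hs'⟩ := hy
    refine ⟨s ∪ s', fun t ht => ?_⟩
    conv_lhs => rw [hs t (union_subset_left ht), hs' t (union_subset_right ht)]
    simp only [← sum_add_distrib, map_add, Pi.add_apply, mul_add]
  | hneg x hx =>
    obtain ⟨s, hs⟩ := hx
    refine ⟨s, fun t ht => ?_⟩
    conv_lhs => rw [hs t ht]
    simp only [← sum_neg_distrib, map_neg, Pi.neg_apply, mul_neg]
  | h0 => exact ⟨∅, fun t _ => by simp⟩

theorem coeff_hom {F : D.S A →ₐ[ℂ] D.S B} {f : A →ₐ[ℂ] B} {c : D.Mon → ℂ}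
    (hF : ∀ I a, F (D.mono A I * (D.inc A).toAlgHom a) =
      c I • (D.mono B I * (D.inc B).toAlgHom (f a))) (x : D.S A) (I : D.Mon) :
    D.coeff B (F x) I = c I • f (D.coeff A x I) := by
  induction x using D.induction with
  | hm I' a =>
    rw [hF, ← mul_smul_comm, ← map_smul]
    by_cases h : I' = I
    · subst h
      refine (D.coeff_mono_self B I' _).trans ?_
      rw [show D.coeff A (D.mono A I' * (D.inc A).toAlgHom a) I' = a from D.coeff_mono_self A I' a]
    · refine (D.coeff_mono_ne B I' I _ h).trans ?_
      rw [show D.coeff A (D.mono A I' * (D.inc A).toAlgHom a) I = 0 from D.coeff_mono_ne A I' I a h,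
        map_zero, smul_zero]
  | hadd x y hx hy => simp only [map_add, Pi.add_apply, hx, hy, smul_add]
  | hneg x hx => simp only [map_neg, Pi.neg_apply, hx, smul_neg]
  | h0 => simp

theorem list_prod_mem {C : SAlg} {x : J → C} (hx : ∀ j, x j ∈ C.grade (par j)) (w : List J) :
    (w.map x).prod ∈ C.grade (w.map par).sum := by
  induction w with
  | nil => exact C.one_mem
  | cons j w ih =>
    simp only [List.map_cons, List.prod_cons, List.sum_cons]
    exact mul_mem_grade (hx j) ih rfl

theorem coeff_mem {r : ZMod 2} {x : D.S A} (hx : x ∈ (D.S A).grade r) (I : D.Mon) :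
    D.coeff A x I ∈ A.grade (D.mpar I + r) := by
  have h := D.coeff_hom (F := (D.S A).sg 1) (f := A.sg 1) (c := fun I => sgn (D.mpar I))
    (fun I a => by
      rw [map_mul, (D.S A).sg_of_mem 1 (show D.mono A I ∈ (D.S A).grade (D.mpar I) from
        list_prod_mem (D.gen_mem A) (D.word I)), one_mul,
        smul_mul_assoc, (D.inc A).map_sg]) x I
  rw [(D.S A).sg_of_mem 1 hx, one_mul] at h
  have h' : D.coeff A (sgn r • x) I = sgn r • D.coeff A x I := by
    rw [← mul_one x, ← map_one (D.inc A).toAlgHom, ← mul_smul_comm, ← map_smul, D.coeff_mul_inc,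
      D.coeff_mul_inc, mul_smul_comm]
  rw [h'] at h
  rw [A.mem_grade_iff, sgn_add, mul_smul, h, smul_smul, sgn_mul_self, one_smul]

variable [Fintype J]

theorem lin_mem {M : Matrix J J A} (hM : IsEvenMat A par par M) (j : J) :
    ∑ i, D.gen A i * (D.inc A).toAlgHom (M i j) ∈ (D.S A).grade (par j) := by
  refine sum_mem fun i _ => mul_mem_grade (D.gen_mem A i) ((D.inc A).map_grade _ _ (hM i j)) ?_
  rw [← add_assoc, parity_add_self, zero_add]

/-- The endomorphism of the free extension given by an even matrix. -/
def phi {M : Matrix J J A} (hM : IsEvenMat A par par M) : SAlg.Hom (D.S A) (D.S A) :=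
  (D.exists_lift (D.inc A) _ (D.lin_mem hM)).choose

theorem phi_inc {M : Matrix J J A} (hM : IsEvenMat A par par M) (a : A) :
    (D.phi hM).toAlgHom ((D.inc A).toAlgHom a) = (D.inc A).toAlgHom a :=
  (D.exists_lift (D.inc A) _ (D.lin_mem hM)).choose_spec.1 a

theorem phi_gen {M : Matrix J J A} (hM : IsEvenMat A par par M) (j : J) :
    (D.phi hM).toAlgHom (D.gen A j) = ∑ i, D.gen A i * (D.inc A).toAlgHom (M i j) :=
  (D.exists_lift (D.inc A) _ (D.lin_mem hM)).choose_spec.2 j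

theorem phi_phi {M N P : Matrix J J A} (hM : IsEvenMat A par par M) (hN : IsEvenMat A par par N)
    (hP : IsEvenMat A par par P) (h : P = M * N) (x : D.S A) :
    (D.phi hM).toAlgHom ((D.phi hN).toAlgHom x) = (D.phi hP).toAlgHom x := by
  refine D.hom_ext (F := (D.phi hM).toAlgHom.comp (D.phi hN).toAlgHom) (G := (D.phi hP).toAlgHom)
    (fun a => ?_) (fun j => ?_) x
  · rw [AlgHom.comp_apply, phi_inc, phi_inc, phi_inc]
  · rw [AlgHom.comp_apply, phi_gen, phi_gen, map_sum, h]
    simp only [map_mul, phi_inc, phi_gen, Matrix.mul_apply, map_sum, sum_mul, mul_sum, mul_assoc]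
    exact sum_comm

theorem phi_diagonal {t : J → A} (ht : ∀ j, t j ∈ A.grade 0)
    (hM : IsEvenMat A par par (diagonal t)) (I : D.Mon) :
    (D.phi hM).toAlgHom (D.mono A I) =
      D.mono A I * (D.inc A).toAlgHom ((D.word I).map t).prod := by
  have hgen : ∀ j, (D.phi hM).toAlgHom (D.gen A j) = D.gen A j * (D.inc A).toAlgHom (t j) := by
    intro j
    rw [phi_gen, sum_eq_single_of_mem j (mem_univ j), diagonal_apply_eq]
    intro i _ hij
    rw [diagonal_apply_ne _ hij, map_zero, mul_zero]
  rw [mono]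
  induction D.word I with
  | nil => simp
  | cons j w ih =>
    simp only [List.map_cons, List.prod_cons, map_mul] at ih ⊢
    rw [ih, hgen, mul_assoc, ← mul_assoc _ _ ((D.inc A).toAlgHom (w.map t).prod),
      (D.S A).mul_eq_of_mem ((D.inc A).map_grade 0 _ (ht j)), SAlg.sg_zero]
    simp only [mul_assoc]

theorem isEvenMat_diagonal {t : J → A} (ht : ∀ j, t j ∈ A.grade 0) :
    IsEvenMat A par par (diagonal t) := by
  intro i j
  by_cases h : i = j
  · subst h
    rw [diagonal_apply_eq, parity_add_self]
    exact ht i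
  · rw [diagonal_apply_ne _ h]
    exact zero_mem _

theorem coeff_phi_eq_zero {M : Matrix J J A} (hM : IsEvenMat A par par M) {I I' : D.Mon}
    (h : (D.word I).length ≠ (D.word I').length) :
    D.coeff A ((D.phi hM).toAlgHom (D.mono A I')) I = 0 := by
  have h2 : ∀ _ : J, (algebraMap ℂ A 2) ∈ A.grade 0 := fun _ => by
    rw [Algebra.algebraMap_eq_smul_one]
    exact Submodule.smul_mem _ _ A.one_mem
  have hs := isEvenMat_diagonal (par := par) h2
  have hprod : ∀ I : D.Mon, ((D.word I).map fun _ => algebraMap ℂ A 2).prod =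
      (2 : ℂ) ^ (D.word I).length • (1 : A) := fun I => by
    rw [List.map_const', List.prod_replicate, ← map_pow, Algebra.algebraMap_eq_smul_one]
  have e1 := D.coeff_hom (F := (D.phi hs).toAlgHom) (f := AlgHom.id ℂ A)
    (c := fun I => (2 : ℂ) ^ (D.word I).length) (fun I a => by
      rw [map_mul, D.phi_diagonal h2, phi_inc, hprod, map_smul, map_one, mul_smul_comm, mul_one,
        smul_mul_assoc]
      rfl) ((D.phi hM).toAlgHom (D.mono A I')) I
  have hcomm : diagonal (fun _ : J => algebraMap ℂ A 2) * M =
      M * diagonal (fun _ => algebraMap ℂ A 2) := by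
    ext i j
    rw [Matrix.diagonal_mul, mul_diagonal, Algebra.commutes]
  have hsM : IsEvenMat A par par (diagonal (fun _ : J => algebraMap ℂ A 2) * M) :=
    isEvenMat_mul hs hM
  rw [D.phi_phi hs hM hsM rfl, ← D.phi_phi hM hs hsM hcomm, D.phi_diagonal h2, hprod, map_mul,
    phi_inc, D.coeff_mul_inc, mul_smul_comm, mul_one, AlgHom.id_apply, ← sub_eq_zero,
    ← sub_smul] at e1
  refine (smul_eq_zero.1 e1).resolve_left fun h0 => h ?_
  have h3 : (2 : ℂ) ^ (D.word I').length = 2 ^ (D.word I).length := sub_eq_zero.1 h0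
  have h4 : 2 ^ (D.word I').length = 2 ^ (D.word I).length := by exact_mod_cast h3
  exact (Nat.pow_right_injective le_rfl h4).symm

/-- The monomials of degree `k`. -/
abbrev Deg (k : ℕ) : Type := {I : D.Mon // (D.word I).length = k}

theorem finite_deg (k : ℕ) : Finite (D.Deg k) :=
  Finite.of_injective (β := J → Fin (k + 1))
    (fun I j => ⟨(D.word I.1).count j, Nat.lt_succ_of_le (List.count_le_length.trans_eq I.2)⟩)
    fun _ _ h => Subtype.ext (D.count_injective _ _ fun j => Fin.mk.inj_iff.1 (congrFun h j))

instance (k : ℕ) : Fintype (D.Deg k) := @Fintype.ofFinite _ (D.finite_deg k)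

/-- The matrix of the `k`-th symmetric power. -/
def symMat (k : ℕ) {M : Matrix J J A} (hM : IsEvenMat A par par M) :
    Matrix (D.Deg k) (D.Deg k) A :=
  Matrix.of fun I I' => D.coeff A ((D.phi hM).toAlgHom (D.mono A I'.1)) I.1

theorem phi_mono {M : Matrix J J A} (hM : IsEvenMat A par par M) (k : ℕ) (I' : D.Deg k) :
    (D.phi hM).toAlgHom (D.mono A I'.1) =
      ∑ I : D.Deg k, D.mono A I.1 * (D.inc A).toAlgHom (D.symMat k hM I I') := by
  classical
  obtain ⟨s, hs⟩ := D.exists_expansion ((D.phi hM).toAlgHom (D.mono A I'.1))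
  let t : Finset D.Mon := univ.image (Subtype.val : D.Deg k → D.Mon)
  rw [hs (s ∪ t) subset_union_left]
  have h1 := sum_subset (subset_union_right (s₁ := s) (s₂ := t))
    (f := fun I => D.mono A I * (D.inc A).toAlgHom
      (D.coeff A ((D.phi hM).toAlgHom (D.mono A I'.1)) I)) (fun I _ hI => by
        rw [D.coeff_phi_eq_zero hM, map_zero, mul_zero]
        intro h
        exact hI (mem_image.2 ⟨⟨I, h.trans I'.2⟩, mem_univ _, rfl⟩))
  rw [← h1, sum_image fun _ _ _ _ h => Subtype.ext h]
  rfl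

theorem symMat_even (k : ℕ) {M : Matrix J J A} (hM : IsEvenMat A par par M) :
    IsEvenMat A (fun I : D.Deg k => D.mpar I.1) (fun I => D.mpar I.1) (D.symMat k hM) :=
  fun _ _ => D.coeff_mem ((D.phi hM).map_grade _ _ (list_prod_mem (D.gen_mem A) _)) _

theorem symMat_diagonal (k : ℕ) {M : Matrix J J A} (hM : IsEvenMat A par par M) {t : J → A}
    (ht : ∀ j, t j ∈ A.grade 0) (h : M = diagonal t) [DecidableEq (D.Deg k)] :
    D.symMat k hM = diagonal fun I => ((D.word I.1).map t).prod := by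
  classical
  subst h
  ext I I'
  rw [symMat, of_apply, D.phi_diagonal ht, D.coeff_mul_inc, D.coeff_mono, Matrix.diagonal_apply]
  by_cases h : I = I'
  · subst h
    rw [if_pos rfl, if_pos rfl, one_mul]
  · rw [if_neg (fun e => h (Subtype.ext e.symm)), if_neg h, zero_mul]

theorem symMat_one (k : ℕ) {M : Matrix J J A} (hM : IsEvenMat A par par M) (h : M = 1)
    [DecidableEq (D.Deg k)] : D.symMat k hM = 1 := by
  rw [D.symMat_diagonal k hM (t := fun _ => 1) (fun _ => A.one_mem) (h.trans diagonal_one.symm)]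
  simp

theorem symMat_mul (k : ℕ) {M N P : Matrix J J A} (hM : IsEvenMat A par par M)
    (hN : IsEvenMat A par par N) (hP : IsEvenMat A par par P) (h : P = M * N) :
    D.symMat k hP = D.symMat k hM * D.symMat k hN := by
  ext I I'
  rw [symMat, of_apply, ← D.phi_phi hM hN hP h, D.phi_mono hN k I', map_sum, map_sum,
    Finset.sum_apply, Matrix.mul_apply]
  refine sum_congr rfl fun K _ => ?_
  rw [map_mul, phi_inc, coeff_mul_inc]
  rfl

theorem symMat_map (k : ℕ) (f : SAlg.Hom A B) {M : Matrix J J A} {N : Matrix J J B}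
    (hM : IsEvenMat A par par M) (hN : IsEvenMat B par par N) (h : N = M.map f.toAlgHom) :
    D.symMat k hN = (D.symMat k hM).map f.toAlgHom := by
  obtain ⟨F, hFi, hFg⟩ := D.exists_lift ((D.inc B).comp f) (D.gen B) (D.gen_mem B)
  have hFi' : ∀ a, F.toAlgHom ((D.inc A).toAlgHom a) = (D.inc B).toAlgHom (f.toAlgHom a) := hFi
  have hmono : ∀ I, F.toAlgHom (D.mono A I) = D.mono B I := fun I => by
    rw [mono, mono, map_list_prod, List.map_map]
    congr 1
    exact List.map_congr_left fun j _ => hFg j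
  ext I I'
  rw [map_apply, symMat, symMat, of_apply, of_apply]
  have h1 := D.coeff_hom (F := F.toAlgHom) (f := f.toAlgHom) (c := fun _ => 1) (fun I a => by
    rw [map_mul, hFi', hmono, one_smul]) ((D.phi hM).toAlgHom (D.mono A I'.1)) I.1
  rw [one_smul] at h1
  rw [← h1, ← hmono]
  refine congrArg (fun y => D.coeff B y I.1) (D.hom_ext (F := (D.phi hN).toAlgHom.comp F.toAlgHom)
    (G := F.toAlgHom.comp (D.phi hM).toAlgHom) (fun a => ?_) (fun j => ?_) _)
  · rw [AlgHom.comp_apply, AlgHom.comp_apply, hFi', phi_inc, phi_inc, hFi']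
  · rw [AlgHom.comp_apply, AlgHom.comp_apply, hFg, phi_gen, phi_gen, map_sum]
    refine sum_congr rfl fun i _ => ?_
    rw [map_mul, hFg, hFi', h, map_apply]

/-- The symmetric power of a representation. -/
def symRep {n m : ℕ} (V : SLRep n m) (D : FreeExt V.ι V.par) (k : ℕ) : SLRep n m where
  ι := D.Deg k
  dec := Classical.decEq _
  par I := D.mpar I.1
  act A g := D.symMat k (V.act_even A g)
  act_even _ _ := D.symMat_even k _
  act_one A g hg := @symMat_one _ _ _ D _ _ k _ _ (V.act_one A g hg) (Classical.decEq _)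
  act_mul A g h l hl := D.symMat_mul k _ _ _ (V.act_mul A g h l hl)
  act_natural A B f g g' hg := D.symMat_map k f _ _ (V.act_natural A B f g g' hg)

end FreeExt

namespace FreeExt

theorem count_append_map_right {α β γ : Type} [DecidableEq α] [DecidableEq γ] {f : α → γ}
    {g : β → γ} (hf : Injective f) (h : ∀ a b, f a ≠ g b) (l : List α) (l' : List β)
    (a : α) : (l'.map g ++ l.map f).count (f a) = l.count a := by
  rw [List.count_append, List.count_map_of_injective _ _ hf, List.count_eq_zero_of_not_mem, zero_add]
  intro ha
  obtain ⟨b, _, hb⟩ := List.mem_map.1 ha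
  exact h a b hb.symm

theorem count_append_map_left {α β γ : Type} [DecidableEq β] [DecidableEq γ] {f : α → γ}
    {g : β → γ} (hg : Injective g) (h : ∀ a b, f a ≠ g b) (l : List α) (l' : List β)
    (b : β) : (l'.map g ++ l.map f).count (g b) = l'.count b := by
  rw [List.count_append, List.count_map_of_injective _ _ hg,
    List.count_eq_zero_of_not_mem (l := l.map f), add_zero]
  intro hb
  obtain ⟨a, _, ha⟩ := List.mem_map.1 hb
  exact h a b ha

/-- The free extension on two families of generators. -/
def sum {J K : Type} [DecidableEq J] [DecidableEq K] [DecidableEq (J ⊕ K)] {r : J ⊕ K → ZMod 2}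
    (D : FreeExt J (r ∘ inl)) (E : FreeExt K (r ∘ inr)) : FreeExt (J ⊕ K) r :=
  have hmono : ∀ (A : SAlg) (I : E.Mon × D.Mon) (a : A),
      ((((E.word I.1).map inr ++ (D.word I.2).map inl).map
        (Sum.elim (fun j => (E.inc (D.S A)).toAlgHom (D.gen A j)) (E.gen (D.S A)))).prod *
        ((E.inc (D.S A)).comp (D.inc A)).toAlgHom a : E.S (D.S A)) =
      E.mono (D.S A) I.1 * (E.inc (D.S A)).toAlgHom (D.mono A I.2 * (D.inc A).toAlgHom a) := by
    intro A I a
    rw [List.map_append, List.map_map, List.map_map, List.prod_append, map_mul, mono, mono,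
      map_list_prod, List.map_map, mul_assoc]
    rfl
  have hl : ∀ (I : E.Mon × D.Mon) (j : J),
      @List.count _ instBEqOfDecidableEq (inl j)
        ((E.word I.1).map inr ++ (D.word I.2).map inl : List (J ⊕ K)) =
        (D.word I.2).count j :=
    fun _ _ => count_append_map_right Sum.inl_injective (fun _ _ => Sum.inl_ne_inr) _ _ _
  have hr : ∀ (I : E.Mon × D.Mon) (j : K),
      @List.count _ instBEqOfDecidableEq (inr j)
        ((E.word I.1).map inr ++ (D.word I.2).map inl : List (J ⊕ K)) =
        (E.word I.1).count j :=
    fun _ _ => count_append_map_left Sum.inr_injective (fun _ _ => Sum.inl_ne_inr) _ _ _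
  { Mon := E.Mon × D.Mon
    word := fun I => (E.word I.1).map inr ++ (D.word I.2).map inl
    S := fun A => E.S (D.S A)
    inc := fun A => (E.inc (D.S A)).comp (D.inc A)
    gen := fun A => Sum.elim (fun j => (E.inc (D.S A)).toAlgHom (D.gen A j)) (E.gen (D.S A))
    gen_mem := fun A j => by
      rcases j with j | j
      · exact (E.inc (D.S A)).map_grade _ _ (D.gen_mem A j)
      · exact E.gen_mem (D.S A) j
    coeff := fun A =>
      { toFun := fun x I => D.coeff A (E.coeff (D.S A) x I.1) I.2
        map_zero' := by simp only [map_zero, Pi.zero_apply]; rfl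
        map_add' := fun x y => by simp only [map_add, Pi.add_apply]; rfl }
    coeff_mono_self := fun A I a => by
      rw [hmono, AddMonoidHom.coe_mk, ZeroHom.coe_mk]
      exact (congrArg (fun y => D.coeff A y I.2) (E.coeff_mono_self _ _ _)).trans
        (D.coeff_mono_self _ _ _)
    coeff_mono_ne := fun A I I' a h => by
      rw [hmono, AddMonoidHom.coe_mk, ZeroHom.coe_mk]
      by_cases h1 : I.1 = I'.1
      · rw [← h1]
        exact (congrArg (fun y => D.coeff A y I'.2) (E.coeff_mono_self _ _ _)).trans
          (D.coeff_mono_ne _ _ _ _ fun h2 => h (Prod.ext h1 h2))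
      · refine (congrArg (fun y => D.coeff A y I'.2) (E.coeff_mono_ne _ _ _ _ h1)).trans ?_
        rw [map_zero, Pi.zero_apply]
    expand := fun A x => by
      induction x using E.induction with
      | hm I b =>
        induction b using D.induction with
        | hm I' a => exact AddSubgroup.subset_closure ⟨(I, I'), a, (hmono A (I, I') a).symm⟩
        | hadd x y hx hy => rw [map_add, mul_add]; exact add_mem hx hy
        | hneg x hx => rw [map_neg, mul_neg]; exact neg_mem hx
        | h0 => rw [map_zero, mul_zero]; exact zero_mem _
      | hadd x y hx hy => exact add_mem hx hy
      | hneg x hx => exact neg_mem hx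
      | h0 => exact zero_mem _
    exists_lift := fun {A B} f y hy => by
      obtain ⟨F, h1, h2⟩ := D.exists_lift f (y ∘ inl) fun j => hy _
      obtain ⟨G, h3, h4⟩ := E.exists_lift F (y ∘ inr) fun j => hy _
      refine ⟨G, fun a => (h3 _).trans (h1 a), fun j => ?_⟩
      rcases j with j | j
      · exact (h3 _).trans (h2 j)
      · exact h4 j
    count_le := fun I j h => by
      rcases j with j | j
      · exact (hl I j).trans_le (D.count_le _ _ h)
      · exact (hr I j).trans_le (E.count_le _ _ h)
    count_injective := fun I I' h => Prod.ext
      (E.count_injective _ _ fun j => (hr I j).symm.trans ((h _).trans (hr I' j)))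
      (D.count_injective _ _ fun j => (hl I j).symm.trans ((h _).trans (hl I' j)))
    count_surjective := fun l h => by
      obtain ⟨I, hI⟩ := D.count_surjective (l ∘ inl) fun j => h _
      obtain ⟨I', hI'⟩ := E.count_surjective (l ∘ inr) fun j => h _
      refine ⟨(I', I), fun j => ?_⟩
      rcases j with j | j
      · exact (hl (I', I) j).trans (hI j)
      · exact (hr (I', I) j).trans (hI' j) }

/-- Renaming the generators. -/
def congr {J K : Type} [DecidableEq J] [DecidableEq K] {r : K → ZMod 2} (e : J ≃ K)
    (D : FreeExt J (r ∘ e)) : FreeExt K r :=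
  have hmap : ∀ (A : SAlg) (I : D.Mon),
      ((D.word I).map e).map (fun k => D.gen A (e.symm k)) = (D.word I).map (D.gen A) := by
    intro A I
    rw [List.map_map]
    exact List.map_congr_left fun j _ => congrArg (D.gen A) (e.symm_apply_apply j)
  have hc : ∀ (I : D.Mon) (k : K), ((D.word I).map e).count k = (D.word I).count (e.symm k) := by
    intro I k
    obtain ⟨j, rfl⟩ := e.surjective k
    rw [List.count_map_of_injective _ _ e.injective, e.symm_apply_apply]
  { Mon := D.Mon
    word := fun I => (D.word I).map e
    S := D.S
    inc := D.inc
    gen := fun A k => D.gen A (e.symm k)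
    gen_mem := fun A k => by
      have h := D.gen_mem A (e.symm k)
      rwa [Function.comp_apply, e.apply_symm_apply] at h
    coeff := D.coeff
    coeff_mono_self := fun A I a => by rw [hmap]; exact D.coeff_mono_self A I a
    coeff_mono_ne := fun A I I' a h => by rw [hmap]; exact D.coeff_mono_ne A I I' a h
    expand := fun A x => by simp only [hmap]; exact D.expand A x
    exists_lift := fun {A B} f y hy => by
      obtain ⟨F, h1, h2⟩ := D.exists_lift f (y ∘ e) fun j => hy _
      refine ⟨F, h1, fun k => (h2 _).trans ?_⟩
      rw [Function.comp_apply, e.apply_symm_apply]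
    count_le := fun I k h => by
      rw [hc]
      exact D.count_le _ _ (by rwa [Function.comp_apply, e.apply_symm_apply])
    count_injective := fun I I' h => D.count_injective _ _ fun j => by
      have := h (e j)
      rwa [hc, hc, e.symm_apply_apply] at this
    count_surjective := fun l h => by
      obtain ⟨I, hI⟩ := D.count_surjective (l ∘ e) fun j => h _
      refine ⟨I, fun k => ?_⟩
      rw [hc, hI, Function.comp_apply, e.apply_symm_apply] }

/-- The free extension without generators. -/
def empty {J : Type} [DecidableEq J] [IsEmpty J] (r : J → ZMod 2) : FreeExt J r where
  Mon := Unit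
  word _ := []
  S A := A
  inc A := ⟨AlgHom.id ℂ A, fun _ _ h => h⟩
  gen _ j := isEmptyElim j
  gen_mem _ j := isEmptyElim j
  coeff _ := ⟨⟨fun a _ => a, rfl⟩, fun _ _ => rfl⟩
  coeff_mono_self _ _ a := one_mul a
  coeff_mono_ne _ _ _ _ h := absurd rfl h
  expand _ x := AddSubgroup.subset_closure ⟨(), x, (one_mul x).symm⟩
  exists_lift f _ _ := ⟨f, fun _ => rfl, fun j => isEmptyElim j⟩
  count_le _ j := isEmptyElim j
  count_injective _ _ _ := rfl
  count_surjective _ _ := ⟨(), fun j => isEmptyElim j⟩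

/-- The free extension with one odd generator. -/
def odd [DecidableEq PUnit.{1}] {r : PUnit.{1} → ZMod 2} (hr : r PUnit.unit = 1) :
    FreeExt PUnit.{1} r where
  Mon := Bool
  word b := if b then [PUnit.unit] else []
  S A := A.nil 1
  inc A := A.nilInc 1
  gen A _ := A.eta 1
  gen_mem A j := by rw [show r j = 1 from hr]; exact SAlg.eta_mem
  coeff A := ⟨⟨fun x b => if b then x.2 else x.1, by ext b; cases b <;> rfl⟩,
    fun x y => by ext b; cases b <;> rfl⟩
  coeff_mono_self A b a := by
    cases b
    · simpa using SAlg.nilInc_fst a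
    · simpa using congrArg NilExt.snd (SAlg.eta_mul_inc a)
  coeff_mono_ne A b b' a h := by
    cases b <;> cases b'
    · exact absurd rfl h
    · simpa using SAlg.nilInc_snd a
    · simpa using congrArg NilExt.fst (SAlg.eta_mul_inc a)
    · exact absurd rfl h
  expand A x := by
    rw [A.nil_eq x]
    exact add_mem (AddSubgroup.subset_closure ⟨false, x.1, by simp⟩)
      (AddSubgroup.subset_closure ⟨true, x.2, by simp⟩)
  exists_lift {A B} f y hy := by
    have h : y PUnit.unit ∈ B.grade 1 := hr ▸ hy PUnit.unit
    refine ⟨SAlg.nilLift f (y PUnit.unit) h (B.mul_self_of_odd h), fun a => ?_,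
      fun j => SAlg.nilLift_eta _ _ _ _⟩
    rw [SAlg.nilLift_apply, SAlg.nilInc_fst, SAlg.nilInc_snd, map_zero, mul_zero, add_zero]
  count_le b j _ := by cases b <;> simp
  count_injective b b' h := by
    have := h PUnit.unit
    cases b <;> cases b' <;> simp_all
  count_surjective l h := by
    have := h PUnit.unit hr
    rcases Nat.le_one_iff_eq_zero_or_eq_one.1 this with h | h
    · exact ⟨false, fun j => by simp [h]⟩
    · exact ⟨true, fun j => by simp [h]⟩

theorem map_sg_eq_iff {A : SAlg} {i : ZMod 2} {f : Polynomial A} :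
    Polynomial.mapAlgHom (A.sg 1) f = sgn i • f ↔ ∀ k, f.coeff k ∈ A.grade i := by
  rw [Polynomial.ext_iff]
  refine forall_congr' fun k => ?_
  rw [A.mem_grade_iff, Polynomial.coeff_smul]
  simp [Polynomial.coe_mapAlgHom, Polynomial.coeff_map]

/-- Polynomials over a superalgebra in an even variable. -/
abbrev polySAlg (A : SAlg) : SAlg :=
  SAlg.ofInvolution (Polynomial A) (Polynomial.mapAlgHom (A.sg 1))
    (fun f => by
      ext k
      simp [Polynomial.coe_mapAlgHom, Polynomial.coeff_map, A.sg_self])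
    (fun i j f g hf hg => by
      rw [map_sg_eq_iff] at hf hg
      ext k
      rw [Polynomial.coeff_smul, Polynomial.coeff_mul, Polynomial.coeff_mul,
        ← Nat.sum_antidiagonal_swap, smul_sum]
      exact sum_congr rfl fun p _ => A.comm _ _ _ _ (hf _) (hg _))

/-- The free extension with one even generator. -/
def even [DecidableEq PUnit.{1}] {r : PUnit.{1} → ZMod 2} (hr : r PUnit.unit = 0) :
    FreeExt PUnit.{1} r where
  Mon := ℕ
  word k := List.replicate k PUnit.unit
  S A := polySAlg A
  inc A := ⟨Polynomial.CAlgHom, fun i a ha => (mem_invGrade _).2 (map_sg_eq_iff.2 fun k => by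
    change (Polynomial.C a).coeff k ∈ _
    rw [Polynomial.coeff_C]
    split_ifs
    exacts [ha, zero_mem _])⟩
  gen A _ := (Polynomial.X : Polynomial A)
  gen_mem A j := by
    rw [show r j = 0 from hr]
    refine (mem_invGrade _).2 (map_sg_eq_iff.2 fun k => ?_)
    rw [Polynomial.coeff_X]
    split_ifs
    exacts [A.one_mem, zero_mem _]
  coeff A := ⟨⟨fun f k => Polynomial.coeff f k, rfl⟩, fun f g => by
    ext k
    exact Polynomial.coeff_add f g k⟩
  coeff_mono_self A k a := by
    rw [List.map_replicate, List.prod_replicate]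
    change (Polynomial.X ^ k * Polynomial.C a).coeff k = a
    simp
  coeff_mono_ne A k k' a h := by
    rw [List.map_replicate, List.prod_replicate]
    change (Polynomial.X ^ k * Polynomial.C a).coeff k' = 0
    rw [Polynomial.X_pow_mul_C, Polynomial.coeff_C_mul_X_pow, if_neg (Ne.symm h)]
  expand A f := by
    induction (f : Polynomial A) using Polynomial.induction_on' with
    | add p q hp hq => exact add_mem hp hq
    | monomial k a =>
      refine AddSubgroup.subset_closure ⟨k, a, ?_⟩
      rw [List.map_replicate, List.prod_replicate]
      change _ = Polynomial.X ^ k * Polynomial.C a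
      rw [Polynomial.X_pow_mul_C, Polynomial.C_mul_X_pow_eq_monomial]
  exists_lift {A B} f y hy := by
    have h : y PUnit.unit ∈ B.grade 0 := hr ▸ hy PUnit.unit
    have hc : ∀ a, Commute (f.toAlgHom a) (y PUnit.unit) := fun a => by
      rw [commute_iff_eq, B.mul_comm_of_mem h, B.sg_zero]
    refine ⟨⟨Polynomial.eval₂AlgHom f.toAlgHom (y PUnit.unit) hc, fun i p hp => ?_⟩,
      fun a => Polynomial.eval₂_C _ _, fun j => Polynomial.eval₂_X _ _⟩
    change Polynomial.eval₂ _ _ _ ∈ _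
    rw [Polynomial.eval₂_eq_sum_range]
    have hpow : ∀ k, y PUnit.unit ^ k ∈ B.grade 0 := fun k => by
      induction k with
      | zero => rw [pow_zero]; exact B.one_mem
      | succ k ih => rw [pow_succ]; exact mul_mem_grade ih h rfl
    exact sum_mem fun k _ => mul_mem_grade
      (f.map_grade _ _ (map_sg_eq_iff.1 ((mem_invGrade _).1 hp) k)) (hpow k) (add_zero i)
  count_le k j h := absurd (hr.symm.trans h) (by decide)
  count_injective k k' h := by simpa using h PUnit.unit
  count_surjective l _ := ⟨l PUnit.unit, fun j => by simp⟩

/-- Free extensions exist for all finite families of generators. -/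
theorem nonempty (J : Type) [Finite J] :
    ∀ (_ : DecidableEq J) (r : J → ZMod 2), Nonempty (FreeExt J r) := by
  induction J using Finite.induction_empty_option with
  | of_equiv e ih =>
    intro _ r
    classical
    obtain ⟨D⟩ := ih inferInstance (r ∘ e)
    exact ⟨D.congr e⟩
  | h_empty => exact fun _ r => ⟨empty r⟩
  | h_option ih =>
    rename_i J _
    intro _ r
    classical
    let e := (Equiv.optionEquivSumPUnit.{0} J).symm
    obtain ⟨D⟩ := ih inferInstance ((r ∘ e) ∘ inl)
    rcases parity_cases (r (e (inr PUnit.unit))) with h | h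
    · exact ⟨congr e (sum (r := r ∘ e) D (even h))⟩
    · exact ⟨congr e (sum (r := r ∘ e) D (odd h))⟩

end FreeExt

/-! ### Symmetric powers of the standard representation and of its dual -/

variable {n m : ℕ}

/-- The standard representation. -/
def stdRep (n m : ℕ) : SLRep n m where
  ι := Idx n m
  par := stdParity
  act _ g := g.1
  act_even _ g := g.2.1
  act_one _ _ h := h
  act_mul _ _ _ _ h := h
  act_natural _ _ _ _ _ h := h

theorem exists_inverse {A : SAlg} (g : SLPoints n m A) :
    ∃ h : SMat n m A, IsEvenMat A stdParity stdParity h ∧ g.1 * h = 1 := by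
  obtain ⟨b, c, a, d, hb, hc, hd, had, hg⟩ := mem_SLPoints_iff.1 g.2
  have hd' : IsUnit d⁻¹.det := by
    rw [det_nonsing_inv]
    exact hd.ringInverse
  refine ⟨uMinus (-c) * (dg a⁻¹ d⁻¹ * uPlus (-b)),
    (SLPoints.mul_mem (uMinus_mem fun i j => neg_mem (hc i j)) (SLPoints.mul_mem (dg_mem hd' ?_)
      (uPlus_mem fun i j => neg_mem (hb i j)))).1, ?_⟩
  · rw [det_nonsing_inv, det_nonsing_inv, had]
  · rw [hg, mul_assoc, ← mul_assoc (uMinus c), ← uMinus_add, add_neg_cancel, uMinus_zero, one_mul,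
      mul_assoc, ← mul_assoc (dg a d), ← dg_mul, mul_nonsing_inv _ (had ▸ hd), mul_nonsing_inv _ hd,
      dg_one, one_mul, ← uPlus_add, add_neg_cancel, uPlus_zero]

/-- The inverse of a point. -/
def ptInv {A : SAlg} (g : SLPoints n m A) : SMat n m A := (exists_inverse g).choose

theorem ptInv_even {A : SAlg} (g : SLPoints n m A) : IsEvenMat A stdParity stdParity (ptInv g) :=
  (exists_inverse g).choose_spec.1

theorem mul_ptInv {A : SAlg} (g : SLPoints n m A) : g.1 * ptInv g = 1 :=
  (exists_inverse g).choose_spec.2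

theorem eq_ptInv {A : SAlg} {g : SLPoints n m A} {h : SMat n m A}
    (hh : g.1 * h = 1) : ptInv g = h := by
  obtain ⟨u, hu⟩ := g.2.2.1
  have h1 := mul_ptInv g
  rw [← hu] at h1 hh
  exact u.isUnit.mul_left_cancel (h1.trans hh.symm)

/-- The dual of the standard representation: the inverse of the supertranspose. -/
def dualRep (n m : ℕ) : SLRep n m where
  ι := Idx n m
  par := stdParity
  act _ g := Matrix.of fun i j => sgn ((stdParity i + stdParity j) * stdParity j) • ptInv g j i
  act_even A g i j := Submodule.smul_mem _ _ (add_comm (stdParity i) _ ▸ ptInv_even g j i)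
  act_one A g hg := by
    have h : ptInv g = 1 := eq_ptInv (by rw [hg, one_mul])
    ext i j
    rw [Matrix.of_apply, h]
    by_cases hij : i = j
    · subst hij
      rw [parity_add_self, zero_mul, sgn_zero, one_smul]
    · rw [one_apply_ne hij, one_apply_ne (Ne.symm hij), smul_zero]
  act_mul A g h k hk := by
    have e : ptInv k = ptInv h * ptInv g := eq_ptInv (by
      rw [hk, mul_assoc, ← mul_assoc h.1, mul_ptInv, one_mul, mul_ptInv])
    ext i j
    rw [Matrix.of_apply, e, Matrix.mul_apply, Matrix.mul_apply, smul_sum]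
    refine sum_congr rfl fun l _ => ?_
    rw [Matrix.of_apply, Matrix.of_apply, smul_mul_smul_comm,
      A.comm _ _ _ _ (ptInv_even h j l) (ptInv_even g l i), smul_smul, ← sgn_add, ← sgn_add]
    have hs : ∀ a b c : ZMod 2,
        (a + b) * b + (b + c) * (c + a) = (a + c) * c + (c + b) * b := by decide
    rw [hs]
  act_natural A B f g g' hg := by
    have e : ptInv g' = (ptInv g).map f.toAlgHom := eq_ptInv (by
      rw [hg, ← Matrix.map_mul, mul_ptInv, Matrix.map_one _ (map_zero _) (map_one _)])
    ext i j
    rw [map_apply, Matrix.of_apply, Matrix.of_apply, e, map_smul, map_apply]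

theorem dualRep_actT : (dualRep n m).actT = diagonal fun j => ex (-wtM j) := by
  have e : ptInv (A := evenSAlg (TorusRing n m)) ⟨_, univTorus_mem⟩ =
      diagonal fun j => (ex (-wtM j) : TorusRing n m) := eq_ptInv (by
    refine (diagonal_mul_diagonal (α := TorusRing n m) _ _).trans ?_
    simp only [← ex_add, add_neg_cancel]
    exact diagonal_one (α := TorusRing n m))
  refine Matrix.ext fun i j => ?_
  change sgn ((stdParity i + stdParity j) * stdParity j) •
    ptInv (A := evenSAlg (TorusRing n m)) ⟨_, univTorus_mem⟩ j i = _
  rw [e]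
  by_cases hij : i = j
  · subst hij
    rw [parity_add_self, zero_mul, sgn_zero, one_smul]
  · exact (congrArg _ (diagonal_apply_ne (α := TorusRing n m) _ (Ne.symm hij))).trans
      ((smul_zero _).trans (diagonal_apply_ne (α := TorusRing n m) _ hij).symm)

section Count

variable {J : Type} [Fintype J] [DecidableEq J]

theorem prod_map_eq_prod_pow_count {R : Type} [CommMonoid R] (f : J → R) (w : List J) :
    (w.map f).prod = ∏ j, f j ^ w.count j := by
  induction w with
  | nil => simp
  | cons j w ih =>
    simp only [List.map_cons, List.prod_cons, ih, List.count_cons, beq_iff_eq, pow_add,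
      prod_mul_distrib]
    simp [mul_comm, pow_ite]

theorem sum_count (w : List J) : ∑ j, w.count j = w.length := by
  induction w with
  | nil => simp
  | cons j w ih => simp [List.count_cons, sum_add_distrib, ih]

theorem sgn_smul_prod {R : Type} [CommRing R] [Algebra ℂ R] (par : J → ZMod 2) (t : J → R)
    (w : List J) :
    sgn (w.map par).sum • (w.map t).prod = (w.map fun j => sgn (par j) • t j).prod := by
  induction w with
  | nil => simp [sgn_zero]
  | cons j w ih =>
    simp only [List.map_cons, List.prod_cons, List.sum_cons, sgn_add, ← ih, smul_mul_smul_comm]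

end Count

/-- The multidegree of a monomial. -/
def FreeExt.deg {J : Type} [Fintype J] [DecidableEq J] {par : J → ZMod 2} (D : FreeExt J par)
    (I : D.Mon) : J →₀ ℕ := Finsupp.equivFunOnFinite.symm fun j => (D.word I).count j

theorem FreeExt.deg_apply {J : Type} [Fintype J] [DecidableEq J] {par : J → ZMod 2}
    (D : FreeExt J par) (I : D.Mon) (j : J) : D.deg I j = (D.word I).count j := by
  simp [deg]

/-- The supercharacter of the symmetric powers of a diagonal matrix. -/
theorem FreeExt.sum_deg {R : Type} [CommRing R] [Algebra ℂ R] (D : FreeExt (Idx n m) stdParity)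
    (t : Idx n m → R) (k : ℕ) :
    ∑ I : D.Deg k, sgn (D.mpar I.1) • ((D.word I.1).map t).prod =
      hCoeff (fun i => t (inl i)) (fun p => t (inr p)) k := by
  let G : Idx n m → PowerSeries R := Sum.elim (fun i => PowerSeries.mk fun k => t (inl i) ^ k)
    fun p => 1 - PowerSeries.C (t (inr p)) * PowerSeries.X
  have hG : ∏ j, G j = hSeries (fun i => t (inl i)) (fun p => t (inr p)) := by
    apply eq_hSeries
    rw [Fintype.prod_sum_type, mul_right_comm, ← prod_mul_distrib]
    simp only [G, Sum.elim_inl, Sum.elim_inr, mk_pow_mul, prod_const_one, one_mul]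
  have h1 : ∀ j a, (stdParity j = 1 → a ≤ 1) →
      PowerSeries.coeff a (G j) = (sgn (stdParity j) • t j) ^ a := by
    rintro (i | p) a h
    · simp [G, stdParity, sgn_zero]
    · obtain rfl | rfl := Nat.le_one_iff_eq_zero_or_eq_one.1 (h rfl)
      · simp [G]
      · simp [G, stdParity, sgn_one, PowerSeries.coeff_one]
  have h2 : ∀ j a, ¬ (stdParity j = 1 → a ≤ 1) → PowerSeries.coeff a (G j) = 0 := by
    rintro (i | p) a h
    · exact absurd (fun h0 => absurd h0 (by simp [stdParity])) h
    · have h3 : 1 < a := by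
        by_contra h'
        exact h fun _ => not_lt.1 h'
      obtain ⟨b, rfl⟩ : ∃ b, a = b + 2 := ⟨a - 2, by omega⟩
      simp [G, PowerSeries.coeff_one, PowerSeries.coeff_succ_mul_X]
  rw [← coeff_hSeries, ← hG, PowerSeries.coeff_prod]
  refine sum_of_injOn (fun I => D.deg I.1) ?_ ?_ ?_ ?_
  · intro I _ I' _ h
    refine Subtype.ext (D.count_injective _ _ fun j => ?_)
    rw [← D.deg_apply, ← D.deg_apply]
    exact DFunLike.congr_fun h j
  · intro I _
    rw [mem_coe, mem_finsuppAntidiag]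
    refine ⟨?_, subset_univ _⟩
    simp only [D.deg_apply, sum_count, I.2]
  · intro l hl hl'
    rw [mem_finsuppAntidiag] at hl
    by_contra h
    obtain ⟨I, hI⟩ := D.count_surjective l fun j => by
      by_contra h'
      exact h (prod_eq_zero (mem_univ j) (h2 j _ h'))
    refine hl' ⟨⟨I, ?_⟩, mem_coe.2 (mem_univ _),
      Finsupp.ext fun j => (D.deg_apply _ j).trans (hI j)⟩
    rw [← sum_count, ← hl.1]
    exact sum_congr rfl fun j _ => hI j
  · intro I _
    rw [mpar, sgn_smul_prod, prod_map_eq_prod_pow_count]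
    refine prod_congr rfl fun j _ => ?_
    rw [D.deg_apply]
    exact (h1 j _ (D.count_le I.1 j)).symm

theorem FreeExt.strT_symRep (V : SLRep n m) (D : FreeExt V.ι V.par) (k : ℕ)
    {t : V.ι → TorusRing n m} (h : V.actT = diagonal t) :
    (symRep V D k).strT = ∑ I : D.Deg k, sgn (D.mpar I.1) • ((D.word I.1).map t).prod := by
  classical
  have h1 := D.symMat_diagonal (A := evenSAlg (TorusRing n m)) k (V.act_even _ ⟨_, univTorus_mem⟩)
    (t := t) (fun j => mem_evenSAlg_zero _) h
  refine sum_congr rfl fun I _ => congrArg _ ?_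
  exact (congrFun (congrFun h1 I) I).trans (diagonal_apply_eq _ _)

theorem exists_sch_eq_hk (k : ℕ) : ∃ V : SLRep n m, V.sch = hk n m k := by
  obtain ⟨D⟩ := FreeExt.nonempty (Idx n m) inferInstance stdParity
  refine ⟨FreeExt.symRep (stdRep n m) D k, SLRep.sch_eq_of_strT ?_⟩
  rw [FreeExt.strT_symRep (stdRep n m) D k (t := fun j => ex (wtM j)) rfl]
  refine (congrArg _ (D.sum_deg (fun j => ex (wtM j)) k)).trans ?_
  rw [map_hCoeff, hk, map_hCoeff]
  simp only [torusToCP_single, toCP_single, coe_wtM, Int.cast_one]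

theorem exists_sch_eq_hkStar (k : ℕ) : ∃ V : SLRep n m, V.sch = hkStar n m k := by
  obtain ⟨D⟩ := FreeExt.nonempty (Idx n m) inferInstance stdParity
  refine ⟨FreeExt.symRep (dualRep n m) D k, SLRep.sch_eq_of_strT ?_⟩
  rw [FreeExt.strT_symRep (dualRep n m) D k dualRep_actT]
  refine (congrArg _ (D.sum_deg (fun j => ex (-wtM j)) k)).trans ?_
  rw [map_hCoeff, hkStar, map_hCoeff]
  simp only [torusToCP_single, toCP_single, NegMemClass.coe_neg, coe_wtM, Int.cast_one]

theorem hk_zero : hk n m 0 = 1 := by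
  rw [hk, hCoeff, PowerSeries.coeff_zero_eq_constantCoeff_apply, map_mul, constantCoeff_prod,
    PowerSeries.constantCoeff_invOfUnit]
  simp

end SuperSL

end

theorem mainTheorem7 (n m : ℕ) (hn : 1 ≤ n) (hm : 1 ≤ m) (hnm : (n, m) ≠ (2, 2)) :
    -- `J` is the direct sum of its components
    (iSupIndep (SuperSL.Jcomp n m) ∧ (⨆ a, SuperSL.Jcomp n m a) = (SuperSL.J n m).toAddSubgroup) ∧
    -- the invariant Laurent polynomials modulo `x_1 ⋯ x_n - y_1 ⋯ y_m` embed into `ℤ[P₀]`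
    RingHom.ker ((SuperSL.toZP n m).comp (SuperSL.LaurentInv n m).subtype) =
      Ideal.span {(⟨SuperSL.detRel n m, SuperSL.detRel_mem n m⟩ : SuperSL.LaurentInv n m)} ∧
    -- the components with non-integral `a`
    (∀ a : ℂ, (∀ z : ℤ, a ≠ z) →
      (SuperSL.Jcomp n m (QuotientAddGroup.mk a) : Set (SuperSL.ZP n m)) =
        {f | ∃ g ∈ SuperSL.LaurentInv n m,
          f = SuperSL.ex (SuperSL.omega n m a) * SuperSL.kacFactor n m * SuperSL.toZP n m g}) ∧
    -- the zero component
    (SuperSL.Jzero n m : Set (SuperSL.ZP n m)) =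
      {f | ∃ g ∈ SuperSL.LaurentInv n m,
        (∀ (i : Fin n) (p : Fin m), SuperSL.Dlaurent i p g ∈
          Ideal.span {SuperSL.var (Sum.inr p) - SuperSL.var (Sum.inl i), SuperSL.detRel n m}) ∧
        f = SuperSL.toZP n m g} ∧
    SuperSL.Jzero n m =
      Subring.closure (Set.range (SuperSL.hk n m) ∪ Set.range (SuperSL.hkStar n m)) ∧
    ((n, m) ≠ (1, 1) →
      ∃ φ : SuperSL.GrothSL n m ≃+* SuperSL.Jzero n m,
        ∀ V : SuperSL.SLRep n m, V.IsSupercharacter (φ (SuperSL.grothClass V) : SuperSL.ZP n m)) := by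
  have h0 : 0 < n + m := by omega
  refine ⟨⟨SuperSL.iSupIndep_Jcomp ⟨0, hn⟩ ⟨0, hm⟩, SuperSL.iSup_Jcomp ⟨0, hn⟩ ⟨0, hm⟩⟩,
    SuperSL.ker_toZP h0, fun a ha => SuperSL.Jcomp_nonintegral hn hm hnm a ha, SuperSL.coe_Jzero h0,
    SuperSL.Jzero_eq_hRing h0 hnm, fun h1 => ?_⟩
  exact SuperSL.exists_ringEquiv hn hm h1 (SuperSL.Jzero_eq_hRing h0 hnm)
    (by
      rintro _ (⟨k, rfl⟩ | ⟨k, rfl⟩)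
      exacts [SuperSL.exists_sch_eq_hk k, SuperSL.exists_sch_eq_hkStar k])
    (SuperSL.hk_zero (n := n) (m := m) ▸ SuperSL.exists_sch_eq_hk 0)
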